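/- **Conventions.** Space is a coordinate chart $\mathbb R^3$; $a,b,c,d\in\{0,1,2,3\}$ are spacetime indices ($0$ = time), $i,j,k\in\{1,2,3\}$ spatial ones, $A,B,C,D$ Lorentz indices moved with the Minkowski metric $\eta$; $[AB]$ is antisymmetrization with total weight one ($X_{[AB]}=\frac12(X_{AB}-X_{BA})$); $\epsilon^{ijk}=\epsilon^{0ijk}$, $\epsilon^{123}=1$. All fields are smooth. The fields are a connection $\omega_a^{AB}=-\omega_a^{BA}$, a co-frame $\theta^A_a$, and 2-forms $B^{AB}_{ab}$ (antisymmetric in $AB$ and in $ab$), $\beta^A_{ab}$; $\Omega=d\omega+\omega\wedge\omega$, $\Theta=d\theta+\omega\wedge\theta$, and $D$ ($D_i$) is the covariant derivative of $\omega$ (of $\omega_i$). Poincaré BF theory has the action $S_0=\int B_{AB}\wedge\Omega^{AB}+\beta_A\wedge\Theta^A$ with Lagrangian density $L$. The momenta of $\omega,\theta,B,\beta$ are $\Pi^a_{AB},\pi^a_A,\Phi^{ab}_{AB},\phi^{ab}_A$, with equal-time brackets $\{\omega_a^{AB}(\mathbf x),\Pi^b_{CD}(\mathbf y)\}=\delta^{[A}_C\delta^{B]}_D\delta_a^b\,\delta(\mathbf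 x,\mathbf y)$, $\{\theta^A_a,\pi^b_B\}=\delta^A_B\delta^b_a\delta(\mathbf x,\mathbf y)$, $\{B_{ab}^{AB},\Phi^{cd}_{CD}\}=\delta^{[A}_C\delta^{B]}_D\delta^c_{[a}\delta^d_{b]}\delta(\mathbf x,\mathbf y)$, $\{\beta^A_{ab},\phi^{cd}_B\}=\delta^A_B\delta^c_{[a}\delta^d_{b]}\delta(\mathbf x,\mathbf y)$. All brackets below are understood after smearing with compactly supported smooth functions. The following hold. **1. Primary constraints and Hamiltonian.** The momenta $\partial L/\partial\dot q$ do not depend on the velocities: the primary constraints are $\Pi^0_{AB}=0$, $\pi^0_A=0$, $\Phi^{ab}_{AB}=0$, $\phi^{ab}_A=0$, $\Pi^i_{AB}-\frac12\epsilon^{ijk}B_{jkAB}=0$, $\pi^i_A-\frac12\epsilon^{ijk}\beta_{jkA}=0$. The total Hamiltonian density $\mathscr H=p\dot q-L$ is the sum of the primary constraints, multiplied by the velocities, and of $\mathscr H_c=-L|_{\dot q=0}$. Let $H$ be its integral. **2. Second-class constraints.** The only non-zero brackets among the primary constraints are $$\{\Phi^{ij}_{AB},\Pi^{k\,CD}-\tfrac12\epsilon^{klm}B_{lm}^{CD}\}=\tfrac12\epsilon^{ijk}\delta^{[C}_A\delta^{D]}_B\,\delta(\mathbf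 x,\mathbf y),\qquad \{\phi^{ij}_A,\pi^{kB}-\tfrac12\epsilon^{klm}\beta^B_{lm}\}=\tfrac12\epsilon^{ijk}\delta^B_A\,\delta(\mathbf x,\mathbf y)$$ (and their transposes). Hence $\Pi^0,\pi^0,\Phi^{0i},\phi^{0i}$ commute with all the primary constraints, while $\Pi^i-\frac12\epsilon B$, $\pi^i-\frac12\epsilon\beta$, $\Phi^{ij}$, $\phi^{ij}$ are second class (their bracket matrix is non-degenerate). The bracket of each primary constraint with $H$ is the Euler–Lagrange derivative of $S_0$ with respect to the corresponding field component; preservation of the second-class constraints determines uniquely the velocities of $\omega_i,\theta_i,B_{ij},\beta_{ij}$, for any given velocities of the temporal components. The second-class constraints are solved, uniquely, by $B_{ij}^{AB}=\epsilon_{ijk}\Pi^{kAB}$, $\beta^A_{ij}=\epsilon_{ijk}\pi^{kA}$, $\Phi^{ij}=0$, $\phi^{ij}=0$, and the Dirac bracket becomes the canonical bracket of the remaining pairs $(\omega_a,\Pi^a),(\theta_a,\pi^a),(B_{0i},\Phi^{0i}),(\beta_{0i},\phi^{0i})$ (the reduced phase space). Let $H'$, $\mathscr H'_c$ be the restrictions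 of $H$, $\mathscr H_c$. **3. Secondary constraints.** On the reduced phase space $$\{\Pi^0_{AB},H'\}=\chi^0_{AB}=D_i\Pi^i_{AB}-\theta_{i[A}\pi^i_{B]},\qquad \{\pi^0_A,H'\}=\chi^0_A=D_i\pi^i_A,$$ $$\{\Phi^{0i}_{AB},H'\}=\chi^{0i}_{AB}=\tfrac12\epsilon^{ijk}(\partial_j\omega_{kAB}+\omega_{jA}{}^C\omega_{kCB}),\qquad \{\phi^{0i}_A,H'\}=\chi^{0i}_A=\tfrac12\epsilon^{ijk}D_j\theta_{kA},$$ $$-\mathscr H'_c=\omega_0^{AB}\chi^0_{AB}+\theta_0^A\chi^0_A+2B_{0i}^{AB}\chi^{0i}_{AB}+2\beta^A_{0i}\chi^{0i}_A-\partial_i(\omega_0^{AB}\Pi^i_{AB}+\theta_0^A\pi^i_A).$$ The constraints $\Pi^0,\pi^0,\Phi^{0i},\phi^{0i}$ commute with each other and with all $\chi$, and (each right-hand side multiplied by $\delta(\mathbf x,\mathbf y)$) $$\{\chi^0_{AB},\chi^0_{CD}\}=\chi^0_{C[A}\eta_{B]D}-\chi^0_{D[A}\eta_{B]C},\quad \{\chi^0_{AB},\chi^0_C\}=\chi^0_{[A}\eta_{B]C},\quad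 \{\chi^0_{AB},\chi^{0i}_{CD}\}=\chi^{0i}_{C[A}\eta_{B]D}-\chi^{0i}_{D[A}\eta_{B]C},$$ $$\{\chi^0_{AB},\chi^{0i}_C\}=\chi^{0i}_{[A}\eta_{B]C},\quad \{\chi^0_A,\chi^{0i}_B\}=-\chi^{0i}_{AB},$$ all the other brackets of the $\chi$ being zero. Where all $\chi$ vanish, $\{\chi,H'\}=0$ for all velocities, so there are no further constraints. **4. Count.** The phase space has $200$ dimensions per point, the number of second-class constraints (the rank of the bracket matrix of the primary constraints) is $60$, and the reduced phase space has dimension $140$. There are $40$ primary and $40$ secondary first-class constraints; the latter satisfy identically the $6+4$ relations $D_i\chi^{0i}_{AB}=0$ and $D_i\chi^{0i}_A+\theta_i^B\chi^{0i}_{BA}=0$, and $40-(6+4)=30$ of them are independent (the rank of the principal symbol of the linearized secondary constraints on every non-zero covector is $30$). The number of local degrees of freedom is therefore $200-60-2(40+30)=200-60-140=0$; in this sense the theory is topological. **5. Gauge generator.** For parameters $\mathsf U^{AB}=-\mathsf U^{BA}$, $\mathsf u^A$, $\Xi_i^{AB}=-\Xi_i^{BA}$, $\xi_i^A$ put $$\mathscr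 J(\mathsf U)=\int\dot{\mathsf U}^{AB}\Pi^0_{AB}-\mathsf U^{AB}\big(2\omega_{0A}{}^C\Pi^0_{CB}-\theta_{0A}\pi^0_B+4B_{0iA}{}^C\Phi^{0i}_{CB}-2\beta_{0iA}\phi^{0i}_B+\chi^0_{AB}\big),$$ $$\mathscr P(\mathsf u)=\int\dot{\mathsf u}^A\pi^0_A-\mathsf u^A\big(\omega_{0A}{}^B\pi^0_B+2\beta^B_{0i}\Phi^{0i}_{BA}+\chi^0_A\big),\qquad \mathscr F(\Xi)=\int\dot\Xi_i^{AB}\Phi^{0i}_{AB}-\Xi_i^{AB}\big(2\omega_{0A}{}^C\Phi^{0i}_{CB}+\chi^{0i}_{AB}\big),$$ $$\mathscr T(\xi)=\int\dot\xi_i^A\phi^{0i}_A-\xi_i^A\big(\omega_{0A}{}^B\phi^{0i}_B+\theta_0^B\Phi^{0i}_{BA}+\chi^{0i}_A\big),\qquad \mathcal G=-\mathscr J(\mathsf U)-\mathscr P(\mathsf u)+2\mathscr F(\Xi)+2\mathscr T(\xi).$$ These are built from Castellani chains: $\mathcal G_{(0)}=(\Pi^0,\pi^0,\Phi^{0i},\phi^{0i})$;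 the coefficients $\mathcal G_{(1)}$ of the undifferentiated parameters are $-\chi$, i.e. $-\{\mathcal G_{(0)},H'\}$, up to combinations of primary constraints; $\{\mathcal G_{(1)},\int\mathscr H'_c\}=0$, and $\{\mathcal G_{(1)},H'\}=0$, for all velocities, where the first-class primary constraints vanish. On the whole reduced phase space, $\delta f=\{f,\mathcal G\}$ is the following transformation of the canonical variables: $$\delta\omega_0^{AB}=-(\dot{\mathsf U}^{AB}+\omega_0{}^A{}_C\mathsf U^{CB}+\omega_0{}^B{}_C\mathsf U^{AC}),\quad \delta\omega_i=-D_i\mathsf U,\quad \delta\theta_0^A=-(\dot{\mathsf u}^A+\omega_0{}^A{}_B\mathsf u^B)+\mathsf U^A{}_B\theta_0^B,\quad \delta\theta_i^A=-D_i\mathsf u^A+\mathsf U^A{}_B\theta_i^B,$$ $$\delta B_{0i}^{AB}=\mathsf U^A{}_CB_{0i}^{CB}+\mathsf U^B{}_CB_{0i}^{AC}-\mathsf u^{[A}\beta_{0i}^{B]}+\dot\Xi_i^{AB}+\omega_0{}^A{}_C\Xi_i^{CB}+\omega_0{}^B{}_C\Xi_i^{AC}-\theta_0^{[A}\xi_i^{B]},\qquad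 \delta\beta_{0i}^A=\mathsf U^A{}_B\beta_{0i}^B+\dot\xi_i^A+\omega_0{}^A{}_B\xi_i^B,$$ $$\delta\Pi^0_{AB}=\mathsf U_A{}^C\Pi^0_{CB}+\mathsf U_B{}^C\Pi^0_{AC}-\mathsf u_{[A}\pi^0_{B]}-2\Xi_{iA}{}^C\Phi^{0i}_{CB}-2\Xi_{iB}{}^C\Phi^{0i}_{AC}+2\xi_{i[A}\phi^{0i}_{B]},\qquad \delta\pi^0_A=\mathsf U_A{}^B\pi^0_B+2\xi_i^B\Phi^{0i}_{AB},$$ $$\delta\Pi^i_{AB}=\mathsf U_A{}^C\Pi^i_{CB}+\mathsf U_B{}^C\Pi^i_{AC}-\mathsf u_{[A}\pi^i_{B]}+\epsilon^{ijk}(D_j\Xi_{kAB}-\theta_{j[A}\xi_{|k|B]}),\qquad \delta\pi^i_A=\mathsf U_A{}^B\pi^i_B+\epsilon^{ijk}D_j\xi_{kA},$$ $$\delta\Phi^{0i}_{AB}=\mathsf U_A{}^C\Phi^{0i}_{CB}+\mathsf U_B{}^C\Phi^{0i}_{AC},\qquad \delta\phi^{0i}_A=\mathsf U_A{}^B\phi^{0i}_B+\mathsf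 u^B\Phi^{0i}_{BA}.$$ **6. Covariant transformations.** Together with $\delta B^{AB}_{ij}=\epsilon_{ijk}\delta\Pi^{kAB}$, $\delta\beta^A_{ij}=\epsilon_{ijk}\delta\pi^{kA}$ these are, for all components of all the fields, the covariant Lagrangian gauge transformations $$\delta\omega=-D\mathsf U,\quad \delta\theta^A=-D\mathsf u^A+\mathsf U^A{}_B\theta^B,\quad \delta B^{AB}=\mathsf U^A{}_CB^{CB}+\mathsf U^B{}_CB^{AC}-\mathsf u^{[A}\beta^{B]}+D\Xi^{AB}-\xi^{[A}\wedge\theta^{B]},\quad \delta\beta^A=\mathsf U^A{}_B\beta^B+D\xi^A,$$ for every history of the fields and all parameters $\mathsf U,\mathsf u,\Xi_i,\xi_i$ on spacetime with $\Xi_0=\xi_0=0$. For general 1-forms $\Xi,\xi$ the covariant transformation at any instant is generated by $\mathcal G$ with the independent data $\dot\Xi_i^{AB},\dot\xi_i^A$ at that instant replaced by $\dot\Xi_i^{AB}-D_i\Xi_0^{AB}-\xi_0^{[A}\theta_i^{B]}$ and $\dot\xi_i^A-D_i\xi_0^A$; moreover, on solutions of the field equations, the covariant transformation does not change when $(\Xi^{AB},\xi^A)$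 is replaced by $(\Xi^{AB}+D\lambda^{AB}+l^{[A}\theta^{B]},\ \xi^A+Dl^A)$ with arbitrary $\lambda^{AB}=-\lambda^{BA}$, $l^A$. -/

import Mathlib

open scoped ContDiff
open MeasureTheory

namespace PoincareBF

noncomputable section

/-! ## Index conventions, fields on a spatial slice

Space is a coordinate chart `ℝ³`; spatial indices `i j k : Fin 3`, spacetime indices `a b c d : Fin 4`
with `0` the time index and `i.succ` the spatial index `i`; Lorentz indices `A B C : Fin 4`. -/

/-- The coordinate chart of space. -/
abbrev Space := Fin 3 → ℝ

/-- The Minkowski metric `η = diag(-1, 1, 1, 1)` (its diagonal entries, which are also those of the inverse). -/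
def η (A : Fin 4) : ℝ := if A = 0 then -1 else 1

/-- The Levi-Civita symbol: the sign of `s` if `s` is a permutation, and `0` otherwise. -/
def leviCivita {n : ℕ} (s : Fin n → Fin n) : ℝ :=
  Matrix.det (Matrix.of fun r c => if s r = c then (1 : ℝ) else 0)

/-- `ε^{ijk}` with `ε^{123} = 1`. -/
def eps3 (i j k : Fin 3) : ℝ := leviCivita ![i, j, k]

/-- `ε^{abcd}` with `ε^{0123} = 1`; hence `ε^{0ijk} = ε^{ijk}`. -/
def eps4 (a b c d : Fin 4) : ℝ := leviCivita ![a, b, c, d]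

/-- Labels of the field components `ω_a^{AB}`, `θ_a^A`, `B_{ab}^{AB}`, `β_{ab}^A`. -/
abbrev CIdx :=
  (Fin 4 × Fin 4 × Fin 4) ⊕ (Fin 4 × Fin 4) ⊕ (Fin 4 × Fin 4 × Fin 4 × Fin 4) ⊕ (Fin 4 × Fin 4 × Fin 4)

/-- Values at one point of all components of `(ω, θ, B, β)` (Lorentz indices up), of velocities,
or of momenta (Lorentz indices down). -/
abbrev Config := CIdx → ℝ

/-- Values at one point of fields `(ω, θ, B, β)` and of momenta `(Π, π, Φ, φ)`. -/
abbrev Phase := Config × Config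

/-- The component `ω_a^{AB}` (of a momentum: `Π^a_{AB}`). -/
def om (q : Config) (a A B : Fin 4) : ℝ := q (Sum.inl (a, A, B))
/-- The component `θ_a^A` (of a momentum: `π^a_A`). -/
def th (q : Config) (a A : Fin 4) : ℝ := q (Sum.inr (Sum.inl (a, A)))
/-- The component `B_{ab}^{AB}` (of a momentum: `Φ^{ab}_{AB}`). -/
def bB (q : Config) (a b A B : Fin 4) : ℝ := q (Sum.inr (Sum.inr (Sum.inl (a, b, A, B))))
/-- The component `β_{ab}^A` (of a momentum: `φ^{ab}_A`). -/
def be (q : Config) (a b A : Fin 4) : ℝ := q (Sum.inr (Sum.inr (Sum.inr (a, b, A))))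

/-- Assemble a `Config` from its four families of components. -/
def mkConfig (o : Fin 4 → Fin 4 → Fin 4 → ℝ) (t : Fin 4 → Fin 4 → ℝ)
    (b : Fin 4 → Fin 4 → Fin 4 → Fin 4 → ℝ) (e : Fin 4 → Fin 4 → Fin 4 → ℝ) : Config :=
  Sum.elim (fun i => o i.1 i.2.1 i.2.2) (Sum.elim (fun i => t i.1 i.2)
    (Sum.elim (fun i => b i.1 i.2.1 i.2.2.1 i.2.2.2) (fun i => e i.1 i.2.1 i.2.2)))

/-- The symmetries of the components: `ω_a^{AB}`, `B_{ab}^{AB}` antisymmetric in `AB`, and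
`B_{ab}^{AB}`, `β_{ab}^A` antisymmetric in `ab`. -/
def configFibre : Submodule ℝ Config where
  carrier := {q | (∀ a A B, om q a B A = -om q a A B) ∧ (∀ a b A B, bB q a b B A = -bB q a b A B) ∧
    (∀ a b A B, bB q b a A B = -bB q a b A B) ∧ (∀ a b A, be q b a A = -be q a b A)}
  zero_mem' := by simp [om, bB, be]
  add_mem' := by
    rintro p q ⟨h1, h2, h3, h4⟩ ⟨k1, k2, k3, k4⟩
    simp only [om, bB, be] at *
    refine ⟨fun a A B => ?_, fun a b A B => ?_, fun a b A B => ?_, fun a b A => ?_⟩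
    · simp only [Pi.add_apply, h1 a A B, k1 a A B]; ring
    · simp only [Pi.add_apply, h2 a b A B, k2 a b A B]; ring
    · simp only [Pi.add_apply, h3 a b A B, k3 a b A B]; ring
    · simp only [Pi.add_apply, h4 a b A, k4 a b A]; ring
  smul_mem' := by
    rintro c q ⟨h1, h2, h3, h4⟩
    simp only [om, bB, be] at *
    refine ⟨fun a A B => ?_, fun a b A B => ?_, fun a b A B => ?_, fun a b A => ?_⟩
    · simp only [Pi.smul_apply, smul_eq_mul, h1 a A B]; ring
    · simp only [Pi.smul_apply, smul_eq_mul, h2 a b A B]; ring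
    · simp only [Pi.smul_apply, smul_eq_mul, h3 a b A B]; ring
    · simp only [Pi.smul_apply, smul_eq_mul, h4 a b A]; ring

/-- Configurations (multipliers, velocities) with vanishing temporal components
`ω_0 = θ_0 = B_{0b} = β_{0b} = 0`. -/
def spatialConfig : Submodule ℝ Config where
  carrier := {q | q ∈ configFibre ∧ (∀ A B, om q 0 A B = 0) ∧ (∀ A, th q 0 A = 0) ∧
    (∀ b A B, bB q 0 b A B = 0) ∧ (∀ b A, be q 0 b A = 0)}
  zero_mem' := ⟨configFibre.zero_mem, by simp [om, th, bB, be]⟩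
  add_mem' := by
    rintro p q ⟨h0, h1, h2, h3, h4⟩ ⟨k0, k1, k2, k3, k4⟩
    refine ⟨configFibre.add_mem h0 k0, ?_⟩
    simp only [om, th, bB, be] at *
    simp [h1, h2, h3, h4, k1, k2, k3, k4]
  smul_mem' := by
    rintro c q ⟨h0, h1, h2, h3, h4⟩
    refine ⟨configFibre.smul_mem c h0, ?_⟩
    simp only [om, th, bB, be] at *
    simp [h1, h2, h3, h4]

/-- Configurations in which the spatial 2-form components `B_{ij}`, `β_{ij}` vanish. -/
def reducedConfig : Submodule ℝ Config where
  carrier := {q | q ∈ configFibre ∧ (∀ (i j : Fin 3) A B, bB q i.succ j.succ A B = 0) ∧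
    (∀ (i j : Fin 3) A, be q i.succ j.succ A = 0)}
  zero_mem' := ⟨configFibre.zero_mem, by simp [bB, be]⟩
  add_mem' := by
    rintro p q ⟨h0, h3, h4⟩ ⟨k0, k3, k4⟩
    refine ⟨configFibre.add_mem h0 k0, ?_⟩
    simp only [bB, be] at *
    simp [h3, h4, k3, k4]
  smul_mem' := by
    rintro c q ⟨h0, h3, h4⟩
    refine ⟨configFibre.smul_mem c h0, ?_⟩
    simp only [bB, be] at *
    simp [h3, h4]

/-- Configurations (multipliers) with only temporal components: `ω_i = θ_i = B_{ij} = β_{ij} = 0`. -/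
def temporalConfig : Submodule ℝ Config where
  carrier := {q | q ∈ reducedConfig ∧ (∀ (i : Fin 3) A B, om q i.succ A B = 0) ∧
    (∀ (i : Fin 3) A, th q i.succ A = 0)}
  zero_mem' := ⟨reducedConfig.zero_mem, by simp [om, th]⟩
  add_mem' := by
    rintro p q ⟨h0, h3, h4⟩ ⟨k0, k3, k4⟩
    refine ⟨reducedConfig.add_mem h0 k0, ?_⟩
    simp only [om, th] at *
    simp [h3, h4, k3, k4]
  smul_mem' := by
    rintro c q ⟨h0, h3, h4⟩
    refine ⟨reducedConfig.smul_mem c h0, ?_⟩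
    simp only [om, th] at *
    simp [h3, h4]

/-- The full phase space, at one point. -/
def phaseFibre : Submodule ℝ Phase := configFibre.prod configFibre

/-- The reduced phase space, at one point: the canonical pairs
`(ω_a, Π^a)`, `(θ_a, π^a)`, `(B_{0i}, Φ^{0i})`, `(β_{0i}, φ^{0i})`. -/
def reducedFibre : Submodule ℝ Phase := reducedConfig.prod reducedConfig

/-- A smooth field on space with values in a linear subspace `W`. -/
structure IsField {V : Type*} [NormedAddCommGroup V] [NormedSpace ℝ V] (W : Submodule ℝ V)
    (z : Space → V) : Prop where
  smooth : ContDiff ℝ ∞ z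
  mem : ∀ x, z x ∈ W

/-- A smooth field with compact support (smearing function, variation). -/
structure IsTest {V : Type*} [NormedAddCommGroup V] [NormedSpace ℝ V] (W : Submodule ℝ V)
    (z : Space → V) : Prop extends IsField W z where
  compact : HasCompactSupport z

/-! ## Local functionals and Poisson brackets -/

/-- A local functional `∫ F[z](x) d³x`, given by its density. -/
abbrev Density := (Space → Phase) → Space → ℝ

/-- The contraction of all components, summed over all values of all indices. -/
def pair (w w' : Phase) : ℝ := dotProduct w.1 w'.1 + dotProduct w.2 w'.2

/-- `g` is the functional derivative at `z` of `∫ F`, on the space of fields with values in `W`: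
`δ ∫ F = ∫ ⟨g, δz⟩` for all compactly supported variations. (For antisymmetric components the
sum over all index values in `pair` gives the bracket
`{ω_a^{AB}(x), Π^b_{CD}(y)} = δ^{[A}_C δ^{B]}_D δ_a^b δ(x, y)` with unit-weight antisymmetrization,
and similarly for the other pairs.) -/
structure HasGradient (W : Submodule ℝ Phase) (F : Density) (z g : Space → Phase) : Prop where
  isField : IsField W g
  integrable : ∀ h, IsTest W h → ∀ s : ℝ, Integrable fun x => F (z + s • h) x - F z x
  hasDerivAt : ∀ h, IsTest W h →
    HasDerivAt (fun s : ℝ => ∫ x, (F (z + s • h) x - F z x)) (∫ x, pair (g x) (h x)) 0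

/-- The pointwise canonical bracket of two covectors, `∂f/∂q ∂g/∂p - ∂f/∂p ∂g/∂q`. -/
def poisson (f g : Phase) : ℝ := dotProduct f.1 g.2 - dotProduct f.2 g.1

/-- The equal-time Poisson bracket of `∫ F` and `∫ G` exists at `z` and equals `c`. -/
def HasBracket (W : Submodule ℝ Phase) (F G : Density) (z : Space → Phase) (c : ℝ) : Prop :=
  ∃ f g, HasGradient W F z f ∧ HasGradient W G z g ∧
    Integrable (fun x => poisson (f x) (g x)) ∧ c = ∫ x, poisson (f x) (g x)

/-! ## Lorentz algebra -/

/-- The action on a bivector: `U^A_C X^{CB} + U^B_C X^{AC}`. -/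
def rot (U X : Fin 4 → Fin 4 → ℝ) (A B : Fin 4) : ℝ :=
  ∑ C, η C * (U A C * X C B + U B C * X A C)
/-- The action on a vector: `U^A_C v^C`. -/
def rotV (U : Fin 4 → Fin 4 → ℝ) (v : Fin 4 → ℝ) (A : Fin 4) : ℝ := ∑ C, η C * U A C * v C
/-- The action on a bivector with lower indices: `U_A^C Y_{CB} + U_B^C Y_{AC}`. -/
def rotL (U Y : Fin 4 → Fin 4 → ℝ) (A B : Fin 4) : ℝ :=
  ∑ C, (η A * U A C * Y C B + η B * U B C * Y A C)
/-- The action on a vector with lower index: `U_A^C y_C`. -/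
def rotVL (U : Fin 4 → Fin 4 → ℝ) (y : Fin 4 → ℝ) (A : Fin 4) : ℝ := ∑ C, η A * U A C * y C
/-- `u^{[A} v^{B]}`, with unit weight. -/
def asym (u v : Fin 4 → ℝ) (A B : Fin 4) : ℝ := (u A * v B - u B * v A) / 2
/-- Lowering (or raising) one index. -/
def low (v : Fin 4 → ℝ) (A : Fin 4) : ℝ := η A * v A
/-- Lowering (or raising) two indices. -/
def low2 (X : Fin 4 → Fin 4 → ℝ) (A B : Fin 4) : ℝ := η A * η B * X A B
/-- The metric `η_{AB}`. -/
def ηη (A B : Fin 4) : ℝ := if A = B then η A else 0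

/-! ## Lagrangian and total Hamiltonian -/

/-- The partial derivative `∂_i f`. -/
def pd (i : Fin 3) (f : Space → ℝ) (x : Space) : ℝ := fderiv ℝ f x (Pi.single i 1)

/-- The spacetime derivative `∂_a` of a component of fields `q` with velocities `v = ∂_0 q`. -/
def dst (q v : Space → Config) (a : Fin 4) (c : Config → ℝ) (x : Space) : ℝ :=
  Fin.cases (c (v x)) (fun i => pd i (fun y => c (q y)) x) a

/-- The curvature `Ω_{ab}^{AB}` of `Ω = dω + ω ∧ ω`. -/
def curv (q v : Space → Config) (a b : Fin 4) (x : Space) (A B : Fin 4) : ℝ :=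
  dst q v a (fun p => om p b A B) x - dst q v b (fun p => om p a A B) x +
    ∑ C, η C * (om (q x) a A C * om (q x) b C B - om (q x) b A C * om (q x) a C B)

/-- The torsion `Θ_{ab}^A` of `Θ = dθ + ω ∧ θ`. -/
def tors (q v : Space → Config) (a b : Fin 4) (x : Space) (A : Fin 4) : ℝ :=
  dst q v a (fun p => th p b A) x - dst q v b (fun p => th p a A) x +
    rotV (om (q x) a) (th (q x) b) A - rotV (om (q x) b) (th (q x) a) A

/-- The Lagrangian density of `S₀ = ∫ B_{AB} ∧ Ω^{AB} + β_A ∧ Θ^A`, as a function of fields and velocities. -/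
def lagrangian (q v : Space → Config) (x : Space) : ℝ :=
  (1 / 4) * ∑ a, ∑ b, ∑ c, ∑ d, eps4 a b c d *
    ((∑ A, ∑ B, low2 (bB (q x) a b) A B * curv q v c d x A B) +
      ∑ A, low (be (q x) a b) A * tors q v c d x A)

/-- The conjugate momenta as functions of the fields:
`Π^i_{AB} = ½ ε^{ijk} B_{jk AB}`, `π^i_A = ½ ε^{ijk} β_{jk A}`, all the others zero. -/
def momenta (q : Config) : Config :=
  mkConfig
    (fun a A B => Fin.cases 0 (fun i => (1 / 2) * ∑ j : Fin 3, ∑ k : Fin 3,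
      eps3 i j k * low2 (bB q j.succ k.succ) A B) a)
    (fun a A => Fin.cases 0 (fun i => (1 / 2) * ∑ j : Fin 3, ∑ k : Fin 3,
      eps3 i j k * low (be q j.succ k.succ) A) a)
    (fun _ _ _ _ => 0) (fun _ _ _ => 0)

/-- The Euler-Lagrange derivatives of `S₀` (with `v` the velocities of `q`), as components:
`δS/δω_a^{AB} = ½ ε^{abcd} (D_b B_{cd} - θ_b^{[·} β_{cd}^{·]})_{AB}`, `δS/δθ_a^A = ½ ε^{abcd} D_b β_{cd A}`,
`δS/δB_{ab}^{AB} = ¼ ε^{abcd} Ω_{cd AB}`, `δS/δβ_{ab}^A = ¼ ε^{abcd} Θ_{cd A}`. -/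
def eulerLagrange (q v : Space → Config) (x : Space) : Config :=
  mkConfig
    (fun a => low2 fun A B => (1 / 2) * ∑ b, ∑ c, ∑ d, eps4 a b c d *
      (dst q v b (fun p => bB p c d A B) x + rot (om (q x) b) (bB (q x) c d) A B
        - asym (th (q x) b) (be (q x) c d) A B))
    (fun a => low fun A => (1 / 2) * ∑ b, ∑ c, ∑ d, eps4 a b c d *
      (dst q v b (fun p => be p c d A) x + rotV (om (q x) b) (be (q x) c d) A))
    (fun a b => low2 fun A B => (1 / 4) * ∑ c, ∑ d, eps4 a b c d * curv q v c d x A B)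
    (fun a b => low fun A => (1 / 4) * ∑ c, ∑ d, eps4 a b c d * tors q v c d x A)

/-- The combination, with multipliers `l`, of all primary constraints `p - ∂L/∂q̇`. -/
def primary (l : Space → Config) : Density := fun z x =>
  dotProduct (l x) ((z x).2 - momenta (z x).1)

/-- The total Hamiltonian density `p q̇ - L(q, q̇)`, with the velocities `v = q̇` as undetermined multipliers. -/
def hamiltonian (v : Space → Config) : Density := fun z x =>
  dotProduct (z x).2 (v x) - lagrangian (fun y => (z y).1) v x

/-- The canonical Hamiltonian density: minus the Lagrangian at zero velocities. -/
def canonicalHamiltonian : Density := fun z x => -lagrangian (fun y => (z y).1) 0 x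

/-! ## Classification of the primary constraints -/

/-- The matrix of brackets of the primary constraints with multipliers `l` and `l'`. -/
def diracForm (l l' : Config) : ℝ := dotProduct (momenta l) l' - dotProduct l (momenta l')

theorem momenta_add (q q' : Config) : momenta (q + q') = momenta q + momenta q' := by
  funext c
  rcases c with ⟨a, A, B⟩ | ⟨a, A⟩ | c | c
  · refine Fin.cases ?_ (fun i => ?_) a
    · simp [momenta, mkConfig]
    · simp [momenta, mkConfig, low2, bB, mul_add, Finset.sum_add_distrib]
  · refine Fin.cases ?_ (fun i => ?_) a
    · simp [momenta, mkConfig]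
    · simp [momenta, mkConfig, low, be, mul_add, Finset.sum_add_distrib]
  · simp [momenta, mkConfig]
  · simp [momenta, mkConfig]

theorem momenta_smul (r : ℝ) (q : Config) : momenta (r • q) = r • momenta q := by
  funext c
  rcases c with ⟨a, A, B⟩ | ⟨a, A⟩ | c | c
  · refine Fin.cases ?_ (fun i => ?_) a
    · simp [momenta, mkConfig]
    · simp only [momenta, mkConfig, low2, bB, Sum.elim_inl, Fin.cases_succ, Pi.smul_apply, smul_eq_mul,
        Finset.mul_sum]
      refine Finset.sum_congr rfl fun j _ => Finset.sum_congr rfl fun k _ => ?_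
      ring
  · refine Fin.cases ?_ (fun i => ?_) a
    · simp [momenta, mkConfig]
    · simp only [momenta, mkConfig, low, be, Sum.elim_inl, Sum.elim_inr, Fin.cases_succ, Pi.smul_apply,
        smul_eq_mul, Finset.mul_sum]
      refine Finset.sum_congr rfl fun j _ => Finset.sum_congr rfl fun k _ => ?_
      ring
  · simp [momenta, mkConfig]
  · simp [momenta, mkConfig]

/-- The multipliers whose primary constraint commutes with all the primary constraints. -/
def primaryRadical : Submodule ℝ Config where
  carrier := {l | l ∈ configFibre ∧ ∀ l' ∈ configFibre, diracForm l l' = 0}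
  zero_mem' := by
    have h : momenta 0 = 0 := by simpa using momenta_smul 0 0
    exact ⟨configFibre.zero_mem, fun l' _ => by simp [diracForm, h]⟩
  add_mem' := by
    rintro p q ⟨h0, h1⟩ ⟨k0, k1⟩
    refine ⟨configFibre.add_mem h0 k0, fun l' hl => ?_⟩
    have h := h1 l' hl
    have k := k1 l' hl
    simp only [diracForm, momenta_add, add_dotProduct] at *
    linarith
  smul_mem' := by
    rintro c q ⟨h0, h1⟩
    refine ⟨configFibre.smul_mem c h0, fun l' hl => ?_⟩
    have h := h1 l' hl
    simp only [diracForm, momenta_smul, smul_dotProduct, smul_eq_mul] at *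
    rw [← mul_sub, h, mul_zero]

/-- The differentials (as covectors) of the second-class constraints, i.e. of the primary constraints with
multipliers in `spatialConfig`: `Π^i - ½ ε^{ijk} B_{jk}`, `π^i - ½ ε^{ijk} β_{jk}`, `Φ^{ij}`, `φ^{ij}`. -/
def secondClassCovectors : Set Phase :=
  {s | s ∈ phaseFibre ∧ ∃ l ∈ spatialConfig, ∀ w ∈ phaseFibre, pair s w = dotProduct l (w.2 - momenta w.1)}

/-- The Dirac bracket of `∫ F` and `∫ G` exists at `z` and equals `c`: each differential is corrected by a
combination of the second-class constraints so that it commutes with all of them, and the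
Poisson bracket of the corrected differentials is taken. -/
def HasDiracBracket (F G : Density) (z : Space → Phase) (c : ℝ) : Prop :=
  ∃ f g a b, HasGradient phaseFibre F z f ∧ HasGradient phaseFibre G z g ∧
    IsField phaseFibre a ∧ IsField phaseFibre b ∧
    (∀ x, a x ∈ secondClassCovectors ∧ b x ∈ secondClassCovectors) ∧
    (∀ x, ∀ s ∈ secondClassCovectors, poisson (f x + a x) s = 0 ∧ poisson (g x + b x) s = 0) ∧
    Integrable (fun x => poisson (f x + a x) (g x + b x)) ∧
    c = ∫ x, poisson (f x + a x) (g x + b x)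

/-- The solution of the second-class constraints: `B_{ij}^{AB} = ε_{ijk} Π^{k AB}`,
`β_{ij}^A = ε_{ijk} π^{k A}` (and `Φ^{ij} = φ^{ij} = 0` on `reducedFibre`). -/
def lift (w : Phase) : Phase :=
  (mkConfig (om w.1) (th w.1)
    (fun a b A B => Fin.cases (bB w.1 0 b A B) (fun i => Fin.cases (bB w.1 i.succ 0 A B) (fun j =>
      ∑ k : Fin 3, eps3 i j k * low2 (om w.2 k.succ) A B) b) a)
    (fun a b A => Fin.cases (be w.1 0 b A) (fun i => Fin.cases (be w.1 i.succ 0 A) (fun j =>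
      ∑ k : Fin 3, eps3 i j k * low (th w.2 k.succ) A) b) a), w.2)

/-- A functional restricted to the surface of the second-class constraints. -/
def restrict (F : Density) : Density := fun z => F fun x => lift (z x)

/-! ## First-class constraints -/

/-- Smearing parameters, and values of a multiplet of constraints, at one point:
components `(·^{AB}, ·^A, ·_i^{AB}, ·_i^A)`. -/
abbrev Par :=
  (Fin 4 → Fin 4 → ℝ) × (Fin 4 → ℝ) × (Fin 3 → Fin 4 → Fin 4 → ℝ) × (Fin 3 → Fin 4 → ℝ)

/-- Antisymmetry in the Lorentz index pairs. -/
def parFibre : Submodule ℝ Par where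
  carrier := {N | (∀ A B, N.1 B A = -N.1 A B) ∧ (∀ i A B, N.2.2.1 i B A = -N.2.2.1 i A B)}
  zero_mem' := by simp
  add_mem' := by
    rintro p q ⟨h1, h2⟩ ⟨k1, k2⟩
    refine ⟨fun A B => ?_, fun i A B => ?_⟩
    · simp only [Prod.fst_add, Pi.add_apply, h1 A B, k1 A B]; ring
    · simp only [Prod.fst_add, Prod.snd_add, Pi.add_apply, h2 i A B, k2 i A B]; ring
  smul_mem' := by
    rintro c q ⟨h1, h2⟩
    refine ⟨fun A B => ?_, fun i A B => ?_⟩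
    · simp only [Prod.smul_fst, Pi.smul_apply, smul_eq_mul, h1 A B]; ring
    · simp only [Prod.smul_fst, Prod.smul_snd, Pi.smul_apply, smul_eq_mul, h2 i A B]; ring

/-- `N^{AB} K_{AB} + N^A K_A + N_i^{AB} K^i_{AB} + N_i^A K^i_A`. -/
def parPair (N K : Par) : ℝ :=
  (∑ A, ∑ B, N.1 A B * K.1 A B) + (∑ A, N.2.1 A * K.2.1 A) +
    (∑ i, ∑ A, ∑ B, N.2.2.1 i A B * K.2.2.1 i A B) + ∑ i, ∑ A, N.2.2.2 i A * K.2.2.2 i A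

/-- The first-class primary constraints `(Π^0_{AB}, π^0_A, Φ^{0i}_{AB}, φ^{0i}_A)`. -/
def temporalMomenta (w : Phase) : Par :=
  (om w.2 0, th w.2 0, fun i => bB w.2 0 i.succ, fun i => be w.2 0 i.succ)

/-- `(ω_0^{AB}, θ_0^A, 2 B_{0i}^{AB}, 2 β_{0i}^A)`. -/
def temporalFields (w : Phase) : Par :=
  (om w.1 0, th w.1 0, fun i A B => 2 * bB w.1 0 i.succ A B, fun i A => 2 * be w.1 0 i.succ A)

/-- The secondary constraints
`χ^0_{AB} = D_i Π^i_{AB} - θ_{i[A} π^i_{B]}`, `χ^0_A = D_i π^i_A`,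
`χ^{0i}_{AB} = ½ ε^{ijk} (∂_j ω_{kAB} + ω_{jA}^C ω_{kCB})`, `χ^{0i}_A = ½ ε^{ijk} D_j θ_{kA}`. -/
def chi (z : Space → Phase) (x : Space) : Par :=
  (fun A B => ∑ i : Fin 3, (pd i (fun y => om (z y).2 i.succ A B) x
      + rotL (om (z x).1 i.succ) (om (z x).2 i.succ) A B
      - asym (low (th (z x).1 i.succ)) (th (z x).2 i.succ) A B),
    fun A => ∑ i : Fin 3, (pd i (fun y => th (z y).2 i.succ A) x
      + rotVL (om (z x).1 i.succ) (th (z x).2 i.succ) A),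
    fun i => low2 fun A B => (1 / 2) * ∑ j : Fin 3, ∑ k : Fin 3, eps3 i j k *
      (pd j (fun y => om (z y).1 k.succ A B) x +
        ∑ C, η C * om (z x).1 j.succ A C * om (z x).1 k.succ C B),
    fun i => low fun A => (1 / 2) * ∑ j : Fin 3, ∑ k : Fin 3, eps3 i j k *
      (pd j (fun y => th (z y).1 k.succ A) x + rotV (om (z x).1 j.succ) (th (z x).1 k.succ) A))

/-- The first-class primary constraints smeared with `N`. -/
def prim (N : Space → Par) : Density := fun z x => parPair (N x) (temporalMomenta (z x))

/-- The secondary constraints smeared with `N`. -/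
def sec (N : Space → Par) : Density := fun z x => parPair (N x) (chi z x)

/-- The right-hand sides of the algebra of the secondary constraints, contracted with smearing
parameters `N = (U, u, Ξ, ξ)` and `N' = (U', u', Ξ', ξ')`; `K` is the value of the constraints. -/
def algebra (N N' K : Par) : ℝ :=
  (∑ A, ∑ B, ∑ C, ∑ D, N.1 A B * N'.1 C D *
      ((K.1 C A * ηη B D - K.1 C B * ηη A D) / 2 - (K.1 D A * ηη B C - K.1 D B * ηη A C) / 2))
  + (∑ A, ∑ B, ∑ C, (N.1 A B * N'.2.1 C - N'.1 A B * N.2.1 C) *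
      ((K.2.1 A * ηη B C - K.2.1 B * ηη A C) / 2))
  + (∑ i, ∑ A, ∑ B, ∑ C, ∑ D, (N.1 A B * N'.2.2.1 i C D - N'.1 A B * N.2.2.1 i C D) *
      ((K.2.2.1 i C A * ηη B D - K.2.2.1 i C B * ηη A D) / 2
        - (K.2.2.1 i D A * ηη B C - K.2.2.1 i D B * ηη A C) / 2))
  + (∑ i, ∑ A, ∑ B, ∑ C, (N.1 A B * N'.2.2.2 i C - N'.1 A B * N.2.2.2 i C) *
      ((K.2.2.2 i A * ηη B C - K.2.2.2 i B * ηη A C) / 2))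
  - ∑ i, ∑ A, ∑ B, (N.2.1 A * N'.2.2.2 i B - N'.2.1 A * N.2.2.2 i B) * K.2.2.1 i A B

/-! ## Degrees of freedom -/

/-- The principal symbol of the linearized secondary constraints at `x`, on the covector `k`: the linear response
at `x` to the variation `k·(y - x) w` of the fields. -/
def chiSymbol (z : Space → Phase) (x : Space) (k : Fin 3 → ℝ) (w : Phase) : Par :=
  deriv (fun s : ℝ => chi (fun y => z y + (s * dotProduct k (y - x)) • w) x) 0

/-- The number of independent secondary constraints: the rank of their principal symbol. -/
def secondaryRank (z : Space → Phase) (x : Space) (k : Fin 3 → ℝ) : ℕ :=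
  Module.finrank ℝ (Submodule.span ℝ (chiSymbol z x k '' (reducedFibre : Set Phase)))

/-- The number of second-class constraints: the rank of the bracket matrix of the primary constraints. -/
def secondClassCount : ℕ := Module.finrank ℝ configFibre - Module.finrank ℝ primaryRadical

/-- Dirac's count of the local phase-space degrees of freedom: the dimension of the phase space, minus the
number of second-class constraints, minus twice the number of independent first-class constraints. -/
def localDegreesOfFreedom (z : Space → Phase) (x : Space) (k : Fin 3 → ℝ) : ℤ :=
  (Module.finrank ℝ phaseFibre : ℤ) - secondClassCount
    - 2 * ((Module.finrank ℝ primaryRadical : ℤ) + secondaryRank z x k)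

/-! ## The gauge generator -/

/-- The combinations of first-class primary constraints that complete the secondary ones in the
Castellani chains. -/
def chainShift (w : Phase) : Par :=
  (fun A B => (∑ C, 2 * η A * om w.1 0 A C * om w.2 0 C B) - low (th w.1 0) A * th w.2 0 B
      + ∑ i : Fin 3, ((∑ C, 4 * η A * bB w.1 0 i.succ A C * bB w.2 0 i.succ C B)
        - 2 * low (be w.1 0 i.succ) A * be w.2 0 i.succ B),
    fun A => (∑ C, η A * om w.1 0 A C * th w.2 0 C)
      + ∑ i : Fin 3, ∑ C, 2 * be w.1 0 i.succ C * bB w.2 0 i.succ C A,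
    fun i A B => ∑ C, 2 * η A * om w.1 0 A C * bB w.2 0 i.succ C B,
    fun i A => ∑ C, (η A * om w.1 0 A C * be w.2 0 i.succ C + th w.1 0 C * bB w.2 0 i.succ C A))

/-- The second link `G_{(1)} = -χ + (primary)` of the Castellani chains, smeared with `N`;
the first link `G_{(0)}` is `prim N`. -/
def chain (N : Space → Par) : Density := fun z x => -parPair (N x) (chi z x + chainShift (z x))

/-- `J(U) = ∫ U̇^{AB} Π^0_{AB} - U^{AB}(…)`, with `V = U̇`. -/
def genJ (U V : Space → Fin 4 → Fin 4 → ℝ) : Density := fun z x =>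
  prim (fun y => (V y, 0, 0, 0)) z x + chain (fun y => (U y, 0, 0, 0)) z x
/-- `P(u) = ∫ u̇^A π^0_A - u^A(…)`, with `v = u̇`. -/
def genP (u v : Space → Fin 4 → ℝ) : Density := fun z x =>
  prim (fun y => (0, v y, 0, 0)) z x + chain (fun y => (0, u y, 0, 0)) z x
/-- `F(Ξ) = ∫ Ξ̇_i^{AB} Φ^{0i}_{AB} - Ξ_i^{AB}(…)`, with `V = Ξ̇`. -/
def genF (X V : Space → Fin 3 → Fin 4 → Fin 4 → ℝ) : Density := fun z x =>
  prim (fun y => (0, 0, V y, 0)) z x + chain (fun y => (0, 0, X y, 0)) z x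
/-- `T(ξ) = ∫ ξ̇_i^A φ^{0i}_A - ξ_i^A(…)`, with `v = ξ̇`. -/
def genT (X v : Space → Fin 3 → Fin 4 → ℝ) : Density := fun z x =>
  prim (fun y => (0, 0, 0, v y)) z x + chain (fun y => (0, 0, 0, X y)) z x

/-- The gauge generator `G = -J(U) - P(u) + 2 F(Ξ) + 2 T(ξ)`, for the parameters
`N = (U, u, Ξ, ξ)` and their time derivatives `M`. -/
def generator (N M : Space → Par) : Density := fun z x =>
  -genJ (fun y => (N y).1) (fun y => (M y).1) z x
    - genP (fun y => (N y).2.1) (fun y => (M y).2.1) z x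
    + 2 * genF (fun y => (N y).2.2.1) (fun y => (M y).2.2.1) z x
    + 2 * genT (fun y => (N y).2.2.2) (fun y => (M y).2.2.2) z x

/-- The spatial covariant derivative of a bivector field. -/
def covB (z : Space → Phase) (i : Fin 3) (X : Space → Fin 4 → Fin 4 → ℝ) (x : Space) (A B : Fin 4) : ℝ :=
  pd i (fun y => X y A B) x + rot (om (z x).1 i.succ) (X x) A B
/-- The spatial covariant derivative of a vector field. -/
def covV (z : Space → Phase) (i : Fin 3) (X : Space → Fin 4 → ℝ) (x : Space) (A : Fin 4) : ℝ :=
  pd i (fun y => X y A) x + rotV (om (z x).1 i.succ) (X x) A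

/-- The variation `δB_{0i}`. -/
def varB (N M : Space → Par) (z : Space → Phase) (x : Space) (i : Fin 3) (A B : Fin 4) : ℝ :=
  rot (N x).1 (bB (z x).1 0 i.succ) A B - asym (N x).2.1 (be (z x).1 0 i.succ) A B
    + ((M x).2.2.1 i A B + rot (om (z x).1 0) ((N x).2.2.1 i) A B)
    - asym (th (z x).1 0) ((N x).2.2.2 i) A B
/-- The variation `δβ_{0i}`. -/
def varBe (N M : Space → Par) (z : Space → Phase) (x : Space) (i : Fin 3) (A : Fin 4) : ℝ :=
  rotV (N x).1 (be (z x).1 0 i.succ) A + ((M x).2.2.2 i A + rotV (om (z x).1 0) ((N x).2.2.2 i) A)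

/-- The gauge variation of all the canonical variables of the reduced phase space, for the parameters
`N = (U, u, Ξ, ξ)` and their time derivatives `M`. -/
def gaugeVariation (N M : Space → Par) (z : Space → Phase) (x : Space) : Phase :=
  (mkConfig
    (fun a A B => Fin.cases (-((M x).1 A B + rot (om (z x).1 0) (N x).1 A B))
      (fun i => -covB z i (fun y => (N y).1) x A B) a)
    (fun a A => Fin.cases
      (-((M x).2.1 A + rotV (om (z x).1 0) (N x).2.1 A) + rotV (N x).1 (th (z x).1 0) A)
      (fun i => -covV z i (fun y => (N y).2.1) x A + rotV (N x).1 (th (z x).1 i.succ) A) a)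
    (fun a b A B => Fin.cases (Fin.cases 0 (fun j => varB N M z x j A B) b)
      (fun i => Fin.cases (-varB N M z x i A B) (fun _ => 0) b) a)
    (fun a b A => Fin.cases (Fin.cases 0 (fun j => varBe N M z x j A) b)
      (fun i => Fin.cases (-varBe N M z x i A) (fun _ => 0) b) a),
  mkConfig
    (fun a A B => Fin.cases
      (rotL (N x).1 (om (z x).2 0) A B - asym (low (N x).2.1) (th (z x).2 0) A B
        + ∑ i : Fin 3, (-2 * rotL ((N x).2.2.1 i) (bB (z x).2 0 i.succ) A B
          + 2 * asym (low ((N x).2.2.2 i)) (be (z x).2 0 i.succ) A B))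
      (fun i => rotL (N x).1 (om (z x).2 i.succ) A B - asym (low (N x).2.1) (th (z x).2 i.succ) A B
        + ∑ j : Fin 3, ∑ k : Fin 3, eps3 i j k * low2 (fun A B =>
          covB z j (fun y => (N y).2.2.1 k) x A B - asym (th (z x).1 j.succ) ((N x).2.2.2 k) A B) A B) a)
    (fun a A => Fin.cases
      (rotVL (N x).1 (th (z x).2 0) A
        + ∑ i : Fin 3, ∑ C, 2 * (N x).2.2.2 i C * bB (z x).2 0 i.succ A C)
      (fun i => rotVL (N x).1 (th (z x).2 i.succ) A
        + ∑ j : Fin 3, ∑ k : Fin 3, eps3 i j k * low (covV z j (fun y => (N y).2.2.2 k) x) A) a)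
    (fun a b A B => Fin.cases (Fin.cases 0 (fun j => rotL (N x).1 (bB (z x).2 0 j.succ) A B) b)
      (fun i => Fin.cases (-rotL (N x).1 (bB (z x).2 0 i.succ) A B) (fun _ => 0) b) a)
    (fun a b A => Fin.cases
      (Fin.cases 0 (fun j => rotVL (N x).1 (be (z x).2 0 j.succ) A
        + ∑ C, (N x).2.1 C * bB (z x).2 0 j.succ C A) b)
      (fun i => Fin.cases (-(rotVL (N x).1 (be (z x).2 0 i.succ) A
        + ∑ C, (N x).2.1 C * bB (z x).2 0 i.succ C A)) (fun _ => 0) b) a))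

/-! ## Covariant gauge transformations of field histories -/

/-- Covariant parameters `(U^{AB}, u^A, Ξ_a^{AB}, ξ_a^A)` at one point of spacetime. -/
abbrev STPar :=
  (Fin 4 → Fin 4 → ℝ) × (Fin 4 → ℝ) × (Fin 4 → Fin 4 → Fin 4 → ℝ) × (Fin 4 → Fin 4 → ℝ)

/-- A smooth function on spacetime, as a family of functions on space. -/
def IsHistory {V : Type*} [NormedAddCommGroup V] [NormedSpace ℝ V] (Q : ℝ → Space → V) : Prop :=
  ContDiff ℝ ∞ fun p : ℝ × Space => Q p.1 p.2

/-- The velocities of a history. -/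
def velocity (Q : ℝ → Space → Config) (t : ℝ) (x : Space) : Config := deriv (fun s => Q s x) t

/-- A history of the fields is a solution of the covariant field equations. -/
def IsSolution (Q : ℝ → Space → Config) : Prop := ∀ t x, eulerLagrange (Q t) (velocity Q t) x = 0

/-- The spacetime derivative `∂_a`. -/
def stD (a : Fin 4) (f : ℝ → Space → ℝ) (t : ℝ) (x : Space) : ℝ :=
  Fin.cases (deriv (fun s => f s x) t) (fun i => pd i (f t) x) a

/-- The spacetime covariant derivative `D_a X^{AB}`. -/
def stB (Q : ℝ → Space → Config) (a : Fin 4) (X : ℝ → Space → Fin 4 → Fin 4 → ℝ) (t : ℝ) (x : Space)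
    (A B : Fin 4) : ℝ :=
  stD a (fun s y => X s y A B) t x + rot (om (Q t x) a) (X t x) A B
/-- The spacetime covariant derivative `D_a X^A`. -/
def stV (Q : ℝ → Space → Config) (a : Fin 4) (X : ℝ → Space → Fin 4 → ℝ) (t : ℝ) (x : Space)
    (A : Fin 4) : ℝ :=
  stD a (fun s y => X s y A) t x + rotV (om (Q t x) a) (X t x) A

/-- The covariant gauge transformations
`δω = -DU`, `δθ^A = -Du^A + U^A_B θ^B`,
`δB^{AB} = U^A_C B^{CB} + U^B_C B^{AC} - u^{[A} β^{B]} + DΞ^{AB} - ξ^{[A} ∧ θ^{B]}`,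
`δβ^A = U^A_B β^B + Dξ^A`. -/
def covariantVariation (Q : ℝ → Space → Config) (P : ℝ → Space → STPar) (t : ℝ) (x : Space) : Config :=
  mkConfig
    (fun a A B => -stB Q a (fun s y => (P s y).1) t x A B)
    (fun a A => -stV Q a (fun s y => (P s y).2.1) t x A + rotV (P t x).1 (th (Q t x) a) A)
    (fun a b A B => rot (P t x).1 (bB (Q t x) a b) A B - asym (P t x).2.1 (be (Q t x) a b) A B
      + (stB Q a (fun s y => (P s y).2.2.1 b) t x A B - stB Q b (fun s y => (P s y).2.2.1 a) t x A B)
      - (asym ((P t x).2.2.2 a) (th (Q t x) b) A B - asym ((P t x).2.2.2 b) (th (Q t x) a) A B))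
    (fun a b A => rotV (P t x).1 (be (Q t x) a b) A
      + (stV Q a (fun s y => (P s y).2.2.2 b) t x A - stV Q b (fun s y => (P s y).2.2.2 a) t x A))

/-- The parameters `(U, u, Ξ_i, ξ_i)` at time `t`. -/
def spatialPar (P : ℝ → Space → STPar) (t : ℝ) (x : Space) : Par :=
  ((P t x).1, (P t x).2.1, fun i => (P t x).2.2.1 i.succ, fun i => (P t x).2.2.2 i.succ)

/-- The time derivatives of the parameters `(U, u, Ξ_i, ξ_i)` at time `t`. -/
def ratePar (P : ℝ → Space → STPar) (t : ℝ) (x : Space) : Par := deriv (fun s => spatialPar P s x) t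

/-- The contribution of the temporal components `Ξ_0`, `ξ_0` (zero if these vanish): the values
`(0, 0, -D_i Ξ_0 - ξ_0^{[·} θ_i^{·]}, -D_i ξ_0)`. -/
def temporalShift (Q : ℝ → Space → Config) (P : ℝ → Space → STPar) (t : ℝ) (x : Space) : Par :=
  (0, 0, fun i A B => -stB Q i.succ (fun s y => (P s y).2.2.1 0) t x A B
      - asym ((P t x).2.2.2 0) (th (Q t x) i.succ) A B,
    fun i A => -stV Q i.succ (fun s y => (P s y).2.2.2 0) t x A)

/-- The covariant parameters `Ξ = Dλ + l^{[·} θ^{·]}`, `ξ = Dl` (with `U = u = 0`). -/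
def exactPar (Q : ℝ → Space → Config) (lam : ℝ → Space → Fin 4 → Fin 4 → ℝ) (l : ℝ → Space → Fin 4 → ℝ)
    (t : ℝ) (x : Space) : STPar :=
  (0, 0, fun a A B => stB Q a lam t x A B + asym (l t x) (th (Q t x) a) A B, fun a A => stV Q a l t x A)

end

end PoincareBF

/-!
Poincaré BF theory is of first order in time derivatives and polynomial in the fields, and all its structure comes
from the Lorentz algebra acting on bivectors and vectors. Everything is therefore expressed with the bilinear
operations `rotB`, `rotW`, `wdg` on upper-index quantities and the contractions `ipB`, `ipV`; the only facts about
the Minkowski metric that matter are the representation identities `rotB_rotB`, `rotW_rotW`, the equivariance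
`rotB_wdg` and the invariance `ipB_rotB`, `ipV_rotW`, `ipB_wdg`.

*Functional derivatives.* Each functional that occurs is the integral of a local density of degree at most three in
the fields, so it is a polynomial in the parameter along every compactly supported variation, and
`IsLocal.hasGradient` reduces the existence of its functional derivative to an integration by parts of the linear
coefficient.

*Primary and second-class constraints.* The Lagrangian is affine in the velocities with coefficients `momenta`
(`lagrangian_split`). The brackets of the primary constraints form the constant matrix `diracMatrix`. Its kernel
consists of the temporal components, and on the spatial components it has the inverse `diracInv`. This gives the
first-class and second-class constraints, the unique spatial velocities (`existsUnique_velocity`), the unique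
correction of a functional by second-class constraints (`commutes_iff`), and the Dirac bracket: correcting a
differential amounts to applying the transpose `liftT` of the parametrization of the constraint surface, up to a
term that does not contribute to brackets (`add_correction`).

*Secondary constraints.* On the reduced phase space the canonical Hamiltonian is, up to a divergence, a combination
of the secondary constraints `χ` with the temporal fields as coefficients. Let `secX` be the Hamiltonian vector
field of `∫ N·χ`. Along it `χ` transforms covariantly, by the coadjoint action `coadj` of the Lie algebra of smearing
parameters with bracket `adj` (`chiLin_secX`), because covariant derivatives satisfy the Jacobi identity. Hence `χ`
represents this Lie algebra (`integral_poisson_sec`), which yields the constraint algebra and the preservation of the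
constraints. The terms completing the Castellani chains are the action `adj` on the temporal fields, contracted with
their momenta (`parPair_chainShift`). The brackets of the two parts of a chain with the canonical Hamiltonian cancel,
and the Hamiltonian vector field of the gauge generator can be read off (`gaugeVariation_eq`).

*Counting.* The relations among the secondary constraints are the spatial Bianchi identities. Their principal symbol
is the contraction with the covector `k`, and its kernel is exactly the image of the principal symbol of the
secondary constraints (`map_symbol`), since `X ↦ k × X` maps onto the vectors orthogonal to `k`. So the rank is
`40 - 10`.

*Covariance.* The spatial 2-forms are dual to the spatial momenta, so that the product of two Levi-Civita symbols
turns the curls in the variations of the momenta into exterior covariant derivatives (`sum_eps3_cross`,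
`lift_gaugeVariation`). On solutions curvature and torsion vanish (`curv_eq_zero`, `tors_eq_zero`), covariant
derivatives commute, and exact parameters act trivially (`covariantVariation_add_exactPar`).
-/

namespace PoincareBF

noncomputable section

/-! ### Calculus on a spatial slice -/

section Calculus

variable {E F G : Type*} [NormedAddCommGroup E] [NormedSpace ℝ E] [NormedAddCommGroup F]
  [NormedSpace ℝ F] [NormedAddCommGroup G] [NormedSpace ℝ G]

/-- The partial derivative `∂_i f` of a vector-valued function. -/
def dd (i : Fin 3) (f : Space → E) (x : Space) : E := fderiv ℝ f x (Pi.single i 1)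

theorem dd_add (i : Fin 3) {f g : Space → E} {x : Space} (hf : DifferentiableAt ℝ f x)
    (hg : DifferentiableAt ℝ g x) : dd i (fun y => f y + g y) x = dd i f x + dd i g x := by
  unfold dd; rw [fderiv_fun_add hf hg]; rfl

theorem dd_sub (i : Fin 3) {f g : Space → E} {x : Space} (hf : DifferentiableAt ℝ f x)
    (hg : DifferentiableAt ℝ g x) : dd i (fun y => f y - g y) x = dd i f x - dd i g x := by
  unfold dd; rw [fderiv_fun_sub hf hg]; rfl

theorem dd_const_smul (i : Fin 3) (c : ℝ) {f : Space → E} {x : Space} (hf : DifferentiableAt ℝ f x) :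
    dd i (fun y => c • f y) x = c • dd i f x := by
  unfold dd; rw [fderiv_fun_const_smul hf]; rfl

theorem dd_linear [FiniteDimensional ℝ E] (i : Fin 3) (L : E →ₗ[ℝ] F) {f : Space → E} {x : Space}
    (hf : DifferentiableAt ℝ f x) : dd i (fun y => L (f y)) x = L (dd i f x) := by
  have h := (L.toContinuousLinearMap.hasFDerivAt (x := f x)).comp x hf.hasFDerivAt
  have h' : HasFDerivAt (fun y => L (f y)) (L.toContinuousLinearMap.comp (fderiv ℝ f x)) x := h
  unfold dd; rw [h'.fderiv]; rfl

theorem dd_bilinear [FiniteDimensional ℝ E] [FiniteDimensional ℝ F] (i : Fin 3)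
    (L : E →ₗ[ℝ] F →ₗ[ℝ] G) {f : Space → E} {g : Space → F} {x : Space}
    (hf : DifferentiableAt ℝ f x) (hg : DifferentiableAt ℝ g x) :
    dd i (fun y => L (f y) (g y)) x = L (dd i f x) (g x) + L (f x) (dd i g x) := by
  have h := L.toContinuousBilinearMap.hasFDerivAt_of_bilinear hf.hasFDerivAt hg.hasFDerivAt
  have h' : HasFDerivAt (fun y => L (f y) (g y)) _ x := h
  unfold dd; rw [h'.fderiv]
  simp [add_comm]

theorem contDiff_linear [FiniteDimensional ℝ E] {D : Type*} [NormedAddCommGroup D] [NormedSpace ℝ D]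
    (L : E →ₗ[ℝ] F) {f : D → E} (hf : ContDiff ℝ ∞ f) : ContDiff ℝ ∞ fun y => L (f y) :=
  L.toContinuousLinearMap.contDiff.comp hf

theorem contDiff_bilinear [FiniteDimensional ℝ E] [FiniteDimensional ℝ F]
    {D : Type*} [NormedAddCommGroup D] [NormedSpace ℝ D]
    (L : E →ₗ[ℝ] F →ₗ[ℝ] G) {f : D → E} {g : D → F} (hf : ContDiff ℝ ∞ f) (hg : ContDiff ℝ ∞ g) :
    ContDiff ℝ ∞ fun y => L (f y) (g y) := by
  have h := L.toContinuousBilinearMap.isBoundedBilinearMap.contDiff (n := ∞)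
  exact h.comp (hf.prodMk hg)

theorem contDiff_dd (i : Fin 3) {f : Space → E} (hf : ContDiff ℝ ∞ f) : ContDiff ℝ ∞ (dd i f) :=
  (hf.fderiv_right (m := ∞) (by simp)).clm_apply contDiff_const

theorem dd_comm (i j : Fin 3) {f : Space → E} (hf : ContDiff ℝ ∞ f) (x : Space) :
    dd i (dd j f) x = dd j (dd i f) x := by
  have h1 : DifferentiableAt ℝ (fderiv ℝ f) x :=
    ((hf.fderiv_right (m := ∞) (by simp)).differentiable (by simp)) x
  have key : ∀ k l : Fin 3, dd k (dd l f) x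
      = fderiv ℝ (fderiv ℝ f) x (Pi.single k 1) (Pi.single l 1) := by
    intro k l
    unfold dd
    rw [fderiv_clm_apply h1 (differentiableAt_const _)]
    simp
  rw [key, key]
  exact (hf.contDiffAt.isSymmSndFDerivAt (by
    rw [minSmoothness_of_isRCLikeNormedField]
    exact WithTop.coe_le_coe.2 (le_top : (2 : ℕ∞) ≤ ⊤))).eq _ _

theorem hasCompactSupport_dd (i : Fin 3) {f : Space → E} (hf : HasCompactSupport f) :
    HasCompactSupport (dd i f) :=
  hf.fderiv_apply (𝕜 := ℝ) _

theorem integral_dd_eq_zero (i : Fin 3) {f : Space → ℝ} (hf : ContDiff ℝ ∞ f)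
    (hs : HasCompactSupport f) : ∫ x, dd i f x = 0 := by
  have h1 : Continuous (dd i f) := (contDiff_dd i hf).continuous
  have h2 : Integrable (dd i f) := h1.integrable_of_hasCompactSupport (hasCompactSupport_dd i hs)
  have h3 : Integrable f := hf.continuous.integrable_of_hasCompactSupport hs
  have h := integral_mul_fderiv_eq_neg_fderiv_mul_of_integrable (μ := (volume : Measure Space))
    (f := fun _ => (1 : ℝ)) (g := f) (v := Pi.single i 1) (by simp)
    (by simp only [one_mul]; exact h2)
    (by simpa using h3) (fun _ _ => differentiableAt_const _)
    (fun x _ => (hf.differentiable (by simp)) x)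
  simpa [dd] using h

theorem dd_congr (i : Fin 3) {f g : Space → E} {x : Space} (h : f =ᶠ[nhds x] g) :
    dd i f x = dd i g x := by
  unfold dd; rw [h.fderiv_eq]

end Calculus

/-! ### Functional derivatives of polynomial local functionals -/

theorem IsField.differentiable {V : Type*} [NormedAddCommGroup V] [NormedSpace ℝ V] {W : Submodule ℝ V}
    {z : Space → V} (h : IsField W z) : Differentiable ℝ z := h.smooth.differentiable (by simp)

theorem IsField.add {V : Type*} [NormedAddCommGroup V] [NormedSpace ℝ V] {W : Submodule ℝ V}
    {z w : Space → V} (h : IsField W z) (k : IsField W w) : IsField W (z + w) :=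
  ⟨h.smooth.add k.smooth, fun x => W.add_mem (h.mem x) (k.mem x)⟩

theorem IsField.smul {V : Type*} [NormedAddCommGroup V] [NormedSpace ℝ V] {W : Submodule ℝ V}
    {z : Space → V} (h : IsField W z) (s : ℝ) : IsField W (s • z) :=
  ⟨h.smooth.const_smul s, fun x => W.smul_mem s (h.mem x)⟩

theorem IsField.mono {V : Type*} [NormedAddCommGroup V] [NormedSpace ℝ V] {W W' : Submodule ℝ V}
    {z : Space → V} (h : IsField W z) (hW : W ≤ W') : IsField W' z :=
  ⟨h.smooth, fun x => hW (h.mem x)⟩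

theorem IsField.linear {V V' : Type*} [NormedAddCommGroup V] [NormedSpace ℝ V] [FiniteDimensional ℝ V]
    [NormedAddCommGroup V'] [NormedSpace ℝ V'] {W : Submodule ℝ V} {W' : Submodule ℝ V'}
    {z : Space → V} (h : IsField W z) (L : V →ₗ[ℝ] V') (hL : ∀ v ∈ W, L v ∈ W') :
    IsField W' fun x => L (z x) :=
  ⟨contDiff_linear L h.smooth, fun x => hL _ (h.mem x)⟩

theorem IsTest.linear {V V' : Type*} [NormedAddCommGroup V] [NormedSpace ℝ V] [FiniteDimensional ℝ V]
    [NormedAddCommGroup V'] [NormedSpace ℝ V'] {W : Submodule ℝ V} {W' : Submodule ℝ V'}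
    {z : Space → V} (h : IsTest W z) (L : V →ₗ[ℝ] V') (hL : ∀ v ∈ W, L v ∈ W') :
    IsTest W' fun x => L (z x) :=
  ⟨h.toIsField.linear L hL, h.compact.comp_left (g := L) (map_zero L)⟩

theorem pair_add_left (a b c : Phase) : pair (a + b) c = pair a c + pair b c := by
  simp only [pair, Prod.fst_add, Prod.snd_add, add_dotProduct]; ring

theorem pair_smul_left (r : ℝ) (a c : Phase) : pair (r • a) c = r * pair a c := by
  simp only [pair, Prod.smul_fst, Prod.smul_snd, smul_dotProduct, smul_eq_mul]; ring

theorem pair_add_right (a b c : Phase) : pair a (b + c) = pair a b + pair a c := by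
  simp only [pair, Prod.fst_add, Prod.snd_add, dotProduct_add]; ring

theorem pair_smul_right (r : ℝ) (a c : Phase) : pair a (r • c) = r * pair a c := by
  simp only [pair, Prod.smul_fst, Prod.smul_snd, dotProduct_smul, smul_eq_mul]; ring

/-- The contraction of all components as a bilinear map. -/
def pairL : Phase →ₗ[ℝ] Phase →ₗ[ℝ] ℝ :=
  LinearMap.mk₂ ℝ pair pair_add_left pair_smul_left pair_add_right pair_smul_right

/-- The pointwise canonical bracket as a bilinear map. -/
def poissonL : Phase →ₗ[ℝ] Phase →ₗ[ℝ] ℝ :=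
  LinearMap.mk₂ ℝ poisson
    (by intros; simp only [poisson, Prod.fst_add, Prod.snd_add, add_dotProduct]; ring)
    (by intros; simp only [poisson, Prod.smul_fst, Prod.smul_snd, smul_dotProduct, smul_eq_mul]; ring)
    (by intros; simp only [poisson, Prod.fst_add, Prod.snd_add, dotProduct_add]; ring)
    (by intros; simp only [poisson, Prod.smul_fst, Prod.smul_snd, dotProduct_smul, smul_eq_mul]; ring)

@[simp] theorem poissonL_apply (a b : Phase) : poissonL a b = poisson a b := rfl

theorem continuous_pair {a b : Space → Phase} (ha : ContDiff ℝ ∞ a) (hb : ContDiff ℝ ∞ b) :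
    Continuous fun x => pair (a x) (b x) := (contDiff_bilinear pairL ha hb).continuous

theorem continuous_poisson {a b : Space → Phase} (ha : ContDiff ℝ ∞ a) (hb : ContDiff ℝ ∞ b) :
    Continuous fun x => poisson (a x) (b x) := (contDiff_bilinear poissonL ha hb).continuous

theorem integrable_pair_right {a b : Space → Phase} (ha : ContDiff ℝ ∞ a) (hb : ContDiff ℝ ∞ b)
    (hs : HasCompactSupport b) : Integrable fun x => pair (a x) (b x) :=
  (continuous_pair ha hb).integrable_of_hasCompactSupport
    (hs.mono fun x hx h => hx (by change pairL (a x) (b x) = 0; rw [h, map_zero]))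

theorem integrable_poisson_left {a b : Space → Phase} (ha : ContDiff ℝ ∞ a) (hb : ContDiff ℝ ∞ b)
    (hs : HasCompactSupport a) : Integrable fun x => poisson (a x) (b x) :=
  (continuous_poisson ha hb).integrable_of_hasCompactSupport
    (hs.mono fun x hx h => hx (by
      change poissonL (a x) (b x) = 0; rw [h, map_zero, LinearMap.zero_apply]))

theorem integrable_poisson_right {a b : Space → Phase} (ha : ContDiff ℝ ∞ a) (hb : ContDiff ℝ ∞ b)
    (hs : HasCompactSupport b) : Integrable fun x => poisson (a x) (b x) :=
  (continuous_poisson ha hb).integrable_of_hasCompactSupport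
    (hs.mono fun x hx h => hx (by change poissonL (a x) (b x) = 0; rw [h, map_zero]))

/-- A density that varies continuously over space and at each point depends only on the germ of the field. -/
structure IsLocal (W : Submodule ℝ Phase) (F : Density) : Prop where
  continuous : ∀ z, IsField W z → Continuous (F z)
  local_eq : ∀ z w x, IsField W z → IsField W w → z =ᶠ[nhds x] w → F z x = F w x

/-- A local density that is a cubic polynomial along every line `z + s h` has a functional derivative
as soon as the integral of its linear coefficient does. -/
theorem IsLocal.hasGradient {W : Submodule ℝ Phase} {F : Density} {z g : Space → Phase}
    (hF : IsLocal W F) (hz : IsField W z) (hg : IsField W g)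
    (L Q R : (Space → Phase) → Space → ℝ)
    (hpoly : ∀ h, IsTest W h → ∀ (s : ℝ) x,
      F (z + s • h) x = F z x + s * L h x + s ^ 2 * Q h x + s ^ 3 * R h x)
    (hL : ∀ h, IsTest W h → ∫ x, L h x = ∫ x, pair (g x) (h x)) : HasGradient W F z g := by
  have hint : ∀ h, IsTest W h → ∀ s : ℝ, Integrable fun x => F (z + s • h) x - F z x := by
    intro h hh s
    have hf := hz.add (hh.toIsField.smul s)
    refine ((hF.continuous _ hf).sub (hF.continuous _ hz)).integrable_of_hasCompactSupport ?_
    refine HasCompactSupport.intro' hh.compact (isClosed_tsupport h) fun x hx => ?_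
    have h0 : z + s • h =ᶠ[nhds x] z := by
      filter_upwards [notMem_tsupport_iff_eventuallyEq.1 hx] with y hy
      simp [hy]
    rw [Pi.sub_apply, hF.local_eq _ _ x hf hz h0, sub_self]
  refine ⟨hg, hint, fun h hh => ?_⟩
  -- The differences at `s = 1, -1, 2` determine `L`, `Q`, `R`, which are therefore integrable.
  have i1 := hint h hh 1
  have i2 := hint h hh (-1)
  have i3 := hint h hh 2
  have iQ : Integrable (Q h) := by
    refine ((i1.add i2).const_mul (1 / 2)).congr (Filter.Eventually.of_forall fun x => ?_)
    simp only [Pi.add_apply, hpoly h hh]; ring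
  have iR : Integrable (R h) := by
    refine (((i3.sub (iQ.const_mul 4)).sub (i1.sub i2)).const_mul (1 / 6)).congr
      (Filter.Eventually.of_forall fun x => ?_)
    simp only [Pi.sub_apply, hpoly h hh]; ring
  have iL : Integrable (L h) := by
    refine ((i1.sub iQ).sub iR).congr (Filter.Eventually.of_forall fun x => ?_)
    simp only [Pi.sub_apply, hpoly h hh]; ring
  have key : ∀ s : ℝ, ∫ x, (F (z + s • h) x - F z x)
      = s * (∫ x, L h x) + s ^ 2 * (∫ x, Q h x) + s ^ 3 * ∫ x, R h x := by
    intro s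
    rw [← integral_const_mul, ← integral_const_mul, ← integral_const_mul,
      ← integral_add (iL.const_mul _) (iQ.const_mul _)]
    have i4 : Integrable fun x => s * L h x + s ^ 2 * Q h x :=
      (iL.const_mul _).add (iQ.const_mul _)
    rw [← integral_add i4 (iR.const_mul _)]
    refine integral_congr_ae (Filter.Eventually.of_forall fun x => ?_)
    simp only [hpoly h hh]; ring
  simp only [key]
  rw [← hL h hh]
  have e1 := (hasDerivAt_id (0 : ℝ)).mul_const (∫ x, L h x)
  have e2 := (hasDerivAt_pow 2 (0 : ℝ)).mul_const (∫ x, Q h x)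
  have e3 := (hasDerivAt_pow 3 (0 : ℝ)).mul_const (∫ x, R h x)
  have e := (e1.add e2).add e3
  exact (e.congr_deriv (by simp)).congr_of_eventuallyEq (Filter.Eventually.of_forall fun s => rfl)

theorem HasGradient.add {W : Submodule ℝ Phase} {F G : Density} {z f g : Space → Phase}
    (hF : HasGradient W F z f) (hG : HasGradient W G z g) :
    HasGradient W (fun z x => F z x + G z x) z (f + g) where
  isField := hF.isField.add hG.isField
  integrable h hh s := by
    refine ((hF.integrable h hh s).add (hG.integrable h hh s)).congr
      (Filter.Eventually.of_forall fun x => ?_)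
    simp only [Pi.add_apply]; ring
  hasDerivAt h hh := by
    have h1 := (hF.hasDerivAt h hh).add (hG.hasDerivAt h hh)
    rw [← integral_add (integrable_pair_right hF.isField.smooth hh.smooth hh.compact)
      (integrable_pair_right hG.isField.smooth hh.smooth hh.compact)] at h1
    simp only [Pi.add_apply, pair_add_left]
    refine h1.congr_of_eventuallyEq (Filter.Eventually.of_forall fun s => ?_)
    simp only [Pi.add_apply]
    rw [← integral_add (hF.integrable h hh s) (hG.integrable h hh s)]
    refine integral_congr_ae (Filter.Eventually.of_forall fun x => ?_)
    simp only; ring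

theorem HasGradient.neg {W : Submodule ℝ Phase} {F : Density} {z f : Space → Phase}
    (hF : HasGradient W F z f) : HasGradient W (fun z x => -F z x) z (-f) where
  isField := by simpa using hF.isField.smul (-1)
  integrable h hh s := by
    refine (hF.integrable h hh s).neg.congr (Filter.Eventually.of_forall fun x => ?_)
    simp only [Pi.neg_apply]; ring
  hasDerivAt h hh := by
    have h1 := (hF.hasDerivAt h hh).neg
    rw [← integral_neg] at h1
    have e : ∀ x, pair ((-f) x) (h x) = -pair (f x) (h x) := fun x => by
      have := pair_smul_left (-1) (f x) (h x); simpa using this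
    simp only [e]
    refine h1.congr_of_eventuallyEq (Filter.Eventually.of_forall fun s => ?_)
    simp only [Pi.neg_apply]
    rw [← integral_neg]
    refine integral_congr_ae (Filter.Eventually.of_forall fun x => ?_)
    simp only; ring

theorem HasGradient.congr {W : Submodule ℝ Phase} {F G : Density} {z f : Space → Phase}
    (hF : HasGradient W F z f) (hz : IsField W z) (h : ∀ z, IsField W z → ∀ x, G z x = F z x) :
    HasGradient W G z f where
  isField := hF.isField
  integrable k hk s := by
    simpa only [h _ hz, h _ (hz.add (hk.toIsField.smul s))] using hF.integrable k hk s
  hasDerivAt k hk := by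
    simpa only [h _ hz, h _ (hz.add (hk.toIsField.smul _))] using hF.hasDerivAt k hk

/-- The chain rule for a pointwise linear substitution `Λ` with transpose `T`. -/
theorem HasGradient.comp_linear {W W' : Submodule ℝ Phase} {F : Density} {z g : Space → Phase}
    (Λ T : Phase →ₗ[ℝ] Phase) (hΛ : ∀ w ∈ W, Λ w ∈ W') (hT : ∀ w ∈ W', T w ∈ W)
    (hadj : ∀ v ∈ W', ∀ w ∈ W, pair (T v) w = pair v (Λ w))
    (hF : HasGradient W' F (fun x => Λ (z x)) g) :
    HasGradient W (fun z => F fun x => Λ (z x)) z fun x => T (g x) where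
  isField := hF.isField.linear T hT
  integrable h hh s := by
    have e : (fun x => Λ (z x)) + s • (fun x => Λ (h x)) = fun x => Λ ((z + s • h) x) := by
      funext x; simp
    have := hF.integrable _ (hh.linear Λ hΛ) s
    rwa [e] at this
  hasDerivAt h hh := by
    have e : ∀ s : ℝ, (fun x => Λ (z x)) + s • (fun x => Λ (h x)) = fun x => Λ ((z + s • h) x) := by
      intro s; funext x; simp
    have := hF.hasDerivAt _ (hh.linear Λ hΛ)
    simp only [e] at this
    simpa only [hadj _ (hF.isField.mem _) _ (hh.mem _)] using this

/-- The functional `∫ ⟨a, z⟩` has the constant functional derivative `a`. -/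
theorem hasGradient_pair {W : Submodule ℝ Phase} {z a : Space → Phase} (hz : IsField W z)
    (ha : IsField W a) : HasGradient W (fun z x => pair (a x) (z x)) z a := by
  refine IsLocal.hasGradient ⟨fun z hz => continuous_pair ha.smooth hz.smooth,
    fun z w x _ _ h => by rw [h.eq_of_nhds]⟩ hz ha (fun h x => pair (a x) (h x)) 0 0
    (fun h _ s x => ?_) fun h _ => rfl
  simp [pair_add_right, pair_smul_right]

/-! ### Lorentz algebra -/

/-- Bivectors `X^{AB}` (without a symmetry requirement). -/
abbrev Biv := Fin 4 → Fin 4 → ℝ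
/-- Lorentz vectors `v^A`. -/
abbrev Vec := Fin 4 → ℝ

/-- The antisymmetric bivectors, i.e. the Lorentz Lie algebra. -/
def skew : Submodule ℝ Biv where
  carrier := {X | ∀ A B, X B A = -X A B}
  zero_mem' := by simp
  add_mem' := by
    intro X Y hX hY A B
    simp only [Pi.add_apply, hX A B, hY A B]; ring
  smul_mem' := by
    intro c X hX A B
    simp only [Pi.smul_apply, smul_eq_mul, hX A B]; ring

/-- The values of an antisymmetric bivector in terms of those with increasing indices. -/
theorem skew_vals {X : Biv} (h : X ∈ skew) :
    X 0 0 = 0 ∧ X 1 1 = 0 ∧ X 2 2 = 0 ∧ X 3 3 = 0 ∧ X 1 0 = -X 0 1 ∧ X 2 0 = -X 0 2 ∧ X 3 0 = -X 0 3 ∧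
    X 2 1 = -X 1 2 ∧ X 3 1 = -X 1 3 ∧ X 3 2 = -X 2 3 := by
  have d : ∀ A, X A A = 0 := fun A => by have := h A A; linarith
  exact ⟨d _, d _, d _, d _, h _ _, h _ _, h _ _, h _ _, h _ _, h _ _⟩

theorem η_zero : η 0 = -1 := by simp [η]
theorem η_one : η 1 = 1 := by simp [η]
theorem η_two : η 2 = 1 := by simp [η]
theorem η_three : η 3 = 1 := by simp [η]
theorem η_mul_self (A : Fin 4) : η A * η A = 1 := by unfold η; split_ifs <;> norm_num

/-- `rot` as a bilinear map. -/
def rotB : Biv →ₗ[ℝ] Biv →ₗ[ℝ] Biv :=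
  LinearMap.mk₂ ℝ rot
    (by intros; ext A B; simp only [rot, Pi.add_apply, Fin.sum_univ_four]; ring)
    (by intros; ext A B; simp only [rot, Pi.smul_apply, smul_eq_mul, Fin.sum_univ_four]; ring)
    (by intros; ext A B; simp only [rot, Pi.add_apply, Fin.sum_univ_four]; ring)
    (by intros; ext A B; simp only [rot, Pi.smul_apply, smul_eq_mul, Fin.sum_univ_four]; ring)

/-- `rotV` as a bilinear map. -/
def rotW : Biv →ₗ[ℝ] Vec →ₗ[ℝ] Vec :=
  LinearMap.mk₂ ℝ rotV
    (by intros; ext A; simp only [rotV, Pi.add_apply, Fin.sum_univ_four]; ring)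
    (by intros; ext A; simp only [rotV, Pi.smul_apply, smul_eq_mul, Fin.sum_univ_four]; ring)
    (by intros; ext A; simp only [rotV, Pi.add_apply, Fin.sum_univ_four]; ring)
    (by intros; ext A; simp only [rotV, Pi.smul_apply, smul_eq_mul, Fin.sum_univ_four]; ring)

/-- `asym` as a bilinear map. -/
def wdg : Vec →ₗ[ℝ] Vec →ₗ[ℝ] Biv :=
  LinearMap.mk₂ ℝ asym
    (by intros; ext A B; simp only [asym, Pi.add_apply]; ring)
    (by intros; ext A B; simp only [asym, Pi.smul_apply, smul_eq_mul]; ring)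
    (by intros; ext A B; simp only [asym, Pi.add_apply]; ring)
    (by intros; ext A B; simp only [asym, Pi.smul_apply, smul_eq_mul]; ring)

/-- The matrix product `X^A_C Y^{CB}`. -/
def mm : Biv →ₗ[ℝ] Biv →ₗ[ℝ] Biv :=
  LinearMap.mk₂ ℝ (fun X Y A B => ∑ C, η C * X A C * Y C B)
    (by intros; ext A B; simp only [Pi.add_apply, Fin.sum_univ_four]; ring)
    (by intros; ext A B; simp only [Pi.smul_apply, smul_eq_mul, Fin.sum_univ_four]; ring)
    (by intros; ext A B; simp only [Pi.add_apply, Fin.sum_univ_four]; ring)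
    (by intros; ext A B; simp only [Pi.smul_apply, smul_eq_mul, Fin.sum_univ_four]; ring)

/-- `low2` as a linear map. -/
def lo2 : Biv →ₗ[ℝ] Biv where
  toFun := low2
  map_add' X Y := by ext A B; simp only [low2, Pi.add_apply]; ring
  map_smul' r X := by ext A B; simp only [low2, Pi.smul_apply, smul_eq_mul, RingHom.id_apply]; ring

/-- `low` as a linear map. -/
def lo : Vec →ₗ[ℝ] Vec where
  toFun := low
  map_add' X Y := by ext A; simp only [low, Pi.add_apply]; ring
  map_smul' r X := by ext A; simp only [low, Pi.smul_apply, smul_eq_mul, RingHom.id_apply]; ring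

/-- The contraction `X^{AB} Y_{AB}`. -/
def ipB : Biv →ₗ[ℝ] Biv →ₗ[ℝ] ℝ :=
  LinearMap.mk₂ ℝ (fun X Y => ∑ A, ∑ B, X A B * Y A B)
    (by intros; simp only [Pi.add_apply, add_mul, Finset.sum_add_distrib])
    (by intros; simp only [Pi.smul_apply, smul_eq_mul, mul_assoc, Finset.mul_sum])
    (by intros; simp only [Pi.add_apply, mul_add, Finset.sum_add_distrib])
    (by intros; simp only [Pi.smul_apply, smul_eq_mul, mul_left_comm, Finset.mul_sum])

/-- The contraction `x^A y_A`. -/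
def ipV : Vec →ₗ[ℝ] Vec →ₗ[ℝ] ℝ :=
  LinearMap.mk₂ ℝ (fun x y => ∑ A, x A * y A)
    (by intros; simp only [Pi.add_apply, add_mul, Finset.sum_add_distrib])
    (by intros; simp only [Pi.smul_apply, smul_eq_mul, mul_assoc, Finset.mul_sum])
    (by intros; simp only [Pi.add_apply, mul_add, Finset.sum_add_distrib])
    (by intros; simp only [Pi.smul_apply, smul_eq_mul, mul_left_comm, Finset.mul_sum])

theorem rotB_apply (U X : Biv) : rotB U X = rot U X := rfl
theorem rotW_apply (U : Biv) (x : Vec) : rotW U x = rotV U x := rfl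
theorem wdg_apply (x y : Vec) : wdg x y = asym x y := rfl
theorem mm_apply (X Y : Biv) (A B : Fin 4) : mm X Y A B = ∑ C, η C * X A C * Y C B := rfl
theorem lo2_apply (X : Biv) : lo2 X = low2 X := rfl
theorem lo_apply (x : Vec) : lo x = low x := rfl
theorem ipB_apply (X Y : Biv) : ipB X Y = ∑ A, ∑ B, X A B * Y A B := rfl
theorem ipV_apply (x y : Vec) : ipV x y = ∑ A, x A * y A := rfl

@[simp] theorem lo2_lo2 (X : Biv) : lo2 (lo2 X) = X := by
  ext A B
  have h1 := η_mul_self A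
  have h2 := η_mul_self B
  simp only [lo2_apply, low2]
  linear_combination (η B * η B * X A B) * h1 + X A B * h2

@[simp] theorem lo_lo (x : Vec) : lo (lo x) = x := by
  ext A
  simp only [lo_apply, low]
  linear_combination x A * η_mul_self A

theorem rotL_eq (U Y : Biv) : rotL U Y = lo2 (rotB U (lo2 Y)) := by
  ext A B
  simp only [lo2_apply, low2, rotB_apply, rotL, rot, Finset.mul_sum]
  refine Finset.sum_congr rfl fun C _ => ?_
  linear_combination (-η A * η B * η B * U A C * Y C B - η B * η A * η A * U B C * Y A C) * η_mul_self C
    - η A * U A C * Y C B * η_mul_self B - η B * U B C * Y A C * η_mul_self A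

theorem rotVL_eq (U : Biv) (y : Vec) : rotVL U y = lo (rotW U (lo y)) := by
  ext A
  simp only [lo_apply, low, rotW_apply, rotVL, rotV, Finset.mul_sum]
  refine Finset.sum_congr rfl fun C _ => ?_
  linear_combination (-η A * U A C * y C) * η_mul_self C

theorem asym_low_left (u y : Vec) : asym (low u) y = lo2 (wdg u (lo y)) := by
  ext A B
  simp only [lo2_apply, lo_apply, low2, low, wdg_apply, asym]
  linear_combination (-η A * u A * y B / 2) * η_mul_self B + (η B * u B * y A / 2) * η_mul_self A

theorem rotB_mem_skew (U : Biv) {X : Biv} (hX : X ∈ skew) : rotB U X ∈ skew := by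
  intro A B
  simp only [rotB_apply, rot, ← Finset.sum_neg_distrib]
  refine Finset.sum_congr rfl fun C _ => ?_
  rw [hX A C, hX C B]; ring

theorem wdg_mem_skew (x y : Vec) : wdg x y ∈ skew := by
  intro A B; simp only [wdg_apply, asym]; ring

theorem lo2_mem_skew {X : Biv} (hX : X ∈ skew) : lo2 X ∈ skew := by
  intro A B; simp only [lo2_apply, low2, hX A B]; ring

theorem wdg_comm (x y : Vec) : wdg x y = -wdg y x := by
  ext A B; simp only [wdg_apply, asym, Pi.neg_apply]; ring

theorem rotB_eq_mm {U : Biv} (hU : U ∈ skew) (V : Biv) : rotB U V = mm U V - mm V U := by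
  ext A B
  simp only [rotB_apply, rot, Pi.sub_apply, mm_apply, ← Finset.sum_sub_distrib]
  refine Finset.sum_congr rfl fun C _ => ?_
  rw [hU C B]; ring

theorem rotB_comm {U V : Biv} (hU : U ∈ skew) (hV : V ∈ skew) : rotB U V = -rotB V U := by
  rw [rotB_eq_mm hU, rotB_eq_mm hV]; abel

/-- Bivectors carry a representation of the Lorentz algebra (the Jacobi identity). -/
theorem rotB_rotB {U : Biv} (hU : U ∈ skew) (V X : Biv) :
    rotB U (rotB V X) = rotB (rotB U V) X + rotB V (rotB U X) := by
  obtain ⟨h0, h1, h2, h3, h10, h20, h30, h21, h31, h32⟩ := skew_vals hU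
  ext A B
  simp only [rotB_apply, rot, Pi.add_apply, Fin.sum_univ_four, η_zero, η_one, η_two, η_three,
    h0, h1, h2, h3, h10, h20, h30, h21, h31, h32]
  ring

/-- Vectors carry a representation of the Lorentz algebra. -/
theorem rotW_rotW {U : Biv} (hU : U ∈ skew) (V : Biv) (x : Vec) :
    rotW U (rotW V x) = rotW (rotB U V) x + rotW V (rotW U x) := by
  obtain ⟨h0, h1, h2, h3, h10, h20, h30, h21, h31, h32⟩ := skew_vals hU
  ext A
  simp only [rotB_apply, rotW_apply, rot, rotV, Pi.add_apply, Fin.sum_univ_four, η_zero, η_one, η_two,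
    η_three, h0, h1, h2, h3, h10, h20, h30, h21, h31, h32]
  ring

theorem rotB_wdg (U : Biv) (x y : Vec) : rotB U (wdg x y) = wdg (rotW U x) y + wdg x (rotW U y) := by
  ext A B
  simp only [rotB_apply, rotW_apply, wdg_apply, rot, rotV, asym, Pi.add_apply, Fin.sum_univ_four]
  ring

theorem ipB_lo2 (X Y : Biv) : ipB (lo2 X) Y = ipB X (lo2 Y) := by
  simp only [ipB_apply, lo2_apply, low2]
  exact Finset.sum_congr rfl fun A _ => Finset.sum_congr rfl fun B _ => by ring

theorem ipV_lo (x y : Vec) : ipV (lo x) y = ipV x (lo y) := by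
  simp only [ipV_apply, lo_apply, low]
  exact Finset.sum_congr rfl fun A _ => by ring

theorem ipB_comm (X Y : Biv) : ipB X Y = ipB Y X := by
  simp only [ipB_apply, mul_comm]

theorem ipV_comm (x y : Vec) : ipV x y = ipV y x := by
  simp only [ipV_apply, mul_comm]

/-- Invariance of the contraction of bivectors. -/
theorem ipB_rotB {U : Biv} (hU : U ∈ skew) (X Y : Biv) :
    ipB X (lo2 (rotB U Y)) = -ipB (rotB U X) (lo2 Y) := by
  obtain ⟨h0, h1, h2, h3, h10, h20, h30, h21, h31, h32⟩ := skew_vals hU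
  simp only [ipB_apply, lo2_apply, low2, rotB_apply, rot, Fin.sum_univ_four, η_zero, η_one, η_two, η_three,
    h0, h1, h2, h3, h10, h20, h30, h21, h31, h32]
  ring

/-- Invariance of the contraction of vectors. -/
theorem ipV_rotW {U : Biv} (hU : U ∈ skew) (x y : Vec) :
    ipV x (lo (rotW U y)) = -ipV (rotW U x) (lo y) := by
  obtain ⟨h0, h1, h2, h3, h10, h20, h30, h21, h31, h32⟩ := skew_vals hU
  simp only [ipV_apply, lo_apply, low, rotW_apply, rotV, Fin.sum_univ_four, η_zero, η_one, η_two, η_three,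
    h0, h1, h2, h3, h10, h20, h30, h21, h31, h32]
  ring

/-- The action on vectors is the transpose of the antisymmetrized product. -/
theorem ipB_wdg {U : Biv} (hU : U ∈ skew) (x y : Vec) :
    ipB U (lo2 (wdg x y)) = -ipV (rotW U x) (lo y) := by
  obtain ⟨h0, h1, h2, h3, h10, h20, h30, h21, h31, h32⟩ := skew_vals hU
  simp only [ipB_apply, ipV_apply, lo2_apply, lo_apply, low2, low, rotW_apply, wdg_apply, asym, rotV,
    Fin.sum_univ_four, η_zero, η_one, η_two, η_three,
    h0, h1, h2, h3, h10, h20, h30, h21, h31, h32]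
  ring

/-! ### Components and pairings -/

/-- The component `ω_a` as a linear map. -/
def omL (a : Fin 4) : Config →ₗ[ℝ] Biv where
  toFun q := om q a
  map_add' _ _ := rfl
  map_smul' _ _ := rfl
/-- The component `θ_a` as a linear map. -/
def thL (a : Fin 4) : Config →ₗ[ℝ] Vec where
  toFun q := th q a
  map_add' _ _ := rfl
  map_smul' _ _ := rfl
/-- The component `B_{ab}` as a linear map. -/
def bBL (a b : Fin 4) : Config →ₗ[ℝ] Biv where
  toFun q := bB q a b
  map_add' _ _ := rfl
  map_smul' _ _ := rfl
/-- The component `β_{ab}` as a linear map. -/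
def beL (a b : Fin 4) : Config →ₗ[ℝ] Vec where
  toFun q := be q a b
  map_add' _ _ := rfl
  map_smul' _ _ := rfl

theorem om_add (p q : Config) (a : Fin 4) : om (p + q) a = om p a + om q a := rfl
theorem th_add (p q : Config) (a : Fin 4) : th (p + q) a = th p a + th q a := rfl
theorem bB_add (p q : Config) (a b : Fin 4) : bB (p + q) a b = bB p a b + bB q a b := rfl
theorem be_add (p q : Config) (a b : Fin 4) : be (p + q) a b = be p a b + be q a b := rfl
theorem om_smul (r : ℝ) (q : Config) (a : Fin 4) : om (r • q) a = r • om q a := rfl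
theorem th_smul (r : ℝ) (q : Config) (a : Fin 4) : th (r • q) a = r • th q a := rfl
theorem bB_smul (r : ℝ) (q : Config) (a b : Fin 4) : bB (r • q) a b = r • bB q a b := rfl
theorem be_smul (r : ℝ) (q : Config) (a b : Fin 4) : be (r • q) a b = r • be q a b := rfl
theorem om_zero (a : Fin 4) : om 0 a = 0 := rfl
theorem th_zero (a : Fin 4) : th 0 a = 0 := rfl

theorem config_ext {p q : Config} (h1 : ∀ a, om p a = om q a) (h2 : ∀ a, th p a = th q a)
    (h3 : ∀ a b, bB p a b = bB q a b) (h4 : ∀ a b, be p a b = be q a b) : p = q := by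
  funext c
  rcases c with ⟨a, A, B⟩ | ⟨a, A⟩ | ⟨a, b, A, B⟩ | ⟨a, b, A⟩
  · exact congrFun (congrFun (h1 a) A) B
  · exact congrFun (h2 a) A
  · exact congrFun (congrFun (h3 a b) A) B
  · exact congrFun (h4 a b) A

theorem mem_configFibre {q : Config} : q ∈ configFibre ↔ (∀ a, om q a ∈ skew) ∧
    (∀ a b, bB q a b ∈ skew) ∧ (∀ a b, bB q b a = -bB q a b) ∧ ∀ a b, be q b a = -be q a b :=
  ⟨fun h => ⟨h.1, h.2.1, fun a b => by ext A B; exact h.2.2.1 a b A B,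
    fun a b => by ext A; exact h.2.2.2 a b A⟩,
   fun h => ⟨h.1, h.2.1, fun a b A B => congrFun (congrFun (h.2.2.1 a b) A) B,
    fun a b A => congrFun (h.2.2.2 a b) A⟩⟩

theorem bB_self {q : Config} (h : q ∈ configFibre) (a : Fin 4) : bB q a a = 0 := by
  ext A B
  have := h.2.2.1 a a A B
  simp only [Pi.zero_apply]; linarith

theorem be_self {q : Config} (h : q ∈ configFibre) (a : Fin 4) : be q a a = 0 := by
  ext A
  have := h.2.2.2 a a A
  simp only [Pi.zero_apply]; linarith

theorem mem_reducedConfig {q : Config} : q ∈ reducedConfig ↔ q ∈ configFibre ∧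
    (∀ i j : Fin 3, bB q i.succ j.succ = 0) ∧ ∀ i j : Fin 3, be q i.succ j.succ = 0 :=
  ⟨fun h => ⟨h.1, fun i j => by ext A B; exact h.2.1 i j A B, fun i j => by ext A; exact h.2.2 i j A⟩,
   fun h => ⟨h.1, fun i j A B => congrFun (congrFun (h.2.1 i j) A) B,
    fun i j A => congrFun (h.2.2 i j) A⟩⟩

theorem reducedConfig_le : reducedConfig ≤ configFibre := fun _ h => h.1
theorem reducedFibre_le : reducedFibre ≤ phaseFibre := fun _ h => ⟨h.1.1, h.2.1⟩

/-- Values of spatial components `(ω_i, θ_i)`, or of their momenta. -/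
abbrev SPar := (Fin 3 → Biv) × (Fin 3 → Vec)

/-- Antisymmetry in the Lorentz index pair. -/
def sparFibre : Submodule ℝ SPar where
  carrier := {S | ∀ i, S.1 i ∈ skew}
  zero_mem' _ := skew.zero_mem
  add_mem' h k i := skew.add_mem (h i) (k i)
  smul_mem' c _ h i := skew.smul_mem c (h i)

/-- The configuration with temporal components `T = (ω_0, θ_0, B_{0i}, β_{0i})`, with
`S = (ω_i, θ_i)`, and with `B_{ij} = β_{ij} = 0`. -/
def redConfig (T : Par) (S : SPar) : Config :=
  mkConfig (fun a => Fin.cases (motive := fun _ => Biv) T.1 S.1 a)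
    (fun a => Fin.cases (motive := fun _ => Vec) T.2.1 S.2 a)
    (fun a b => Fin.cases (motive := fun _ => Biv) (Fin.cases (motive := fun _ => Biv) 0 T.2.2.1 b)
      (fun i => Fin.cases (motive := fun _ => Biv) (-T.2.2.1 i) (fun _ => 0) b) a)
    (fun a b => Fin.cases (motive := fun _ => Vec) (Fin.cases (motive := fun _ => Vec) 0 T.2.2.2 b)
      (fun i => Fin.cases (motive := fun _ => Vec) (-T.2.2.2 i) (fun _ => 0) b) a)

section
variable (T : Par) (S : SPar) (i j : Fin 3)
@[simp] theorem om_red_zero : om (redConfig T S) 0 = T.1 := rfl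
@[simp] theorem om_red_succ : om (redConfig T S) i.succ = S.1 i := rfl
@[simp] theorem th_red_zero : th (redConfig T S) 0 = T.2.1 := rfl
@[simp] theorem th_red_succ : th (redConfig T S) i.succ = S.2 i := rfl
@[simp] theorem bB_red_zero : bB (redConfig T S) 0 0 = 0 := rfl
@[simp] theorem bB_red_zero_succ : bB (redConfig T S) 0 i.succ = T.2.2.1 i := rfl
@[simp] theorem bB_red_succ_zero : bB (redConfig T S) i.succ 0 = -T.2.2.1 i := rfl
@[simp] theorem bB_red_succ : bB (redConfig T S) i.succ j.succ = 0 := rfl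
@[simp] theorem be_red_zero : be (redConfig T S) 0 0 = 0 := rfl
@[simp] theorem be_red_zero_succ : be (redConfig T S) 0 i.succ = T.2.2.2 i := rfl
@[simp] theorem be_red_succ_zero : be (redConfig T S) i.succ 0 = -T.2.2.2 i := rfl
@[simp] theorem be_red_succ : be (redConfig T S) i.succ j.succ = 0 := rfl
end

/-- `redConfig` as a linear map. -/
def redL : Par × SPar →ₗ[ℝ] Config where
  toFun p := redConfig p.1 p.2
  map_add' p q := by
    refine config_ext (fun a => ?_) (fun a => ?_) (fun a b => ?_) (fun a b => ?_)
    · refine Fin.cases rfl (fun i => rfl) a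
    · refine Fin.cases rfl (fun i => rfl) a
    · refine Fin.cases (Fin.cases ?_ (fun j => rfl) b) (fun i => Fin.cases ?_ (fun j => ?_) b) a
      · simp [bB_add]
      · simp [bB_add, add_comm]
      · simp [bB_add]
    · refine Fin.cases (Fin.cases ?_ (fun j => rfl) b) (fun i => Fin.cases ?_ (fun j => ?_) b) a
      · simp [be_add]
      · simp [be_add, add_comm]
      · simp [be_add]
  map_smul' r p := by
    refine config_ext (fun a => ?_) (fun a => ?_) (fun a b => ?_) (fun a b => ?_)
    · refine Fin.cases rfl (fun i => rfl) a
    · refine Fin.cases rfl (fun i => rfl) a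
    · refine Fin.cases (Fin.cases ?_ (fun j => rfl) b) (fun i => Fin.cases ?_ (fun j => ?_) b) a <;>
        simp [bB_smul]
    · refine Fin.cases (Fin.cases ?_ (fun j => rfl) b) (fun i => Fin.cases ?_ (fun j => ?_) b) a <;>
        simp [be_smul]

theorem mem_parFibre {N : Par} : N ∈ parFibre ↔ N.1 ∈ skew ∧ ∀ i, N.2.2.1 i ∈ skew := Iff.rfl

theorem redConfig_mem {T : Par} {S : SPar} (hT : T ∈ parFibre) (hS : S ∈ sparFibre) :
    redConfig T S ∈ reducedConfig := by
  rw [mem_reducedConfig, mem_configFibre]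
  refine ⟨⟨fun a => ?_, fun a b => ?_, fun a b => ?_, fun a b => ?_⟩, fun i j => rfl, fun i j => rfl⟩
  · exact Fin.cases hT.1 (fun i => hS i) a
  · refine Fin.cases (Fin.cases ?_ (fun j => hT.2 j) b) (fun i => Fin.cases ?_ (fun j => ?_) b) a
    · exact skew.zero_mem
    · exact skew.neg_mem (hT.2 i)
    · exact skew.zero_mem
  · refine Fin.cases (Fin.cases ?_ (fun j => ?_) b) (fun i => Fin.cases ?_ (fun j => ?_) b) a <;> simp
  · refine Fin.cases (Fin.cases ?_ (fun j => ?_) b) (fun i => Fin.cases ?_ (fun j => ?_) b) a <;> simp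

/-- The temporal components of a configuration. -/
def temporalPart (q : Config) : Par :=
  (om q 0, th q 0, fun i => bB q 0 i.succ, fun i => be q 0 i.succ)

/-- The spatial components `(ω_i, θ_i)` of a configuration. -/
def spatialPart (q : Config) : SPar := (fun i => om q i.succ, fun i => th q i.succ)

theorem reduced_eq {q : Config} (h : q ∈ reducedConfig) :
    q = redConfig (temporalPart q) (spatialPart q) := by
  obtain ⟨h0, h1, h2⟩ := mem_reducedConfig.1 h
  have h0' := mem_configFibre.1 h0
  refine config_ext (fun a => ?_) (fun a => ?_) (fun a b => ?_) (fun a b => ?_)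
  · exact Fin.cases rfl (fun i => rfl) a
  · exact Fin.cases rfl (fun i => rfl) a
  · refine Fin.cases (Fin.cases ?_ (fun j => rfl) b) (fun i => Fin.cases ?_ (fun j => h1 i j) b) a
    · exact bB_self h0 0
    · exact h0'.2.2.1 0 i.succ
  · refine Fin.cases (Fin.cases ?_ (fun j => rfl) b) (fun i => Fin.cases ?_ (fun j => h2 i j) b) a
    · exact be_self h0 0
    · exact h0'.2.2.2 0 i.succ

theorem temporalPart_mem {q : Config} (h : q ∈ configFibre) : temporalPart q ∈ parFibre :=
  ⟨(mem_configFibre.1 h).1 0, fun i => (mem_configFibre.1 h).2.1 0 i.succ⟩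

theorem spatialPart_mem {q : Config} (h : q ∈ configFibre) : spatialPart q ∈ sparFibre :=
  fun i => (mem_configFibre.1 h).1 i.succ

theorem dot_eq (g h : Config) : dotProduct g h =
    (∑ a, ipB (om g a) (om h a)) + (∑ a, ipV (th g a) (th h a)) +
      (∑ a, ∑ b, ipB (bB g a b) (bB h a b)) + ∑ a, ∑ b, ipV (be g a b) (be h a b) := by
  simp only [dotProduct, Fintype.sum_sum_type, Fintype.sum_prod_type, ipB_apply, ipV_apply, om, th, bB, be]
  ring

/-- The contraction with a reduced configuration; components `0i` and `i0` contribute equally. -/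
theorem dot_red (T : Par) (S : SPar) {h : Config} (hh : h ∈ configFibre) :
    dotProduct (redConfig T S) h = ipB T.1 (om h 0) + ipV T.2.1 (th h 0)
      + 2 * (∑ i, ipB (T.2.2.1 i) (bB h 0 i.succ)) + 2 * (∑ i, ipV (T.2.2.2 i) (be h 0 i.succ))
      + (∑ i, ipB (S.1 i) (om h i.succ)) + ∑ i, ipV (S.2 i) (th h i.succ) := by
  obtain ⟨-, -, h3, h4⟩ := mem_configFibre.1 hh
  have e3 : ∀ i : Fin 3, bB h i.succ 0 = -bB h 0 i.succ := fun i => h3 0 i.succ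
  have e4 : ∀ i : Fin 3, be h i.succ 0 = -be h 0 i.succ := fun i => h4 0 i.succ
  rw [dot_eq]
  simp only [Fin.sum_univ_succ (n := 3), om_red_zero, om_red_succ, th_red_zero, th_red_succ, bB_red_zero,
    bB_red_zero_succ, bB_red_succ_zero, bB_red_succ, be_red_zero, be_red_zero_succ, be_red_succ_zero,
    be_red_succ, e3, e4, map_neg, map_zero, LinearMap.neg_apply, LinearMap.zero_apply, neg_neg,
    Finset.sum_const_zero, add_zero, zero_add]
  ring

theorem parPair_eq (N K : Par) : parPair N K = ipB N.1 K.1 + ipV N.2.1 K.2.1 +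
    (∑ i, ipB (N.2.2.1 i) (K.2.2.1 i)) + ∑ i, ipV (N.2.2.2 i) (K.2.2.2 i) := rfl

/-- `parPair` as a bilinear map. -/
def parPairL : Par →ₗ[ℝ] Par →ₗ[ℝ] ℝ :=
  LinearMap.mk₂ ℝ parPair
    (by
      intros
      simp only [parPair_eq, Prod.fst_add, Prod.snd_add, Pi.add_apply, map_add, LinearMap.add_apply,
        Finset.sum_add_distrib]
      ring)
    (by
      intros
      simp only [parPair_eq, Prod.smul_fst, Prod.smul_snd, Pi.smul_apply, map_smul, LinearMap.smul_apply,
        smul_eq_mul, ← Finset.mul_sum]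
      ring)
    (by
      intros
      simp only [parPair_eq, Prod.fst_add, Prod.snd_add, Pi.add_apply, map_add, Finset.sum_add_distrib]
      ring)
    (by
      intros
      simp only [parPair_eq, Prod.smul_fst, Prod.smul_snd, Pi.smul_apply, map_smul, smul_eq_mul,
        ← Finset.mul_sum]
      ring)

theorem parPairL_apply (N K : Par) : parPairL N K = parPair N K := rfl

/-! ### The Levi-Civita symbol -/

theorem eps3_eq (i j k : Fin 3) : eps3 i j k =
    if j = i + 1 ∧ k = i + 2 then 1 else if j = i + 2 ∧ k = i + 1 then -1 else 0 := by
  unfold eps3 leviCivita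
  rw [Matrix.det_fin_three]
  fin_cases i <;> fin_cases j <;> fin_cases k <;> simp [Matrix.of_apply]

theorem sum_eps3 {E : Type*} [AddCommGroup E] [Module ℝ E] (i : Fin 3) (f : Fin 3 → Fin 3 → E) :
    ∑ j, ∑ k, eps3 i j k • f j k = f (i + 1) (i + 2) - f (i + 2) (i + 1) := by
  simp only [eps3_eq, Fin.sum_univ_three]
  fin_cases i <;> simp <;> abel

theorem sum_eps3_mul (i : Fin 3) (f : Fin 3 → Fin 3 → ℝ) :
    ∑ j, ∑ k, eps3 i j k * f j k = f (i + 1) (i + 2) - f (i + 2) (i + 1) := sum_eps3 i f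

/-! ### The secondary constraints as polynomials in the jets of the fields -/

/-- The first derivatives of a field at a point. -/
def jet {E : Type*} [NormedAddCommGroup E] [NormedSpace ℝ E] (z : Space → E) (x : Space) (i : Fin 3) : E :=
  dd i z x

theorem pd_config (i : Fin 3) {q : Space → Config} {x : Space} (hq : DifferentiableAt ℝ q x) (c : CIdx) :
    pd i (fun y => q y c) x = dd i q x c :=
  dd_linear i (LinearMap.proj c : Config →ₗ[ℝ] ℝ) hq

theorem dd_fst {E F : Type*} [NormedAddCommGroup E] [NormedSpace ℝ E] [NormedAddCommGroup F]
    [NormedSpace ℝ F] (i : Fin 3) {z : Space → E × F} {x : Space}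
    (hz : DifferentiableAt ℝ z x) : dd i (fun y => (z y).1) x = (dd i z x).1 := by
  unfold dd; rw [fderiv.fst hz]; rfl

theorem dd_snd {E F : Type*} [NormedAddCommGroup E] [NormedSpace ℝ E] [NormedAddCommGroup F]
    [NormedSpace ℝ F] (i : Fin 3) {z : Space → E × F} {x : Space}
    (hz : DifferentiableAt ℝ z x) : dd i (fun y => (z y).2) x = (dd i z x).2 := by
  unfold dd; rw [fderiv.snd hz]; rfl

theorem dd_apply {ι E : Type*} [Fintype ι] [NormedAddCommGroup E] [NormedSpace ℝ E] (i : Fin 3)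
    {f : Space → ι → E} {x : Space} (hf : DifferentiableAt ℝ f x) (k : ι) :
    dd i (fun y => f y k) x = dd i f x k := by
  have h := hasFDerivAt_pi'.1 hf.hasFDerivAt k
  unfold dd; rw [h.fderiv]; rfl

/-- The secondary constraints as a function of the fields `w` and their first derivatives `d` at a point. -/
def chiJ (w : Phase) (d : Fin 3 → Phase) : Par :=
  (∑ i : Fin 3, (om (d i).2 i.succ + lo2 (rotB (om w.1 i.succ) (lo2 (om w.2 i.succ)))
      - lo2 (wdg (th w.1 i.succ) (lo (th w.2 i.succ)))),
    ∑ i : Fin 3, (th (d i).2 i.succ + lo (rotW (om w.1 i.succ) (lo (th w.2 i.succ)))),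
    fun i => lo2 ((1 / 2 : ℝ) • (om (d (i + 1)).1 (i + 2).succ - om (d (i + 2)).1 (i + 1).succ
      + rotB (om w.1 (i + 1).succ) (om w.1 (i + 2).succ))),
    fun i => lo ((1 / 2 : ℝ) • (th (d (i + 1)).1 (i + 2).succ - th (d (i + 2)).1 (i + 1).succ
      + rotW (om w.1 (i + 1).succ) (th w.1 (i + 2).succ) - rotW (om w.1 (i + 2).succ) (th w.1 (i + 1).succ))))

/-- The linearization of `chiJ w d` in the direction of a variation `h` with first derivatives `e`. -/
def chiLin (w h : Phase) (e : Fin 3 → Phase) : Par :=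
  (∑ i : Fin 3, (om (e i).2 i.succ + lo2 (rotB (om w.1 i.succ) (lo2 (om h.2 i.succ)))
      + lo2 (rotB (om h.1 i.succ) (lo2 (om w.2 i.succ)))
      - lo2 (wdg (th w.1 i.succ) (lo (th h.2 i.succ))) - lo2 (wdg (th h.1 i.succ) (lo (th w.2 i.succ)))),
    ∑ i : Fin 3, (th (e i).2 i.succ + lo (rotW (om w.1 i.succ) (lo (th h.2 i.succ)))
      + lo (rotW (om h.1 i.succ) (lo (th w.2 i.succ)))),
    fun i => lo2 ((1 / 2 : ℝ) • (om (e (i + 1)).1 (i + 2).succ - om (e (i + 2)).1 (i + 1).succ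
      + rotB (om w.1 (i + 1).succ) (om h.1 (i + 2).succ) + rotB (om h.1 (i + 1).succ) (om w.1 (i + 2).succ))),
    fun i => lo ((1 / 2 : ℝ) • (th (e (i + 1)).1 (i + 2).succ - th (e (i + 2)).1 (i + 1).succ
      + rotW (om w.1 (i + 1).succ) (th h.1 (i + 2).succ) - rotW (om w.1 (i + 2).succ) (th h.1 (i + 1).succ)
      + rotW (om h.1 (i + 1).succ) (th w.1 (i + 2).succ) - rotW (om h.1 (i + 2).succ) (th w.1 (i + 1).succ))))

theorem chiJ_add (w h : Phase) (d e : Fin 3 → Phase) (s : ℝ) :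
    chiJ (w + s • h) (d + s • e) = chiJ w d + s • chiLin w h e + s ^ 2 • chiJ h 0 := by
  refine Prod.ext ?_ (Prod.ext ?_ (Prod.ext (funext fun i => ?_) (funext fun i => ?_)))
  all_goals
    simp only [chiJ, chiLin, Prod.fst_add, Prod.snd_add, Prod.smul_fst, Prod.smul_snd, Pi.add_apply,
      Pi.smul_apply, Pi.zero_apply, Prod.fst_zero, Prod.snd_zero, om_zero, th_zero,
      om_add, th_add, om_smul, th_smul, map_add, map_sub, map_smul, LinearMap.add_apply, LinearMap.smul_apply,
      Fin.sum_univ_three]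
    module

theorem chi_eq {z : Space → Phase} {x : Space} (hz : DifferentiableAt ℝ z x)
    (hs : ∀ i : Fin 3, om (z x).1 i.succ ∈ skew) : chi z x = chiJ (z x) (jet z x) := by
  have d1 : DifferentiableAt ℝ (fun y => (z y).1) x := hz.fst
  have d2 : DifferentiableAt ℝ (fun y => (z y).2) x := hz.snd
  have o1 : ∀ (i : Fin 3) a A B, pd i (fun y => om (z y).1 a A B) x = om (jet z x i).1 a A B :=
    fun i a A B => (pd_config i d1 _).trans (by rw [dd_fst i hz]; rfl)
  have o2 : ∀ (i : Fin 3) a A B, pd i (fun y => om (z y).2 a A B) x = om (jet z x i).2 a A B :=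
    fun i a A B => (pd_config i d2 _).trans (by rw [dd_snd i hz]; rfl)
  have t1 : ∀ (i : Fin 3) a A, pd i (fun y => th (z y).1 a A) x = th (jet z x i).1 a A :=
    fun i a A => (pd_config i d1 _).trans (by rw [dd_fst i hz]; rfl)
  have t2 : ∀ (i : Fin 3) a A, pd i (fun y => th (z y).2 a A) x = th (jet z x i).2 a A :=
    fun i a A => (pd_config i d2 _).trans (by rw [dd_snd i hz]; rfl)
  refine Prod.ext ?_ (Prod.ext ?_ (Prod.ext (funext fun i => ?_) (funext fun i => ?_)))
  · ext A B
    simp only [chi, chiJ, o2, rotL_eq, asym_low_left, Finset.sum_apply, Pi.add_apply, Pi.sub_apply]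
  · ext A
    simp only [chi, chiJ, t2, rotVL_eq, Finset.sum_apply, Pi.add_apply]
  · simp only [chi, chiJ, o1, ← lo2_apply]
    congr 1
    ext A B
    rw [sum_eps3_mul, rotB_eq_mm (hs _)]
    simp only [Pi.smul_apply, Pi.add_apply, Pi.sub_apply, mm_apply, smul_eq_mul]
    ring
  · simp only [chi, chiJ, t1, ← lo_apply]
    congr 1
    ext A
    rw [sum_eps3_mul]
    simp only [Pi.smul_apply, Pi.add_apply, Pi.sub_apply, smul_eq_mul, rotW_apply]
    ring

theorem skew_of_phase {w : Phase} (hw : w ∈ phaseFibre) (a : Fin 4) : om w.1 a ∈ skew :=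
  (mem_configFibre.1 hw.1).1 a

theorem chi_field {z : Space → Phase} (hz : IsField phaseFibre z) (x : Space) :
    chi z x = chiJ (z x) (jet z x) :=
  chi_eq (hz.differentiable x) fun i => skew_of_phase (hz.mem x) i.succ

theorem dd_mem {V : Type*} [NormedAddCommGroup V] [NormedSpace ℝ V] [FiniteDimensional ℝ V]
    {W : Submodule ℝ V} {z : Space → V} (hz : IsField W z) (i : Fin 3) (x : Space) : dd i z x ∈ W := by
  by_contra hn
  obtain ⟨f, hf0, hf⟩ := W.exists_le_ker_of_notMem hn
  have h1 := dd_linear i f (hz.differentiable x)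
  have h2 : (fun y => f (z y)) = fun _ => 0 := funext fun y => hf (hz.mem y)
  rw [h2] at h1
  apply hf0
  rw [← h1]
  unfold dd; simp

theorem chiJ_mem {w : Phase} (hw : w ∈ phaseFibre) {d : Fin 3 → Phase} (hd : ∀ i, d i ∈ phaseFibre) :
    chiJ w d ∈ parFibre := by
  have h1 := mem_configFibre.1 hw.1
  have h2 := mem_configFibre.1 hw.2
  refine mem_parFibre.2 ⟨?_, fun i => lo2_mem_skew (skew.smul_mem _ ?_)⟩
  · simp only [chiJ]
    refine Submodule.sum_mem _ fun i _ => ?_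
    exact skew.sub_mem (skew.add_mem ((mem_configFibre.1 (hd i).2).1 _)
      (lo2_mem_skew (rotB_mem_skew _ (lo2_mem_skew (h2.1 _))))) (lo2_mem_skew (wdg_mem_skew _ _))
  · exact skew.add_mem (skew.sub_mem ((mem_configFibre.1 (hd _).1).1 _)
      ((mem_configFibre.1 (hd _).1).1 _)) (rotB_mem_skew _ (h1.1 _))

theorem chi_mem {z : Space → Phase} (hz : IsField phaseFibre z) (x : Space) : chi z x ∈ parFibre := by
  rw [chi_field hz]; exact chiJ_mem (hz.mem x) fun i => dd_mem hz i x

/-! ### Smoothness of the constraints -/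

section Smooth
variable {D : Type*} [NormedAddCommGroup D] [NormedSpace ℝ D]

@[fun_prop] theorem ContDiff.om {q : D → Config} (hq : ContDiff ℝ ∞ q) (a : Fin 4) :
    ContDiff ℝ ∞ fun y => om (q y) a := contDiff_linear (omL a) hq
@[fun_prop] theorem ContDiff.th {q : D → Config} (hq : ContDiff ℝ ∞ q) (a : Fin 4) :
    ContDiff ℝ ∞ fun y => th (q y) a := contDiff_linear (thL a) hq
@[fun_prop] theorem ContDiff.bB {q : D → Config} (hq : ContDiff ℝ ∞ q) (a b : Fin 4) :
    ContDiff ℝ ∞ fun y => bB (q y) a b := contDiff_linear (bBL a b) hq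
@[fun_prop] theorem ContDiff.be {q : D → Config} (hq : ContDiff ℝ ∞ q) (a b : Fin 4) :
    ContDiff ℝ ∞ fun y => be (q y) a b := contDiff_linear (beL a b) hq
@[fun_prop] theorem ContDiff.rotB {U X : D → Biv} (hU : ContDiff ℝ ∞ U) (hX : ContDiff ℝ ∞ X) :
    ContDiff ℝ ∞ fun y => rotB (U y) (X y) := contDiff_bilinear _ hU hX
@[fun_prop] theorem ContDiff.rotW {U : D → Biv} {X : D → Vec} (hU : ContDiff ℝ ∞ U)
    (hX : ContDiff ℝ ∞ X) : ContDiff ℝ ∞ fun y => rotW (U y) (X y) := contDiff_bilinear _ hU hX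
@[fun_prop] theorem ContDiff.wdg {U X : D → Vec} (hU : ContDiff ℝ ∞ U) (hX : ContDiff ℝ ∞ X) :
    ContDiff ℝ ∞ fun y => wdg (U y) (X y) := contDiff_bilinear _ hU hX
@[fun_prop] theorem ContDiff.lo2 {X : D → Biv} (hX : ContDiff ℝ ∞ X) :
    ContDiff ℝ ∞ fun y => lo2 (X y) := contDiff_linear _ hX
@[fun_prop] theorem ContDiff.lo {X : D → Vec} (hX : ContDiff ℝ ∞ X) :
    ContDiff ℝ ∞ fun y => lo (X y) := contDiff_linear _ hX
@[fun_prop] theorem ContDiff.ipB {U X : D → Biv} (hU : ContDiff ℝ ∞ U) (hX : ContDiff ℝ ∞ X) :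
    ContDiff ℝ ∞ fun y => ipB (U y) (X y) := contDiff_bilinear _ hU hX
@[fun_prop] theorem ContDiff.ipV {U X : D → Vec} (hU : ContDiff ℝ ∞ U) (hX : ContDiff ℝ ∞ X) :
    ContDiff ℝ ∞ fun y => ipV (U y) (X y) := contDiff_bilinear _ hU hX
@[fun_prop] theorem ContDiff.parPair {N K : D → Par} (hN : ContDiff ℝ ∞ N) (hK : ContDiff ℝ ∞ K) :
    ContDiff ℝ ∞ fun y => parPair (N y) (K y) := contDiff_bilinear parPairL hN hK
@[fun_prop] theorem ContDiff.redConfig {T : D → Par} {S : D → SPar} (hT : ContDiff ℝ ∞ T)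
    (hS : ContDiff ℝ ∞ S) : ContDiff ℝ ∞ fun y => redConfig (T y) (S y) :=
  contDiff_linear redL (hT.prodMk hS)
attribute [fun_prop] contDiff_dd

theorem contDiff_jet {E : Type*} [NormedAddCommGroup E] [NormedSpace ℝ E] {z : Space → E}
    (hz : ContDiff ℝ ∞ z) (i : Fin 3) : ContDiff ℝ ∞ fun x => jet z x i := contDiff_dd i hz

theorem contDiff_chiJ {w : D → Phase} {d : D → Fin 3 → Phase} (hw : ContDiff ℝ ∞ w)
    (hd : ∀ i, ContDiff ℝ ∞ fun y => d y i) : ContDiff ℝ ∞ fun y => chiJ (w y) (d y) := by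
  unfold chiJ
  have h1 := hw.fst
  have h2 := hw.snd
  have d1 := fun i => (hd i).fst
  have d2 := fun i => (hd i).snd
  refine ContDiff.prodMk ?_ (ContDiff.prodMk ?_ (ContDiff.prodMk (contDiff_pi.2 fun i => ?_)
    (contDiff_pi.2 fun i => ?_)))
  · refine ContDiff.sum fun i _ => ?_
    have := d2 i
    fun_prop
  · refine ContDiff.sum fun i _ => ?_
    have := d2 i
    fun_prop
  · have := d1 (i + 1)
    have := d1 (i + 2)
    fun_prop
  · have := d1 (i + 1)
    have := d1 (i + 2)
    fun_prop

theorem contDiff_chi {z : Space → Phase} (hz : IsField phaseFibre z) : ContDiff ℝ ∞ (chi z) := by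
  have h : chi z = fun x => chiJ (z x) (jet z x) := funext fun x => chi_field hz x
  rw [h]
  exact contDiff_chiJ hz.smooth (contDiff_jet hz.smooth)

end Smooth

theorem jet_congr {E : Type*} [NormedAddCommGroup E] [NormedSpace ℝ E] {z w : Space → E} {x : Space}
    (h : z =ᶠ[nhds x] w) : jet z x = jet w x := funext fun i => dd_congr i h

theorem chi_congr {z w : Space → Phase} {x : Space} (hz : IsField phaseFibre z)
    (hw : IsField phaseFibre w) (h : z =ᶠ[nhds x] w) : chi z x = chi w x := by
  rw [chi_field hz, chi_field hw, jet_congr h, h.eq_of_nhds]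

theorem jet_add_smul {z h : Space → Phase} (hz : Differentiable ℝ z) (hh : Differentiable ℝ h) (s : ℝ)
    (x : Space) : jet (z + s • h) x = jet z x + s • jet h x := by
  funext i
  have h1 := dd_add i (hz x) ((hh x).const_smul s)
  rw [show dd i (fun y => (s • h) y) x = s • dd i h x from dd_const_smul i s (hh x)] at h1
  exact h1

theorem chi_add {z h : Space → Phase} (hz : IsField phaseFibre z) (hh : IsField phaseFibre h) (s : ℝ)
    (x : Space) : chi (z + s • h) x =
      chi z x + s • chiLin (z x) (h x) (jet h x) + s ^ 2 • chiJ (h x) 0 := by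
  rw [chi_field (hz.add (hh.smul s)), chi_field hz, jet_add_smul hz.differentiable hh.differentiable,
    ← chiJ_add]
  rfl

/-! ### The Hamiltonian vector fields of the secondary constraints -/

/-- The Hamiltonian vector field of the secondary constraints smeared with `N = (U, u, Ξ, ξ)`, in terms of the
values `w` of the fields and of the values `N` and first derivatives `d` of the parameters at a point. -/
def secX (w : Phase) (N : Par) (d : Fin 3 → Par) : Phase :=
  (redConfig 0
    (fun i => -((d i).1 + rotB (om w.1 i.succ) N.1),
      fun i => -((d i).2.1 + rotW (om w.1 i.succ) N.2.1) + rotW N.1 (th w.1 i.succ)),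
   redConfig 0
    (fun i => lo2 (rotB N.1 (lo2 (om w.2 i.succ)) - wdg N.2.1 (lo (th w.2 i.succ))
        - (1 / 2 : ℝ) • ((d (i + 1)).2.2.1 (i + 2) - (d (i + 2)).2.2.1 (i + 1)
          + rotB (om w.1 (i + 1).succ) (N.2.2.1 (i + 2)) - rotB (om w.1 (i + 2).succ) (N.2.2.1 (i + 1))
          - wdg (th w.1 (i + 1).succ) (N.2.2.2 (i + 2)) + wdg (th w.1 (i + 2).succ) (N.2.2.2 (i + 1)))),
      fun i => lo (rotW N.1 (lo (th w.2 i.succ))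
        - (1 / 2 : ℝ) • ((d (i + 1)).2.2.2 (i + 2) - (d (i + 2)).2.2.2 (i + 1)
          + rotW (om w.1 (i + 1).succ) (N.2.2.2 (i + 2)) - rotW (om w.1 (i + 2).succ) (N.2.2.2 (i + 1))))))

/-- The covector with Hamiltonian vector field `X`, i.e. `(δq, δp) ↦ (-δp, δq)`. -/
def sharp : Phase →ₗ[ℝ] Phase where
  toFun X := (-X.2, X.1)
  map_add' X Y := by ext <;> simp [add_comm]
  map_smul' r X := by ext <;> simp

theorem poisson_sharp_left (X g : Phase) : poisson (sharp X) g = -pair g X := by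
  simp only [poisson, pair, sharp, LinearMap.coe_mk, AddHom.coe_mk, neg_dotProduct, dotProduct_comm X.2,
    dotProduct_comm X.1]
  ring

theorem poisson_comm (f g : Phase) : poisson f g = -poisson g f := by
  simp only [poisson, dotProduct_comm g.1, dotProduct_comm g.2]; ring

theorem sharp_mem {X : Phase} (hX : X ∈ reducedFibre) : sharp X ∈ reducedFibre :=
  ⟨reducedConfig.neg_mem hX.2, hX.1⟩

/-- The vector field whose divergence is discarded when the secondary constraints are integrated by parts. -/
def flux (i : Fin 3) : Par →ₗ[ℝ] Phase →ₗ[ℝ] ℝ :=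
  LinearMap.mk₂ ℝ (fun N h => ipB N.1 (om h.2 i.succ) + ipV N.2.1 (th h.2 i.succ)
      + (1 / 2) * (ipB (lo2 (N.2.2.1 (i + 2))) (om h.1 (i + 1).succ)
        - ipB (lo2 (N.2.2.1 (i + 1))) (om h.1 (i + 2).succ)
        + ipV (lo (N.2.2.2 (i + 2))) (th h.1 (i + 1).succ)
        - ipV (lo (N.2.2.2 (i + 1))) (th h.1 (i + 2).succ)))
    (by
      intros
      simp only [Prod.fst_add, Prod.snd_add, Pi.add_apply, map_add, LinearMap.add_apply]
      ring)
    (by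
      intros
      simp only [Prod.smul_fst, Prod.smul_snd, Pi.smul_apply, map_smul, LinearMap.smul_apply, smul_eq_mul]
      ring)
    (by
      intros
      simp only [Prod.fst_add, Prod.snd_add, om_add, th_add, map_add]
      ring)
    (by
      intros
      simp only [Prod.smul_fst, Prod.smul_snd, om_smul, th_smul, map_smul, smul_eq_mul]
      ring)

theorem flux_apply (i : Fin 3) (N : Par) (h : Phase) : flux i N h =
    ipB N.1 (om h.2 i.succ) + ipV N.2.1 (th h.2 i.succ)
      + (1 / 2) * (ipB (lo2 (N.2.2.1 (i + 2))) (om h.1 (i + 1).succ)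
        - ipB (lo2 (N.2.2.1 (i + 1))) (om h.1 (i + 2).succ)
        + ipV (lo (N.2.2.2 (i + 2))) (th h.1 (i + 1).succ)
        - ipV (lo (N.2.2.2 (i + 1))) (th h.1 (i + 2).succ)) := rfl

/-- Integration by parts: the linearized secondary constraints, smeared with `N`, equal the variation along
the covector of `secX` up to a divergence. -/
theorem parPair_chiLin {w h : Phase} (hw : w ∈ phaseFibre) (hh : h ∈ phaseFibre) {N : Par}
    (hN : N ∈ parFibre) (d : Fin 3 → Par) (e : Fin 3 → Phase) :
    parPair N (chiLin w h e) = pair (sharp (secX w N d)) h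
      + ∑ i, (flux i (d i) h + flux i N (e i)) := by
  have wo : ∀ a, om w.1 a ∈ skew := (mem_configFibre.1 hw.1).1
  have wp : ∀ a, om w.2 a ∈ skew := (mem_configFibre.1 hw.2).1
  have ho : ∀ a, om h.1 a ∈ skew := (mem_configFibre.1 hh.1).1
  have hp : ∀ a, om h.2 a ∈ skew := (mem_configFibre.1 hh.2).1
  have hU := hN.1
  have hX := hN.2
  -- Each term is transposed onto the variation by the invariance of the contractions.
  have l1 : ∀ a b, ipB N.1 (lo2 (rotB (om w.1 a) (lo2 (om h.2 b)))) = -ipB (rotB (om w.1 a) N.1) (om h.2 b) :=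
    fun a b => by rw [ipB_rotB (wo a), lo2_lo2]
  have l2 : ∀ a b, ipB N.1 (lo2 (rotB (om h.1 a) (lo2 (om w.2 b))))
      = -ipB (lo2 (rotB N.1 (lo2 (om w.2 b)))) (om h.1 a) := fun a b => by
    have hs := lo2_mem_skew (wp b)
    rw [rotB_comm (ho a) hs, map_neg, map_neg, ipB_rotB hs, rotB_comm hs hU, map_neg,
      LinearMap.neg_apply, neg_neg, ipB_lo2]
  have l3 : ∀ a b, ipB N.1 (lo2 (wdg (th w.1 a) (lo (th h.2 b)))) = -ipV (rotW N.1 (th w.1 a)) (th h.2 b) :=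
    fun a b => by rw [ipB_wdg hU, lo_lo]
  have l4 : ∀ a b, ipB N.1 (lo2 (wdg (th h.1 a) (lo (th w.2 b))))
      = ipV (lo (rotW N.1 (lo (th w.2 b)))) (th h.1 a) := fun a b => by
    rw [wdg_comm, map_neg, map_neg, ipB_wdg hU, neg_neg, ipV_lo]
  have l5 : ∀ a b, ipV N.2.1 (lo (rotW (om w.1 a) (lo (th h.2 b))))
      = -ipV (rotW (om w.1 a) N.2.1) (th h.2 b) := fun a b => by rw [ipV_rotW (wo a), lo_lo]
  have l6 : ∀ a b, ipV N.2.1 (lo (rotW (om h.1 a) (lo (th w.2 b))))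
      = ipB (lo2 (wdg N.2.1 (lo (th w.2 b)))) (om h.1 a) := fun a b => by
    rw [ipV_rotW (ho a), ← ipB_wdg (ho a), ipB_comm]
  have l7 : ∀ i a b, ipB (N.2.2.1 i) (lo2 (rotB (om w.1 a) (om h.1 b)))
      = -ipB (lo2 (rotB (om w.1 a) (N.2.2.1 i))) (om h.1 b) := fun i a b => by
    rw [ipB_rotB (wo a), ipB_lo2]
  have l7' : ∀ i a b, ipB (N.2.2.1 i) (lo2 (rotB (om h.1 b) (om w.1 a)))
      = ipB (lo2 (rotB (om w.1 a) (N.2.2.1 i))) (om h.1 b) := fun i a b => by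
    rw [rotB_comm (ho b) (wo a), map_neg, map_neg, l7, neg_neg]
  have l8 : ∀ i a b, ipV (N.2.2.2 i) (lo (rotW (om w.1 a) (th h.1 b)))
      = -ipV (lo (rotW (om w.1 a) (N.2.2.2 i))) (th h.1 b) := fun i a b => by
    rw [ipV_rotW (wo a), ipV_lo]
  have l9 : ∀ i a b, ipV (N.2.2.2 i) (lo (rotW (om h.1 b) (th w.1 a)))
      = -ipB (lo2 (wdg (th w.1 a) (N.2.2.2 i))) (om h.1 b) := fun i a b => by
    rw [ipV_rotW (ho b), ← ipB_wdg (ho b), ipB_comm, wdg_comm, map_neg, LinearMap.map_neg,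
      LinearMap.neg_apply]
  have e1 : ∀ i j a, ipB (N.2.2.1 i) (lo2 (om (e j).1 a)) = ipB (lo2 (N.2.2.1 i)) (om (e j).1 a) :=
    fun i j a => (ipB_lo2 _ _).symm
  have e2 : ∀ i j a, ipV (N.2.2.2 i) (lo (th (e j).1 a)) = ipV (lo (N.2.2.2 i)) (th (e j).1 a) :=
    fun i j a => (ipV_lo _ _).symm
  have neg_eq : sharp (secX w N d) = ((-1 : ℝ) • (secX w N d).2, (secX w N d).1) := by
    simp [sharp]
  rw [neg_eq]
  simp only [pair, smul_dotProduct, smul_eq_mul]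
  simp only [secX]
  rw [dot_red _ _ hh.1, dot_red _ _ hh.2]
  simp only [parPair_eq, chiLin, flux_apply, Fin.sum_univ_three, map_add, map_sub, map_neg, map_smul,
    LinearMap.add_apply, LinearMap.sub_apply, LinearMap.neg_apply, LinearMap.smul_apply, smul_eq_mul,
    l1, l2, l3, l4, l5, l6, l7, l7', l8, l9, e1, e2, Prod.fst_zero, Prod.snd_zero, Pi.zero_apply, map_zero,
    LinearMap.zero_apply, Fin.isValue, Fin.reduceAdd, zero_add]
  ring

/-! ### Functional derivatives of the secondary constraints and of the canonical Hamiltonian -/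

theorem secX_mem {w : Phase} (hw : w ∈ phaseFibre) {N : Par} (hN : N ∈ parFibre) {d : Fin 3 → Par}
    (hd : ∀ i, d i ∈ parFibre) : secX w N d ∈ reducedFibre := by
  have wp : ∀ a, om w.2 a ∈ skew := (mem_configFibre.1 hw.2).1
  refine ⟨redConfig_mem parFibre.zero_mem fun i => ?_, redConfig_mem parFibre.zero_mem fun i => ?_⟩
  · exact skew.neg_mem (skew.add_mem (hd i).1 (rotB_mem_skew _ hN.1))
  · refine lo2_mem_skew (skew.sub_mem (skew.sub_mem (rotB_mem_skew _ (lo2_mem_skew (wp _)))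
      (wdg_mem_skew _ _)) (skew.smul_mem _ ?_))
    exact skew.add_mem (skew.sub_mem (skew.sub_mem (skew.add_mem (skew.sub_mem ((hd _).2 _) ((hd _).2 _))
      (rotB_mem_skew _ (hN.2 _))) (rotB_mem_skew _ (hN.2 _))) (wdg_mem_skew _ _)) (wdg_mem_skew _ _)

theorem contDiff_secX {D : Type*} [NormedAddCommGroup D] [NormedSpace ℝ D] {w : D → Phase} {N : D → Par}
    {d : D → Fin 3 → Par} (hw : ContDiff ℝ ∞ w) (hN : ContDiff ℝ ∞ N)
    (hd : ∀ i, ContDiff ℝ ∞ fun y => d y i) : ContDiff ℝ ∞ fun y => secX (w y) (N y) (d y) := by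
  unfold secX
  have h1 := hw.fst
  have h2 := hw.snd
  have n1 := hN.fst
  have n2 := hN.snd.fst
  have n3 := fun i => contDiff_pi.1 hN.snd.snd.fst i
  have n4 := fun i => contDiff_pi.1 hN.snd.snd.snd i
  have d1 := fun i => (hd i).fst
  have d2 := fun i => (hd i).snd.fst
  have d3 := fun i j => contDiff_pi.1 (hd i).snd.snd.fst j
  have d4 := fun i j => contDiff_pi.1 (hd i).snd.snd.snd j
  refine ContDiff.prodMk (ContDiff.redConfig contDiff_const (ContDiff.prodMk (contDiff_pi.2 fun i => ?_)
    (contDiff_pi.2 fun i => ?_))) (ContDiff.redConfig contDiff_const (ContDiff.prodMk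
    (contDiff_pi.2 fun i => ?_) (contDiff_pi.2 fun i => ?_)))
  · have := d1 i
    fun_prop
  · have := d2 i
    fun_prop
  · have := d3 (i + 1) (i + 2)
    have := d3 (i + 2) (i + 1)
    have := n3 (i + 1)
    have := n3 (i + 2)
    have := n4 (i + 1)
    have := n4 (i + 2)
    fun_prop
  · have := d4 (i + 1) (i + 2)
    have := d4 (i + 2) (i + 1)
    have := n4 (i + 1)
    have := n4 (i + 2)
    fun_prop

/-- The Hamiltonian vector field of `∫ N·χ`. -/
def secField (N : Space → Par) (z : Space → Phase) (x : Space) : Phase := secX (z x) (N x) (jet N x)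

theorem isField_secField {N : Space → Par} {z : Space → Phase} (hz : IsField phaseFibre z)
    (hN : IsField parFibre N) : IsField reducedFibre (secField N z) :=
  ⟨contDiff_secX hz.smooth hN.smooth (contDiff_jet hN.smooth),
    fun x => secX_mem (hz.mem x) (hN.mem x) fun i => dd_mem hN i x⟩

theorem isField_sharp {X : Space → Phase} (hX : IsField reducedFibre X) :
    IsField reducedFibre fun x => sharp (X x) := hX.linear sharp fun _ => sharp_mem

/-- The linearized secondary constraints along a variation `h`. -/
def chiVar (z h : Space → Phase) (x : Space) : Par := chiLin (z x) (h x) (jet h x)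

theorem contDiff_chiLin {D : Type*} [NormedAddCommGroup D] [NormedSpace ℝ D] {w h : D → Phase}
    {e : D → Fin 3 → Phase} (hw : ContDiff ℝ ∞ w) (hh : ContDiff ℝ ∞ h)
    (he : ∀ i, ContDiff ℝ ∞ fun y => e y i) : ContDiff ℝ ∞ fun y => chiLin (w y) (h y) (e y) := by
  have key : ∀ y, chiLin (w y) (h y) (e y)
      = chiJ (w y + (1 : ℝ) • h y) (0 + (1 : ℝ) • e y) - chiJ (w y) 0 - chiJ (h y) 0 := by
    intro y
    rw [chiJ_add]
    module
  simp only [key]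
  refine ((contDiff_chiJ (hw.add (hh.const_smul (1 : ℝ))) fun i => ?_).sub
    (contDiff_chiJ hw fun i => contDiff_const)).sub (contDiff_chiJ hh fun i => contDiff_const)
  exact contDiff_const.add ((he i).const_smul (1 : ℝ))

theorem chiLin_zero (w : Phase) : chiLin w 0 0 = 0 := by
  refine Prod.ext ?_ (Prod.ext ?_ (Prod.ext (funext fun i => ?_) (funext fun i => ?_))) <;>
    simp [chiLin, om_zero, th_zero]

theorem integral_sum_dd {V : Fin 3 → Space → ℝ} (hV : ∀ i, ContDiff ℝ ∞ (V i))
    (hs : ∀ i, HasCompactSupport (V i)) : ∫ x, ∑ i, dd i (V i) x = 0 := by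
  rw [integral_finsetSum]
  · exact Finset.sum_eq_zero fun i _ => integral_dd_eq_zero i (hV i) (hs i)
  · intro i _
    exact (contDiff_dd i (hV i)).continuous.integrable_of_hasCompactSupport (hasCompactSupport_dd i (hs i))

theorem integrable_sum_dd {V : Fin 3 → Space → ℝ} (hV : ∀ i, ContDiff ℝ ∞ (V i))
    (hs : ∀ i, HasCompactSupport (V i)) : Integrable fun x => ∑ i, dd i (V i) x :=
  integrable_finsetSum _ fun i _ =>
    (contDiff_dd i (hV i)).continuous.integrable_of_hasCompactSupport (hasCompactSupport_dd i (hs i))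

/-- Integrated form of `parPair_chiLin`. -/
theorem integral_chiVar {z h : Space → Phase} {N : Space → Par} (hz : IsField phaseFibre z)
    (hN : IsField parFibre N) (hh : IsTest phaseFibre h) :
    ∫ x, parPair (N x) (chiVar z h x) = ∫ x, pair (sharp (secField N z x)) (h x) := by
  have hV : ∀ i, ContDiff ℝ ∞ fun x => flux i (N x) (h x) :=
    fun i => contDiff_bilinear _ hN.smooth hh.smooth
  have hs : ∀ i, HasCompactSupport fun x => flux i (N x) (h x) :=
    fun i => hh.compact.mono fun x hx h0 => hx (by simp only [h0, map_zero])
  have e : ∀ x, parPair (N x) (chiVar z h x) = pair (sharp (secField N z x)) (h x)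
      + ∑ i, dd i (fun x => flux i (N x) (h x)) x := by
    intro x
    rw [chiVar, parPair_chiLin (hz.mem x) (hh.mem x) (hN.mem x) (jet N x), secField]
    congr 1
    refine Finset.sum_congr rfl fun i _ => ?_
    rw [dd_bilinear i (flux i) (hN.differentiable x) (hh.toIsField.differentiable x)]
    rfl
  simp only [e]
  rw [integral_add (integrable_pair_right
    (isField_sharp (isField_secField hz hN)).smooth hh.smooth hh.compact) (integrable_sum_dd hV hs),
    integral_sum_dd hV hs, add_zero]

section Gradients
variable {W : Submodule ℝ Phase} (h1 : reducedFibre ≤ W) (h2 : W ≤ phaseFibre)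
include h1 h2

theorem hasGradient_sec {N : Space → Par} {z : Space → Phase} (hz : IsField W z)
    (hN : IsField parFibre N) : HasGradient W (sec N) z fun x => sharp (secField N z x) := by
  refine IsLocal.hasGradient ⟨fun z hz => ?_, fun z w x hz hw h => ?_⟩ hz
    ((isField_sharp (isField_secField (hz.mono h2) hN)).mono h1)
    (fun h x => parPair (N x) (chiVar z h x)) (fun h x => parPair (N x) (chiJ (h x) 0)) 0
    (fun h hh s x => ?_) fun h hh =>
      integral_chiVar (hz.mono h2) hN ⟨hh.toIsField.mono h2, hh.compact⟩
  · exact (ContDiff.parPair hN.smooth (contDiff_chi (hz.mono h2))).continuous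
  · simp only [sec, chi_congr (hz.mono h2) (hw.mono h2) h]
  · simp only [sec, chi_add (hz.mono h2) (hh.toIsField.mono h2), ← parPairL_apply, map_add, map_smul,
      smul_eq_mul, chiVar, Pi.zero_apply, mul_zero, add_zero]

end Gradients

/-- `temporalFields` as a linear map. -/
def tfL : Phase →ₗ[ℝ] Par where
  toFun := temporalFields
  map_add' v w := by
    refine Prod.ext rfl (Prod.ext rfl (Prod.ext (funext fun i => ?_) (funext fun i => ?_)))
    · ext A B; simp [temporalFields, bB, mul_add]
    · ext A; simp [temporalFields, be, mul_add]
  map_smul' r w := by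
    refine Prod.ext rfl (Prod.ext rfl (Prod.ext (funext fun i => ?_) (funext fun i => ?_)))
    · ext A B; simp [temporalFields, bB, mul_left_comm]
    · ext A; simp [temporalFields, be, mul_left_comm]

theorem tfL_apply (w : Phase) : tfL w = temporalFields w := rfl

theorem temporalFields_eq (w : Phase) : temporalFields w = (om w.1 0, th w.1 0,
    fun i => (2 : ℝ) • bB w.1 0 i.succ, fun i => (2 : ℝ) • be w.1 0 i.succ) := rfl

theorem temporalFields_mem {w : Phase} (hw : w ∈ phaseFibre) : temporalFields w ∈ parFibre :=
  ⟨(mem_configFibre.1 hw.1).1 0, fun i => skew.smul_mem 2 ((mem_configFibre.1 hw.1).2.1 0 i.succ)⟩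

theorem isField_temporalFields {z : Space → Phase} (hz : IsField phaseFibre z) :
    IsField parFibre fun x => temporalFields (z x) := hz.linear tfL fun _ => temporalFields_mem

/-- The covector `h ↦ ⟨temporalFields h, K⟩`. -/
def tempCovector : Par →ₗ[ℝ] Phase where
  toFun K := (redConfig K 0, 0)
  map_add' K K' := by
    have := map_add redL (K, (0 : SPar)) (K', 0)
    simp only [Prod.mk_add_mk, add_zero] at this ⊢
    exact congrArg (fun p => (p, (0 : Config))) this
  map_smul' r K := by
    have := map_smul redL r (K, (0 : SPar))
    simp only [Prod.smul_mk, smul_zero, RingHom.id_apply] at this ⊢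
    exact congrArg (fun p => (p, (0 : Config))) this

theorem tempCovector_apply (K : Par) : tempCovector K = (redConfig K 0, 0) := rfl

theorem tempCovector_mem {K : Par} (hK : K ∈ parFibre) : tempCovector K ∈ reducedFibre :=
  ⟨redConfig_mem hK sparFibre.zero_mem, reducedConfig.zero_mem⟩

theorem pair_tempCovector (K : Par) {h : Phase} (hh : h ∈ phaseFibre) :
    pair (tempCovector K) h = parPair (temporalFields h) K := by
  rw [tempCovector_apply, pair, dot_red _ _ hh.1, parPair_eq, temporalFields_eq]
  simp only [zero_dotProduct, Prod.fst_zero, Prod.snd_zero, Pi.zero_apply, map_zero, LinearMap.zero_apply,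
    Finset.sum_const_zero, map_smul, LinearMap.smul_apply, smul_eq_mul, ← Finset.mul_sum, add_zero]
  simp only [ipB_comm, ipV_comm]

/-- The combination of the secondary constraints in the canonical Hamiltonian. -/
def tempChi : Density := fun z x => parPair (temporalFields (z x)) (chi z x)

/-- The functional derivative of `tempChi`. -/
def tempChiGrad (z : Space → Phase) (x : Space) : Phase :=
  sharp (secField (fun y => temporalFields (z y)) z x) + tempCovector (chi z x)

/-- The quantity whose divergence distinguishes the canonical Hamiltonian from `-tempChi`. -/
def boundary (i : Fin 3) : Phase →ₗ[ℝ] Phase →ₗ[ℝ] ℝ :=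
  LinearMap.mk₂ ℝ (fun w w' => ipB (om w.1 0) (om w'.2 i.succ) + ipV (th w.1 0) (th w'.2 i.succ))
    (by
      intros
      simp only [Prod.fst_add, om_add, th_add, map_add, LinearMap.add_apply]
      ring)
    (by
      intros
      simp only [Prod.smul_fst, om_smul, th_smul, map_smul, LinearMap.smul_apply, smul_eq_mul]
      ring)
    (by
      intros
      simp only [Prod.snd_add, om_add, th_add, map_add]
      ring)
    (by
      intros
      simp only [Prod.smul_snd, om_smul, th_smul, map_smul, smul_eq_mul]
      ring)

theorem boundary_apply (i : Fin 3) (w w' : Phase) : boundary i w w' =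
    ipB (om w.1 0) (om w'.2 i.succ) + ipV (th w.1 0) (th w'.2 i.succ) := rfl

/-- The canonical Hamiltonian density in terms of the secondary constraints. -/
def canonDensity : Density := fun z x => -tempChi z x + ∑ i, dd i (fun y => boundary i (z y) (z y)) x

section Gradients
variable {W : Submodule ℝ Phase} (h1 : reducedFibre ≤ W) (h2 : W ≤ phaseFibre)

theorem isField_tempChiGrad {z : Space → Phase} (hz : IsField phaseFibre z) :
    IsField reducedFibre (tempChiGrad z) := by
  have hT := isField_temporalFields hz
  have hc : IsField parFibre (chi z) := ⟨contDiff_chi hz, chi_mem hz⟩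
  exact (isField_sharp (isField_secField hz hT)).add (hc.linear tempCovector fun _ => tempCovector_mem)

include h1 h2 in
/-- The smearing parameters of `tempChi` depend on the fields themselves, which contributes the term
`tempCovector χ` to its functional derivative. -/
theorem hasGradient_tempChi {z : Space → Phase} (hz : IsField W z) :
    HasGradient W tempChi z (tempChiGrad z) := by
  have hz' := hz.mono h2
  have hT := isField_temporalFields hz'
  refine IsLocal.hasGradient ⟨fun z hz => ?_, fun z w x hz hw h => ?_⟩ hz
    ((isField_tempChiGrad hz').mono h1)
    (fun h x => parPair (temporalFields (z x)) (chiVar z h x) + parPair (temporalFields (h x)) (chi z x))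
    (fun h x => parPair (temporalFields (z x)) (chiJ (h x) 0)
      + parPair (temporalFields (h x)) (chiVar z h x))
    (fun h x => parPair (temporalFields (h x)) (chiJ (h x) 0))
    (fun h hh s x => ?_) fun h hh => ?_
  · exact (ContDiff.parPair (isField_temporalFields (hz.mono h2)).smooth
      (contDiff_chi (hz.mono h2))).continuous
  · simp only [tempChi, chi_congr (hz.mono h2) (hw.mono h2) h, h.eq_of_nhds]
  · simp only [tempChi, chi_add hz' (hh.toIsField.mono h2), ← parPairL_apply, ← tfL_apply, Pi.add_apply,
      Pi.smul_apply, map_add, map_smul, LinearMap.add_apply, LinearMap.smul_apply, smul_eq_mul, chiVar]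
    ring
  · have hh' : IsTest phaseFibre h := ⟨hh.toIsField.mono h2, hh.compact⟩
    have i1 : Integrable fun x => parPair (temporalFields (z x)) (chiVar z h x) := by
      refine (ContDiff.parPair hT.smooth (contDiff_chiLin hz.smooth hh.smooth
        (contDiff_jet hh.smooth))).continuous.integrable_of_hasCompactSupport ?_
      refine HasCompactSupport.intro' hh.compact (isClosed_tsupport h) fun x hx => ?_
      have h0 : h =ᶠ[nhds x] 0 := notMem_tsupport_iff_eventuallyEq.1 hx
      have hj : jet h x = 0 := by
        rw [jet_congr h0]; funext i; unfold jet dd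
        simp only [fderiv_zero, Pi.zero_apply, _root_.zero_apply]
      simp only [h0.eq_of_nhds, hj, Pi.zero_apply, chiLin_zero, ← parPairL_apply, map_zero]
    have i2 : Integrable fun x => parPair (temporalFields (h x)) (chi z x) := by
      refine (ContDiff.parPair (isField_temporalFields hh'.toIsField).smooth
        (contDiff_chi hz')).continuous.integrable_of_hasCompactSupport ?_
      exact hh.compact.mono fun x hx h0 => hx (by
        simp only [h0, ← parPairL_apply, ← tfL_apply, map_zero, LinearMap.zero_apply])
    have i3 : Integrable fun x => pair (sharp (secField (fun y => temporalFields (z y)) z x)) (h x) :=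
      integrable_pair_right (isField_sharp (isField_secField hz' hT)).smooth hh.smooth hh.compact
    rw [integral_add i1 i2, integral_chiVar hz' hT hh', ← integral_add i3 i2]
    simp only [tempChiGrad, pair_add_left, pair_tempCovector _ (hh'.mem _)]

/-- A divergence has zero functional derivative, since variations have compact support. -/
theorem hasGradient_boundary {z : Space → Phase} (hz : IsField W z) :
    HasGradient W (fun z x => ∑ i, dd i (fun y => boundary i (z y) (z y)) x) z 0 := by
  have hc : ∀ {z w : Space → Phase}, ContDiff ℝ ∞ z → ContDiff ℝ ∞ w → ∀ i,
      ContDiff ℝ ∞ fun y => boundary i (z y) (w y) := fun hz hw i => contDiff_bilinear _ hz hw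
  refine IsLocal.hasGradient ⟨fun z hz => ?_, fun z w x hz hw h => ?_⟩ hz
    ⟨contDiff_const, fun _ => W.zero_mem⟩
    (fun h x => ∑ i, dd i (fun y => boundary i (z y) (h y) + boundary i (h y) (z y)) x)
    (fun h x => ∑ i, dd i (fun y => boundary i (h y) (h y)) x) 0
    (fun h hh s x => ?_) fun h hh => ?_
  · exact (ContDiff.sum fun i _ => contDiff_dd i (hc hz.smooth hz.smooth i)).continuous
  · refine Finset.sum_congr rfl fun i _ => dd_congr i ?_
    filter_upwards [h] with y hy
    rw [hy]
  · have dz := fun i => (hc hz.smooth hz.smooth i).differentiable (by simp)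
    have dzh := fun i => (hc hz.smooth hh.smooth i).differentiable (by simp)
    have dhz := fun i => (hc hh.smooth hz.smooth i).differentiable (by simp)
    have dh := fun i => (hc hh.smooth hh.smooth i).differentiable (by simp)
    have e : ∀ i : Fin 3, (fun y => boundary i ((z + s • h) y) ((z + s • h) y))
        = fun y => boundary i (z y) (z y) + (s • (boundary i (z y) (h y) + boundary i (h y) (z y))
          + s ^ 2 • boundary i (h y) (h y)) := by
      intro i; funext y
      simp only [Pi.add_apply, Pi.smul_apply, map_add, map_smul, LinearMap.add_apply, LinearMap.smul_apply,
        smul_eq_mul]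
      ring
    simp only [Pi.zero_apply, mul_zero, add_zero, e, Finset.mul_sum, ← Finset.sum_add_distrib]
    refine Finset.sum_congr rfl fun i _ => ?_
    have key : ∀ a b c : Space → ℝ, Differentiable ℝ a → Differentiable ℝ b → Differentiable ℝ c →
        dd i (fun y => a y + (s • b y + s ^ 2 • c y)) x = dd i a x + s * dd i b x + s ^ 2 * dd i c x := by
      intro a b c ha hb hc
      have h1 : DifferentiableAt ℝ (fun y => s • b y) x := (hb.const_smul s) x
      have h2 : DifferentiableAt ℝ (fun y => s ^ 2 • c y) x := (hc.const_smul (s ^ 2)) x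
      have h3 : DifferentiableAt ℝ (fun y => s • b y + s ^ 2 • c y) x := h1.add h2
      rw [dd_add i (ha x) h3, dd_add i h1 h2, dd_const_smul i s (hb x),
        dd_const_smul i _ (hc x)]
      simp only [smul_eq_mul, add_assoc]
    exact key _ _ _ (dz i) ((dzh i).add (dhz i)) (dh i)
  · have hs : ∀ i, HasCompactSupport fun y => boundary i (z y) (h y) + boundary i (h y) (z y) :=
      fun i => hh.compact.mono fun x hx h0 => hx (by simp only [h0, map_zero, LinearMap.zero_apply, add_zero])
    rw [integral_sum_dd (fun i => (hc hz.smooth hh.smooth i).add (hc hh.smooth hz.smooth i)) hs]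
    have : ∀ x, pair ((0 : Space → Phase) x) (h x) = 0 := fun x => by
      change pairL 0 (h x) = 0; rw [map_zero, LinearMap.zero_apply]
    simp only [this, integral_zero]

include h1 h2 in
theorem hasGradient_canonDensity {z : Space → Phase} (hz : IsField W z) :
    HasGradient W canonDensity z fun x => -tempChiGrad z x := by
  have h := (hasGradient_tempChi h1 h2 hz).neg.add (hasGradient_boundary hz)
  rw [add_zero] at h
  exact h

end Gradients

/-! ### The algebra of the secondary constraints -/

/-- The action of the smeared secondary constraints with parameters `N` on the values `K` of the secondary
constraints, i.e. minus the transpose of `adj N`. -/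
def coadj (N K : Par) : Par :=
  (lo2 (rotB N.1 (lo2 K.1) - wdg N.2.1 (lo K.2.1)
      - ∑ i, (rotB (lo2 (K.2.2.1 i)) (N.2.2.1 i) + wdg (N.2.2.2 i) (lo (K.2.2.2 i)))),
    lo (rotW N.1 (lo K.2.1) - ∑ i, rotW (lo2 (K.2.2.1 i)) (N.2.2.2 i)),
    fun i => lo2 (-rotB (lo2 (K.2.2.1 i)) N.1),
    fun i => lo (rotW N.1 (lo (K.2.2.2 i)) - rotW (lo2 (K.2.2.1 i)) N.2.1))

/-- The Lie bracket of smearing parameters. -/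
def adj (N N' : Par) : Par :=
  (rotB N.1 N'.1, rotW N.1 N'.2.1 - rotW N'.1 N.2.1,
    fun i => rotB N.1 (N'.2.2.1 i) - rotB N'.1 (N.2.2.1 i) + wdg (N'.2.2.2 i) N.2.1 - wdg (N.2.2.2 i) N'.2.1,
    fun i => rotW N.1 (N'.2.2.2 i) - rotW N'.1 (N.2.2.2 i))

theorem parPair_coadj {N N' K : Par} (hN : N ∈ parFibre) (hN' : N' ∈ parFibre) (hK : K ∈ parFibre) :
    parPair N' (coadj N K) = -parPair (adj N N') K := by
  have a1 : ipB N'.1 (lo2 (rotB N.1 (lo2 K.1))) = -ipB (rotB N.1 N'.1) K.1 := by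
    rw [ipB_rotB hN.1, lo2_lo2]
  have a2 : ipB N'.1 (lo2 (wdg N.2.1 (lo K.2.1))) = -ipV (rotW N'.1 N.2.1) K.2.1 := by
    rw [ipB_wdg hN'.1, lo_lo]
  have a3 : ∀ i, ipB N'.1 (lo2 (rotB (lo2 (K.2.2.1 i)) (N.2.2.1 i))) = -ipB (rotB N'.1 (N.2.2.1 i)) (K.2.2.1 i) :=
    fun i => by
      have hs := lo2_mem_skew (hK.2 i)
      rw [rotB_comm hs (hN.2 i), map_neg, map_neg, ipB_rotB (hN.2 i), lo2_lo2,
        rotB_comm (hN.2 i) hN'.1, LinearMap.map_neg, LinearMap.neg_apply, neg_neg]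
  have a4 : ∀ i, ipB N'.1 (lo2 (wdg (N.2.2.2 i) (lo (K.2.2.2 i)))) = -ipV (rotW N'.1 (N.2.2.2 i)) (K.2.2.2 i) :=
    fun i => by rw [ipB_wdg hN'.1, lo_lo]
  have a5 : ipV N'.2.1 (lo (rotW N.1 (lo K.2.1))) = -ipV (rotW N.1 N'.2.1) K.2.1 := by
    rw [ipV_rotW hN.1, lo_lo]
  have a6 : ∀ i, ipV N'.2.1 (lo (rotW (lo2 (K.2.2.1 i)) (N.2.2.2 i)))
      = -ipB (wdg (N.2.2.2 i) N'.2.1) (K.2.2.1 i) := fun i => by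
    have hs := lo2_mem_skew (hK.2 i)
    rw [ipV_rotW hs, ← ipB_wdg hs, ipB_lo2, lo2_lo2, ipB_comm, wdg_comm, LinearMap.map_neg,
      LinearMap.neg_apply]
  have a7 : ∀ i, ipB (N'.2.2.1 i) (lo2 (rotB (lo2 (K.2.2.1 i)) N.1)) = ipB (rotB N.1 (N'.2.2.1 i)) (K.2.2.1 i) :=
    fun i => by
      have hs := lo2_mem_skew (hK.2 i)
      rw [rotB_comm hs hN.1, map_neg, map_neg, ipB_rotB hN.1, lo2_lo2, neg_neg]
  have a8 : ∀ i, ipV (N'.2.2.2 i) (lo (rotW N.1 (lo (K.2.2.2 i)))) = -ipV (rotW N.1 (N'.2.2.2 i)) (K.2.2.2 i) :=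
    fun i => by rw [ipV_rotW hN.1, lo_lo]
  have a9 : ∀ i, ipV (N'.2.2.2 i) (lo (rotW (lo2 (K.2.2.1 i)) N.2.1))
      = ipB (wdg (N'.2.2.2 i) N.2.1) (K.2.2.1 i) := fun i => by
    have hs := lo2_mem_skew (hK.2 i)
    rw [ipV_rotW hs, ← ipB_wdg hs, ipB_lo2, lo2_lo2, ipB_comm, wdg_comm, LinearMap.map_neg,
      LinearMap.neg_apply, wdg_comm, LinearMap.map_neg, LinearMap.neg_apply, neg_neg]
  simp only [parPair_eq, coadj, adj, Fin.sum_univ_three, map_add, map_sub, map_neg, LinearMap.add_apply,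
    LinearMap.sub_apply, a1, a2, a3, a4, a5, a6, a7, a8, a9]
  ring

/-- `(a, b) ↦ (redConfig 0 a, redConfig 0 b)` as a linear map. -/
def spatialL : SPar × SPar →ₗ[ℝ] Phase :=
  (redL.comp ((LinearMap.inr ℝ Par SPar).comp (LinearMap.fst ℝ SPar SPar))).prod
    (redL.comp ((LinearMap.inr ℝ Par SPar).comp (LinearMap.snd ℝ SPar SPar)))

/-- The components of `secX`. -/
def secS (w : Phase) (N : Par) (d : Fin 3 → Par) : SPar × SPar :=
  ((fun i => -((d i).1 + rotB (om w.1 i.succ) N.1),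
      fun i => -((d i).2.1 + rotW (om w.1 i.succ) N.2.1) + rotW N.1 (th w.1 i.succ)),
    (fun i => lo2 (rotB N.1 (lo2 (om w.2 i.succ)) - wdg N.2.1 (lo (th w.2 i.succ))
        - (1 / 2 : ℝ) • ((d (i + 1)).2.2.1 (i + 2) - (d (i + 2)).2.2.1 (i + 1)
          + rotB (om w.1 (i + 1).succ) (N.2.2.1 (i + 2)) - rotB (om w.1 (i + 2).succ) (N.2.2.1 (i + 1))
          - wdg (th w.1 (i + 1).succ) (N.2.2.2 (i + 2)) + wdg (th w.1 (i + 2).succ) (N.2.2.2 (i + 1)))),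
      fun i => lo (rotW N.1 (lo (th w.2 i.succ))
        - (1 / 2 : ℝ) • ((d (i + 1)).2.2.2 (i + 2) - (d (i + 2)).2.2.2 (i + 1)
          + rotW (om w.1 (i + 1).succ) (N.2.2.2 (i + 2)) - rotW (om w.1 (i + 2).succ) (N.2.2.2 (i + 1))))))

theorem secX_eq (w : Phase) (N : Par) (d : Fin 3 → Par) : secX w N d = spatialL (secS w N d) := rfl

/-- The part of `secS` that is bilinear in the fields and the parameters. -/
def secBil : Phase →ₗ[ℝ] Par →ₗ[ℝ] SPar × SPar :=
  LinearMap.mk₂ ℝ (fun w N => secS w N 0)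
    (by
      intros
      refine Prod.ext (Prod.ext (funext fun i => ?_) (funext fun i => ?_))
        (Prod.ext (funext fun i => ?_) (funext fun i => ?_))
      all_goals
        simp only [secS, Prod.fst_add, Prod.snd_add, Pi.add_apply, Pi.zero_apply, Prod.fst_zero, Prod.snd_zero,
          om_add, th_add, map_add, map_sub, map_smul, map_zero, LinearMap.add_apply]
        module)
    (by
      intros
      refine Prod.ext (Prod.ext (funext fun i => ?_) (funext fun i => ?_))
        (Prod.ext (funext fun i => ?_) (funext fun i => ?_))
      all_goals
        simp only [secS, Prod.smul_fst, Prod.smul_snd, Pi.smul_apply, Pi.zero_apply, Prod.fst_zero,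
          Prod.snd_zero, om_smul, th_smul, map_add, map_sub, map_smul, map_zero, LinearMap.smul_apply]
        module)
    (by
      intros
      refine Prod.ext (Prod.ext (funext fun i => ?_) (funext fun i => ?_))
        (Prod.ext (funext fun i => ?_) (funext fun i => ?_))
      all_goals
        simp only [secS, Prod.fst_add, Prod.snd_add, Pi.add_apply, Pi.zero_apply, Prod.fst_zero, Prod.snd_zero,
          map_add, map_sub, map_smul, map_zero, LinearMap.add_apply]
        module)
    (by
      intros
      refine Prod.ext (Prod.ext (funext fun i => ?_) (funext fun i => ?_))
        (Prod.ext (funext fun i => ?_) (funext fun i => ?_))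
      all_goals
        simp only [secS, Prod.smul_fst, Prod.smul_snd, Pi.smul_apply, Pi.zero_apply, Prod.fst_zero,
          Prod.snd_zero, map_add, map_sub, map_smul, map_zero, LinearMap.smul_apply]
        module)

/-- The part of `secS` that is linear in the first derivatives of the parameters. -/
def secDer : (Fin 3 → Par) →ₗ[ℝ] SPar × SPar where
  toFun d := secS 0 0 d
  map_add' d d' := by
    refine Prod.ext (Prod.ext (funext fun i => ?_) (funext fun i => ?_))
      (Prod.ext (funext fun i => ?_) (funext fun i => ?_))
    all_goals
      simp only [secS, Prod.fst_add, Prod.snd_add, Pi.add_apply, Pi.zero_apply, Prod.fst_zero, Prod.snd_zero,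
        om_zero, th_zero, map_add, map_sub, map_smul, map_zero]
      module
  map_smul' r d := by
    refine Prod.ext (Prod.ext (funext fun i => ?_) (funext fun i => ?_))
      (Prod.ext (funext fun i => ?_) (funext fun i => ?_))
    all_goals
      simp only [secS, Prod.smul_fst, Prod.smul_snd, Pi.smul_apply, Pi.zero_apply, Prod.fst_zero,
        Prod.snd_zero, om_zero, th_zero, map_add, map_sub, map_smul, map_zero, RingHom.id_apply]
      module

theorem secS_eq (w : Phase) (N : Par) (d : Fin 3 → Par) : secS w N d = secDer d + secBil w N := by
  change secS w N d = secS 0 0 d + secS w N 0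
  refine Prod.ext (Prod.ext (funext fun i => ?_) (funext fun i => ?_))
    (Prod.ext (funext fun i => ?_) (funext fun i => ?_))
  all_goals
    simp only [secS, Prod.fst_add, Prod.snd_add, Pi.add_apply, Pi.zero_apply, Prod.fst_zero, Prod.snd_zero,
      om_zero, th_zero, map_add, map_sub, map_smul, map_zero]
    module

/-- The derivative of `secX` along fields with derivative `w'` and parameters with derivatives `N'`, `d'`. -/
def secXder (w : Phase) (N : Par) (w' : Phase) (N' : Par) (d' : Fin 3 → Par) : Phase :=
  spatialL (secDer d' + (secBil w' N + secBil w N'))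

theorem dd_secField {z : Space → Phase} {N : Space → Par} (hz : ContDiff ℝ ∞ z) (hN : ContDiff ℝ ∞ N)
    (i : Fin 3) (x : Space) : dd i (secField N z) x =
      secXder (z x) (N x) (dd i z x) (dd i N x) fun j => dd i (dd j N) x := by
  have hz' := hz.differentiable (by simp) x
  have hN' := hN.differentiable (by simp) x
  have hj : Differentiable ℝ (fun y => jet N y) :=
    (contDiff_pi.2 fun j => contDiff_jet hN j).differentiable (by simp)
  have hb : ContDiff ℝ ∞ fun y => secBil (z y) (N y) := contDiff_bilinear _ hz hN
  have hd : ContDiff ℝ ∞ fun y => secDer (jet N y) :=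
    contDiff_linear _ (contDiff_pi.2 fun j => contDiff_jet hN j)
  have e : secField N z = fun y => spatialL (secDer (jet N y) + secBil (z y) (N y)) := by
    funext y; rw [secField, secX_eq, secS_eq]
  have d1 := hd.differentiable (by simp) x
  have d2 := hb.differentiable (by simp) x
  have d3 : DifferentiableAt ℝ (fun y => secDer (jet N y) + secBil (z y) (N y)) x := d1.add d2
  rw [e, dd_linear i spatialL d3, dd_add i d1 d2, dd_linear i secDer (hj x),
    dd_bilinear i secBil hz' hN', secXder]
  congr 3
  funext j
  exact (dd_apply i (hj x) j).symm

theorem secXder_om (w : Phase) (N : Par) (w' : Phase) (N' : Par) (d' : Fin 3 → Par) (i : Fin 3) :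
    om (secXder w N w' N' d').1 i.succ =
      -((d' i).1 + rotB (om w'.1 i.succ) N.1 + rotB (om w.1 i.succ) N'.1) := by
  change (secS 0 0 d').1.1 i + ((secS w' N 0).1.1 i + (secS w N' 0).1.1 i) = _
  simp only [secS, om_zero, map_zero, LinearMap.zero_apply, Pi.zero_apply, Prod.fst_zero]
  module

theorem secXder_th (w : Phase) (N : Par) (w' : Phase) (N' : Par) (d' : Fin 3 → Par) (i : Fin 3) :
    th (secXder w N w' N' d').1 i.succ =
      -((d' i).2.1 + rotW (om w'.1 i.succ) N.2.1 + rotW (om w.1 i.succ) N'.2.1)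
        + rotW N.1 (th w'.1 i.succ) + rotW N'.1 (th w.1 i.succ) := by
  change (secS 0 0 d').1.2 i + ((secS w' N 0).1.2 i + (secS w N' 0).1.2 i) = _
  simp only [secS, om_zero, th_zero, map_zero, Pi.zero_apply, Prod.fst_zero, Prod.snd_zero]
  module

theorem secXder_Pi (w : Phase) (N : Par) (w' : Phase) (N' : Par) (d' : Fin 3 → Par) (i : Fin 3) :
    om (secXder w N w' N' d').2 i.succ =
      lo2 (rotB N.1 (lo2 (om w'.2 i.succ)) + rotB N'.1 (lo2 (om w.2 i.succ))
        - wdg N.2.1 (lo (th w'.2 i.succ)) - wdg N'.2.1 (lo (th w.2 i.succ))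
        - (1 / 2 : ℝ) • ((d' (i + 1)).2.2.1 (i + 2) - (d' (i + 2)).2.2.1 (i + 1)
          + rotB (om w'.1 (i + 1).succ) (N.2.2.1 (i + 2)) - rotB (om w'.1 (i + 2).succ) (N.2.2.1 (i + 1))
          + rotB (om w.1 (i + 1).succ) (N'.2.2.1 (i + 2)) - rotB (om w.1 (i + 2).succ) (N'.2.2.1 (i + 1))
          - wdg (th w'.1 (i + 1).succ) (N.2.2.2 (i + 2)) + wdg (th w'.1 (i + 2).succ) (N.2.2.2 (i + 1))
          - wdg (th w.1 (i + 1).succ) (N'.2.2.2 (i + 2)) + wdg (th w.1 (i + 2).succ) (N'.2.2.2 (i + 1)))) := by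
  change (secS 0 0 d').2.1 i + ((secS w' N 0).2.1 i + (secS w N' 0).2.1 i) = _
  simp only [secS, om_zero, th_zero, map_zero, Pi.zero_apply, Prod.fst_zero,
    Prod.snd_zero, map_add, map_sub, map_smul]
  module

theorem secXder_pi (w : Phase) (N : Par) (w' : Phase) (N' : Par) (d' : Fin 3 → Par) (i : Fin 3) :
    th (secXder w N w' N' d').2 i.succ =
      lo (rotW N.1 (lo (th w'.2 i.succ)) + rotW N'.1 (lo (th w.2 i.succ))
        - (1 / 2 : ℝ) • ((d' (i + 1)).2.2.2 (i + 2) - (d' (i + 2)).2.2.2 (i + 1)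
          + rotW (om w'.1 (i + 1).succ) (N.2.2.2 (i + 2)) - rotW (om w'.1 (i + 2).succ) (N.2.2.2 (i + 1))
          + rotW (om w.1 (i + 1).succ) (N'.2.2.2 (i + 2)) - rotW (om w.1 (i + 2).succ) (N'.2.2.2 (i + 1)))) := by
  change (secS 0 0 d').2.2 i + ((secS w' N 0).2.2 i + (secS w N' 0).2.2 i) = _
  simp only [secS, om_zero, th_zero, map_zero, Pi.zero_apply, Prod.fst_zero,
    Prod.snd_zero, map_add, map_sub, map_smul]
  module

theorem lo2_injective : Function.Injective lo2 := Function.LeftInverse.injective lo2_lo2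
theorem lo_injective : Function.Injective lo := Function.LeftInverse.injective lo_lo

/-- The secondary constraints vary covariantly along the Hamiltonian vector field of `∫ N·χ`. -/
theorem chiLin_secX {w : Phase} (hw : w ∈ phaseFibre) {N : Par} (hN : N ∈ parFibre) {d : Fin 3 → Phase}
    (hd : ∀ i, d i ∈ phaseFibre) {N1 : Fin 3 → Par} (hN1 : ∀ i, N1 i ∈ parFibre)
    (N2 : Fin 3 → Fin 3 → Par) (hN2 : ∀ i j, N2 i j = N2 j i) :
    chiLin w (secX w N N1) (fun i => secXder w N (d i) (N1 i) (N2 i)) = coadj N (chiJ w d) := by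
  have wo : ∀ a, om w.1 a ∈ skew := (mem_configFibre.1 hw.1).1
  have wp : ∀ a, om w.2 a ∈ skew := (mem_configFibre.1 hw.2).1
  have do' : ∀ i a, om (d i).1 a ∈ skew := fun i => (mem_configFibre.1 (hd i).1).1
  refine Prod.ext ?_ (Prod.ext ?_ (Prod.ext (funext fun i => ?_) (funext fun i => ?_)))
  · apply lo2_injective
    have f : ∀ i K, wdg (N.2.2.2 i) K = -wdg K (N.2.2.2 i) := fun i K => wdg_comm _ _
    simp only [chiLin, coadj, chiJ, secXder_om, secXder_th, secXder_Pi, secX, om_red_succ, th_red_succ, lo2_lo2,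
      lo_lo, Fin.sum_univ_three, Fin.isValue, Fin.reduceAdd, zero_add, map_add, map_sub, map_neg, map_smul,
      LinearMap.add_apply, LinearMap.neg_apply, LinearMap.sub_apply, LinearMap.smul_apply, rotB_wdg, f]
    -- The second derivatives of `N` cancel by symmetry; what remains are commutators in the representations.
    rw [hN2 1 0, hN2 2 0, hN2 2 1]
    have e1 := fun i : Fin 3 => rotB_rotB (wo i.succ) N.1 (lo2 (om w.2 i.succ))
    have e2 := fun i : Fin 3 => rotB_rotB (wo (i + 1).succ) (om w.1 (i + 2).succ) (N.2.2.1 i)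
    have a0 := e2 0
    have a1 := e2 1
    have a2 := e2 2
    simp only [Fin.isValue, Fin.reduceAdd, zero_add] at a0 a1 a2
    linear_combination (norm := module) e1 0 + e1 1 + e1 2 - (1 / 2 : ℝ) • a0 - (1 / 2 : ℝ) • a1
      - (1 / 2 : ℝ) • a2
  · apply lo_injective
    simp only [chiLin, coadj, chiJ, secXder_om, secXder_pi, secX, om_red_succ, th_red_succ, lo2_lo2,
      lo_lo, Fin.sum_univ_three, Fin.isValue, Fin.reduceAdd, zero_add, map_add, map_sub, map_neg, map_smul,
      LinearMap.add_apply, LinearMap.neg_apply, LinearMap.sub_apply, LinearMap.smul_apply]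
    rw [hN2 1 0, hN2 2 0, hN2 2 1]
    have e1 := fun i : Fin 3 => rotW_rotW (wo i.succ) N.1 (lo (th w.2 i.succ))
    have e2 := fun i : Fin 3 => rotW_rotW (wo (i + 1).succ) (om w.1 (i + 2).succ) (N.2.2.2 i)
    have a0 := e2 0
    have a1 := e2 1
    have a2 := e2 2
    simp only [Fin.isValue, Fin.reduceAdd, zero_add] at a0 a1 a2
    linear_combination (norm := module) e1 0 + e1 1 + e1 2 - (1 / 2 : ℝ) • a0 - (1 / 2 : ℝ) • a1
      - (1 / 2 : ℝ) • a2
  · simp only [chiLin, coadj, chiJ, secXder_om, secX, om_red_succ, lo2_lo2]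
    congr 1
    generalize hi : i + 1 = a
    generalize hj : i + 2 = b
    rw [hN2 b a]
    simp only [map_add, map_sub, map_neg, map_smul, LinearMap.add_apply, LinearMap.neg_apply,
      LinearMap.sub_apply, LinearMap.smul_apply, rotB_comm (hN1 a).1 (wo b.succ)]
    have e1 := rotB_rotB (wo a.succ) (om w.1 b.succ) N.1
    have e2 := rotB_comm (rotB_mem_skew (om w.1 a.succ) hN.1) (wo b.succ)
    rw [e2]
    linear_combination (norm := module) (-(1 / 2 : ℝ)) • e1
  · simp only [chiLin, coadj, chiJ, secXder_om, secXder_th, secX, om_red_succ, th_red_succ, lo_lo, lo2_lo2]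
    congr 1
    generalize hi : i + 1 = a
    generalize hj : i + 2 = b
    rw [hN2 b a]
    simp only [map_add, map_sub, map_neg, map_smul, LinearMap.add_apply, LinearMap.neg_apply,
      LinearMap.sub_apply, LinearMap.smul_apply]
    have e1 := rotW_rotW (wo a.succ) (om w.1 b.succ) N.2.1
    have e2 := rotW_rotW (wo a.succ) N.1 (th w.1 b.succ)
    have e3 := rotW_rotW (wo b.succ) N.1 (th w.1 a.succ)
    linear_combination (norm := module) (-(1 / 2 : ℝ)) • e1 + (1 / 2 : ℝ) • e2 - (1 / 2 : ℝ) • e3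

/-- The structure constants of the Lorentz algebra in terms of `rotB`. -/
theorem sum_structure_rotB {U V K : Biv} (hU : U ∈ skew) (hV : V ∈ skew) (hK : K ∈ skew) :
    ∑ A, ∑ B, ∑ C, ∑ D, U A B * V C D *
      ((K C A * ηη B D - K C B * ηη A D) / 2 - (K D A * ηη B C - K D B * ηη A C) / 2)
      = ipB (rotB U V) K := by
  have step : ∀ A B, ∑ C, ∑ D, U A B * V C D *
      ((K C A * ηη B D - K C B * ηη A D) / 2 - (K D A * ηη B C - K D B * ηη A C) / 2)
      = ∑ C, U A B * (η B * V C B * K C A - η A * V C A * K C B) := by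
    intro A B
    have e : ∀ C D, U A B * V C D *
        ((K C A * ηη B D - K C B * ηη A D) / 2 - (K D A * ηη B C - K D B * ηη A C) / 2)
        = (if B = D then U A B * V C D * K C A * η B / 2 else 0)
          - (if A = D then U A B * V C D * K C B * η A / 2 else 0)
          - (if B = C then U A B * V C D * K D A * η B / 2 else 0)
          + (if A = C then U A B * V C D * K D B * η A / 2 else 0) := by
      intro C D
      simp only [ηη]
      split_ifs <;> ring
    have s1 : ∀ (g : Fin 4 → Fin 4 → ℝ) (E : Fin 4),
        ∑ C, ∑ D, (if E = C then g C D else 0) = ∑ D, g E D := by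
      intro g E
      rw [Finset.sum_comm]
      simp
    simp only [e, Finset.sum_add_distrib, Finset.sum_sub_distrib, s1, Finset.sum_ite_eq, Finset.mem_univ,
      if_true]
    rw [← Finset.sum_sub_distrib, ← Finset.sum_sub_distrib, ← Finset.sum_add_distrib]
    refine Finset.sum_congr rfl fun C _ => ?_
    rw [hV C B, hV C A]
    ring
  obtain ⟨h0, h1, h2, h3, h10, h20, h30, h21, h31, h32⟩ := skew_vals hU
  obtain ⟨v0, v1, v2, v3, v10, v20, v30, v21, v31, v32⟩ := skew_vals hV
  obtain ⟨k0, k1, k2, k3, k10, k20, k30, k21, k31, k32⟩ := skew_vals hK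
  simp only [step]
  simp only [ipB_apply, rotB_apply, rot, Fin.sum_univ_four, η_zero, η_one, η_two, η_three,
    h0, h1, h2, h3, h10, h20, h30, h21, h31, h32, v0, v1, v2, v3, v10, v20, v30, v21, v31, v32,
    k0, k1, k2, k3, k10, k20, k30, k21, k31, k32]
  ring

/-- The structure constants between the Lorentz algebra and the vectors in terms of `rotW`. -/
theorem sum_structure_rotW {U : Biv} (hU : U ∈ skew) (u k : Vec) :
    ∑ A, ∑ B, ∑ C, U A B * u C * ((k A * ηη B C - k B * ηη A C) / 2) = ipV (rotW U u) k := by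
  have step : ∀ A B, ∑ C, U A B * u C * ((k A * ηη B C - k B * ηη A C) / 2)
      = U A B * (η B * u B * k A - η A * u A * k B) / 2 := by
    intro A B
    have e : ∀ C, U A B * u C * ((k A * ηη B C - k B * ηη A C) / 2)
        = (if B = C then U A B * u C * k A * η B / 2 else 0)
          - (if A = C then U A B * u C * k B * η A / 2 else 0) := by
      intro C
      simp only [ηη]
      split_ifs <;> ring
    simp only [e, Finset.sum_sub_distrib, Finset.sum_ite_eq, Finset.mem_univ, if_true]
    ring
  obtain ⟨h0, h1, h2, h3, h10, h20, h30, h21, h31, h32⟩ := skew_vals hU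
  simp only [step]
  simp only [ipV_apply, rotW_apply, rotV, Fin.sum_univ_four, η_zero, η_one, η_two, η_three,
    h0, h1, h2, h3, h10, h20, h30, h21, h31, h32]
  ring

theorem sum_sum_eq_wdg (u v : Vec) {K : Biv} (hK : K ∈ skew) :
    ∑ A, ∑ B, u A * v B * K A B = ipB (wdg u v) K := by
  obtain ⟨k0, k1, k2, k3, k10, k20, k30, k21, k31, k32⟩ := skew_vals hK
  simp only [ipB_apply, wdg_apply, asym, Fin.sum_univ_four,
    k0, k1, k2, k3, k10, k20, k30, k21, k31, k32]
  ring

/-- The structure constants of the constraint algebra are those of `adj`. -/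
theorem algebra_eq {N N' K : Par} (hN : N ∈ parFibre) (hN' : N' ∈ parFibre) (hK : K ∈ parFibre) :
    algebra N N' K = parPair (adj N N') K := by
  simp only [algebra, sub_mul, Finset.sum_sub_distrib, sum_structure_rotB hN.1 hN'.1 hK.1,
    sum_structure_rotW hN.1, sum_structure_rotW hN'.1, sum_structure_rotB hN.1 (hN'.2 _) (hK.2 _),
    sum_structure_rotB hN'.1 (hN.2 _) (hK.2 _), sum_sum_eq_wdg _ _ (hK.2 _)]
  simp only [parPair_eq, adj, map_add, map_sub, LinearMap.add_apply, LinearMap.sub_apply,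
    Finset.sum_add_distrib, Finset.sum_sub_distrib]
  have f1 : ∀ i, ipB (wdg (N'.2.2.2 i) N.2.1) (K.2.2.1 i) = -ipB (wdg N.2.1 (N'.2.2.2 i)) (K.2.2.1 i) :=
    fun i => by rw [wdg_comm, LinearMap.map_neg, LinearMap.neg_apply]
  have f2 : ∀ i, ipB (wdg (N.2.2.2 i) N'.2.1) (K.2.2.1 i) = -ipB (wdg N'.2.1 (N.2.2.2 i)) (K.2.2.1 i) :=
    fun i => by rw [wdg_comm, LinearMap.map_neg, LinearMap.neg_apply]
  simp only [f1, f2, Finset.sum_neg_distrib]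
  ring

theorem isTest_secField {z : Space → Phase} {N : Space → Par} (hz : IsField phaseFibre z)
    (hN : IsTest parFibre N) : IsTest reducedFibre (secField N z) := by
  refine ⟨isField_secField hz hN.toIsField, ?_⟩
  refine HasCompactSupport.intro' hN.compact (isClosed_tsupport N) fun x hx => ?_
  have h0 : N =ᶠ[nhds x] 0 := notMem_tsupport_iff_eventuallyEq.1 hx
  have hj : jet N x = 0 := by
    rw [jet_congr h0]; funext i; unfold jet dd
    simp only [fderiv_zero, Pi.zero_apply, _root_.zero_apply]
  rw [secField, h0.eq_of_nhds, hj, secX_eq, secS_eq]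
  simp only [Pi.zero_apply, map_zero, add_zero]

/-- The secondary constraints represent the Lie algebra of smearing parameters. -/
theorem integral_poisson_sec {z : Space → Phase} {N N' : Space → Par} (hz : IsField phaseFibre z)
    (hN : IsTest parFibre N) (hN' : IsField parFibre N') :
    ∫ x, poisson (sharp (secField N z x)) (sharp (secField N' z x))
      = ∫ x, parPair (adj (N x) (N' x)) (chi z x) := by
  have hX : IsTest phaseFibre (secField N z) :=
    ⟨(isField_secField hz hN.toIsField).mono reducedFibre_le, (isTest_secField hz hN).compact⟩
  -- Up to sign, the bracket is the variation of `∫ N'·χ` along the Hamiltonian vector field of `∫ N·χ`.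
  have h1 := integral_chiVar hz hN' hX
  have e : ∀ x, chiVar z (secField N z) x = coadj (N x) (chi z x) := by
    intro x
    have h3 := chiLin_secX (hz.mem x) (hN.mem x) (fun i => dd_mem hz i x)
      (fun i => dd_mem hN.toIsField i x) (fun i j => dd i (dd j N) x) (fun i j => dd_comm i j hN.smooth x)
    rw [chi_field hz, show jet z x = fun i => dd i z x from rfl, ← h3, chiVar]
    congr 1
    funext i
    exact dd_secField hz.smooth hN.smooth i x
  have h2 : ∀ x, poisson (sharp (secField N z x)) (sharp (secField N' z x))
      = -pair (sharp (secField N' z x)) (secField N z x) := fun x => poisson_sharp_left _ _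
  simp only [h2, integral_neg, ← h1, e]
  rw [← integral_neg]
  refine integral_congr_ae (Filter.Eventually.of_forall fun x => ?_)
  simp only [parPair_coadj (hN.mem x) (hN'.mem x) (chi_mem hz x), neg_neg]

/-! ### Splitting space and time in the Lagrangian -/

theorem leviCivita_permute {n : ℕ} (s : Fin n → Fin n) (σ : Equiv.Perm (Fin n)) :
    leviCivita (s ∘ σ) = (Equiv.Perm.sign σ : ℤ) * leviCivita s := by
  unfold leviCivita
  exact Matrix.det_permute σ (Matrix.of fun r c => if s r = c then (1 : ℝ) else 0)

theorem leviCivita_eq_zero {n : ℕ} {s : Fin n → Fin n} {a b : Fin n} (hab : a ≠ b) (h : s a = s b) :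
    leviCivita s = 0 :=
  Matrix.det_zero_of_row_eq hab (by funext c; simp [Matrix.of_apply, h])

theorem eps4_zero (i j k : Fin 3) : eps4 0 i.succ j.succ k.succ = eps3 i j k := by
  unfold eps4 eps3 leviCivita
  rw [Matrix.det_succ_row_zero, Finset.sum_eq_single 0]
  · simp only [Fin.val_zero, pow_zero, one_mul, Matrix.of_apply, Matrix.cons_val_zero, if_true]
    congr 1
    ext r c
    fin_cases r <;> simp [Matrix.submatrix_apply, Fin.succ_inj] <;> congr
  · intro b _ hb
    simp [Matrix.of_apply, hb.symm]
  · simp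

theorem eps4_swap01 (a b c d : Fin 4) : eps4 a b c d = -eps4 b a c d := by
  have h := leviCivita_permute ![b, a, c, d] (Equiv.swap 0 1)
  have e : ![b, a, c, d] ∘ (Equiv.swap (0 : Fin 4) 1) = ![a, b, c, d] := by
    funext i; fin_cases i <;> rfl
  rw [e, Equiv.Perm.sign_swap (by decide)] at h
  simpa [eps4] using h

theorem eps4_swap12 (a b c d : Fin 4) : eps4 a b c d = -eps4 a c b d := by
  have h := leviCivita_permute ![a, c, b, d] (Equiv.swap 1 2)
  have e : ![a, c, b, d] ∘ (Equiv.swap (1 : Fin 4) 2) = ![a, b, c, d] := by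
    funext i; fin_cases i <;> rfl
  rw [e, Equiv.Perm.sign_swap (by decide)] at h
  simpa [eps4] using h

theorem eps4_swap23 (a b c d : Fin 4) : eps4 a b c d = -eps4 a b d c := by
  have h := leviCivita_permute ![a, b, d, c] (Equiv.swap 2 3)
  have e : ![a, b, d, c] ∘ (Equiv.swap (2 : Fin 4) 3) = ![a, b, c, d] := by
    funext i; fin_cases i <;> rfl
  rw [e, Equiv.Perm.sign_swap (by decide)] at h
  simpa [eps4] using h

theorem eps4_one (i j k : Fin 3) : eps4 i.succ 0 j.succ k.succ = -eps3 i j k := by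
  rw [eps4_swap01, eps4_zero]
theorem eps4_two (i j k : Fin 3) : eps4 i.succ j.succ 0 k.succ = eps3 i j k := by
  rw [eps4_swap12, eps4_one, neg_neg]
theorem eps4_three (i j k : Fin 3) : eps4 i.succ j.succ k.succ 0 = -eps3 i j k := by
  rw [eps4_swap23, eps4_two]
theorem eps4_spatial (i j k l : Fin 3) : eps4 i.succ j.succ k.succ l.succ = 0 := by
  refine Matrix.det_eq_zero_of_column_eq_zero 0 fun r => ?_
  fin_cases r <;> simp [Matrix.of_apply, Fin.succ_ne_zero]
theorem eps4_00 (c d : Fin 4) : eps4 0 0 c d = 0 := leviCivita_eq_zero (a := 0) (b := 1) (by decide) rfl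
theorem eps4_0_0 (b d : Fin 4) : eps4 0 b 0 d = 0 := leviCivita_eq_zero (a := 0) (b := 2) (by decide) rfl
theorem eps4_zero_last (b c : Fin 4) : eps4 0 b c 0 = 0 := leviCivita_eq_zero (a := 0) (b := 3) (by decide) rfl
theorem eps4_00' (a d : Fin 4) : eps4 a 0 0 d = 0 := leviCivita_eq_zero (a := 1) (b := 2) (by decide) rfl
theorem eps4_0_0' (a c : Fin 4) : eps4 a 0 c 0 = 0 := leviCivita_eq_zero (a := 1) (b := 3) (by decide) rfl
theorem eps4_00'' (a b : Fin 4) : eps4 a b 0 0 = 0 := leviCivita_eq_zero (a := 2) (b := 3) (by decide) rfl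

/-- The contraction of `ε^{abcd}` with an array antisymmetric in `ab` and in `cd`. -/
theorem sum_eps4 (f : Fin 4 → Fin 4 → Fin 4 → Fin 4 → ℝ) (h1 : ∀ a b c d, f b a c d = -f a b c d)
    (h2 : ∀ a b c d, f a b d c = -f a b c d) :
    (1 / 4) * ∑ a, ∑ b, ∑ c, ∑ d, eps4 a b c d * f a b c d =
      ∑ i : Fin 3, (f 0 i.succ (i + 1).succ (i + 2).succ + f (i + 1).succ (i + 2).succ 0 i.succ) := by
  simp only [Fin.sum_univ_succ (n := 3), eps4_zero, eps4_one, eps4_two, eps4_three, eps4_spatial, eps4_00,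
    eps4_0_0, eps4_zero_last, eps4_00', eps4_0_0', eps4_00'', zero_mul, Finset.sum_const_zero, add_zero, zero_add,
    neg_mul, Finset.sum_neg_distrib, Finset.sum_add_distrib, sum_eps3_mul]
  have e1 : ∀ (i : Fin 3) c d, f i.succ 0 c d = -f 0 i.succ c d := fun i c d => h1 0 i.succ c d
  have e2 : ∀ a b (i : Fin 3), f a b i.succ 0 = -f a b 0 i.succ := fun a b i => h2 a b 0 i.succ
  have e3 : ∀ a b, f a b (2 : Fin 3).succ (1 : Fin 3).succ = -f a b (1 : Fin 3).succ (2 : Fin 3).succ :=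
    fun a b => h2 _ _ _ _
  have e4 : ∀ a b, f a b (1 : Fin 3).succ (0 : Fin 3).succ = -f a b (0 : Fin 3).succ (1 : Fin 3).succ :=
    fun a b => h2 _ _ _ _
  have e5 : ∀ a b, f a b (0 : Fin 3).succ (2 : Fin 3).succ = -f a b (2 : Fin 3).succ (0 : Fin 3).succ :=
    fun a b => h2 _ _ _ _
  have e6 : ∀ a b, f (2 : Fin 3).succ (1 : Fin 3).succ a b = -f (1 : Fin 3).succ (2 : Fin 3).succ a b :=
    fun a b => h1 _ _ _ _
  have e7 : ∀ a b, f (1 : Fin 3).succ (0 : Fin 3).succ a b = -f (0 : Fin 3).succ (1 : Fin 3).succ a b :=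
    fun a b => h1 _ _ _ _
  have e8 : ∀ a b, f (0 : Fin 3).succ (2 : Fin 3).succ a b = -f (2 : Fin 3).succ (0 : Fin 3).succ a b :=
    fun a b => h1 _ _ _ _
  simp only [Fin.sum_univ_three, Fin.isValue, Fin.reduceAdd, zero_add, e1, e2, e3, e4, e5, e6, e7, e8]
  ring

/-- `momenta` as a linear map. -/
def momentaL : Config →ₗ[ℝ] Config where
  toFun := momenta
  map_add' := momenta_add
  map_smul' := momenta_smul

theorem bB_momenta (q : Config) (a b : Fin 4) : bB (momenta q) a b = 0 := rfl
theorem be_momenta (q : Config) (a b : Fin 4) : be (momenta q) a b = 0 := rfl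

theorem om_momenta {q : Config} (hq : q ∈ configFibre) (i : Fin 3) :
    om (momenta q) i.succ = lo2 (bB q (i + 1).succ (i + 2).succ) := by
  ext A B
  change (1 / 2) * (∑ j : Fin 3, ∑ k : Fin 3, eps3 i j k * low2 (bB q j.succ k.succ) A B) = _
  rw [sum_eps3_mul, (mem_configFibre.1 hq).2.2.1 (i + 1).succ (i + 2).succ, ← lo2_apply, ← lo2_apply, map_neg]
  simp only [Pi.neg_apply]; ring

theorem th_momenta {q : Config} (hq : q ∈ configFibre) (i : Fin 3) :
    th (momenta q) i.succ = lo (be q (i + 1).succ (i + 2).succ) := by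
  ext A
  change (1 / 2) * (∑ j : Fin 3, ∑ k : Fin 3, eps3 i j k * low (be q j.succ k.succ) A) = _
  rw [sum_eps3_mul, (mem_configFibre.1 hq).2.2.2 (i + 1).succ (i + 2).succ, ← lo_apply, ← lo_apply, map_neg]
  simp only [Pi.neg_apply]; ring

theorem momenta_eq {q : Config} (hq : q ∈ configFibre) : momenta q = redConfig 0
    (fun i => lo2 (bB q (i + 1).succ (i + 2).succ), fun i => lo (be q (i + 1).succ (i + 2).succ)) := by
  refine config_ext (fun a => ?_) (fun a => ?_) (fun a b => ?_) (fun a b => ?_)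
  · exact Fin.cases rfl (fun i => om_momenta hq i) a
  · exact Fin.cases rfl (fun i => th_momenta hq i) a
  · rw [bB_momenta]
    refine Fin.cases (Fin.cases rfl (fun j => rfl) b) (fun i => Fin.cases ?_ (fun j => rfl) b) a
    simp
  · rw [be_momenta]
    refine Fin.cases (Fin.cases rfl (fun j => rfl) b) (fun i => Fin.cases ?_ (fun j => rfl) b) a
    simp

theorem momenta_mem {q : Config} (hq : q ∈ configFibre) : momenta q ∈ reducedConfig := by
  rw [momenta_eq hq]
  exact redConfig_mem parFibre.zero_mem fun i => lo2_mem_skew ((mem_configFibre.1 hq).2.1 _ _)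

theorem dot_momenta {q l : Config} (hq : q ∈ configFibre) (hl : l ∈ configFibre) :
    dotProduct (momenta q) l = (∑ i : Fin 3, ipB (lo2 (bB q (i + 1).succ (i + 2).succ)) (om l i.succ))
      + ∑ i : Fin 3, ipV (lo (be q (i + 1).succ (i + 2).succ)) (th l i.succ) := by
  rw [momenta_eq hq, dot_red _ _ hl]
  simp

/-- The substitution `p = ∂L/∂q̇`. -/
def legendre : Phase →ₗ[ℝ] Phase := (LinearMap.fst ℝ Config Config).prod
  (momentaL.comp (LinearMap.fst ℝ Config Config))

theorem legendre_apply (w : Phase) : legendre w = (w.1, momenta w.1) := rfl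

theorem legendre_mem {w : Phase} (hw : w ∈ phaseFibre) : legendre w ∈ phaseFibre :=
  ⟨hw.1, reducedConfig_le (momenta_mem hw.1)⟩

section Jets
variable {q v : Space → Config} (hq : IsField configFibre q) (x : Space)
include hq

theorem curv_zero (i : Fin 3) : curv q v 0 i.succ x =
    om (v x) i.succ - om (dd i q x) 0 + rotB (om (q x) 0) (om (q x) i.succ) := by
  ext A B
  rw [rotB_eq_mm ((mem_configFibre.1 (hq.mem x)).1 0)]
  simp only [curv, Pi.add_apply, Pi.sub_apply, mm_apply, mul_sub, Finset.sum_sub_distrib, ← mul_assoc]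
  congr 2
  exact pd_config i (hq.differentiable x) _

theorem curv_succ (i j : Fin 3) : curv q v i.succ j.succ x =
    om (dd i q x) j.succ - om (dd j q x) i.succ + rotB (om (q x) i.succ) (om (q x) j.succ) := by
  ext A B
  rw [rotB_eq_mm ((mem_configFibre.1 (hq.mem x)).1 _)]
  simp only [curv, Pi.add_apply, Pi.sub_apply, mm_apply, mul_sub, Finset.sum_sub_distrib, ← mul_assoc]
  congr 2
  · exact pd_config i (hq.differentiable x) _
  · exact pd_config j (hq.differentiable x) _

theorem tors_zero (i : Fin 3) : tors q v 0 i.succ x = th (v x) i.succ - th (dd i q x) 0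
    + rotW (om (q x) 0) (th (q x) i.succ) - rotW (om (q x) i.succ) (th (q x) 0) := by
  ext A
  simp only [tors, Pi.add_apply, Pi.sub_apply, rotW_apply]
  congr 3
  exact pd_config i (hq.differentiable x) _

theorem tors_succ (i j : Fin 3) : tors q v i.succ j.succ x = th (dd i q x) j.succ - th (dd j q x) i.succ
    + rotW (om (q x) i.succ) (th (q x) j.succ) - rotW (om (q x) j.succ) (th (q x) i.succ) := by
  ext A
  simp only [tors, Pi.add_apply, Pi.sub_apply, rotW_apply]
  congr 3
  · exact pd_config i (hq.differentiable x) _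
  · exact pd_config j (hq.differentiable x) _

end Jets

theorem curv_antisymm (q v : Space → Config) (a b : Fin 4) (x : Space) :
    curv q v b a x = -curv q v a b x := by
  ext A B
  simp only [curv, Pi.neg_apply, neg_add, ← Finset.sum_neg_distrib]
  congr 1
  · ring
  · exact Finset.sum_congr rfl fun C _ => by ring

theorem tors_antisymm (q v : Space → Config) (a b : Fin 4) (x : Space) :
    tors q v b a x = -tors q v a b x := by
  ext A
  simp only [tors, Pi.neg_apply]; ring

theorem lagrangian_eq {q v : Space → Config} (hq : IsField configFibre q) (x : Space) :
    lagrangian q v x = ∑ i : Fin 3,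
      ((ipB (lo2 (bB (q x) 0 i.succ)) (curv q v (i + 1).succ (i + 2).succ x)
        + ipV (lo (be (q x) 0 i.succ)) (tors q v (i + 1).succ (i + 2).succ x))
      + (ipB (lo2 (bB (q x) (i + 1).succ (i + 2).succ)) (curv q v 0 i.succ x)
        + ipV (lo (be (q x) (i + 1).succ (i + 2).succ)) (tors q v 0 i.succ x))) := by
  obtain ⟨-, -, h3, h4⟩ := mem_configFibre.1 (hq.mem x)
  refine sum_eps4 (fun a b c d => ipB (lo2 (bB (q x) a b)) (curv q v c d x)
    + ipV (lo (be (q x) a b)) (tors q v c d x)) (fun a b c d => ?_) (fun a b c d => ?_)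
  · simp only [h3 a b, h4 a b, map_neg, LinearMap.neg_apply]; ring
  · simp only [curv_antisymm q v c d, tors_antisymm q v c d, map_neg]; ring

/-- The Lagrangian is affine in the velocities, with coefficients `momenta`. -/
theorem lagrangian_split {q v : Space → Config} (hq : IsField configFibre q) (x : Space)
    (hv : v x ∈ configFibre) :
    lagrangian q v x = dotProduct (momenta (q x)) (v x) + lagrangian q 0 x := by
  rw [lagrangian_eq hq, lagrangian_eq hq, dot_momenta (hq.mem x) hv]
  simp only [curv_zero hq, tors_zero hq, curv_succ hq, tors_succ hq, Pi.zero_apply, om_zero, th_zero, map_add,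
    map_sub, map_zero, Fin.sum_univ_three]
  ring

/-- The canonical Hamiltonian in terms of the secondary constraints. -/
theorem canonicalHamiltonian_eq {z : Space → Phase} (hz : IsField phaseFibre z) (x : Space) :
    canonicalHamiltonian z x = canonDensity (fun y => legendre (z y)) x := by
  have hw : IsField phaseFibre fun y => legendre (z y) := hz.linear legendre fun _ => legendre_mem
  have hq : IsField configFibre fun y => (z y).1 := hz.linear (LinearMap.fst ℝ Config Config) fun _ h => h.1
  have hd := hw.differentiable x
  have wo : ∀ a, om (z x).1 a ∈ skew := (mem_configFibre.1 (hq.mem x)).1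
  have hj : ∀ i : Fin 3, dd i (fun y => (z y).1) x = (jet (fun y => legendre (z y)) x i).1 := fun i =>
    dd_fst i hd
  have hb : ∀ i : Fin 3, dd i (fun y => boundary i (legendre (z y)) (legendre (z y))) x
      = boundary i (jet (fun y => legendre (z y)) x i) (legendre (z x))
        + boundary i (legendre (z x)) (jet (fun y => legendre (z y)) x i) :=
    fun i => dd_bilinear i (boundary i) hd hd
  simp only [canonicalHamiltonian, canonDensity, tempChi, lagrangian_eq hq, chi_field hw, hb]
  simp only [boundary_apply, curv_zero hq, tors_zero hq, curv_succ hq,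
    tors_succ hq, hj, parPair_eq, temporalFields_eq, chiJ, ← om_momenta (hq.mem x), ← th_momenta (hq.mem x)]
  simp only [legendre_apply (z x)]
  generalize jet (fun y => legendre (z y)) x = d
  -- The derivatives of `ω_0`, `θ_0` match those in `boundary`; the rest is invariance of the contractions.
  have l1 : ∀ i : Fin 3, ipB (om (z x).1 0) (lo2 (rotB (om (z x).1 i.succ) (lo2 (om (momenta (z x).1) i.succ))))
      = ipB (om (momenta (z x).1) i.succ) (rotB (om (z x).1 0) (om (z x).1 i.succ)) := fun i => by
    rw [ipB_rotB (wo _), lo2_lo2, ipB_comm, rotB_comm (wo 0) (wo i.succ), map_neg]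
  have l2 : ∀ i : Fin 3, ipB (om (z x).1 0) (lo2 (wdg (th (z x).1 i.succ) (lo (th (momenta (z x).1) i.succ))))
      = -ipV (th (momenta (z x).1) i.succ) (rotW (om (z x).1 0) (th (z x).1 i.succ)) := fun i => by
    rw [ipB_wdg (wo _), lo_lo, ipV_comm]
  have l3 : ∀ i : Fin 3, ipV (th (z x).1 0) (lo (rotW (om (z x).1 i.succ) (lo (th (momenta (z x).1) i.succ))))
      = -ipV (th (momenta (z x).1) i.succ) (rotW (om (z x).1 i.succ) (th (z x).1 0)) := fun i => by
    rw [ipV_rotW (wo _), lo_lo, ipV_comm]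
  simp only [Pi.zero_apply, om_zero, th_zero, map_add, map_sub, map_zero, map_smul, LinearMap.smul_apply,
    Fin.sum_univ_three, l1, l2, l3, ipB_lo2, ipV_lo, smul_eq_mul]
  simp only [ipB_comm (om (momenta (z x).1) _) (om (d _).1 _), ipV_comm (th (momenta (z x).1) _) (th (d _).1 _)]
  ring

theorem hamiltonian_eq {z : Space → Phase} {v : Space → Config} (hz : IsField phaseFibre z) (x : Space)
    (hv : v x ∈ configFibre) : hamiltonian v z x = primary v z x + canonicalHamiltonian z x := by
  have hq : IsField configFibre fun y => (z y).1 := hz.linear (LinearMap.fst ℝ Config Config) fun _ h => h.1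
  simp only [hamiltonian, primary, canonicalHamiltonian, lagrangian_split hq x hv, dotProduct_comm (v x), sub_dotProduct]
  ring

/-! ### The Euler-Lagrange derivatives -/

theorem succ_add_one (i : Fin 3) : i + 1 + 1 = i + 2 := by fin_cases i <;> rfl
theorem succ_add_one_two (i : Fin 3) : i + 1 + 2 = i := by fin_cases i <;> rfl

/-- A sum over pairs of spatial indices, for an array that vanishes on the diagonal. -/
theorem sum_sum_offdiag {f : Fin 3 → Fin 3 → ℝ} (h : ∀ i, f i i = 0) :
    ∑ i, ∑ j, f i j = ∑ i, (f (i + 1) (i + 2) + f (i + 2) (i + 1)) := by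
  simp only [Fin.sum_univ_three, Fin.isValue, Fin.reduceAdd, zero_add, h]
  ring

theorem dot_config {g h : Config} (hg : g ∈ configFibre) (hh : h ∈ configFibre) :
    dotProduct g h = ipB (om g 0) (om h 0) + ipV (th g 0) (th h 0)
      + 2 * (∑ i : Fin 3, ipB (bB g 0 i.succ) (bB h 0 i.succ))
      + 2 * (∑ i : Fin 3, ipV (be g 0 i.succ) (be h 0 i.succ))
      + (∑ i : Fin 3, ipB (om g i.succ) (om h i.succ)) + (∑ i : Fin 3, ipV (th g i.succ) (th h i.succ))
      + 2 * (∑ i : Fin 3, ipB (bB g (i + 1).succ (i + 2).succ) (bB h (i + 1).succ (i + 2).succ))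
      + 2 * (∑ i : Fin 3, ipV (be g (i + 1).succ (i + 2).succ) (be h (i + 1).succ (i + 2).succ)) := by
  obtain ⟨-, -, g3, g4⟩ := mem_configFibre.1 hg
  obtain ⟨-, -, h3, h4⟩ := mem_configFibre.1 hh
  have eg3 : ∀ i : Fin 3, bB g i.succ 0 = -bB g 0 i.succ := fun i => g3 0 i.succ
  have eh3 : ∀ i : Fin 3, bB h i.succ 0 = -bB h 0 i.succ := fun i => h3 0 i.succ
  have eg4 : ∀ i : Fin 3, be g i.succ 0 = -be g 0 i.succ := fun i => g4 0 i.succ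
  have eh4 : ∀ i : Fin 3, be h i.succ 0 = -be h 0 i.succ := fun i => h4 0 i.succ
  rw [dot_eq]
  simp only [Fin.sum_univ_succ (n := 3), Finset.sum_add_distrib, bB_self hg, be_self hg, eg3, eg4, eh3, eh4]
  rw [sum_sum_offdiag (f := fun i j => ipB (bB g i.succ j.succ) (bB h i.succ j.succ))
      (fun i => by simp [bB_self hg]),
    sum_sum_offdiag (f := fun i j => ipV (be g i.succ j.succ) (be h i.succ j.succ))
      (fun i => by simp [be_self hg])]
  have e1 : ∀ i : Fin 3, ipB (bB g (i + 2).succ (i + 1).succ) (bB h (i + 2).succ (i + 1).succ)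
      = ipB (bB g (i + 1).succ (i + 2).succ) (bB h (i + 1).succ (i + 2).succ) := fun i => by
    rw [g3 (i + 1).succ (i + 2).succ, h3 (i + 1).succ (i + 2).succ]; simp
  have e2 : ∀ i : Fin 3, ipV (be g (i + 2).succ (i + 1).succ) (be h (i + 2).succ (i + 1).succ)
      = ipV (be g (i + 1).succ (i + 2).succ) (be h (i + 1).succ (i + 2).succ) := fun i => by
    rw [g4 (i + 1).succ (i + 2).succ, h4 (i + 1).succ (i + 2).succ]; simp
  simp only [e1, e2, Finset.sum_add_distrib, map_neg, LinearMap.neg_apply, neg_neg, map_zero,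
    LinearMap.zero_apply]
  ring

/-- `½ ε^{0bcd} X_{bcd}` for `X` antisymmetric in `cd`. -/
theorem sum_eps4_zero (X : Fin 4 → Fin 4 → Fin 4 → ℝ) (h : ∀ b c d, X b d c = -X b c d) :
    (1 / 2) * ∑ b, ∑ c, ∑ d, eps4 0 b c d * X b c d = ∑ i : Fin 3, X i.succ (i + 1).succ (i + 2).succ := by
  simp only [Fin.sum_univ_succ (n := 3), eps4_zero, eps4_00, eps4_0_0, eps4_zero_last, zero_mul,
    Finset.sum_const_zero, zero_add, sum_eps3_mul]
  have e : ∀ i : Fin 3, X i.succ (i + 2).succ (i + 1).succ = -X i.succ (i + 1).succ (i + 2).succ :=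
    fun i => h _ _ _
  simp only [e, sub_neg_eq_add, ← two_mul, ← Finset.mul_sum]
  ring

/-- `½ ε^{ibcd} X_{bcd}` for `X` antisymmetric in `cd`. -/
theorem sum_eps4_succ (i : Fin 3) (X : Fin 4 → Fin 4 → Fin 4 → ℝ) (h : ∀ b c d, X b d c = -X b c d) :
    (1 / 2) * ∑ b, ∑ c, ∑ d, eps4 i.succ b c d * X b c d =
      -X 0 (i + 1).succ (i + 2).succ + X (i + 1).succ 0 (i + 2).succ - X (i + 2).succ 0 (i + 1).succ := by
  have e : ∀ b (k : Fin 3), X b k.succ 0 = -X b 0 k.succ := fun b k => h b 0 k.succ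
  simp only [Fin.sum_univ_succ (n := 3), eps4_one, eps4_two, eps4_three, eps4_spatial, eps4_00', eps4_0_0',
    eps4_00'', zero_mul, Finset.sum_const_zero, add_zero, zero_add, neg_mul, Finset.sum_neg_distrib,
    Finset.sum_add_distrib, sum_eps3_mul, e, mul_neg, neg_neg]
  rw [h 0 (i + 1).succ (i + 2).succ]
  ring

/-- `¼ ε^{0icd} Y_{cd}` for antisymmetric `Y`. -/
theorem sum_eps4_zero_succ (i : Fin 3) (Y : Fin 4 → Fin 4 → ℝ) (h : ∀ c d, Y d c = -Y c d) :
    (1 / 4) * ∑ c, ∑ d, eps4 0 i.succ c d * Y c d = (1 / 2) * Y (i + 1).succ (i + 2).succ := by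
  simp only [Fin.sum_univ_succ (n := 3), eps4_zero, eps4_0_0, eps4_zero_last, zero_mul,
    Finset.sum_const_zero, zero_add, sum_eps3_mul]
  rw [h (i + 1).succ (i + 2).succ]; ring

/-- `¼ ε^{jkcd} Y_{cd}` for antisymmetric `Y` and `ε_{ijk} = 1`. -/
theorem sum_eps4_succ_succ (i : Fin 3) (Y : Fin 4 → Fin 4 → ℝ) (h : ∀ c d, Y d c = -Y c d) :
    (1 / 4) * ∑ c, ∑ d, eps4 (i + 1).succ (i + 2).succ c d * Y c d = (1 / 2) * Y 0 i.succ := by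
  have e : ∀ k : Fin 3, Y k.succ 0 = -Y 0 k.succ := fun k => h 0 k.succ
  have e3 : ∀ k : Fin 3, eps3 (i + 1) (i + 2) k = if k = i then 1 else 0 := by
    intro k; rw [eps3_eq, succ_add_one, succ_add_one_two]
    fin_cases i <;> fin_cases k <;> simp
  simp only [Fin.sum_univ_succ (n := 3), eps4_two, eps4_three, eps4_spatial, eps4_00'', zero_mul,
    Finset.sum_const_zero, add_zero, zero_add, neg_mul, e, mul_neg, neg_neg, e3, ite_mul, one_mul,
    Finset.sum_ite_eq', Finset.mem_univ, if_true]
  ring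

section EulerLagrange
variable {q v : Space → Config} (hq : IsField configFibre q) (x : Space) (hv : v x ∈ configFibre)
include hq

include hv in
theorem om_eulerLagrange_zero : om (eulerLagrange q v x) 0 = lo2 (∑ i : Fin 3,
    (bB (dd i q x) (i + 1).succ (i + 2).succ + rotB (om (q x) i.succ) (bB (q x) (i + 1).succ (i + 2).succ)
      - wdg (th (q x) i.succ) (be (q x) (i + 1).succ (i + 2).succ))) := by
  obtain ⟨-, -, h3, h4⟩ := mem_configFibre.1 (hq.mem x)
  change low2 _ = lo2 _
  rw [← lo2_apply]
  congr 1
  ext A B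
  dsimp only
  rw [sum_eps4_zero]
  · simp only [Finset.sum_apply, Pi.add_apply, Pi.sub_apply]
    refine Finset.sum_congr rfl fun i _ => ?_
    congr 2
    exact pd_config i (hq.differentiable x) _
  · intro b c d
    have e : dst q v b (fun p => bB p d c A B) x = -dst q v b (fun p => bB p c d A B) x := by
      refine Fin.cases ?_ (fun j => ?_) b
      · exact congrFun (congrFun ((mem_configFibre.1 hv).2.2.1 c d) A) B
      · exact (pd_config j (hq.differentiable x) _).trans
          ((congrFun (congrFun ((mem_configFibre.1 (dd_mem hq j x)).2.2.1 c d) A) B).trans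
          (congrArg _ (pd_config j (hq.differentiable x) _).symm))
    rw [e, h3 c d, h4 c d, ← rotB_apply, ← rotB_apply, ← wdg_apply, ← wdg_apply, map_neg, map_neg]
    simp only [Pi.neg_apply]; ring

include hv in
theorem th_eulerLagrange_zero : th (eulerLagrange q v x) 0 = lo (∑ i : Fin 3,
    (be (dd i q x) (i + 1).succ (i + 2).succ
      + rotW (om (q x) i.succ) (be (q x) (i + 1).succ (i + 2).succ))) := by
  obtain ⟨-, -, h3, h4⟩ := mem_configFibre.1 (hq.mem x)
  change low _ = lo _
  rw [← lo_apply]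
  congr 1
  ext A
  dsimp only
  rw [sum_eps4_zero]
  · simp only [Finset.sum_apply, Pi.add_apply]
    refine Finset.sum_congr rfl fun i _ => ?_
    congr 1
    exact pd_config i (hq.differentiable x) _
  · intro b c d
    have e : dst q v b (fun p => be p d c A) x = -dst q v b (fun p => be p c d A) x := by
      refine Fin.cases ?_ (fun j => ?_) b
      · exact congrFun ((mem_configFibre.1 hv).2.2.2 c d) A
      · exact (pd_config j (hq.differentiable x) _).trans
          ((congrFun ((mem_configFibre.1 (dd_mem hq j x)).2.2.2 c d) A).trans
          (congrArg _ (pd_config j (hq.differentiable x) _).symm))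
    rw [e, h4 c d, ← rotW_apply, ← rotW_apply, map_neg]
    simp only [Pi.neg_apply]; ring

include hv in
theorem om_eulerLagrange_succ (i : Fin 3) : om (eulerLagrange q v x) i.succ = lo2 (
    -(bB (v x) (i + 1).succ (i + 2).succ + rotB (om (q x) 0) (bB (q x) (i + 1).succ (i + 2).succ)
      - wdg (th (q x) 0) (be (q x) (i + 1).succ (i + 2).succ))
    + (bB (dd (i + 1) q x) 0 (i + 2).succ + rotB (om (q x) (i + 1).succ) (bB (q x) 0 (i + 2).succ)
      - wdg (th (q x) (i + 1).succ) (be (q x) 0 (i + 2).succ))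
    - (bB (dd (i + 2) q x) 0 (i + 1).succ + rotB (om (q x) (i + 2).succ) (bB (q x) 0 (i + 1).succ)
      - wdg (th (q x) (i + 2).succ) (be (q x) 0 (i + 1).succ))) := by
  obtain ⟨-, -, h3, h4⟩ := mem_configFibre.1 (hq.mem x)
  change low2 _ = lo2 _
  rw [← lo2_apply]
  congr 1
  ext A B
  dsimp only
  rw [sum_eps4_succ]
  · simp only [Pi.add_apply, Pi.sub_apply, Pi.neg_apply]
    congr 4
    · exact pd_config (i + 1) (hq.differentiable x) _
    · exact pd_config (i + 2) (hq.differentiable x) _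
  · intro b c d
    have e : dst q v b (fun p => bB p d c A B) x = -dst q v b (fun p => bB p c d A B) x := by
      refine Fin.cases ?_ (fun j => ?_) b
      · exact congrFun (congrFun ((mem_configFibre.1 hv).2.2.1 c d) A) B
      · exact (pd_config j (hq.differentiable x) _).trans
          ((congrFun (congrFun ((mem_configFibre.1 (dd_mem hq j x)).2.2.1 c d) A) B).trans
          (congrArg _ (pd_config j (hq.differentiable x) _).symm))
    rw [e, h3 c d, h4 c d, ← rotB_apply, ← rotB_apply, ← wdg_apply, ← wdg_apply, map_neg, map_neg]
    simp only [Pi.neg_apply]; ring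

include hv in
theorem th_eulerLagrange_succ (i : Fin 3) : th (eulerLagrange q v x) i.succ = lo (
    -(be (v x) (i + 1).succ (i + 2).succ + rotW (om (q x) 0) (be (q x) (i + 1).succ (i + 2).succ))
    + (be (dd (i + 1) q x) 0 (i + 2).succ + rotW (om (q x) (i + 1).succ) (be (q x) 0 (i + 2).succ))
    - (be (dd (i + 2) q x) 0 (i + 1).succ + rotW (om (q x) (i + 2).succ) (be (q x) 0 (i + 1).succ))) := by
  obtain ⟨-, -, h3, h4⟩ := mem_configFibre.1 (hq.mem x)
  change low _ = lo _
  rw [← lo_apply]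
  congr 1
  ext A
  dsimp only
  rw [sum_eps4_succ]
  · simp only [Pi.add_apply, Pi.sub_apply, Pi.neg_apply]
    congr 3
    · exact pd_config (i + 1) (hq.differentiable x) _
    · exact pd_config (i + 2) (hq.differentiable x) _
  · intro b c d
    have e : dst q v b (fun p => be p d c A) x = -dst q v b (fun p => be p c d A) x := by
      refine Fin.cases ?_ (fun j => ?_) b
      · exact congrFun ((mem_configFibre.1 hv).2.2.2 c d) A
      · exact (pd_config j (hq.differentiable x) _).trans
          ((congrFun ((mem_configFibre.1 (dd_mem hq j x)).2.2.2 c d) A).trans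
          (congrArg _ (pd_config j (hq.differentiable x) _).symm))
    rw [e, h4 c d, ← rotW_apply, ← rotW_apply, map_neg]
    simp only [Pi.neg_apply]; ring

omit hq in
theorem bB_eulerLagrange_zero (i : Fin 3) : bB (eulerLagrange q v x) 0 i.succ =
    lo2 ((1 / 2 : ℝ) • curv q v (i + 1).succ (i + 2).succ x) := by
  change low2 _ = lo2 _
  rw [← lo2_apply]
  congr 1
  ext A B
  dsimp only
  rw [sum_eps4_zero_succ i (fun c d => curv q v c d x A B) fun c d => by rw [curv_antisymm]; rfl]
  rfl

omit hq in
theorem bB_eulerLagrange_succ (i : Fin 3) : bB (eulerLagrange q v x) (i + 1).succ (i + 2).succ =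
    lo2 ((1 / 2 : ℝ) • curv q v 0 i.succ x) := by
  change low2 _ = lo2 _
  rw [← lo2_apply]
  congr 1
  ext A B
  dsimp only
  rw [sum_eps4_succ_succ i (fun c d => curv q v c d x A B) fun c d => by rw [curv_antisymm]; rfl]
  rfl

omit hq in
theorem be_eulerLagrange_zero (i : Fin 3) : be (eulerLagrange q v x) 0 i.succ =
    lo ((1 / 2 : ℝ) • tors q v (i + 1).succ (i + 2).succ x) := by
  change low _ = lo _
  rw [← lo_apply]
  congr 1
  ext A
  dsimp only
  rw [sum_eps4_zero_succ i (fun c d => tors q v c d x A) fun c d => by rw [tors_antisymm]; rfl]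
  rfl

omit hq in
theorem be_eulerLagrange_succ (i : Fin 3) : be (eulerLagrange q v x) (i + 1).succ (i + 2).succ =
    lo ((1 / 2 : ℝ) • tors q v 0 i.succ x) := by
  change low _ = lo _
  rw [← lo_apply]
  congr 1
  ext A
  dsimp only
  rw [sum_eps4_succ_succ i (fun c d => tors q v c d x A) fun c d => by rw [tors_antisymm]; rfl]
  rfl

include hv in
theorem curv_mem_skew (a b : Fin 4) : curv q v a b x ∈ skew := by
  have key : ∀ i : Fin 3, curv q v 0 i.succ x ∈ skew := fun i => by
    rw [curv_zero hq]
    exact skew.add_mem (skew.sub_mem ((mem_configFibre.1 hv).1 _) ((mem_configFibre.1 (dd_mem hq i x)).1 0))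
      (rotB_mem_skew _ ((mem_configFibre.1 (hq.mem x)).1 _))
  refine Fin.cases (Fin.cases ?_ (fun j => key j) b) (fun i => Fin.cases ?_ (fun j => ?_) b) a
  · intro A B
    have h := congrFun (congrFun (curv_antisymm q v 0 0 x) A) B
    have h' := congrFun (congrFun (curv_antisymm q v 0 0 x) B) A
    simp only [Pi.neg_apply] at h h'
    linarith
  · rw [curv_antisymm]; exact skew.neg_mem (key i)
  · rw [curv_succ hq]
    exact skew.add_mem (skew.sub_mem ((mem_configFibre.1 (dd_mem hq i x)).1 _)
      ((mem_configFibre.1 (dd_mem hq j x)).1 _)) (rotB_mem_skew _ ((mem_configFibre.1 (hq.mem x)).1 _))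

include hv in
theorem eulerLagrange_mem : eulerLagrange q v x ∈ configFibre := by
  have o1 := (mem_configFibre.1 (hq.mem x)).2.1
  have o2 := fun i => (mem_configFibre.1 (dd_mem hq i x)).2.1
  have o3 := (mem_configFibre.1 hv).2.1
  refine mem_configFibre.2 ⟨fun a => ?_, fun a b => ?_, fun a b => ?_, fun a b => ?_⟩
  · refine Fin.cases ?_ (fun i => ?_) a
    · rw [om_eulerLagrange_zero hq x hv]
      refine lo2_mem_skew (Submodule.sum_mem _ fun i _ => ?_)
      exact skew.sub_mem (skew.add_mem (o2 i _ _) (rotB_mem_skew _ (o1 _ _))) (wdg_mem_skew _ _)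
    · rw [om_eulerLagrange_succ hq x hv]
      refine lo2_mem_skew (skew.sub_mem (skew.add_mem (skew.neg_mem ?_) ?_) ?_)
      · exact skew.sub_mem (skew.add_mem (o3 _ _) (rotB_mem_skew _ (o1 _ _))) (wdg_mem_skew _ _)
      · exact skew.sub_mem (skew.add_mem (o2 _ _ _) (rotB_mem_skew _ (o1 _ _))) (wdg_mem_skew _ _)
      · exact skew.sub_mem (skew.add_mem (o2 _ _ _) (rotB_mem_skew _ (o1 _ _))) (wdg_mem_skew _ _)
  · refine lo2_mem_skew fun A B => ?_
    simp only [← mul_neg, ← Finset.sum_neg_distrib]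
    refine congrArg _ (Finset.sum_congr rfl fun c _ => Finset.sum_congr rfl fun d _ => ?_)
    rw [curv_mem_skew hq x hv c d A B]
  · change low2 _ = -low2 _
    rw [← lo2_apply, ← lo2_apply, ← map_neg]
    congr 1
    ext A B
    simp only [Pi.neg_apply, ← mul_neg, ← Finset.sum_neg_distrib]
    refine congrArg _ (Finset.sum_congr rfl fun c _ => Finset.sum_congr rfl fun d _ => ?_)
    rw [eps4_swap01]; ring
  · change low _ = -low _
    rw [← lo_apply, ← lo_apply, ← map_neg]
    congr 1
    ext A
    simp only [Pi.neg_apply, ← mul_neg, ← Finset.sum_neg_distrib]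
    refine congrArg _ (Finset.sum_congr rfl fun c _ => Finset.sum_congr rfl fun d _ => ?_)
    rw [eps4_swap01]; ring

end EulerLagrange

/-! ### Spatial components of configurations -/

theorem configFibre_ext {p q : Config} (hp : p ∈ configFibre) (hq : q ∈ configFibre)
    (h1 : ∀ a, om p a = om q a) (h2 : ∀ a, th p a = th q a)
    (h3 : ∀ i : Fin 3, bB p 0 i.succ = bB q 0 i.succ) (h4 : ∀ i : Fin 3, be p 0 i.succ = be q 0 i.succ)
    (h5 : ∀ i : Fin 3, bB p (i + 1).succ (i + 2).succ = bB q (i + 1).succ (i + 2).succ)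
    (h6 : ∀ i : Fin 3, be p (i + 1).succ (i + 2).succ = be q (i + 1).succ (i + 2).succ) : p = q := by
  rw [← sub_eq_zero, ← dotProduct_self_eq_zero, dot_config (configFibre.sub_mem hp hq) (configFibre.sub_mem hp hq)]
  have o : ∀ a, om (p - q) a = 0 := fun a => sub_eq_zero.2 (h1 a)
  have t : ∀ a, th (p - q) a = 0 := fun a => sub_eq_zero.2 (h2 a)
  have b : ∀ i : Fin 3, bB (p - q) 0 i.succ = 0 := fun i => sub_eq_zero.2 (h3 i)
  have b' : ∀ i : Fin 3, be (p - q) 0 i.succ = 0 := fun i => sub_eq_zero.2 (h4 i)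
  have c : ∀ i : Fin 3, bB (p - q) (i + 1).succ (i + 2).succ = 0 := fun i => sub_eq_zero.2 (h5 i)
  have c' : ∀ i : Fin 3, be (p - q) (i + 1).succ (i + 2).succ = 0 := fun i => sub_eq_zero.2 (h6 i)
  simp [o, t, b, b', c, c']

theorem eps3_swap (i j k : Fin 3) : eps3 j i k = -eps3 i j k := by
  have h := leviCivita_permute ![i, j, k] (Equiv.swap 0 1)
  have e : ![i, j, k] ∘ (Equiv.swap (0 : Fin 3) 1) = ![j, i, k] := by
    funext i; fin_cases i <;> rfl
  rw [e, Equiv.Perm.sign_swap (by decide)] at h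
  simpa [eps3] using h

theorem eps3_cyclic (i k : Fin 3) : eps3 (i + 1) (i + 2) k = if k = i then 1 else 0 := by
  rw [eps3_eq, succ_add_one, succ_add_one_two]
  fin_cases i <;> fin_cases k <;> simp

/-- The configuration with only the components `ω_i` and `θ_i` of `q`. -/
def spat : Config →ₗ[ℝ] Config := redL.comp
  ((LinearMap.inr ℝ Par SPar).comp ((LinearMap.pi fun i : Fin 3 => omL i.succ).prod
    (LinearMap.pi fun i : Fin 3 => thL i.succ)))

theorem spat_apply (q : Config) : spat q = redConfig 0 (spatialPart q) := rfl

/-- The spatial 2-forms `B_{ij} = ε_{ijk} ω_k`, `β_{ij} = ε_{ijk} θ_k` (with raised Lorentz indices) built from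
the components `ω_k`, `θ_k` of a configuration. -/
def dual : Config →ₗ[ℝ] Config where
  toFun q := mkConfig 0 0
    (fun a b => Fin.cases (motive := fun _ => Biv) 0 (fun i => Fin.cases (motive := fun _ => Biv) 0
      (fun j => ∑ k : Fin 3, eps3 i j k • lo2 (om q k.succ)) b) a)
    (fun a b => Fin.cases (motive := fun _ => Vec) 0 (fun i => Fin.cases (motive := fun _ => Vec) 0
      (fun j => ∑ k : Fin 3, eps3 i j k • lo (th q k.succ)) b) a)
  map_add' p q := by
    refine config_ext (fun a => ?_) (fun a => ?_) (fun a b => ?_) (fun a b => ?_)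
    · exact (add_zero (0 : Biv)).symm
    · exact (add_zero (0 : Vec)).symm
    · rw [bB_add]
      refine Fin.cases (add_zero (0 : Biv)).symm (fun i => Fin.cases (add_zero (0 : Biv)).symm (fun j => ?_) b) a
      change ∑ k : Fin 3, eps3 i j k • lo2 (om (p + q) k.succ)
        = (∑ k : Fin 3, eps3 i j k • lo2 (om p k.succ)) + ∑ k : Fin 3, eps3 i j k • lo2 (om q k.succ)
      simp only [om_add, map_add, smul_add, Finset.sum_add_distrib]
    · rw [be_add]
      refine Fin.cases (add_zero (0 : Vec)).symm (fun i => Fin.cases (add_zero (0 : Vec)).symm (fun j => ?_) b) a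
      change ∑ k : Fin 3, eps3 i j k • lo (th (p + q) k.succ)
        = (∑ k : Fin 3, eps3 i j k • lo (th p k.succ)) + ∑ k : Fin 3, eps3 i j k • lo (th q k.succ)
      simp only [th_add, map_add, smul_add, Finset.sum_add_distrib]
  map_smul' r p := by
    refine config_ext (fun a => ?_) (fun a => ?_) (fun a b => ?_) (fun a b => ?_)
    · exact (smul_zero r).symm
    · exact (smul_zero r).symm
    · rw [bB_smul]
      refine Fin.cases (smul_zero r).symm (fun i => Fin.cases (smul_zero r).symm (fun j => ?_) b) a
      change ∑ k : Fin 3, eps3 i j k • lo2 (om (r • p) k.succ)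
        = r • ∑ k : Fin 3, eps3 i j k • lo2 (om p k.succ)
      simp only [om_smul, map_smul, Finset.smul_sum, smul_comm r]
    · rw [be_smul]
      refine Fin.cases (smul_zero r).symm (fun i => Fin.cases (smul_zero r).symm (fun j => ?_) b) a
      change ∑ k : Fin 3, eps3 i j k • lo (th (r • p) k.succ)
        = r • ∑ k : Fin 3, eps3 i j k • lo (th p k.succ)
      simp only [th_smul, map_smul, Finset.smul_sum, smul_comm r]

section
variable (q : Config) (a : Fin 4) (i j : Fin 3)
theorem om_dual : om (dual q) a = 0 := rfl
theorem th_dual : th (dual q) a = 0 := rfl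
theorem bB_dual_zero : bB (dual q) 0 a = 0 := rfl
theorem be_dual_zero : be (dual q) 0 a = 0 := rfl
theorem bB_dual_zero' : bB (dual q) i.succ 0 = 0 := rfl
theorem be_dual_zero' : be (dual q) i.succ 0 = 0 := rfl
theorem bB_dual_succ : bB (dual q) i.succ j.succ = ∑ k : Fin 3, eps3 i j k • lo2 (om q k.succ) := rfl
theorem be_dual_succ : be (dual q) i.succ j.succ = ∑ k : Fin 3, eps3 i j k • lo (th q k.succ) := rfl
theorem bB_dual : bB (dual q) (i + 1).succ (i + 2).succ = lo2 (om q i.succ) := by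
  simp [bB_dual_succ, eps3_cyclic]
theorem be_dual : be (dual q) (i + 1).succ (i + 2).succ = lo (th q i.succ) := by
  simp [be_dual_succ, eps3_cyclic]
end

section
variable {p q : Config} (hp : p ∈ configFibre) (hq : q ∈ configFibre)

include hq in
theorem dual_mem : dual q ∈ configFibre := by
  refine mem_configFibre.2 ⟨fun a => skew.zero_mem, fun a b => ?_, fun a b => ?_, fun a b => ?_⟩
  · refine Fin.cases skew.zero_mem (fun i => Fin.cases skew.zero_mem (fun j => ?_) b) a
    rw [bB_dual_succ]
    exact Submodule.sum_mem _ fun k _ => skew.smul_mem _ (lo2_mem_skew ((mem_configFibre.1 hq).1 _))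
  · refine Fin.cases (Fin.cases ?_ (fun j => ?_) b) (fun i => Fin.cases ?_ (fun j => ?_) b) a
    · simp [bB_dual_zero]
    · simp [bB_dual_zero, bB_dual_zero']
    · simp [bB_dual_zero, bB_dual_zero']
    · simp only [bB_dual_succ, eps3_swap i j, neg_smul, Finset.sum_neg_distrib]
  · refine Fin.cases (Fin.cases ?_ (fun j => ?_) b) (fun i => Fin.cases ?_ (fun j => ?_) b) a
    · simp [be_dual_zero]
    · simp [be_dual_zero, be_dual_zero']
    · simp [be_dual_zero, be_dual_zero']
    · simp only [be_dual_succ, eps3_swap i j, neg_smul, Finset.sum_neg_distrib]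

include hq in
theorem spat_mem : spat q ∈ reducedConfig := redConfig_mem parFibre.zero_mem (spatialPart_mem hq)

include hq in
theorem momenta_dual : momenta (dual q) = spat q := by
  rw [momenta_eq (dual_mem hq), spat_apply]
  simp only [bB_dual, be_dual, lo2_lo2, lo_lo]
  rfl

theorem dual_spat (q : Config) : dual (spat q) = dual q := rfl
theorem spat_spat (q : Config) : spat (spat q) = spat q := rfl
theorem spat_dual (q : Config) : spat (dual q) = 0 := map_zero redL
theorem dual_dual (q : Config) : dual (dual q) = 0 := map_zero dual

theorem momenta_eq_zero (hq : q ∈ reducedConfig) : momenta q = 0 := by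
  rw [momenta_eq hq.1]
  obtain ⟨-, h1, h2⟩ := mem_reducedConfig.1 hq
  simp only [h1, h2, map_zero]
  exact map_zero redL

include hq in
theorem spat_momenta : spat (momenta q) = momenta q := by
  rw [momenta_eq hq]; rfl

include hp hq in
/-- Up to a factor, `dual` is the transpose of `momenta`. -/
theorem dot_dual : dotProduct (dual p) q = 2 * dotProduct p (momenta q) := by
  rw [dot_config (dual_mem hp) hq, dotProduct_comm p, dot_momenta hq hp]
  have e1 : ∀ i : Fin 3, ipB (lo2 (om p i.succ)) (bB q (i + 1).succ (i + 2).succ)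
      = ipB (lo2 (bB q (i + 1).succ (i + 2).succ)) (om p i.succ) := fun i => by rw [ipB_lo2, ipB_comm]
  have e2 : ∀ i : Fin 3, ipV (lo (th p i.succ)) (be q (i + 1).succ (i + 2).succ)
      = ipV (lo (be q (i + 1).succ (i + 2).succ)) (th p i.succ) := fun i => by rw [ipV_lo, ipV_comm]
  simp only [om_dual, th_dual, bB_dual_zero, be_dual_zero, bB_dual, be_dual, map_zero, LinearMap.zero_apply,
    Finset.sum_const_zero, e1, e2]
  ring

include hp hq in
theorem dot_spat : dotProduct (spat p) q = dotProduct p (spat q) := by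
  rw [dotProduct_comm p, spat_apply, spat_apply, dot_red _ _ hq, dot_red _ _ hp]
  simp only [spatialPart, Prod.fst_zero, Prod.snd_zero, Pi.zero_apply, map_zero, LinearMap.zero_apply,
    Finset.sum_const_zero, ipB_comm, ipV_comm]

include hq in
theorem mem_spatialConfig : q ∈ spatialConfig ↔ spat q + dual (momenta q) = q := by
  have hm := reducedConfig_le (momenta_mem hq)
  constructor
  · rintro ⟨-, h1, h2, h3, h4⟩
    refine configFibre_ext (configFibre.add_mem (reducedConfig_le (spat_mem hq)) (dual_mem hm)) hq
      (fun a => ?_) (fun a => ?_) (fun i => ?_) (fun i => ?_) (fun i => ?_) (fun i => ?_)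
    · refine Fin.cases ?_ (fun i => ?_) a
      · exact (add_zero (0 : Biv)).trans (by ext A B; exact (h1 A B).symm)
      · exact add_zero (om q i.succ)
    · refine Fin.cases ?_ (fun i => ?_) a
      · exact (add_zero (0 : Vec)).trans (by ext A; exact (h2 A).symm)
      · exact add_zero (th q i.succ)
    · exact (add_zero (0 : Biv)).trans (by ext A B; exact (h3 _ A B).symm)
    · exact (add_zero (0 : Vec)).trans (by ext A; exact (h4 _ A).symm)
    · rw [bB_add, bB_dual, om_momenta hq, lo2_lo2]; exact zero_add _
    · rw [be_add, be_dual, th_momenta hq, lo_lo]; exact zero_add _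
  · intro h
    rw [← h]
    exact ⟨configFibre.add_mem (reducedConfig_le (spat_mem hq)) (dual_mem hm), fun A B => add_zero (0 : ℝ),
      fun A => add_zero (0 : ℝ), fun b A B => by
        refine Fin.cases ?_ (fun j => ?_) b <;> exact add_zero (0 : ℝ),
      fun b A => by refine Fin.cases ?_ (fun j => ?_) b <;> exact add_zero (0 : ℝ)⟩

include hq in
theorem proj_mem_spatialConfig : spat q + dual (momenta q) ∈ spatialConfig := by
  have hm := reducedConfig_le (momenta_mem hq)
  have hs := spat_mem hq
  rw [mem_spatialConfig (configFibre.add_mem hs.1 (dual_mem hm)), momenta_add, momenta_eq_zero hs,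
    momenta_dual hm, map_add, map_add, spat_spat, spat_dual, dual_spat, map_zero, zero_add, add_zero]

theorem spatialConfig_le : spatialConfig ≤ configFibre := fun _ h => h.1

theorem spat_mem_spatialConfig (hq : q ∈ configFibre) : spat q ∈ spatialConfig := by
  rw [mem_spatialConfig (spat_mem hq).1, momenta_eq_zero (spat_mem hq), map_zero, add_zero, spat_spat]

theorem dual_mem_spatialConfig (hq : q ∈ configFibre) : dual q ∈ spatialConfig := by
  rw [mem_spatialConfig (dual_mem hq), momenta_dual hq, spat_dual, dual_spat, zero_add]

include hq in
/-- The part of a configuration without spatial 2-forms. -/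
theorem sub_dual_mem : q - dual (momenta q) ∈ reducedConfig := by
  have hm := reducedConfig_le (momenta_mem hq)
  have hc := configFibre.sub_mem hq (dual_mem hm)
  have e : q - dual (momenta q) = redConfig (temporalPart q) (spatialPart q) := by
    refine configFibre_ext hc (redConfig_mem (temporalPart_mem hq) (spatialPart_mem hq)).1
      (fun a => ?_) (fun a => ?_) (fun i => ?_) (fun i => ?_) (fun i => ?_) (fun i => ?_)
    · exact (sub_zero (om q a)).trans (Fin.cases rfl (fun i => rfl) a)
    · exact (sub_zero (th q a)).trans (Fin.cases rfl (fun i => rfl) a)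
    · exact sub_zero (bB q 0 i.succ)
    · exact sub_zero (be q 0 i.succ)
    · change bB q (i + 1).succ (i + 2).succ - bB (dual (momenta q)) (i + 1).succ (i + 2).succ = 0
      rw [bB_dual, om_momenta hq, lo2_lo2, sub_self]
    · change be q (i + 1).succ (i + 2).succ - be (dual (momenta q)) (i + 1).succ (i + 2).succ = 0
      rw [be_dual, th_momenta hq, lo_lo, sub_self]
  rw [e]
  exact redConfig_mem (temporalPart_mem hq) (spatialPart_mem hq)

/-- Covectors are tested on the spatial components only. -/
theorem dot_spatialConfig (hp : p ∈ spatialConfig) (hq : q ∈ configFibre) :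
    dotProduct p q = dotProduct p (spat q + dual (momenta q)) := by
  have hpc := hp.1
  have hm := reducedConfig_le (momenta_mem hq)
  conv_lhs => rw [← (mem_spatialConfig hpc).1 hp]
  have hmp := reducedConfig_le (momenta_mem hpc)
  rw [add_dotProduct, dot_spat hpc hq, dot_dual hmp hq, dotProduct_add, dotProduct_comm p (dual _),
    dot_dual hm hpc, dotProduct_comm (momenta p)]

theorem eq_zero_of_dot_spatialConfig (hq : q ∈ configFibre)
    (h : ∀ l ∈ spatialConfig, dotProduct l q = 0) : spat q + dual (momenta q) = 0 := by
  have hs := proj_mem_spatialConfig hq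
  rw [← dotProduct_self_eq_zero, ← dot_spatialConfig hs hq]
  exact h _ hs

end

/-! ### The matrix of brackets of the primary constraints -/

/-- The matrix of `diracForm`. -/
def diracMatrix : Config →ₗ[ℝ] Config := (1 / 2 : ℝ) • dual - momentaL
/-- The inverse of the matrix of `diracForm` on the spatial components. -/
def diracInv : Config →ₗ[ℝ] Config := (2 : ℝ) • momentaL - dual

theorem diracMatrix_apply (q : Config) : diracMatrix q = (1 / 2 : ℝ) • dual q - momenta q := rfl
theorem diracInv_apply (q : Config) : diracInv q = (2 : ℝ) • momenta q - dual q := rfl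

section
variable {l l' q : Config} (hl : l ∈ configFibre) (hl' : l' ∈ configFibre)

include hl hl' in
theorem diracForm_eq : diracForm l l' = dotProduct l (diracMatrix l') := by
  rw [diracMatrix_apply, dotProduct_sub, dotProduct_smul, dotProduct_comm l (dual l'), dot_dual hl' hl,
    diracForm, dotProduct_comm l' (momenta l), smul_eq_mul]
  ring

theorem diracForm_swap (l l' : Config) : diracForm l l' = -diracForm l' l := by
  simp only [diracForm, dotProduct_comm l', dotProduct_comm (momenta l')]; ring

include hl in
theorem diracMatrix_mem : diracMatrix l ∈ spatialConfig := by
  rw [diracMatrix_apply, ← spat_momenta hl]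
  exact spatialConfig.sub_mem (spatialConfig.smul_mem _ (dual_mem_spatialConfig hl))
    (spat_mem_spatialConfig (momenta_mem hl).1)

include hl in
theorem diracInv_mem : diracInv l ∈ spatialConfig := by
  rw [diracInv_apply, ← spat_momenta hl]
  exact spatialConfig.sub_mem (spatialConfig.smul_mem _ (spat_mem_spatialConfig (momenta_mem hl).1))
    (dual_mem_spatialConfig hl)

theorem momenta_sub (p q : Config) : momenta (p - q) = momenta p - momenta q := map_sub momentaL p q

theorem momenta_momenta (hq : q ∈ configFibre) : momenta (momenta q) = 0 :=
  momenta_eq_zero (momenta_mem hq)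

include hl in
theorem diracMatrix_diracInv : diracMatrix (diracInv l) = spat l + dual (momenta l) := by
  rw [diracMatrix_apply, diracInv_apply, map_sub, map_smul, dual_dual, momenta_sub, momenta_smul,
    momenta_momenta hl, momenta_dual hl]
  module

theorem diracInv_diracMatrix (hl : l ∈ spatialConfig) : diracInv (diracMatrix l) = l := by
  have h := (mem_spatialConfig hl.1).1 hl
  rw [diracMatrix_apply, diracInv_apply, map_sub, map_smul, dual_dual, momenta_sub, momenta_smul,
    momenta_momenta hl.1, momenta_dual hl.1]
  conv_rhs => rw [← h]
  module

theorem diracForm_nondegenerate (hl : l ∈ spatialConfig)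
    (h : ∀ l' ∈ spatialConfig, diracForm l l' = 0) : l = 0 := by
  have hm := diracMatrix_mem hl.1
  have h1 : diracMatrix l = 0 := by
    rw [← dotProduct_self_eq_zero, ← diracForm_eq hm.1 hl.1, diracForm_swap, h _ hm, neg_zero]
  rw [← diracInv_diracMatrix hl, h1, map_zero]

theorem diracMatrix_eq_zero_iff (hl : l ∈ configFibre) : diracMatrix l = 0 ↔ l ∈ temporalConfig := by
  constructor
  · intro h
    have hm := diracMatrix_mem hl
    have h1 : spat l + dual (momenta l) = 0 := by
      have e : diracMatrix (spat l + dual (momenta l)) = diracMatrix l := by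
        rw [diracMatrix_apply, diracMatrix_apply, map_add, dual_dual, dual_spat, momenta_add,
          momenta_eq_zero (spat_mem hl), momenta_dual (momenta_mem hl).1, spat_momenta hl, add_zero, zero_add]
      rw [← diracInv_diracMatrix (proj_mem_spatialConfig hl), e, h, map_zero]
    have h2 : momenta l = 0 := by
      have := congrArg momenta h1
      rwa [momenta_add, momenta_eq_zero (spat_mem hl), momenta_dual (momenta_mem hl).1, spat_momenta hl,
        zero_add, momenta_eq_zero reducedConfig.zero_mem] at this
    have h3 : spat l = 0 := by rwa [h2, map_zero, add_zero] at h1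
    refine ⟨?_, fun i A B => ?_, fun i A => ?_⟩
    · have := sub_dual_mem hl
      rwa [h2, map_zero, sub_zero] at this
    · exact congrFun (congrFun (congrArg (fun q => om q i.succ) h3) A) B
    · exact congrFun (congrArg (fun q => th q i.succ) h3) A
  · rintro ⟨h1, h2, h3⟩
    have hs : spat l = 0 := by
      have e : spatialPart l = 0 := by
        refine Prod.ext (funext fun i => ?_) (funext fun i => ?_)
        · ext A B; exact h2 i A B
        · ext A; exact h3 i A
      rw [spat_apply, e]
      exact map_zero redL
    rw [diracMatrix_apply, ← dual_spat, hs, momenta_eq_zero h1, map_zero]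
    simp

theorem primaryRadical_eq : primaryRadical = temporalConfig := by
  ext l
  constructor
  · rintro ⟨hl, h⟩
    have hm := diracMatrix_mem hl
    rw [← diracMatrix_eq_zero_iff hl, ← dotProduct_self_eq_zero, ← diracForm_eq hm.1 hl, diracForm_swap,
      h _ hm.1, neg_zero]
  · intro hl
    refine ⟨hl.1.1, fun l' hl' => ?_⟩
    rw [diracForm_swap, diracForm_eq hl' hl.1.1, (diracMatrix_eq_zero_iff hl.1.1).2 hl, dotProduct_zero,
      neg_zero]

theorem diracForm_explicit (hl : l ∈ configFibre) (hl' : l' ∈ configFibre) : diracForm l l' =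
      (1 / 2) * ∑ i : Fin 3, ∑ j : Fin 3, ∑ k : Fin 3, eps3 i j k *
        ((∑ A, ∑ B, (low2 (bB l i.succ j.succ) A B * om l' k.succ A B
            - om l k.succ A B * low2 (bB l' i.succ j.succ) A B))
          + ∑ A, (low (be l i.succ j.succ) A * th l' k.succ A
            - th l k.succ A * low (be l' i.succ j.succ) A)) := by
  have e : ∀ i j k : Fin 3, ((∑ A, ∑ B, (low2 (bB l i.succ j.succ) A B * om l' k.succ A B
            - om l k.succ A B * low2 (bB l' i.succ j.succ) A B))
          + ∑ A, (low (be l i.succ j.succ) A * th l' k.succ A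
            - th l k.succ A * low (be l' i.succ j.succ) A))
      = ipB (lo2 (bB l i.succ j.succ)) (om l' k.succ) - ipB (om l k.succ) (lo2 (bB l' i.succ j.succ))
        + (ipV (lo (be l i.succ j.succ)) (th l' k.succ) - ipV (th l k.succ) (lo (be l' i.succ j.succ))) := by
    intro i j k
    simp only [Finset.sum_sub_distrib]
    rfl
  have cyc : ∀ f : Fin 3 → Fin 3 → Fin 3 → ℝ, (∀ i j k, f j i k = -f i j k) →
      (1 / 2) * ∑ i, ∑ j, ∑ k, eps3 i j k * f i j k = ∑ i, f (i + 1) (i + 2) i := by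
    intro f hf
    simp only [eps3_eq, Fin.sum_univ_three]
    simp
    linear_combination (-1 / 2) * (hf 1 2 0 + hf 0 1 2 + hf 2 0 1)
  simp only [e]
  obtain ⟨-, -, h3, h4⟩ := mem_configFibre.1 hl
  obtain ⟨-, -, h3', h4'⟩ := mem_configFibre.1 hl'
  rw [cyc _ fun i j k => ?_]
  · rw [diracForm, dot_momenta hl hl', dotProduct_comm l, dot_momenta hl' hl]
    simp only [Finset.sum_add_distrib, Finset.sum_sub_distrib, ipB_comm (om l _), ipV_comm (th l _)]
    ring
  · rw [h3 i.succ j.succ, h4 i.succ j.succ, h3' i.succ j.succ, h4' i.succ j.succ]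
    simp only [map_neg, LinearMap.neg_apply]
    ring

end

/-! ### Primary constraints and the total Hamiltonian -/

theorem hasDerivAt_lagrangian {q v : Space → Config} (hq : IsField configFibre q)
    (hv : IsField configFibre v) (x : Space) {w : Config} (hw : w ∈ configFibre) :
    HasDerivAt (fun s : ℝ => lagrangian q (fun y => v y + s • w) x) (dotProduct (momenta (q x)) w) 0 := by
  have e : ∀ s : ℝ, lagrangian q (fun y => v y + s • w) x
      = s * dotProduct (momenta (q x)) w + (dotProduct (momenta (q x)) (v x) + lagrangian q 0 x) := fun s => by
    rw [lagrangian_split hq x (configFibre.add_mem (hv.mem x) (configFibre.smul_mem s hw)), dotProduct_add,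
      dotProduct_smul, smul_eq_mul]
    ring
  simp only [e]
  exact (((hasDerivAt_id (0 : ℝ)).mul_const _).add_const _).congr_deriv (one_mul _)

/-- The differential of the primary constraint with multiplier `l`. -/
def primaryCovector : Config →ₗ[ℝ] Phase := (-((1 / 2 : ℝ) • dual)).prod LinearMap.id

theorem primaryCovector_apply (l : Config) : primaryCovector l = (-((1 / 2 : ℝ) • dual l), l) := rfl

theorem primaryCovector_mem {l : Config} (hl : l ∈ configFibre) : primaryCovector l ∈ phaseFibre :=
  ⟨configFibre.neg_mem (configFibre.smul_mem _ (dual_mem hl)), hl⟩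

theorem pair_primaryCovector {l : Config} (hl : l ∈ configFibre) {w : Phase} (hw : w ∈ phaseFibre) :
    pair (primaryCovector l) w = dotProduct l (w.2 - momenta w.1) := by
  rw [pair, primaryCovector_apply, dotProduct_sub, neg_dotProduct, smul_dotProduct, dot_dual hl hw.1, smul_eq_mul]
  ring

/-- The bracket of a functional with a primary constraint. -/
theorem poisson_primaryCovector {f : Phase} (hf : f ∈ phaseFibre) {l : Config} (hl : l ∈ configFibre) :
    poisson f (primaryCovector l) = dotProduct l (f.1 + momenta f.2) := by
  rw [poisson, primaryCovector_apply, dotProduct_neg, dotProduct_smul, dotProduct_comm f.2, dot_dual hl hf.2,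
    dotProduct_add, dotProduct_comm f.1, smul_eq_mul]
  ring

theorem hasGradient_primary {z : Space → Phase} {l : Space → Config} (hz : IsField phaseFibre z)
    (hl : IsField configFibre l) : HasGradient phaseFibre (primary l) z fun x => primaryCovector (l x) :=
  (hasGradient_pair hz (hl.linear primaryCovector fun _ => primaryCovector_mem)).congr hz fun _ hz x =>
    (pair_primaryCovector (hl.mem x) (hz.mem x)).symm

theorem hasBracket_primary {z : Space → Phase} {l l' : Space → Config} (hz : IsField phaseFibre z)
    (hl : IsTest configFibre l) (hl' : IsField configFibre l') :
    HasBracket phaseFibre (primary l) (primary l') z (∫ x, diracForm (l x) (l' x)) := by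
  have h1 := hasGradient_primary hz hl.toIsField
  have h2 := hasGradient_primary hz hl'
  refine ⟨_, _, h1, h2, integrable_poisson_left h1.isField.smooth h2.isField.smooth
    (hl.linear primaryCovector fun _ => primaryCovector_mem).compact,
    integral_congr_ae (Filter.Eventually.of_forall fun x => ?_)⟩
  simp only
  rw [poisson_primaryCovector (h1.isField.mem x) (hl'.mem x), primaryCovector_apply, dotProduct_add,
    dotProduct_neg, dotProduct_smul, dotProduct_comm (l' x) (dual _), dot_dual (hl.mem x) (hl'.mem x), diracForm,
    dotProduct_comm (l' x), smul_eq_mul]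
  ring

/-- The transpose of `legendre`. -/
def legendreT : Phase →ₗ[ℝ] Phase :=
  ((LinearMap.fst ℝ Config Config) + (1 / 2 : ℝ) • dual.comp (LinearMap.snd ℝ Config Config)).prod 0

theorem legendreT_apply (w : Phase) : legendreT w = (w.1 + (1 / 2 : ℝ) • dual w.2, 0) := rfl

/-- The functional derivative of the total Hamiltonian. -/
def hamiltonianGrad (v : Space → Config) (z : Space → Phase) (x : Space) : Phase :=
  primaryCovector (v x) + legendreT (-tempChiGrad (fun y => legendre (z y)) x)

theorem hasGradient_hamiltonian {z : Space → Phase} {v : Space → Config} (hz : IsField phaseFibre z)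
    (hv : IsField configFibre v) : HasGradient phaseFibre (hamiltonian v) z (hamiltonianGrad v z) := by
  have hw : IsField phaseFibre fun y => legendre (z y) := hz.linear legendre fun _ => legendre_mem
  have h1 := (hasGradient_canonDensity reducedFibre_le le_rfl hw).comp_linear legendre legendreT
    (W := phaseFibre) (fun _ => legendre_mem)
    (fun w hw => ⟨configFibre.add_mem hw.1 (configFibre.smul_mem _ (dual_mem hw.2)), configFibre.zero_mem⟩)
    (fun v hv w hw => by
      rw [legendreT_apply, legendre_apply, pair, pair, add_dotProduct, smul_dotProduct, dot_dual hv.2 hw.1,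
        zero_dotProduct, smul_eq_mul]
      ring)
  exact ((hasGradient_primary hz hv).add h1).congr hz fun z hz x => by
    rw [hamiltonian_eq hz x (hv.mem x), canonicalHamiltonian_eq hz]

set_option maxHeartbeats 800000 in
/-- The time derivatives of the primary constraints are the Euler-Lagrange derivatives. -/
theorem dot_eulerLagrange {q v : Space → Config} (hq : IsField configFibre q) (x : Space)
    (hv : v x ∈ configFibre) {l : Config} (hl : l ∈ configFibre) :
    dotProduct l (eulerLagrange q v x) = diracForm l (v x)
      + pair (tempChiGrad (fun y => legendre (q y, 0)) x) (legendre (l, 0)) := by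
  have hz : IsField phaseFibre fun y => legendre (q y, 0) :=
    ⟨contDiff_linear legendre (hq.smooth.prodMk contDiff_const),
      fun y => legendre_mem ⟨hq.mem y, configFibre.zero_mem⟩⟩
  have hL : legendre (l, 0) ∈ phaseFibre := legendre_mem ⟨hl, configFibre.zero_mem⟩
  have hd : jet (fun y => legendre (q y, 0)) x = fun i => legendre (dd i q x, 0) := funext fun i => by
    exact dd_linear i (legendre.comp (LinearMap.inl ℝ Config Config)) (hq.differentiable x)
  have hq0 := hq.mem x
  have hdq := fun i => dd_mem hq i x
  have hel := eulerLagrange_mem hq x hv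
  have hT : ∀ i : Fin 3, jet (fun y => temporalFields (legendre (q y, 0))) x i
      = temporalFields (dd i q x, 0) := fun i => by
    exact dd_linear i (tfL.comp (LinearMap.inl ℝ Config Config)) (hq.differentiable x)
  have wo := (mem_configFibre.1 hq0).1
  rw [tempChiGrad, pair_add_left, pair_tempCovector _ hL, chi_field hz, secField, secX]
  have neg_eq : ∀ X : Phase, pair (sharp X) (legendre (l, 0))
      = dotProduct X.1 (momenta l) - dotProduct X.2 l := fun X => by
    simp only [sharp, pair, legendre_apply, LinearMap.coe_mk, AddHom.coe_mk, neg_dotProduct]; ring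
  rw [neg_eq, dot_red _ _ (momenta_mem hl).1, dot_red _ _ hl, dotProduct_comm l, dot_config hel hl, diracForm,
    dot_momenta hl hv, dotProduct_comm l, dot_momenta hv hl]
  have c1 : ∀ (X : Biv) i j, ipB X (lo2 (bB l i j)) = ipB (lo2 X) (bB l i j) := fun X i j => (ipB_lo2 _ _).symm
  have c2 : ∀ (X : Vec) i j, ipV X (lo (be l i j)) = ipV (lo X) (be l i j) := fun X i j => (ipV_lo _ _).symm
  have c3 : ∀ a i j, ipB (lo2 (bB l i j)) (om (v x) a) = ipB (lo2 (om (v x) a)) (bB l i j) := fun a i j => by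
    rw [ipB_lo2, ipB_comm]
  have c4 : ∀ a i j, ipV (lo (be l i j)) (th (v x) a) = ipV (lo (th (v x) a)) (be l i j) := fun a i j => by
    rw [ipV_lo, ipV_comm]
  have c5 : ∀ i, rotB (om (q x) i) (om (q x) 0) = -rotB (om (q x) 0) (om (q x) i) := fun i =>
    rotB_comm (wo _) (wo _)
  simp only [hT, hd]
  simp only [om_eulerLagrange_zero hq x hv, om_eulerLagrange_succ hq x hv, th_eulerLagrange_zero hq x hv,
    th_eulerLagrange_succ hq x hv, bB_eulerLagrange_zero, bB_eulerLagrange_succ, be_eulerLagrange_zero,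
    be_eulerLagrange_succ, curv_zero hq, curv_succ hq, tors_zero hq, tors_succ hq, legendre_apply, chiJ,
    om_momenta hq0, th_momenta hq0, om_momenta hl, th_momenta hl, om_momenta (hdq _), th_momenta (hdq _), lo2_lo2,
    lo_lo, temporalFields_eq, parPair_eq, c1, c2, c3, c4, c5]
  simp only [Fin.sum_univ_three, map_add, map_sub, map_neg, map_smul, LinearMap.add_apply, LinearMap.sub_apply,
    LinearMap.neg_apply, LinearMap.smul_apply, smul_eq_mul, Prod.fst_zero, Prod.snd_zero, Pi.zero_apply, map_zero,
    LinearMap.zero_apply, Fin.isValue, Fin.reduceAdd, zero_add, ipB_comm (om l 0), ipV_comm (th l 0),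
    ipB_comm (bB l 0 _), ipV_comm (be l 0 _)]
  ring

theorem hasBracket_primary_hamiltonian {z : Space → Phase} {l v : Space → Config} (hz : IsField phaseFibre z)
    (hl : IsTest configFibre l) (hv : IsField configFibre v) :
    HasBracket phaseFibre (primary l) (hamiltonian v) z
      (∫ x, dotProduct (l x) (eulerLagrange (fun y => (z y).1) v x)) := by
  have hq : IsField configFibre fun y => (z y).1 := hz.linear (LinearMap.fst ℝ Config Config) fun _ h => h.1
  have hz' : IsField phaseFibre fun y => legendre (z y) := hz.linear legendre fun _ => legendre_mem
  have h1 := hasGradient_primary hz hl.toIsField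
  have h2 := hasGradient_hamiltonian hz hv
  refine ⟨_, _, h1, h2, integrable_poisson_left h1.isField.smooth h2.isField.smooth
    (hl.linear primaryCovector fun _ => primaryCovector_mem).compact,
    integral_congr_ae (Filter.Eventually.of_forall fun x => ?_)⟩
  have hlx := hl.mem x
  have hg := (isField_tempChiGrad hz').mem x
  have e : (fun y => legendre ((z y).1, (0 : Config))) = fun y => legendre (z y) := rfl
  simp only
  rw [dot_eulerLagrange hq x (hv.mem x) hlx, e, poisson_comm, poisson_primaryCovector (h2.isField.mem x) hlx,
    hamiltonianGrad, legendreT_apply, primaryCovector_apply, diracForm_eq hlx (hv.mem x), diracMatrix_apply,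
    pair, legendre_apply]
  simp only [Prod.fst_add, Prod.snd_add, Prod.fst_neg, Prod.snd_neg, add_zero, dotProduct_add, dotProduct_sub,
    dotProduct_neg, dotProduct_smul, map_neg, smul_eq_mul]
  rw [dotProduct_comm (l x) (dual (tempChiGrad _ _).2), dot_dual hg.2.1 hlx, dotProduct_comm (l x) (tempChiGrad _ _).1]
  ring

/-! ### Preservation of the second-class constraints -/

theorem contDiff_dst {q v : Space → Config} (hq : ContDiff ℝ ∞ q) (hv : ContDiff ℝ ∞ v) (a : Fin 4) (c : CIdx) :
    ContDiff ℝ ∞ fun x => dst q v a (fun p => p c) x :=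
  Fin.cases (contDiff_pi.1 hv c) (fun i => contDiff_dd i (contDiff_pi.1 hq c)) a

theorem contDiff_eulerLagrange {q v : Space → Config} (hq : ContDiff ℝ ∞ q) (hv : ContDiff ℝ ∞ v) :
    ContDiff ℝ ∞ (eulerLagrange q v) := by
  have ho : ∀ a A B, ContDiff ℝ ∞ fun x => om (q x) a A B := fun a A B => contDiff_pi.1 hq _
  have ht : ∀ a A, ContDiff ℝ ∞ fun x => th (q x) a A := fun a A => contDiff_pi.1 hq _
  have hb : ∀ a b A B, ContDiff ℝ ∞ fun x => bB (q x) a b A B := fun a b A B => contDiff_pi.1 hq _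
  have he : ∀ a b A, ContDiff ℝ ∞ fun x => be (q x) a b A := fun a b A => contDiff_pi.1 hq _
  have hd := contDiff_dst hq hv
  have hcurv : ∀ a b A B, ContDiff ℝ ∞ fun x => curv q v a b x A B := fun a b A B =>
    ((hd _ _).sub (hd _ _)).add (ContDiff.sum fun C _ =>
      contDiff_const.mul (((ho _ _ _).mul (ho _ _ _)).sub ((ho _ _ _).mul (ho _ _ _))))
  have hrotV : ∀ a {X : Space → Vec}, (∀ A, ContDiff ℝ ∞ fun x => X x A) → ∀ A,
      ContDiff ℝ ∞ fun x => rotV (om (q x) a) (X x) A := fun a X hX A =>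
    ContDiff.sum fun C _ => (contDiff_const.mul (ho _ _ _)).mul (hX C)
  have hrot : ∀ a {X : Space → Biv}, (∀ A B, ContDiff ℝ ∞ fun x => X x A B) → ∀ A B,
      ContDiff ℝ ∞ fun x => rot (om (q x) a) (X x) A B := fun a X hX A B =>
    ContDiff.sum fun C _ => contDiff_const.mul (((ho _ _ _).mul (hX _ _)).add ((ho _ _ _).mul (hX _ _)))
  have htors : ∀ a b A, ContDiff ℝ ∞ fun x => tors q v a b x A := fun a b A =>
    (((hd _ _).sub (hd _ _)).add (hrotV _ (ht _) _)).sub (hrotV _ (ht _) _)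
  refine contDiff_pi.2 fun c => ?_
  rcases c with ⟨a, A, B⟩ | ⟨a, A⟩ | ⟨a, b, A, B⟩ | ⟨a, b, A⟩
  · exact contDiff_const.mul (contDiff_const.mul (ContDiff.sum fun b _ => ContDiff.sum fun c _ =>
      ContDiff.sum fun d _ => contDiff_const.mul (((hd _ _).add (hrot _ (hb _ _) _ _)).sub
        ((((ht _ _).mul (he _ _ _)).sub ((ht _ _).mul (he _ _ _))).div_const 2))))
  · exact contDiff_const.mul (contDiff_const.mul (ContDiff.sum fun b _ => ContDiff.sum fun c _ =>
      ContDiff.sum fun d _ => contDiff_const.mul ((hd _ _).add (hrotV _ (he _ _) _))))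
  · exact contDiff_const.mul (contDiff_const.mul (ContDiff.sum fun c _ =>
      ContDiff.sum fun d _ => contDiff_const.mul (hcurv _ _ _ _)))
  · exact contDiff_const.mul (contDiff_const.mul (ContDiff.sum fun c _ =>
      ContDiff.sum fun d _ => contDiff_const.mul (htors _ _ _)))

theorem eulerLagrange_add {q v l : Space → Config} (hq : IsField configFibre q) (hv : IsField configFibre v)
    (x : Space) (hl : l x ∈ configFibre) {l' : Config} (hl' : l' ∈ configFibre) :
    dotProduct l' (eulerLagrange q (fun y => v y + l y) x)
      = dotProduct l' (eulerLagrange q v x + diracMatrix (l x)) := by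
  have h : diracForm l' (v x + l x) = diracForm l' (v x) + diracForm l' (l x) := by
    rw [diracForm_eq hl' (configFibre.add_mem (hv.mem x) hl), map_add, dotProduct_add,
      ← diracForm_eq hl' (hv.mem x), ← diracForm_eq hl' hl]
  rw [dotProduct_add, dot_eulerLagrange hq x (hv.mem x) hl',
    dot_eulerLagrange (v := fun y => v y + l y) hq x (configFibre.add_mem (hv.mem x) hl) hl',
    ← diracForm_eq hl' hl, h]
  ring

/-- A change of the spatial velocities changes the Euler-Lagrange derivatives by `diracMatrix`, which is
invertible on the spatial components. -/
theorem existsUnique_velocity {z : Space → Phase} {v₀ : Space → Config} (hz : IsField phaseFibre z)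
    (hv : IsField configFibre v₀) :
    ∃! v, IsField configFibre v ∧ (∀ x, v x - v₀ x ∈ spatialConfig) ∧
      ∀ x, ∀ l ∈ spatialConfig, dotProduct l (eulerLagrange (fun y => (z y).1) v x) = 0 := by
  have hq : IsField configFibre fun y => (z y).1 := hz.linear (LinearMap.fst ℝ Config Config) fun _ h => h.1
  have hE : IsField configFibre (eulerLagrange (fun y => (z y).1) v₀) :=
    ⟨contDiff_eulerLagrange hq.smooth hv.smooth, fun x => eulerLagrange_mem hq x (hv.mem x)⟩
  have hl : IsField spatialConfig fun x => -diracInv (eulerLagrange (fun y => (z y).1) v₀ x) :=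
    hE.linear (-diracInv) fun _ h => spatialConfig.neg_mem (diracInv_mem h)
  refine ⟨fun x => v₀ x + -diracInv (eulerLagrange (fun y => (z y).1) v₀ x),
    ⟨hv.add (hl.mono spatialConfig_le), fun x => ?_, fun x l hlx => ?_⟩, ?_⟩
  · simp only [add_sub_cancel_left]
    exact hl.mem x
  · rw [eulerLagrange_add hq hv x (hl.mem x).1 hlx.1, map_neg, diracMatrix_diracInv (hE.mem x), dotProduct_add,
      dot_spatialConfig hlx (hE.mem x), dotProduct_neg, add_neg_cancel]
  · rintro v ⟨hv1, hv2, hv3⟩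
    funext x
    have e : v = fun y => v₀ y + (v y - v₀ y) := by funext y; abel
    have hm := diracMatrix_mem (hv2 x).1
    have h0 := eq_zero_of_dot_spatialConfig (configFibre.add_mem (hE.mem x) hm.1) fun l hlx => by
      have h := hv3 x l hlx
      rw [e] at h
      rwa [eulerLagrange_add (l := fun y => v y - v₀ y) hq hv x (hv2 x).1 hlx.1] at h
    rw [map_add, momenta_add, map_add, add_add_add_comm, (mem_spatialConfig hm.1).1 hm, ← diracMatrix_diracInv (hE.mem x),
      ← map_add] at h0
    have h1 := diracInv_diracMatrix (spatialConfig.add_mem (diracInv_mem (hE.mem x)) (hv2 x))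
    rw [h0, map_zero] at h1
    have h2 : v x - v₀ x = -diracInv (eulerLagrange (fun y => (z y).1) v₀ x) := by
      rw [eq_neg_iff_add_eq_zero, add_comm]; exact h1.symm
    rw [← h2]; abel

/-! ### The surface of the second-class constraints and the Dirac bracket -/

/-- `lift` as a linear map: the spatial 2-forms are the duals of the spatial momenta. -/
def liftL : Phase →ₗ[ℝ] Phase :=
  ((LinearMap.fst ℝ Config Config) + dual.comp (LinearMap.snd ℝ Config Config)).prod
    (LinearMap.snd ℝ Config Config)

theorem liftL_apply (w : Phase) : liftL w = (w.1 + dual w.2, w.2) := rfl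

theorem lift_eq {w : Phase} (hw : w ∈ reducedFibre) : lift w = liftL w := by
  obtain ⟨h0, h1, h2⟩ := mem_reducedConfig.1 hw.1
  refine Prod.ext (config_ext (fun a => ?_) (fun a => ?_) (fun a b => ?_) (fun a b => ?_)) rfl
  · exact (add_zero (om w.1 a)).symm
  · exact (add_zero (th w.1 a)).symm
  · refine Fin.cases ?_ (fun i => Fin.cases ?_ (fun j => ?_) b) a
    · exact (add_zero (bB w.1 0 b)).symm
    · exact (add_zero (bB w.1 i.succ 0)).symm
    · rw [liftL_apply, bB_add, h1, zero_add, bB_dual_succ]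
      ext A B
      simp only [Finset.sum_apply, Pi.smul_apply, smul_eq_mul]
      rfl
  · refine Fin.cases ?_ (fun i => Fin.cases ?_ (fun j => ?_) b) a
    · exact (add_zero (be w.1 0 b)).symm
    · exact (add_zero (be w.1 i.succ 0)).symm
    · rw [liftL_apply, be_add, h2, zero_add, be_dual_succ]
      ext A
      simp only [Finset.sum_apply, Pi.smul_apply, smul_eq_mul]
      rfl

theorem liftL_mem {w : Phase} (hw : w ∈ reducedFibre) : liftL w ∈ phaseFibre :=
  ⟨configFibre.add_mem hw.1.1 (dual_mem hw.2.1), hw.2.1⟩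

theorem lift_field {z : Space → Phase} (hz : IsField reducedFibre z) :
    (fun x => lift (z x)) = fun x => liftL (z x) := funext fun x => lift_eq (hz.mem x)

theorem isField_lift {z : Space → Phase} (hz : IsField reducedFibre z) :
    IsField phaseFibre fun x => liftL (z x) := hz.linear liftL fun _ => liftL_mem

theorem secondClass_surface {w : Phase} (hw : w ∈ phaseFibre) :
    (∀ l ∈ spatialConfig, dotProduct l (w.2 - momenta w.1) = 0) ↔ ∃! y, y ∈ reducedFibre ∧ lift y = w := by
  have hm := momenta_mem hw.1
  constructor
  · intro h
    have h0 := eq_zero_of_dot_spatialConfig (configFibre.sub_mem hw.2 hm.1) h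
    rw [momenta_sub, momenta_momenta hw.1, sub_zero, map_sub, spat_momenta hw.1] at h0
    -- The part dual to `momenta w.2` expresses `Φ^{ij} = φ^{ij} = 0`, the other one fixes `B_{ij}`, `β_{ij}`.
    have h1 : momenta w.2 = 0 := by
      have := congrArg momenta h0
      rwa [momenta_add, momenta_sub, momenta_eq_zero (spat_mem hw.2), momenta_momenta hw.1,
        momenta_dual (momenta_mem hw.2).1, spat_momenta hw.2, sub_zero, zero_add,
        momenta_eq_zero reducedConfig.zero_mem] at this
    have h2 : spat w.2 = momenta w.1 := by
      rwa [h1, map_zero, add_zero, sub_eq_zero] at h0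
    have h3 : w.2 ∈ reducedConfig := by
      have := sub_dual_mem hw.2
      rwa [h1, map_zero, sub_zero] at this
    have h4 : dual w.2 = dual (momenta w.1) := by rw [← h2, dual_spat]
    refine ⟨(w.1 - dual (momenta w.1), w.2), ⟨⟨sub_dual_mem hw.1, h3⟩, ?_⟩, ?_⟩
    · rw [lift_eq (w := (w.1 - dual (momenta w.1), w.2)) ⟨sub_dual_mem hw.1, h3⟩, liftL_apply, h4, sub_add_cancel]
    · rintro y ⟨hy, rfl⟩
      rw [← h4, lift_eq hy, liftL_apply, add_sub_cancel_right]
  · rintro ⟨y, ⟨hy, rfl⟩, -⟩ l hl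
    rw [lift_eq hy, liftL_apply]
    have e : momenta (y.1 + dual y.2) = spat y.2 := by
      rw [momenta_add, momenta_eq_zero hy.1, momenta_dual hy.2.1, zero_add]
    have hs := spat_mem hy.2.1
    rw [e, dot_spatialConfig hl (configFibre.sub_mem hy.2.1 hs.1), map_sub, momenta_sub, momenta_eq_zero hy.2,
      momenta_eq_zero hs, spat_spat, sub_self, sub_self, map_zero, add_zero, dotProduct_zero]

/-- The transpose of `liftL`. -/
def liftT : Phase →ₗ[ℝ] Phase :=
  ((LinearMap.id - dual.comp momentaL).comp (LinearMap.fst ℝ Config Config)).prod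
    ((2 : ℝ) • momentaL.comp (LinearMap.fst ℝ Config Config)
      + (LinearMap.id - dual.comp momentaL).comp (LinearMap.snd ℝ Config Config))

theorem liftT_apply (f : Phase) : liftT f = (f.1 - dual (momenta f.1),
    (2 : ℝ) • momenta f.1 + (f.2 - dual (momenta f.2))) := rfl

theorem liftT_mem {f : Phase} (hf : f ∈ phaseFibre) : liftT f ∈ reducedFibre :=
  ⟨sub_dual_mem hf.1, reducedConfig.add_mem (reducedConfig.smul_mem _ (momenta_mem hf.1)) (sub_dual_mem hf.2)⟩

/-- The dual of anything is orthogonal to the configurations without spatial 2-forms. -/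
theorem dot_dual_reduced {p q : Config} (hp : p ∈ configFibre) (hq : q ∈ reducedConfig) :
    dotProduct (dual p) q = 0 := by
  rw [dot_dual hp hq.1, momenta_eq_zero hq, dotProduct_zero, mul_zero]

theorem pair_liftT {f w : Phase} (hf : f ∈ phaseFibre) (hw : w ∈ reducedFibre) :
    pair (liftT f) w = pair f (liftL w) := by
  rw [liftT_apply, liftL_apply, pair, pair, dotProduct_add, sub_dotProduct, add_dotProduct, sub_dotProduct,
    dot_dual_reduced (momenta_mem hf.1).1 hw.1, dot_dual_reduced (momenta_mem hf.2).1 hw.2, smul_dotProduct,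
    dotProduct_comm f.1 (dual w.2), dot_dual hw.2.1 hf.1, dotProduct_comm w.2, smul_eq_mul]
  ring

theorem HasGradient.restrict {F : Density} {z f : Space → Phase} (hz : IsField reducedFibre z)
    (hF : HasGradient phaseFibre F (fun x => liftL (z x)) f) :
    HasGradient reducedFibre (restrict F) z fun x => liftT (f x) :=
  (hF.comp_linear liftL liftT (fun _ => liftL_mem) (fun _ => liftT_mem)
    fun _ hv _ hw => pair_liftT hv hw).congr hz fun z hz x => by rw [PoincareBF.restrict, lift_field hz]

theorem mem_secondClassCovectors {s : Phase} :
    s ∈ secondClassCovectors ↔ ∃ l ∈ spatialConfig, s = primaryCovector l := by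
  constructor
  · rintro ⟨hs, l, hl, h⟩
    have hc := primaryCovector_mem hl.1
    have hd := phaseFibre.sub_mem hs hc
    -- `pair` is positive definite, so a covector is determined by its values.
    have h0 : pair (s - primaryCovector l) (s - primaryCovector l) = 0 := by
      have e : s - primaryCovector l = s + (-1 : ℝ) • primaryCovector l := by module
      have h1 : ∀ w ∈ phaseFibre, pair (s - primaryCovector l) w = 0 := fun w hw => by
        rw [e, pair_add_left, pair_smul_left, h w hw, pair_primaryCovector hl.1 hw]
        ring
      exact h1 _ hd
    have p1 := dotProduct_self_star_nonneg (s - primaryCovector l).1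
    have p2 := dotProduct_self_star_nonneg (s - primaryCovector l).2
    rw [pair] at h0
    simp only [star_trivial] at p1 p2
    refine ⟨l, hl, sub_eq_zero.1 (Prod.ext ?_ ?_)⟩
    · exact dotProduct_self_eq_zero.1 (by linarith)
    · exact dotProduct_self_eq_zero.1 (by linarith)
  · rintro ⟨l, hl, rfl⟩
    exact ⟨primaryCovector_mem hl.1, l, hl, fun w hw => pair_primaryCovector hl.1 hw⟩

/-- The multiplier of the second-class constraints that makes a functional with differential `f` commute
with all of them. -/
def correction : Phase →ₗ[ℝ] Config :=
  diracInv.comp ((LinearMap.fst ℝ Config Config) + momentaL.comp (LinearMap.snd ℝ Config Config))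

theorem correction_apply (f : Phase) : correction f = diracInv (f.1 + momenta f.2) := rfl

section
variable {f : Phase} (hf : f ∈ phaseFibre)
include hf

theorem correction_arg_mem : f.1 + momenta f.2 ∈ configFibre := configFibre.add_mem hf.1 (momenta_mem hf.2).1

theorem correction_mem : correction f ∈ spatialConfig := diracInv_mem (correction_arg_mem hf)

theorem correction_eq : correction f = (2 : ℝ) • momenta f.1 - dual f.1 - dual (momenta f.2) := by
  rw [correction_apply, diracInv_apply, momenta_add, map_add, momenta_momenta hf.2]
  module

theorem poisson_correction {m l : Config} (hm : m ∈ spatialConfig) (hl : l ∈ spatialConfig) :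
    poisson (f + primaryCovector m) (primaryCovector l)
      = dotProduct l ((f.1 + momenta f.2) - diracMatrix m) := by
  rw [poisson_primaryCovector (phaseFibre.add_mem hf (primaryCovector_mem hm.1)) hl.1, primaryCovector_apply,
    diracMatrix_apply]
  congr 1
  simp only [Prod.fst_add, Prod.snd_add, momenta_add]
  abel

/-- The correction exists and is unique, because the second-class constraints have a non-degenerate
bracket matrix. -/
theorem commutes_iff {m : Config} (hm : m ∈ spatialConfig) :
    (∀ s ∈ secondClassCovectors, poisson (f + primaryCovector m) s = 0) ↔ m = correction f := by
  have ha := correction_arg_mem hf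
  have hd := diracMatrix_mem hm.1
  constructor
  · intro h
    have h0 := eq_zero_of_dot_spatialConfig (configFibre.sub_mem ha hd.1) fun l hl => by
      rw [← poisson_correction hf hm hl]
      exact h _ (mem_secondClassCovectors.2 ⟨l, hl, rfl⟩)
    rw [map_sub, momenta_sub, map_sub, sub_add_sub_comm, (mem_spatialConfig hd.1).1 hd, ← diracMatrix_diracInv ha,
      sub_eq_zero] at h0
    rw [← diracInv_diracMatrix hm, ← h0, diracInv_diracMatrix (diracInv_mem ha), correction_apply]
  · rintro rfl s hs
    obtain ⟨l, hl, rfl⟩ := mem_secondClassCovectors.1 hs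
    rw [poisson_correction hf hm hl, correction_apply, diracMatrix_diracInv ha, dotProduct_sub,
      ← dot_spatialConfig hl ha, sub_self]

theorem add_correction : f + primaryCovector (correction f) = liftT f + (0, -dual f.1) := by
  rw [correction_eq hf, primaryCovector_apply, liftT_apply]
  refine Prod.ext ?_ ?_
  · simp only [Prod.fst_add, map_sub, map_smul, dual_dual]
    module
  · simp only [Prod.snd_add]
    module

/-- The corrected differentials have the same bracket as the differentials of the restrictions to the
reduced phase space. -/
theorem poisson_corrected {g : Phase} (hg : g ∈ phaseFibre) :
    poisson (f + primaryCovector (correction f)) (g + primaryCovector (correction g))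
      = poisson (liftT f) (liftT g) := by
  have h1 : ∀ {f g : Phase}, f ∈ phaseFibre → g ∈ phaseFibre → dotProduct (dual f.1) (liftT g).1 = 0 :=
    fun hf hg => dot_dual_reduced hf.1 (liftT_mem hg).1
  rw [add_correction hf, add_correction hg]
  simp only [poisson, Prod.fst_add, Prod.snd_add, add_zero, dotProduct_add, dotProduct_neg, add_dotProduct,
    neg_dotProduct, h1 hf hg, dotProduct_comm (liftT f).1 (dual _), h1 hg hf, neg_zero]

end

/-- On the reduced phase space the Dirac bracket is the canonical bracket. -/
theorem HasDiracBracket.hasBracket {F G : Density} {z : Space → Phase} {c : ℝ} (hz : IsField reducedFibre z)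
    (h : HasDiracBracket F G (fun x => lift (z x)) c) :
    HasBracket reducedFibre (restrict F) (restrict G) z c := by
  obtain ⟨f, g, a, b, hf, hg, -, -, hab, hc, hi, rfl⟩ := h
  rw [lift_field hz] at hf hg
  have e : ∀ x, poisson (f x + a x) (g x + b x) = poisson (liftT (f x)) (liftT (g x)) := fun x => by
    obtain ⟨m, hm, ha⟩ := mem_secondClassCovectors.1 (hab x).1
    obtain ⟨n, hn, hb⟩ := mem_secondClassCovectors.1 (hab x).2
    have h1 := (commutes_iff (hf.isField.mem x) hm).1 fun s hs => ha ▸ (hc x s hs).1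
    have h2 := (commutes_iff (hg.isField.mem x) hn).1 fun s hs => hb ▸ (hc x s hs).2
    rw [ha, hb, h1, h2, poisson_corrected (hf.isField.mem x) (hg.isField.mem x)]
  simp only [e] at hi ⊢
  exact ⟨_, _, hf.restrict hz, hg.restrict hz, hi, rfl⟩

theorem exists_hasDiracBracket {F G : Density} {z f g : Space → Phase}
    (hf : HasGradient phaseFibre F z f) (hg : HasGradient phaseFibre G z g)
    (hs : HasCompactSupport f ∨ HasCompactSupport g) : ∃ c, HasDiracBracket F G z c := by
  have hcor : ∀ {f : Space → Phase}, IsField phaseFibre f →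
      IsField phaseFibre fun x => primaryCovector (correction (f x)) := fun hf =>
    hf.linear (primaryCovector.comp correction) fun _ h => primaryCovector_mem (correction_mem h).1
  have hsum : ∀ {f : Space → Phase}, IsField phaseFibre f →
      ContDiff ℝ ∞ fun x => f x + primaryCovector (correction (f x)) := fun hf =>
    hf.smooth.add (hcor hf).smooth
  have hsupp : ∀ {f : Space → Phase}, HasCompactSupport f →
      HasCompactSupport fun x => f x + primaryCovector (correction (f x)) := fun h =>
    h.mono fun x hx h0 => hx (by simp only [h0, map_zero, add_zero])
  refine ⟨_, f, g, _, _, hf, hg, hcor hf.isField, hcor hg.isField, fun x => ?_, fun x s hs => ?_, ?_, rfl⟩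
  · exact ⟨mem_secondClassCovectors.2 ⟨_, correction_mem (hf.isField.mem x), rfl⟩,
      mem_secondClassCovectors.2 ⟨_, correction_mem (hg.isField.mem x), rfl⟩⟩
  · exact ⟨(commutes_iff (hf.isField.mem x) (correction_mem (hf.isField.mem x))).2 rfl s hs,
      (commutes_iff (hg.isField.mem x) (correction_mem (hg.isField.mem x))).2 rfl s hs⟩
  · rcases hs with hs | hs
    · exact integrable_poisson_left (hsum hf.isField) (hsum hg.isField) (hsupp hs)
    · exact integrable_poisson_right (hsum hf.isField) (hsum hg.isField) (hsupp hs)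

/-! ### Brackets on the reduced phase space -/

theorem dot_red_red (T T' : Par) (S S' : SPar) : dotProduct (redConfig T S) (redConfig T' S') =
    ipB T.1 T'.1 + ipV T.2.1 T'.2.1 + 2 * (∑ i, ipB (T.2.2.1 i) (T'.2.2.1 i))
      + 2 * (∑ i, ipV (T.2.2.2 i) (T'.2.2.2 i)) + (∑ i, ipB (S.1 i) (S'.1 i)) + ∑ i, ipV (S.2 i) (S'.2 i) := by
  rw [dot_eq]
  simp only [Fin.sum_univ_succ (n := 3), om_red_zero, om_red_succ, th_red_zero, th_red_succ, bB_red_zero,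
    bB_red_zero_succ, bB_red_succ_zero, bB_red_succ, be_red_zero, be_red_zero_succ, be_red_succ_zero,
    be_red_succ, map_neg, map_zero, LinearMap.neg_apply, neg_neg, Finset.sum_const_zero, add_zero, zero_add]
  ring

/-- The parameters with the components of the 1-forms halved; it compensates for the two equal
contributions of the components `0i` and `i0` to contractions. -/
def half : Par →ₗ[ℝ] Par :=
  LinearMap.prodMap LinearMap.id (LinearMap.prodMap LinearMap.id ((1 / 2 : ℝ) • LinearMap.id))

theorem half_apply (N : Par) : half N = (N.1, N.2.1, (1 / 2 : ℝ) • N.2.2.1, (1 / 2 : ℝ) • N.2.2.2) := rfl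

theorem half_mem {N : Par} (hN : N ∈ parFibre) : half N ∈ parFibre :=
  ⟨hN.1, fun i => skew.smul_mem _ (hN.2 i)⟩

/-- The differential of the first-class primary constraints smeared with `N`. -/
def primCovector : Par →ₗ[ℝ] Phase := (LinearMap.inr ℝ Config Config).comp
  (redL.comp ((LinearMap.inl ℝ Par SPar).comp half))

theorem primCovector_apply (N : Par) : primCovector N = (0, redConfig (half N) 0) := rfl

theorem primCovector_mem {N : Par} (hN : N ∈ parFibre) : primCovector N ∈ reducedFibre :=
  ⟨reducedConfig.zero_mem, redConfig_mem (half_mem hN) sparFibre.zero_mem⟩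

theorem temporalMomenta_eq (w : Phase) : temporalMomenta w = temporalPart w.2 := rfl

theorem pair_primCovector (N : Par) {h : Phase} (hh : h ∈ phaseFibre) :
    pair (primCovector N) h = parPair N (temporalMomenta h) := by
  rw [primCovector_apply, pair, dot_red _ _ hh.2, parPair_eq, half_apply]
  simp only [zero_dotProduct, Prod.fst_zero, Prod.snd_zero, Pi.zero_apply, Pi.smul_apply, map_zero,
    LinearMap.zero_apply, Finset.sum_const_zero, map_smul, LinearMap.smul_apply, smul_eq_mul, ← Finset.mul_sum,
    temporalMomenta]
  ring

theorem poisson_prim_temp (N K : Par) : poisson (primCovector N) (tempCovector K) = -parPair N K := by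
  rw [poisson, primCovector_apply, tempCovector_apply, dot_red_red, half_apply, parPair_eq]
  simp only [zero_dotProduct, Prod.fst_zero, Prod.snd_zero, Pi.zero_apply, Pi.smul_apply, map_zero,
    Finset.sum_const_zero, map_smul, LinearMap.smul_apply, smul_eq_mul, ← Finset.mul_sum]
  ring

theorem poisson_prim_prim (N N' : Par) : poisson (primCovector N) (primCovector N') = 0 := by
  simp [poisson, primCovector_apply]

theorem poisson_temp_temp (K K' : Par) : poisson (tempCovector K) (tempCovector K') = 0 := by
  simp [poisson, tempCovector_apply]

theorem poisson_prim_sec (N' : Par) (w : Phase) (N : Par) (d : Fin 3 → Par) :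
    poisson (primCovector N') (sharp (secX w N d)) = 0 := by
  rw [poisson_comm, poisson_sharp_left, primCovector_apply, pair, secX, dot_red_red]
  simp

theorem poisson_temp_sec (K : Par) (w : Phase) (N : Par) (d : Fin 3 → Par) :
    poisson (tempCovector K) (sharp (secX w N d)) = 0 := by
  rw [poisson_comm, poisson_sharp_left, tempCovector_apply, pair, secX, dot_red_red]
  simp

theorem poisson_add_left (f g h : Phase) : poisson (f + g) h = poisson f h + poisson g h := by
  simp only [← poissonL_apply, map_add, LinearMap.add_apply]
theorem poisson_add_right (f g h : Phase) : poisson f (g + h) = poisson f g + poisson f h := by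
  simp only [← poissonL_apply, map_add]
theorem poisson_neg_left (f g : Phase) : poisson (-f) g = -poisson f g := by
  simp only [← poissonL_apply, map_neg, LinearMap.neg_apply]
theorem poisson_neg_right (f g : Phase) : poisson f (-g) = -poisson f g := by
  simp only [← poissonL_apply, map_neg]

section
variable {z : Space → Phase} (hz : IsField reducedFibre z)
include hz

theorem hasGradient_prim {N : Space → Par} (hN : IsField parFibre N) :
    HasGradient reducedFibre (prim N) z fun x => primCovector (N x) :=
  (hasGradient_pair hz (hN.linear primCovector fun _ => primCovector_mem)).congr hz fun _ hz x =>
    (pair_primCovector _ (reducedFibre_le (hz.mem x))).symm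

theorem hasGradient_sec_reduced {N : Space → Par} (hN : IsField parFibre N) :
    HasGradient reducedFibre (sec N) z fun x => sharp (secField N z x) :=
  hasGradient_sec le_rfl reducedFibre_le hz hN

end

theorem legendre_liftL {w : Phase} (hw : w ∈ reducedFibre) :
    legendre (liftL w) = (w.1 + dual w.2, spat w.2) := by
  rw [legendre_apply, liftL_apply, momenta_add, momenta_eq_zero hw.1, momenta_dual hw.2.1, zero_add]

/-- The canonical Hamiltonian on the surface of the second-class constraints. -/
theorem restrict_canonicalHamiltonian {z : Space → Phase} (hz : IsField reducedFibre z) (x : Space) :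
    restrict canonicalHamiltonian z x = canonDensity z x := by
  have hl := isField_lift hz
  have hz' := hz.mono reducedFibre_le
  have hLL : IsField phaseFibre fun y => legendre (liftL (z y)) := hl.linear legendre fun _ => legendre_mem
  have hj : jet (fun y => legendre (liftL (z y))) x = fun i => legendre (liftL (jet z x i)) := funext fun i =>
    dd_linear i (legendre.comp liftL) (hz.differentiable x)
  have hd : ∀ i, jet z x i ∈ reducedFibre := fun i => dd_mem hz i x
  have hb : ∀ i y, boundary i (legendre (liftL (z y))) (legendre (liftL (z y))) = boundary i (z y) (z y) :=
    fun i y => by rw [legendre_liftL (hz.mem y)]; simp [boundary_apply, om_add, th_add, om_dual, th_dual, spat_apply,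
      spatialPart]
  have hc : chi (fun y => legendre (liftL (z y))) x = chi z x := by
    rw [chi_field hLL, chi_field hz', hj]
    simp only [legendre_liftL (hz.mem x), legendre_liftL (hd _)]
    simp only [chiJ, om_add, th_add, om_dual, th_dual, add_zero, spat_apply, spatialPart, om_red_succ, th_red_succ]
  have ht : temporalFields (legendre (liftL (z x))) = temporalFields (z x) := by
    rw [legendre_liftL (hz.mem x)]
    simp only [temporalFields_eq, om_add, th_add, bB_add, be_add, om_dual, th_dual, bB_dual_zero, be_dual_zero,
      add_zero]
  rw [restrict, lift_field hz, canonicalHamiltonian_eq hl, canonDensity, canonDensity, tempChi, tempChi, hc, ht]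
  simp only [hb]

theorem isField_velocity {v : Space → Config} (hv : IsField configFibre v) :
    IsField parFibre fun y => temporalFields (v y, 0) :=
  hv.linear (tfL.comp (LinearMap.inl ℝ Config Config)) fun _ h => temporalFields_mem ⟨h, configFibre.zero_mem⟩

theorem restrict_hamiltonian {z : Space → Phase} {v : Space → Config} (hz : IsField reducedFibre z)
    (hv : IsField configFibre v) (x : Space) :
    restrict (hamiltonian v) z x = prim (fun y => temporalFields (v y, 0)) z x + canonDensity z x := by
  rw [← restrict_canonicalHamiltonian hz, restrict, restrict, lift_field hz, hamiltonian_eq (isField_lift hz) x (hv.mem x)]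
  congr 1
  have e : (liftL (z x)).2 - momenta (liftL (z x)).1 = redConfig (temporalPart (z x).2) 0 := by
    have h : momenta (liftL (z x)).1 = spat (z x).2 := congrArg Prod.snd (legendre_liftL (hz.mem x))
    rw [h, liftL_apply, sub_eq_iff_eq_add]
    conv_lhs => rw [reduced_eq (hz.mem x).2]
    have := map_add redL (temporalPart (z x).2, (0 : SPar)) ((0 : Par), spatialPart (z x).2)
    simp only [Prod.mk_add_mk, add_zero, zero_add] at this
    exact this
  rw [primary, e, dotProduct_comm, dot_red _ _ (hv.mem x), prim, parPair_eq, temporalFields_eq, temporalMomenta_eq]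
  simp only [Prod.fst_zero, Prod.snd_zero, Pi.zero_apply, map_zero, LinearMap.zero_apply, Finset.sum_const_zero,
    map_smul, LinearMap.smul_apply, smul_eq_mul, ← Finset.mul_sum, add_zero]
  simp only [ipB_comm, ipV_comm]

section
variable {z : Space → Phase} (hz : IsField reducedFibre z)
include hz

theorem hasGradient_restrict_canonicalHamiltonian :
    HasGradient reducedFibre (restrict canonicalHamiltonian) z fun x => -tempChiGrad z x :=
  (hasGradient_canonDensity le_rfl reducedFibre_le hz).congr hz fun _ hz x => restrict_canonicalHamiltonian hz x

theorem hasGradient_restrict_hamiltonian {v : Space → Config} (hv : IsField configFibre v) :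
    HasGradient reducedFibre (restrict (hamiltonian v)) z
      fun x => primCovector (temporalFields (v x, 0)) + -tempChiGrad z x :=
  ((hasGradient_prim hz (isField_velocity hv)).add (hasGradient_canonDensity le_rfl reducedFibre_le hz)).congr
    hz fun _ hz x => restrict_hamiltonian hz hv x

theorem hasBracket_prim_hamiltonian {N : Space → Par} {v : Space → Config} (hN : IsTest parFibre N)
    (hv : IsField configFibre v) :
    HasBracket reducedFibre (prim N) (restrict (hamiltonian v)) z (∫ x, sec N z x) := by
  have h1 := hasGradient_prim hz hN.toIsField
  have h2 := hasGradient_restrict_hamiltonian hz hv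
  refine ⟨_, _, h1, h2, integrable_poisson_left h1.isField.smooth h2.isField.smooth
    (hN.linear primCovector fun _ => primCovector_mem).compact,
    integral_congr_ae (Filter.Eventually.of_forall fun x => ?_)⟩
  simp only [tempChiGrad, secField, poisson_add_right, poisson_neg_right, poisson_prim_prim, poisson_prim_sec,
    poisson_prim_temp, sec]
  ring

theorem hasBracket_prim_prim {N N' : Space → Par} (hN : IsTest parFibre N) (hN' : IsField parFibre N') :
    HasBracket reducedFibre (prim N) (prim N') z 0 := by
  refine ⟨_, _, hasGradient_prim hz hN.toIsField, hasGradient_prim hz hN', ?_, ?_⟩ <;>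
    simp [poisson_prim_prim]

theorem hasBracket_prim_sec {N N' : Space → Par} (hN : IsTest parFibre N) (hN' : IsField parFibre N') :
    HasBracket reducedFibre (prim N) (sec N') z 0 := by
  refine ⟨_, _, hasGradient_prim hz hN.toIsField, hasGradient_sec_reduced hz hN', ?_, ?_⟩ <;>
    simp [secField, poisson_prim_sec]

theorem isTest_sharp_secField {N : Space → Par} (hN : IsTest parFibre N) :
    IsTest reducedFibre fun x => sharp (secField N z x) :=
  (isTest_secField (hz.mono reducedFibre_le) hN).linear sharp fun _ => sharp_mem

theorem hasBracket_sec_sec {N N' : Space → Par} (hN : IsTest parFibre N) (hN' : IsField parFibre N') :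
    HasBracket reducedFibre (sec N) (sec N') z (∫ x, algebra (N x) (N' x) (chi z x)) := by
  have h1 := hasGradient_sec_reduced hz hN.toIsField
  have h2 := hasGradient_sec_reduced hz hN'
  have hz' := hz.mono reducedFibre_le
  refine ⟨_, _, h1, h2, integrable_poisson_left h1.isField.smooth h2.isField.smooth
    (isTest_sharp_secField hz hN).compact, ?_⟩
  rw [integral_poisson_sec hz' hN hN']
  simp only [algebra_eq (hN.mem _) (hN'.mem _) (chi_mem hz' _)]

/-- The secondary constraints are preserved where they vanish. -/
theorem hasBracket_sec_hamiltonian {N : Space → Par} {v : Space → Config} (hN : IsTest parFibre N)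
    (hv : IsField configFibre v) (h0 : ∀ x, chi z x = 0) :
    HasBracket reducedFibre (sec N) (restrict (hamiltonian v)) z 0 := by
  have h1 := hasGradient_sec_reduced hz hN.toIsField
  have h2 := hasGradient_restrict_hamiltonian hz hv
  have hz' := hz.mono reducedFibre_le
  refine ⟨_, _, h1, h2, integrable_poisson_left h1.isField.smooth h2.isField.smooth
    (isTest_sharp_secField hz hN).compact, ?_⟩
  have e : ∀ x, poisson (sharp (secField N z x)) (primCovector (temporalFields (v x, 0)) + -tempChiGrad z x)
      = -poisson (sharp (secField N z x)) (sharp (secField (fun y => temporalFields (z y)) z x)) := fun x => by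
    rw [poisson_comm _ (_ + _), poisson_comm _ (sharp (secField (fun y => temporalFields (z y)) z x))]
    simp only [tempChiGrad, secField, poisson_add_left, poisson_neg_left, poisson_prim_sec, poisson_temp_sec]
    ring
  simp only [e, integral_neg, integral_poisson_sec hz' hN (isField_temporalFields hz'), h0, ← parPairL_apply,
    map_zero, integral_zero, neg_zero]

end

/-! ### The Castellani chains -/

/-- `adj` as a bilinear map. -/
def adjL : Par →ₗ[ℝ] Par →ₗ[ℝ] Par :=
  LinearMap.mk₂ ℝ adj
    (by
      intros
      refine Prod.ext ?_ (Prod.ext ?_ (Prod.ext (funext fun i => ?_) (funext fun i => ?_))) <;>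
        simp only [adj, Prod.fst_add, Prod.snd_add, Pi.add_apply, map_add, LinearMap.add_apply] <;> abel)
    (by
      intros
      refine Prod.ext ?_ (Prod.ext ?_ (Prod.ext (funext fun i => ?_) (funext fun i => ?_))) <;>
        simp only [adj, Prod.smul_fst, Prod.smul_snd, Pi.smul_apply, map_smul, LinearMap.smul_apply] <;> module)
    (by
      intros
      refine Prod.ext ?_ (Prod.ext ?_ (Prod.ext (funext fun i => ?_) (funext fun i => ?_))) <;>
        simp only [adj, Prod.fst_add, Prod.snd_add, Pi.add_apply, map_add, LinearMap.add_apply] <;> abel)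
    (by
      intros
      refine Prod.ext ?_ (Prod.ext ?_ (Prod.ext (funext fun i => ?_) (funext fun i => ?_))) <;>
        simp only [adj, Prod.smul_fst, Prod.smul_snd, Pi.smul_apply, map_smul, LinearMap.smul_apply] <;> module)

/-- `coadj` as a bilinear map. -/
def coadjL : Par →ₗ[ℝ] Par →ₗ[ℝ] Par :=
  LinearMap.mk₂ ℝ coadj
    (by
      intros
      refine Prod.ext ?_ (Prod.ext ?_ (Prod.ext (funext fun i => ?_) (funext fun i => ?_))) <;>
        simp only [coadj, Prod.fst_add, Prod.snd_add, Pi.add_apply, map_add, map_sub, map_neg, LinearMap.add_apply,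
          Fin.sum_univ_three] <;> abel)
    (by
      intros
      refine Prod.ext ?_ (Prod.ext ?_ (Prod.ext (funext fun i => ?_) (funext fun i => ?_))) <;>
        simp only [coadj, Prod.smul_fst, Prod.smul_snd, Pi.smul_apply, map_smul, map_add, map_sub, map_neg,
          LinearMap.smul_apply, Fin.sum_univ_three] <;> module)
    (by
      intros
      refine Prod.ext ?_ (Prod.ext ?_ (Prod.ext (funext fun i => ?_) (funext fun i => ?_))) <;>
        simp only [coadj, Prod.fst_add, Prod.snd_add, Pi.add_apply, map_add, map_sub, map_neg, LinearMap.add_apply,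
          Fin.sum_univ_three] <;> abel)
    (by
      intros
      refine Prod.ext ?_ (Prod.ext ?_ (Prod.ext (funext fun i => ?_) (funext fun i => ?_))) <;>
        simp only [coadj, Prod.smul_fst, Prod.smul_snd, Pi.smul_apply, map_smul, map_add, map_sub, map_neg,
          LinearMap.smul_apply, Fin.sum_univ_three] <;> module)

theorem adjL_apply (N N' : Par) : adjL N N' = adj N N' := rfl
theorem coadjL_apply (N K : Par) : coadjL N K = coadj N K := rfl

theorem adj_mem {N N' : Par} (hN : N ∈ parFibre) (hN' : N' ∈ parFibre) : adj N N' ∈ parFibre :=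
  ⟨rotB_mem_skew _ hN'.1, fun i => skew.sub_mem (skew.add_mem (skew.sub_mem (rotB_mem_skew _ (hN'.2 i))
    (rotB_mem_skew _ (hN.2 i))) (wdg_mem_skew _ _)) (wdg_mem_skew _ _)⟩

theorem coadj_mem {N K : Par} (hN : N ∈ parFibre) (hK : K ∈ parFibre) : coadj N K ∈ parFibre := by
  refine ⟨lo2_mem_skew (skew.sub_mem (skew.sub_mem (rotB_mem_skew _ (lo2_mem_skew hK.1)) (wdg_mem_skew _ _))
    (Submodule.sum_mem _ fun i _ => skew.add_mem (rotB_mem_skew _ (hN.2 i)) (wdg_mem_skew _ _))), fun i => ?_⟩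
  exact lo2_mem_skew (skew.neg_mem (rotB_mem_skew _ hN.1))

theorem temporalMomenta_mem {w : Phase} (hw : w ∈ phaseFibre) : temporalMomenta w ∈ parFibre :=
  temporalPart_mem hw.2

/-- `temporalMomenta` as a linear map. -/
def tmL : Phase →ₗ[ℝ] Par where
  toFun := temporalMomenta
  map_add' _ _ := rfl
  map_smul' _ _ := rfl

theorem tmL_apply (w : Phase) : tmL w = temporalMomenta w := rfl

/-- The tensor product `x_A y_B`. -/
def tens : Vec →ₗ[ℝ] Vec →ₗ[ℝ] Biv :=
  LinearMap.mk₂ ℝ (fun x y A B => x A * y B)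
    (by intros; ext A B; simp only [Pi.add_apply]; ring)
    (by intros; ext A B; simp only [Pi.smul_apply, smul_eq_mul]; ring)
    (by intros; ext A B; simp only [Pi.add_apply]; ring)
    (by intros; ext A B; simp only [Pi.smul_apply, smul_eq_mul]; ring)

theorem lo2_mm_lo2 (V Y : Biv) (A B : Fin 4) : lo2 (mm V (lo2 Y)) A B = ∑ C, η A * V A C * Y C B := by
  simp only [lo2_apply, low2, mm_apply, Finset.mul_sum]
  refine Finset.sum_congr rfl fun C _ => ?_
  linear_combination (η A * V A C * Y C B) * (η B * η B * η_mul_self C + η_mul_self B)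

theorem lo_rotW_lo (V : Biv) (y : Vec) (A : Fin 4) : lo (rotW V (lo y)) A = ∑ C, η A * V A C * y C := by
  rw [← rotVL_eq]; rfl

theorem sum_mul_skew {Y : Biv} (hY : Y ∈ skew) (b : Vec) (A : Fin 4) : ∑ C, b C * Y C A = -rotW Y (lo b) A := by
  simp only [rotW_apply, rotV, lo_apply, low, ← Finset.sum_neg_distrib]
  refine Finset.sum_congr rfl fun C _ => ?_
  rw [hY A C]
  linear_combination (b C * Y A C) * η_mul_self C

theorem chainShift_eq {w : Phase} (hw : w ∈ phaseFibre) : chainShift w =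
    ((2 : ℝ) • lo2 (mm (om w.1 0) (lo2 (om w.2 0))) - tens (lo (th w.1 0)) (th w.2 0)
        + ∑ i : Fin 3, ((4 : ℝ) • lo2 (mm (bB w.1 0 i.succ) (lo2 (bB w.2 0 i.succ)))
          - (2 : ℝ) • tens (lo (be w.1 0 i.succ)) (be w.2 0 i.succ)),
      lo (rotW (om w.1 0) (lo (th w.2 0)))
        - ∑ i : Fin 3, (2 : ℝ) • rotW (bB w.2 0 i.succ) (lo (be w.1 0 i.succ)),
      fun i => (2 : ℝ) • lo2 (mm (om w.1 0) (lo2 (bB w.2 0 i.succ))),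
      fun i => lo (rotW (om w.1 0) (lo (be w.2 0 i.succ))) - rotW (bB w.2 0 i.succ) (lo (th w.1 0))) := by
  have hY := fun i : Fin 3 => (mem_configFibre.1 hw.2).2.1 0 i.succ
  refine Prod.ext ?_ (Prod.ext ?_ (Prod.ext (funext fun i => ?_) (funext fun i => ?_)))
  · ext A B
    simp only [chainShift, Pi.add_apply, Pi.sub_apply, Finset.sum_apply, Pi.smul_apply, lo2_mm_lo2, smul_eq_mul,
      Finset.mul_sum, mul_assoc]
    rfl
  · ext A
    simp only [chainShift, Pi.sub_apply, Finset.sum_apply, Pi.smul_apply, lo_rotW_lo, smul_eq_mul,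
      mul_assoc, ← Finset.mul_sum, sum_mul_skew (hY _)]
    simp only [Finset.mul_sum, mul_neg, Finset.sum_neg_distrib, sub_eq_add_neg]
  · ext A B
    simp only [chainShift, Pi.smul_apply, lo2_mm_lo2, smul_eq_mul, Finset.mul_sum, mul_assoc]
  · ext A
    simp only [chainShift, Pi.sub_apply, lo_rotW_lo, Finset.sum_add_distrib, sum_mul_skew (hY _), sub_eq_add_neg]

theorem ipB_mm {X V Y : Biv} (hX : X ∈ skew) (hV : V ∈ skew) (hY : Y ∈ skew) :
    ipB X (lo2 (mm V (lo2 Y))) = (1 / 2) * ipB (rotB X V) Y := by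
  obtain ⟨x0, x1, x2, x3, x10, x20, x30, x21, x31, x32⟩ := skew_vals hX
  obtain ⟨v0, v1, v2, v3, v10, v20, v30, v21, v31, v32⟩ := skew_vals hV
  obtain ⟨y0, y1, y2, y3, y10, y20, y30, y21, y31, y32⟩ := skew_vals hY
  simp only [ipB_apply, lo2_mm_lo2, rotB_apply, rot, Fin.sum_univ_four, η_zero, η_one, η_two, η_three, x0, x1, x2, x3,
    x10, x20, x30, x21, x31, x32, v0, v1, v2, v3, v10, v20, v30, v21, v31, v32, y0, y1, y2, y3, y10, y20, y30, y21,
    y31, y32]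
  ring

theorem ipB_tens {X : Biv} (hX : X ∈ skew) (x y : Vec) : ipB X (tens (lo x) y) = -ipV (rotW X x) y := by
  obtain ⟨x0, x1, x2, x3, x10, x20, x30, x21, x31, x32⟩ := skew_vals hX
  simp only [ipB_apply, ipV_apply, tens, LinearMap.mk₂_apply, rotW_apply, rotV, lo_apply, low, Fin.sum_univ_four,
    η_zero, η_one, η_two, η_three, x0, x1, x2, x3, x10, x20, x30, x21, x31, x32]
  ring

theorem ipV_rotW_lo {Y : Biv} (hY : Y ∈ skew) (u b : Vec) : ipV u (rotW Y (lo b)) = -ipB (wdg b u) Y := by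
  have h : ∀ A, rotW Y (lo b) A = -∑ C, b C * Y C A := fun A => by rw [sum_mul_skew hY, neg_neg]
  rw [← sum_sum_eq_wdg b u hY, Finset.sum_comm, ipV_apply]
  simp only [h, mul_neg, Finset.mul_sum, Finset.sum_neg_distrib]
  exact congrArg _ (Finset.sum_congr rfl fun A _ => Finset.sum_congr rfl fun C _ => by ring)

/-- The completion of the chains is the adjoint action on the temporal components. -/
theorem parPair_chainShift {N : Par} (hN : N ∈ parFibre) {w : Phase} (hw : w ∈ phaseFibre) :
    parPair N (chainShift w) = parPair (adj N (temporalFields w)) (temporalMomenta w) := by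
  have wo : om w.1 0 ∈ skew := (mem_configFibre.1 hw.1).1 0
  have wb := fun i : Fin 3 => (mem_configFibre.1 hw.1).2.1 0 i.succ
  have hK := temporalMomenta_mem hw
  have p0 : om w.2 0 ∈ skew := hK.1
  have pb := hK.2
  change ∀ i : Fin 3, bB w.2 0 i.succ ∈ skew at pb
  have l1 : ∀ x y, ipV x (lo (rotW (om w.1 0) (lo y))) = -ipV (rotW (om w.1 0) x) y := fun x y => by
    rw [ipV_rotW wo, lo_lo]
  rw [chainShift_eq hw]
  simp only [parPair_eq, adj, temporalFields_eq, temporalMomenta, map_add, map_sub, map_smul, LinearMap.add_apply,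
    LinearMap.sub_apply, LinearMap.smul_apply, smul_eq_mul, Fin.sum_univ_three, ipB_mm hN.1 wo p0,
    ipB_mm hN.1 (wb _) (pb _), ipB_mm (hN.2 _) wo (pb _), ipB_tens hN.1, ipV_rotW_lo (pb _), l1,
    rotB_comm (hN.2 _) wo, wdg_comm (N.2.2.2 _), map_neg, LinearMap.neg_apply]
  ring

theorem chainShift_eq_zero (w : Phase) (h : temporalMomenta w = 0) : chainShift w = 0 := by
  have h1 : om w.2 0 = 0 := congrArg Prod.fst h
  have h2 : th w.2 0 = 0 := congrArg (fun p => p.2.1) h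
  have h3 : ∀ i : Fin 3, bB w.2 0 i.succ = 0 := fun i => congrArg (fun p => p.2.2.1 i) h
  have h4 : ∀ i : Fin 3, be w.2 0 i.succ = 0 := fun i => congrArg (fun p => p.2.2.2 i) h
  refine Prod.ext ?_ (Prod.ext ?_ (Prod.ext (funext fun i => ?_) (funext fun i => ?_))) <;>
    (simp only [chainShift, h1, h2, h3, h4, Pi.zero_apply, mul_zero, Finset.sum_const_zero, sub_zero, add_zero]; rfl)

/-- The functional derivative of `chainShift` smeared with `N`. -/
def shiftGrad (N : Space → Par) (z : Space → Phase) (x : Space) : Phase :=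
  primCovector (adj (N x) (temporalFields (z x))) - tempCovector (coadj (N x) (temporalMomenta (z x)))

section
variable {z : Space → Phase} (hz : IsField reducedFibre z)
include hz

theorem isField_shiftGrad {N : Space → Par} (hN : IsField parFibre N) : IsField reducedFibre (shiftGrad N z) := by
  have hT := isField_temporalFields (hz.mono reducedFibre_le)
  refine ⟨?_, fun x => ?_⟩
  · exact (contDiff_linear primCovector (contDiff_bilinear adjL hN.smooth hT.smooth)).sub
      (contDiff_linear tempCovector (contDiff_bilinear coadjL hN.smooth (contDiff_linear tmL hz.smooth)))
  · have hw := reducedFibre_le (hz.mem x)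
    exact reducedFibre.sub_mem (primCovector_mem (adj_mem (hN.mem x) (temporalFields_mem hw)))
      (tempCovector_mem (coadj_mem (hN.mem x) (temporalMomenta_mem hw)))

theorem hasGradient_shift {N : Space → Par} (hN : IsField parFibre N) :
    HasGradient reducedFibre (fun z x => parPair (N x) (chainShift (z x))) z (shiftGrad N z) := by
  have hsm : ∀ {a b : Space → Phase}, ContDiff ℝ ∞ a → ContDiff ℝ ∞ b →
      ContDiff ℝ ∞ fun x => parPair (adj (N x) (temporalFields (a x))) (temporalMomenta (b x)) := fun ha hb =>
    contDiff_bilinear parPairL (contDiff_bilinear adjL hN.smooth (contDiff_linear tfL ha)) (contDiff_linear tmL hb)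
  refine HasGradient.congr (F := fun z x => parPair (adj (N x) (temporalFields (z x))) (temporalMomenta (z x)))
    (IsLocal.hasGradient ⟨fun z hz => (hsm hz.smooth hz.smooth).continuous, fun z w x _ _ h => by rw [h.eq_of_nhds]⟩
      hz (isField_shiftGrad hz hN)
      (fun h x => parPair (adj (N x) (temporalFields (z x))) (temporalMomenta (h x))
        + parPair (adj (N x) (temporalFields (h x))) (temporalMomenta (z x)))
      (fun h x => parPair (adj (N x) (temporalFields (h x))) (temporalMomenta (h x))) 0
      (fun h hh s x => ?_) fun h hh => integral_congr_ae (Filter.Eventually.of_forall fun x => ?_)) hz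
    fun z hz x => parPair_chainShift (hN.mem x) (reducedFibre_le (hz.mem x))
  · simp only [← parPairL_apply, ← adjL_apply, ← tfL_apply, ← tmL_apply, Pi.add_apply, Pi.smul_apply, map_add,
      map_smul, LinearMap.add_apply, LinearMap.smul_apply, smul_eq_mul, Pi.zero_apply]
    ring
  · have hw := reducedFibre_le (hz.mem x)
    have hhx := reducedFibre_le (hh.mem x)
    have e : shiftGrad N z x = primCovector (adj (N x) (temporalFields (z x)))
        + (-1 : ℝ) • tempCovector (coadj (N x) (temporalMomenta (z x))) := by rw [shiftGrad]; module
    simp only [e, pair_add_left, pair_smul_left, pair_primCovector _ hhx, pair_tempCovector _ hhx,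
      parPair_coadj (hN.mem x) (temporalFields_mem hhx) (temporalMomenta_mem hw)]
    ring

/-- The functional derivative of the second link of the Castellani chains. -/
theorem hasGradient_chain {N : Space → Par} (hN : IsField parFibre N) :
    HasGradient reducedFibre (chain N) z fun x => -(sharp (secField N z x) + shiftGrad N z x) :=
  ((hasGradient_sec_reduced hz hN).add (hasGradient_shift hz hN)).neg.congr hz fun z hz x => by
    simp only [chain, sec, ← parPairL_apply, map_add]

theorem hasCompactSupport_chain {N : Space → Par} (hN : IsTest parFibre N) :
    HasCompactSupport fun x => -(sharp (secField N z x) + shiftGrad N z x) := by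
  have h1 := (isTest_sharp_secField hz hN).compact
  have h2 : HasCompactSupport (shiftGrad N z) := hN.compact.mono fun x hx h0 => hx (by
    simp only [shiftGrad, h0, ← adjL_apply, ← coadjL_apply, map_zero, LinearMap.zero_apply, sub_self])
  exact (h1.add h2).neg

/-- The brackets with the parts of the canonical Hamiltonian cancel, because `adj` is the bracket of the
secondary constraints. -/
theorem hasBracket_chain_canonicalHamiltonian {N : Space → Par} (hN : IsTest parFibre N) :
    HasBracket reducedFibre (chain N) (restrict canonicalHamiltonian) z 0 ∧
    ∫ x, poisson (-(sharp (secField N z x) + shiftGrad N z x)) (-tempChiGrad z x) = 0 := by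
  have hz' := hz.mono reducedFibre_le
  have h1 := hasGradient_chain hz hN.toIsField
  have h2 := hasGradient_restrict_canonicalHamiltonian hz
  have hT := isField_temporalFields hz'
  have h0 : ∫ x, poisson (-(sharp (secField N z x) + shiftGrad N z x)) (-tempChiGrad z x) = 0 := by
    have e : ∀ x, poisson (-(sharp (secField N z x) + shiftGrad N z x)) (-tempChiGrad z x)
        = poisson (sharp (secField N z x)) (sharp (secField (fun y => temporalFields (z y)) z x))
          - parPair (adj (N x) (temporalFields (z x))) (chi z x) := fun x => by
      have t1 : poisson (sharp (secX (z x) (N x) (jet N x))) (tempCovector (chi z x)) = 0 := by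
        rw [poisson_comm, poisson_temp_sec, neg_zero]
      simp only [shiftGrad, tempChiGrad, secField, sub_eq_add_neg, poisson_add_left, poisson_add_right,
        poisson_neg_left, poisson_neg_right, poisson_prim_sec, poisson_temp_sec, poisson_temp_temp, poisson_prim_temp, t1]
      ring
    simp only [e]
    rw [integral_sub, integral_poisson_sec hz' hN hT, sub_self]
    · exact integrable_poisson_left (isTest_sharp_secField hz hN).smooth
        (isField_sharp (isField_secField hz' hT)).smooth (isTest_sharp_secField hz hN).compact
    · refine (ContDiff.parPair (contDiff_bilinear adjL hN.smooth hT.smooth)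
        (contDiff_chi hz')).continuous.integrable_of_hasCompactSupport ?_
      exact hN.compact.mono fun x hx h0 => hx (by
        simp only [h0, ← parPairL_apply, map_zero, LinearMap.zero_apply])
  exact ⟨⟨_, _, h1, h2, integrable_poisson_left h1.isField.smooth h2.isField.smooth
    (hasCompactSupport_chain hz hN), h0.symm⟩, h0⟩

/-- The brackets with the additional terms of `H'`, the first-class primary constraints multiplied by the
velocities, are combinations of those constraints. -/
theorem hasBracket_chain_hamiltonian {N : Space → Par} {v : Space → Config} (hN : IsTest parFibre N)
    (hv : IsField configFibre v) (h0 : ∀ x, temporalMomenta (z x) = 0) :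
    HasBracket reducedFibre (chain N) (restrict (hamiltonian v)) z 0 := by
  have h1 := hasGradient_chain hz hN.toIsField
  have h2 := hasGradient_restrict_hamiltonian hz hv
  refine ⟨_, _, h1, h2, integrable_poisson_left h1.isField.smooth h2.isField.smooth
    (hasCompactSupport_chain hz hN), ?_⟩
  rw [← (hasBracket_chain_canonicalHamiltonian hz hN).2]
  refine integral_congr_ae (Filter.Eventually.of_forall fun x => ?_)
  have t1 : ∀ V, poisson (sharp (secX (z x) (N x) (jet N x))) (primCovector V) = 0 := fun V => by
    rw [poisson_comm, poisson_prim_sec, neg_zero]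
  simp only
  rw [poisson_add_right]
  simp only [shiftGrad, secField, h0, ← coadjL_apply, map_zero, sub_zero, poisson_neg_left, poisson_add_left,
    poisson_prim_prim, t1, add_zero, neg_zero, zero_add]

end

/-! ### The gauge generator -/

/-- The numerical coefficients of the four terms of the gauge generator. -/
def genCoeff : Par →ₗ[ℝ] Par :=
  (-LinearMap.id).prodMap ((-LinearMap.id).prodMap (((2 : ℝ) • LinearMap.id).prodMap ((2 : ℝ) • LinearMap.id)))

theorem genCoeff_apply (N : Par) : genCoeff N = (-N.1, -N.2.1, (2 : ℝ) • N.2.2.1, (2 : ℝ) • N.2.2.2) := rfl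

theorem genCoeff_mem {N : Par} (hN : N ∈ parFibre) : genCoeff N ∈ parFibre :=
  ⟨skew.neg_mem hN.1, fun i => skew.smul_mem _ (hN.2 i)⟩

theorem generator_eq (N M : Space → Par) (z : Space → Phase) (x : Space) :
    generator N M z x = prim (fun y => genCoeff (M y)) z x + chain (fun y => genCoeff (N y)) z x := by
  have key : ∀ P K : Par, parPair (genCoeff P) K = -parPair (P.1, 0, 0, 0) K - parPair (0, P.2.1, 0, 0) K
      + 2 * parPair (0, 0, P.2.2.1, 0) K + 2 * parPair (0, 0, 0, P.2.2.2) K := fun P K => by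
    simp only [parPair_eq, genCoeff_apply, map_neg, LinearMap.neg_apply, Pi.smul_apply, map_smul,
      LinearMap.smul_apply, smul_eq_mul, ← Finset.mul_sum, map_zero, LinearMap.zero_apply, Pi.zero_apply,
      Finset.sum_const_zero]
    ring
  simp only [generator, genJ, genP, genF, genT, prim, chain, key]
  ring

theorem covB_eq (z : Space → Phase) (i : Fin 3) {X : Space → Biv} {x : Space} (hX : DifferentiableAt ℝ X x) :
    covB z i X x = dd i X x + rotB (om (z x).1 i.succ) (X x) := by
  ext A B
  have hA : DifferentiableAt ℝ (fun y => X y A) x := differentiableAt_pi.1 hX A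
  have e : pd i (fun y => X y A B) x = dd i X x A B := (dd_apply i hA B).trans (by rw [dd_apply i hX A])
  simp only [covB, e, Pi.add_apply, rotB_apply]

theorem covV_eq (z : Space → Phase) (i : Fin 3) {X : Space → Vec} {x : Space} (hX : DifferentiableAt ℝ X x) :
    covV z i X x = dd i X x + rotW (om (z x).1 i.succ) (X x) := by
  ext A
  have e : pd i (fun y => X y A) x = dd i X x A := dd_apply i hX A
  simp only [covV, e, Pi.add_apply, rotW_apply]

/-- The gauge variation in terms of the Hamiltonian vector field of the secondary constraints. -/
theorem gaugeVariation_eq {z : Space → Phase} {N M : Space → Par} (hz : IsField phaseFibre z)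
    (hN : IsField parFibre N) (x : Space) : gaugeVariation N M z x =
      ((redConfig (half (genCoeff (M x) - adj (genCoeff (N x)) (temporalFields (z x)))) 0,
        -redConfig (coadj (genCoeff (N x)) (temporalMomenta (z x))) 0) : Phase)
      - secField (fun y => genCoeff (N y)) z x := by
  have hj : jet (fun y => genCoeff (N y)) x = fun i => genCoeff (jet N x i) := funext fun i =>
    dd_linear i genCoeff (hN.differentiable x)
  have wo := (mem_configFibre.1 (hz.mem x).1).1
  have wp : ∀ i : Fin 3, bB (z x).2 0 i.succ ∈ skew := fun i => (mem_configFibre.1 (hz.mem x).2).2.1 0 i.succ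
  have n1 : (N x).1 ∈ skew := (hN.mem x).1
  have n3 : ∀ i, (N x).2.2.1 i ∈ skew := (hN.mem x).2
  have hN' := hN.differentiable x
  have d1 : ∀ i, dd i (fun y => (N y).1) x = (jet N x i).1 := fun i => dd_fst i hN'
  have d2 : ∀ i, dd i (fun y => (N y).2.1) x = (jet N x i).2.1 := fun i =>
    (dd_fst i hN'.snd).trans (by rw [dd_snd i hN']; rfl)
  have e3 : ∀ k, DifferentiableAt ℝ (fun y => (N y).2.2.1 k) x := fun k => differentiableAt_pi.1 hN'.snd.snd.fst k
  have e4 : ∀ k, DifferentiableAt ℝ (fun y => (N y).2.2.2 k) x := fun k => differentiableAt_pi.1 hN'.snd.snd.snd k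
  have d3 : ∀ i k, dd i (fun y => (N y).2.2.1 k) x = (jet N x i).2.2.1 k := fun i k => by
    rw [dd_apply i hN'.snd.snd.fst, dd_fst i hN'.snd.snd, dd_snd i hN'.snd, dd_snd i hN']; rfl
  have d4 : ∀ i k, dd i (fun y => (N y).2.2.2 k) x = (jet N x i).2.2.2 k := fun i k => by
    rw [dd_apply i hN'.snd.snd.snd, dd_snd i hN'.snd.snd, dd_snd i hN'.snd, dd_snd i hN']; rfl
  have c1 : ∀ i, covB z i (fun y => (N y).1) x = (jet N x i).1 + rotB (om (z x).1 i.succ) (N x).1 := fun i =>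
    (covB_eq z i hN'.fst).trans (by rw [d1])
  have c2 : ∀ i, covV z i (fun y => (N y).2.1) x = (jet N x i).2.1 + rotW (om (z x).1 i.succ) (N x).2.1 := fun i =>
    (covV_eq z i hN'.snd.fst).trans (by rw [d2])
  have c3 : ∀ i k, covB z i (fun y => (N y).2.2.1 k) x
      = (jet N x i).2.2.1 k + rotB (om (z x).1 i.succ) ((N x).2.2.1 k) := fun i k =>
    (covB_eq z i (e3 k)).trans (by rw [d3])
  have c4 : ∀ i k, covV z i (fun y => (N y).2.2.2 k) x
      = (jet N x i).2.2.2 k + rotW (om (z x).1 i.succ) ((N x).2.2.2 k) := fun i k =>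
    (covV_eq z i (e4 k)).trans (by rw [d4])
  have vB : ∀ i, varB N M z x i = rotB (N x).1 (bB (z x).1 0 i.succ) - wdg (N x).2.1 (be (z x).1 0 i.succ)
      + ((M x).2.2.1 i + rotB (om (z x).1 0) ((N x).2.2.1 i)) - wdg (th (z x).1 0) ((N x).2.2.2 i) := fun i => rfl
  have vBe : ∀ i, varBe N M z x i = rotW (N x).1 (be (z x).1 0 i.succ)
      + ((M x).2.2.2 i + rotW (om (z x).1 0) ((N x).2.2.2 i)) := fun i => rfl
  -- `temporalFields` contains `2 B_{0i}` and `2 β_{0i}`; the map `half` undoes the factor.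
  have t3 : ∀ i : Fin 3, (fun A B => 2 * bB (z x).1 0 i.succ A B) = (2 : ℝ) • bB (z x).1 0 i.succ := fun i => rfl
  have t4 : ∀ i : Fin 3, (fun A => 2 * be (z x).1 0 i.succ A) = (2 : ℝ) • be (z x).1 0 i.succ := fun i => rfl
  have H3 : ∀ i, varB N M z x i = (half (genCoeff (M x) - adj (genCoeff (N x)) (temporalFields (z x)))).2.2.1 i := by
    intro i
    simp only [vB, half_apply, genCoeff_apply, adj, temporalFields, t3, t4, Prod.snd_sub, Prod.fst_sub, Pi.smul_apply,
      Pi.sub_apply, map_neg, map_smul, LinearMap.neg_apply, LinearMap.smul_apply, rotB_comm (wo 0) (n3 i),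
      wdg_comm (be (z x).1 0 i.succ) (N x).2.1, wdg_comm ((N x).2.2.2 i) (th (z x).1 0)]
    module
  have H4 : ∀ i, varBe N M z x i = (half (genCoeff (M x) - adj (genCoeff (N x)) (temporalFields (z x)))).2.2.2 i := by
    intro i
    simp only [vBe, half_apply, genCoeff_apply, adj, temporalFields, t3, t4, Prod.snd_sub, Prod.fst_sub, Pi.smul_apply,
      Pi.sub_apply, map_neg, map_smul, LinearMap.neg_apply, LinearMap.smul_apply]
    module
  refine Prod.ext (config_ext (fun a => ?_) (fun a => ?_) (fun a b => ?_) (fun a b => ?_))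
    (config_ext (fun a => ?_) (fun a => ?_) (fun a b => ?_) (fun a b => ?_))
  · refine Fin.cases ?_ (fun i => ?_) a
    · change -((M x).1 + rotB (om (z x).1 0) (N x).1) = -(M x).1 - rotB (-(N x).1) (om (z x).1 0) - 0
      rw [rotB_comm (wo 0) n1, LinearMap.map_neg, LinearMap.neg_apply]
      module
    · change -covB z i (fun y => (N y).1) x = 0 - -((jet (fun y => genCoeff (N y)) x i).1
        + rotB (om (z x).1 i.succ) (-(N x).1))
      rw [c1, hj]
      simp only [genCoeff_apply, map_neg]
      module
  · refine Fin.cases ?_ (fun i => ?_) a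
    · change -((M x).2.1 + rotW (om (z x).1 0) (N x).2.1) + rotW (N x).1 (th (z x).1 0)
        = -(M x).2.1 - (rotW (-(N x).1) (th (z x).1 0) - rotW (om (z x).1 0) (-(N x).2.1)) - 0
      rw [LinearMap.map_neg, LinearMap.neg_apply, map_neg]
      module
    · change -covV z i (fun y => (N y).2.1) x + rotW (N x).1 (th (z x).1 i.succ)
        = 0 - (-((jet (fun y => genCoeff (N y)) x i).2.1 + rotW (om (z x).1 i.succ) (-(N x).2.1))
          + rotW (-(N x).1) (th (z x).1 i.succ))
      rw [c2, hj]
      simp only [genCoeff_apply, map_neg, LinearMap.neg_apply]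
      module
  · refine Fin.cases (Fin.cases ?_ (fun j => ?_) b) (fun i => Fin.cases ?_ (fun j => ?_) b) a
    · exact (sub_zero _).symm
    · exact (H3 j).trans (sub_zero _).symm
    · change -varB N M z x i = -_ - (-0)
      rw [H3, neg_zero, sub_zero]
    · exact (sub_zero _).symm
  · refine Fin.cases (Fin.cases ?_ (fun j => ?_) b) (fun i => Fin.cases ?_ (fun j => ?_) b) a
    · exact (sub_zero _).symm
    · exact (H4 j).trans (sub_zero _).symm
    · change -varBe N M z x i = -_ - (-0)
      rw [H4, neg_zero, sub_zero]
    · exact (sub_zero _).symm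
  · refine Fin.cases ?_ (fun i => ?_) a
    · change (fun A B => rotL (N x).1 (om (z x).2 0) A B - asym (low (N x).2.1) (th (z x).2 0) A B
        + ∑ i : Fin 3, (-2 * rotL ((N x).2.2.1 i) (bB (z x).2 0 i.succ) A B
          + 2 * asym (low ((N x).2.2.2 i)) (be (z x).2 0 i.succ) A B))
        = -(coadj (genCoeff (N x)) (temporalMomenta (z x))).1 - 0
      have e : ∀ i, rotB (lo2 (bB (z x).2 0 i.succ)) ((N x).2.2.1 i)
          = -rotB ((N x).2.2.1 i) (lo2 (bB (z x).2 0 i.succ)) := fun i =>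
        rotB_comm (lo2_mem_skew (wp i)) (n3 i)
      have h : (fun A B => rotL (N x).1 (om (z x).2 0) A B - asym (low (N x).2.1) (th (z x).2 0) A B
          + ∑ i : Fin 3, (-2 * rotL ((N x).2.2.1 i) (bB (z x).2 0 i.succ) A B
            + 2 * asym (low ((N x).2.2.2 i)) (be (z x).2 0 i.succ) A B))
          = lo2 (rotB (N x).1 (lo2 (om (z x).2 0))) - lo2 (wdg (N x).2.1 (lo (th (z x).2 0)))
            + ∑ i : Fin 3, ((-2 : ℝ) • lo2 (rotB ((N x).2.2.1 i) (lo2 (bB (z x).2 0 i.succ)))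
              + (2 : ℝ) • lo2 (wdg ((N x).2.2.2 i) (lo (be (z x).2 0 i.succ)))) := by
        ext A B
        simp only [rotL_eq, asym_low_left, Pi.add_apply, Pi.sub_apply, Pi.smul_apply, smul_eq_mul, Finset.sum_apply]
      rw [h]
      simp only [coadj, genCoeff_apply, temporalMomenta, Pi.smul_apply, map_neg, map_sub, map_add, map_smul,
        LinearMap.neg_apply, LinearMap.smul_apply, e, Fin.sum_univ_three]
      module
    · have h : (fun A B => rotL (N x).1 (om (z x).2 i.succ) A B - asym (low (N x).2.1) (th (z x).2 i.succ) A B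
          + ∑ j : Fin 3, ∑ k : Fin 3, eps3 i j k * low2 (fun A B =>
            covB z j (fun y => (N y).2.2.1 k) x A B - asym (th (z x).1 j.succ) ((N x).2.2.2 k) A B) A B)
          = lo2 (rotB (N x).1 (lo2 (om (z x).2 i.succ))) - lo2 (wdg (N x).2.1 (lo (th (z x).2 i.succ)))
            + (lo2 (covB z (i + 1) (fun y => (N y).2.2.1 (i + 2)) x - wdg (th (z x).1 (i + 1).succ) ((N x).2.2.2 (i + 2)))
              - lo2 (covB z (i + 2) (fun y => (N y).2.2.1 (i + 1)) x
                - wdg (th (z x).1 (i + 2).succ) ((N x).2.2.2 (i + 1)))) := by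
        ext A B
        rw [sum_eps3_mul]
        simp only [rotL_eq, asym_low_left, Pi.add_apply, Pi.sub_apply]
        rfl
      refine h.trans ?_
      change _ = -0 - om (secX (z x) (genCoeff (N x)) (jet (fun y => genCoeff (N y)) x)).2 i.succ
      rw [hj]
      simp only [c3, secX, om_red_succ, genCoeff_apply, Pi.smul_apply, map_neg, map_sub, map_add, map_smul,
        LinearMap.neg_apply]
      module
  · refine Fin.cases ?_ (fun i => ?_) a
    · have e : ∀ i, (fun A => ∑ C, 2 * (N x).2.2.2 i C * bB (z x).2 0 i.succ A C)
          = (2 : ℝ) • lo (rotW (lo2 (bB (z x).2 0 i.succ)) ((N x).2.2.2 i)) := fun i => by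
        ext A
        simp only [Pi.smul_apply, smul_eq_mul, lo_apply, low, rotW_apply, rotV, lo2_apply, low2, Finset.mul_sum]
        refine Finset.sum_congr rfl fun C _ => ?_
        linear_combination (-2 * (N x).2.2.2 i C * bB (z x).2 0 i.succ A C) * η_mul_self A
          - (2 * η A * η A * (N x).2.2.2 i C * bB (z x).2 0 i.succ A C) * η_mul_self C
      have h : th (gaugeVariation N M z x).2 0 = lo (rotW (N x).1 (lo (th (z x).2 0)))
          + ∑ i : Fin 3, (2 : ℝ) • lo (rotW (lo2 (bB (z x).2 0 i.succ)) ((N x).2.2.2 i)) := by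
        ext A
        simp only [← e, ← rotVL_eq, Pi.add_apply, Finset.sum_apply]
        rfl
      refine h.trans ?_
      change _ = -(coadj (genCoeff (N x)) (temporalMomenta (z x))).2.1 - 0
      simp only [coadj, genCoeff_apply, temporalMomenta, Pi.smul_apply, map_neg, map_sub, map_add, map_smul,
        LinearMap.neg_apply, Fin.sum_univ_three]
      module
    · have h : th (gaugeVariation N M z x).2 i.succ = lo (rotW (N x).1 (lo (th (z x).2 i.succ)))
          + (lo (covV z (i + 1) (fun y => (N y).2.2.2 (i + 2)) x)
            - lo (covV z (i + 2) (fun y => (N y).2.2.2 (i + 1)) x)) := by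
        ext A
        simp only [← rotVL_eq, Pi.add_apply, Pi.sub_apply]
        rw [← sum_eps3_mul i fun j k => lo (covV z j (fun y => (N y).2.2.2 k) x) A]
        rfl
      refine h.trans ?_
      change _ = -0 - th (secX (z x) (genCoeff (N x)) (jet (fun y => genCoeff (N y)) x)).2 i.succ
      rw [hj]
      simp only [c4, secX, th_red_succ, genCoeff_apply, Pi.smul_apply, map_neg, map_sub, map_add, map_smul,
        LinearMap.neg_apply]
      module
  · have h : ∀ i, rotL (N x).1 (bB (z x).2 0 i.succ)
        = -(coadj (genCoeff (N x)) (temporalMomenta (z x))).2.2.1 i := fun i => by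
      simp only [rotL_eq, coadj, genCoeff_apply, temporalMomenta, map_neg, neg_neg,
        rotB_comm (lo2_mem_skew (wp i)) n1]
    refine Fin.cases (Fin.cases ?_ (fun j => ?_) b) (fun i => Fin.cases ?_ (fun j => ?_) b) a
    · change (0 : Biv) = -0 - 0
      rw [neg_zero, sub_zero]
    · exact (h j).trans (sub_zero _).symm
    · change -rotL (N x).1 (bB (z x).2 0 i.succ) = - -_ - (-0)
      rw [h, neg_zero, sub_zero]
    · change (0 : Biv) = -0 - 0
      rw [neg_zero, sub_zero]
  · have e : ∀ i : Fin 3, (fun A => ∑ C, (N x).2.1 C * bB (z x).2 0 i.succ C A)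
        = -lo (rotW (lo2 (bB (z x).2 0 i.succ)) (N x).2.1) := fun i => by
      ext A
      simp only [Pi.neg_apply, lo_apply, low, rotW_apply, rotV, lo2_apply, low2, Finset.mul_sum,
        ← Finset.sum_neg_distrib]
      refine Finset.sum_congr rfl fun C _ => ?_
      rw [wp i A C]
      linear_combination ((N x).2.1 C * bB (z x).2 0 i.succ A C) * η_mul_self A
        + (η A * η A * (N x).2.1 C * bB (z x).2 0 i.succ A C) * η_mul_self C
    have h : ∀ i, (fun A => rotVL (N x).1 (be (z x).2 0 i.succ) A + ∑ C, (N x).2.1 C * bB (z x).2 0 i.succ C A)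
        = -(coadj (genCoeff (N x)) (temporalMomenta (z x))).2.2.2 i := fun i => by
      refine (congrArg (rotVL (N x).1 (be (z x).2 0 i.succ) + ·) (e i)).trans ?_
      simp only [rotVL_eq, coadj, genCoeff_apply, temporalMomenta, map_neg, map_sub, LinearMap.neg_apply]
      abel
    refine Fin.cases (Fin.cases ?_ (fun j => ?_) b) (fun i => Fin.cases ?_ (fun j => ?_) b) a
    · change (0 : Vec) = -0 - 0
      rw [neg_zero, sub_zero]
    · exact (h j).trans (sub_zero _).symm
    · refine (congrArg (fun v : Vec => -v) (h i)).trans ?_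
      change - -_ = - -_ - (-(0 : Vec))
      rw [neg_zero, sub_zero]
    · change (0 : Vec) = -0 - 0
      rw [neg_zero, sub_zero]

theorem isField_gaugeVariation {z : Space → Phase} {N M : Space → Par} (hz : IsField reducedFibre z)
    (hN : IsField parFibre N) (hM : IsField parFibre M) : IsField reducedFibre (gaugeVariation N M z) := by
  have hz' := hz.mono reducedFibre_le
  have hT := isField_temporalFields hz'
  have hN' : IsField parFibre fun y => genCoeff (N y) := hN.linear genCoeff fun _ => genCoeff_mem
  have hX := isField_secField hz' hN'
  have e : gaugeVariation N M z = fun x => ((redConfig (half (genCoeff (M x)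
      - adj (genCoeff (N x)) (temporalFields (z x)))) 0,
        -redConfig (coadj (genCoeff (N x)) (temporalMomenta (z x))) 0) : Phase)
      - secField (fun y => genCoeff (N y)) z x := funext fun x => gaugeVariation_eq hz' hN x
  rw [e]
  refine ⟨ContDiff.sub (ContDiff.prodMk (ContDiff.redConfig (contDiff_linear half
    ((contDiff_linear genCoeff hM.smooth).sub (contDiff_bilinear adjL hN'.smooth hT.smooth))) contDiff_const)
    (ContDiff.neg (ContDiff.redConfig (contDiff_bilinear coadjL hN'.smooth (contDiff_linear tmL hz.smooth))
      contDiff_const))) hX.smooth, fun x => reducedFibre.sub_mem ⟨?_, ?_⟩ (hX.mem x)⟩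
  · exact redConfig_mem (half_mem (parFibre.sub_mem (genCoeff_mem (hM.mem x))
      (adj_mem (hN'.mem x) (hT.mem x)))) sparFibre.zero_mem
  · exact reducedConfig.neg_mem (redConfig_mem (coadj_mem (hN'.mem x) (temporalMomenta_mem (hz'.mem x)))
      sparFibre.zero_mem)

theorem hasBracket_generator {z a : Space → Phase} {N M : Space → Par} (hz : IsField reducedFibre z)
    (hN : IsField parFibre N) (hM : IsField parFibre M) (ha : IsTest reducedFibre a) :
    HasBracket reducedFibre (fun z' x => pair (a x) (z' x)) (generator N M) z
      (∫ x, pair (a x) (gaugeVariation N M z x)) := by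
  have hz' := hz.mono reducedFibre_le
  have hN' : IsField parFibre fun y => genCoeff (N y) := hN.linear genCoeff fun _ => genCoeff_mem
  have hM' : IsField parFibre fun y => genCoeff (M y) := hM.linear genCoeff fun _ => genCoeff_mem
  have h1 := hasGradient_pair hz ha.toIsField
  have h2 := ((hasGradient_prim hz hM').add (hasGradient_chain hz hN')).congr (G := generator N M) hz
    fun z _ x => generator_eq N M z x
  refine ⟨_, _, h1, h2, integrable_poisson_left h1.isField.smooth h2.isField.smooth ha.compact,
    integral_congr_ae (Filter.Eventually.of_forall fun x => ?_)⟩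
  simp only
  rw [gaugeVariation_eq hz' hN]
  simp only [Pi.add_apply, shiftGrad, pair, poisson, primCovector_apply, tempCovector_apply, sharp, LinearMap.coe_mk,
    AddHom.coe_mk, Prod.fst_add, Prod.snd_add, Prod.fst_sub, Prod.snd_sub, Prod.fst_neg, Prod.snd_neg]
  have e : redConfig (half (genCoeff (M x) - adj (genCoeff (N x)) (temporalFields (z x)))) 0
      = redConfig (half (genCoeff (M x))) 0 - redConfig (half (adj (genCoeff (N x)) (temporalFields (z x)))) 0 := by
    have := map_sub (redL.comp ((LinearMap.inl ℝ Par SPar).comp half)) (genCoeff (M x))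
      (adj (genCoeff (N x)) (temporalFields (z x)))
    exact this
  simp only [e, dotProduct_add, dotProduct_sub, dotProduct_neg, dotProduct_zero]
  ring

/-! ### Reducibility of the secondary constraints -/

theorem lo_rotW_lo2 (Y : Biv) (b : Vec) : lo (rotW (lo2 Y) b) = rotW Y (lo b) := by
  ext A
  simp only [lo_apply, low, rotW_apply, rotV, lo2_apply, low2, Finset.mul_sum]
  refine Finset.sum_congr rfl fun C _ => ?_
  linear_combination (η C * η C * Y A C * b C) * η_mul_self A

/-- The Jacobi identity in cyclic form. -/
theorem rotB_jacobi {U V W : Biv} (hU : U ∈ skew) (hV : V ∈ skew) (hW : W ∈ skew) :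
    rotB U (rotB V W) + rotB V (rotB W U) + rotB W (rotB U V) = 0 := by
  have e1 := rotB_rotB hU V W
  have e2 : rotB (rotB U V) W = -rotB W (rotB U V) := rotB_comm (rotB_mem_skew U hV) hW
  have e3 : rotB V (rotB U W) = -rotB V (rotB W U) := by rw [rotB_comm hU hW, map_neg]
  rw [e2, e3] at e1
  rw [e1]
  abel

section
variable {z : Space → Phase} (hz : IsField phaseFibre z)
include hz

/-- The spatial Bianchi identity `D_{[i} Ω_{jk]} = 0`. -/
theorem bianchi_curvature (x : Space) :
    ∑ i : Fin 3, (dd i (fun y => (chi z y).2.2.1 i) x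
      + lo2 (rotB (om (z x).1 i.succ) (lo2 ((chi z x).2.2.1 i)))) = 0 := by
  have hs : ∀ a y, om (z y).1 a ∈ skew := fun a y => skew_of_phase (hz.mem y) a
  have hf : ∀ i : Fin 3, ContDiff ℝ ∞ fun y => om (z y).1 i.succ := fun i => by
    have := hz.smooth.fst; fun_prop
  obtain ⟨f, hfe⟩ : ∃ f : Fin 3 → Space → Biv, ∀ i, f i = fun y => om (z y).1 i.succ := ⟨_, fun i => rfl⟩
  have hf' : ∀ i, ContDiff ℝ ∞ (f i) := fun i => by rw [hfe]; exact hf i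
  have hsk : ∀ i y, f i y ∈ skew := fun i y => by rw [hfe]; exact hs _ y
  have hd : ∀ (i j : Fin 3) (y : Space), om (jet z y i).1 j.succ = dd i (f j) y := fun i j y => by
    have h1 := dd_linear i ((omL j.succ).comp (LinearMap.fst ℝ Config Config)) (hz.differentiable y)
    rw [hfe]; exact h1.symm
  have hv : ∀ i y, f i y = om (z y).1 i.succ := fun i y => by rw [hfe]
  have hc : ∀ i, (fun y => (chi z y).2.2.1 i) = fun y => lo2 ((1 / 2 : ℝ) • (dd (i + 1) (f (i + 2)) y
      - dd (i + 2) (f (i + 1)) y + rotB (f (i + 1) y) (f (i + 2) y))) := fun i => funext fun y => by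
    rw [chi_field hz]
    simp only [chiJ, hd, hv]
  have dF : ∀ i j, Differentiable ℝ (dd i (f j)) := fun i j => (contDiff_dd i (hf' j)).differentiable (by simp)
  have df : ∀ i, Differentiable ℝ (f i) := fun i => (hf' i).differentiable (by simp)
  have dr : ∀ i j, Differentiable ℝ fun y => rotB (f i y) (f j y) := fun i j =>
    (contDiff_bilinear rotB (hf' i) (hf' j)).differentiable (by simp)
  have key : ∀ i, dd i (fun y => (chi z y).2.2.1 i) x = lo2 ((1 / 2 : ℝ) • (dd i (dd (i + 1) (f (i + 2))) x
      - dd i (dd (i + 2) (f (i + 1))) x + (rotB (dd i (f (i + 1)) x) (f (i + 2) x)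
        + rotB (f (i + 1) x) (dd i (f (i + 2)) x)))) := fun i => by
    have h1 : DifferentiableAt ℝ (fun y => dd (i + 1) (f (i + 2)) y - dd (i + 2) (f (i + 1)) y) x :=
      (dF _ _).sub (dF _ _) x
    have h2 : DifferentiableAt ℝ (fun y => dd (i + 1) (f (i + 2)) y - dd (i + 2) (f (i + 1)) y
      + rotB (f (i + 1) y) (f (i + 2) y)) x := h1.add (dr _ _ x)
    rw [hc, dd_linear i lo2 (h2.fun_const_smul (1 / 2 : ℝ)), dd_const_smul i _ h2, dd_add i h1 (dr _ _ x), dd_sub i (dF _ _ x) (dF _ _ x),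
      dd_bilinear i rotB (df _ x) (df _ x)]
  simp only [key, ← hv, fun i => congrFun (hc i) x, lo2_lo2, ← map_add, ← map_sum]
  rw [← map_zero lo2]
  congr 1
  have J := rotB_jacobi (hsk 0 x) (hsk 1 x) (hsk 2 x)
  have c : ∀ i j k, rotB (dd i (f j) x) (f k x) = -rotB (f k x) (dd i (f j) x) := fun i j k =>
    rotB_comm (dd_mem ⟨hf' j, hsk j⟩ i x) (hsk k x)
  simp only [Fin.sum_univ_three, Fin.isValue, Fin.reduceAdd, zero_add, c, map_add, map_sub, map_smul,
    dd_comm 1 0 (hf' _) x, dd_comm 2 0 (hf' _) x, dd_comm 2 1 (hf' _) x]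
  linear_combination (norm := module) (1 / 2 : ℝ) • J

/-- The spatial Bianchi identity `D_{[i} Θ_{jk]} = Ω_{[ij} θ_{k]}`. -/
theorem bianchi_torsion (x : Space) :
    ∑ i : Fin 3, (dd i (fun y => (chi z y).2.2.2 i) x + lo (rotW (om (z x).1 i.succ) (lo ((chi z x).2.2.2 i)))
      - lo (rotW (lo2 ((chi z x).2.2.1 i)) (th (z x).1 i.succ))) = 0 := by
  have hs : ∀ a y, om (z y).1 a ∈ skew := fun a y => skew_of_phase (hz.mem y) a
  have hf : ∀ i : Fin 3, ContDiff ℝ ∞ fun y => om (z y).1 i.succ := fun i => by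
    have := hz.smooth.fst; fun_prop
  have he : ∀ i : Fin 3, ContDiff ℝ ∞ fun y => th (z y).1 i.succ := fun i => by
    have := hz.smooth.fst; fun_prop
  obtain ⟨f, hfe⟩ : ∃ f : Fin 3 → Space → Biv, ∀ i, f i = fun y => om (z y).1 i.succ := ⟨_, fun i => rfl⟩
  obtain ⟨e, hee⟩ : ∃ e : Fin 3 → Space → Vec, ∀ i, e i = fun y => th (z y).1 i.succ := ⟨_, fun i => rfl⟩
  have hf' : ∀ i, ContDiff ℝ ∞ (f i) := fun i => by rw [hfe]; exact hf i
  have he' : ∀ i, ContDiff ℝ ∞ (e i) := fun i => by rw [hee]; exact he i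
  have hsk : ∀ i y, f i y ∈ skew := fun i y => by rw [hfe]; exact hs _ y
  have hd : ∀ (i j : Fin 3) (y : Space), om (jet z y i).1 j.succ = dd i (f j) y := fun i j y => by
    have h1 := dd_linear i ((omL j.succ).comp (LinearMap.fst ℝ Config Config)) (hz.differentiable y)
    rw [hfe]; exact h1.symm
  have hde : ∀ (i j : Fin 3) (y : Space), th (jet z y i).1 j.succ = dd i (e j) y := fun i j y => by
    have h1 := dd_linear i ((thL j.succ).comp (LinearMap.fst ℝ Config Config)) (hz.differentiable y)
    rw [hee]; exact h1.symm
  have hv : ∀ i y, f i y = om (z y).1 i.succ := fun i y => by rw [hfe]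
  have hve : ∀ i y, e i y = th (z y).1 i.succ := fun i y => by rw [hee]
  have hc3 : ∀ i, (chi z x).2.2.1 i = lo2 ((1 / 2 : ℝ) • (dd (i + 1) (f (i + 2)) x
      - dd (i + 2) (f (i + 1)) x + rotB (f (i + 1) x) (f (i + 2) x))) := fun i => by
    rw [chi_field hz]
    simp only [chiJ, hd, hv]
  have hc : ∀ i, (fun y => (chi z y).2.2.2 i) = fun y => lo ((1 / 2 : ℝ) • (dd (i + 1) (e (i + 2)) y
      - dd (i + 2) (e (i + 1)) y + rotW (f (i + 1) y) (e (i + 2) y) - rotW (f (i + 2) y) (e (i + 1) y))) :=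
    fun i => funext fun y => by
      rw [chi_field hz]
      simp only [chiJ, hde, hv, hve]
  have dE : ∀ i j, Differentiable ℝ (dd i (e j)) := fun i j => (contDiff_dd i (he' j)).differentiable (by simp)
  have df : ∀ i, Differentiable ℝ (f i) := fun i => (hf' i).differentiable (by simp)
  have de : ∀ i, Differentiable ℝ (e i) := fun i => (he' i).differentiable (by simp)
  have dr : ∀ i j, Differentiable ℝ fun y => rotW (f i y) (e j y) := fun i j =>
    (contDiff_bilinear rotW (hf' i) (he' j)).differentiable (by simp)
  have key : ∀ i, dd i (fun y => (chi z y).2.2.2 i) x = lo ((1 / 2 : ℝ) • (dd i (dd (i + 1) (e (i + 2))) x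
      - dd i (dd (i + 2) (e (i + 1))) x + (rotW (dd i (f (i + 1)) x) (e (i + 2) x)
        + rotW (f (i + 1) x) (dd i (e (i + 2)) x)) - (rotW (dd i (f (i + 2)) x) (e (i + 1) x)
        + rotW (f (i + 2) x) (dd i (e (i + 1)) x)))) := fun i => by
    have h1 : DifferentiableAt ℝ (fun y => dd (i + 1) (e (i + 2)) y - dd (i + 2) (e (i + 1)) y) x :=
      (dE _ _).sub (dE _ _) x
    have h2 : DifferentiableAt ℝ (fun y => dd (i + 1) (e (i + 2)) y - dd (i + 2) (e (i + 1)) y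
      + rotW (f (i + 1) y) (e (i + 2) y)) x := h1.add (dr _ _ x)
    have h3 : DifferentiableAt ℝ (fun y => dd (i + 1) (e (i + 2)) y - dd (i + 2) (e (i + 1)) y
      + rotW (f (i + 1) y) (e (i + 2) y) - rotW (f (i + 2) y) (e (i + 1) y)) x := h2.sub (dr _ _ x)
    rw [hc, dd_linear i lo (h3.fun_const_smul (1 / 2 : ℝ)), dd_const_smul i _ h3, dd_sub i h2 (dr _ _ x),
      dd_add i h1 (dr _ _ x), dd_sub i (dE _ _ x) (dE _ _ x),
      dd_bilinear i rotW (df _ x) (de _ x), dd_bilinear i rotW (df _ x) (de _ x)]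
  simp only [key, hc3, ← hv, ← hve, fun i => congrFun (hc i) x, lo2_lo2, lo_lo, ← map_add, ← map_sub, ← map_sum]
  rw [← map_zero lo]
  congr 1
  have J := fun i : Fin 3 => rotW_rotW (hsk (i + 1) x) (f (i + 2) x) (e i x)
  have j0 := J 0
  have j1 := J 1
  have j2 := J 2
  simp only [Fin.isValue, Fin.reduceAdd, zero_add] at j0 j1 j2
  simp only [Fin.sum_univ_three, Fin.isValue, Fin.reduceAdd, zero_add, map_add, map_sub, map_smul,
    LinearMap.add_apply, LinearMap.sub_apply, LinearMap.smul_apply,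
    dd_comm 1 0 (he' _) x, dd_comm 2 0 (he' _) x, dd_comm 2 1 (he' _) x]
  linear_combination (norm := module) (1 / 2 : ℝ) • (j0 + j1 + j2)

theorem bianchi_curvature_components (x : Space) (A B : Fin 4) :
    ∑ i : Fin 3, (pd i (fun y => (chi z y).2.2.1 i A B) x
      + rotL (om (z x).1 i.succ) ((chi z x).2.2.1 i) A B) = 0 := by
  have hχ := (contDiff_chi hz).differentiable (by simp) x
  have h : ∀ i, DifferentiableAt ℝ (fun y => (chi z y).2.2.1 i) x := fun i =>
    differentiableAt_pi.1 hχ.snd.snd.fst i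
  have e : ∀ i, pd i (fun y => (chi z y).2.2.1 i A B) x = dd i (fun y => (chi z y).2.2.1 i) x A B := fun i =>
    (dd_apply i (differentiableAt_pi.1 (h i) A) B).trans (by rw [dd_apply i (h i) A])
  simp only [e, rotL_eq]
  have := congrFun (congrFun (bianchi_curvature hz x) A) B
  simpa only [Finset.sum_apply, Pi.add_apply, Pi.zero_apply] using this

theorem bianchi_torsion_components (x : Space) (A : Fin 4) :
    ∑ i : Fin 3, (pd i (fun y => (chi z y).2.2.2 i A) x + rotVL (om (z x).1 i.succ) ((chi z x).2.2.2 i) A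
      + ∑ B, th (z x).1 i.succ B * (chi z x).2.2.1 i B A) = 0 := by
  have hχ := (contDiff_chi hz).differentiable (by simp) x
  have h : ∀ i, DifferentiableAt ℝ (fun y => (chi z y).2.2.2 i) x := fun i =>
    differentiableAt_pi.1 hχ.snd.snd.snd i
  have e : ∀ i, pd i (fun y => (chi z y).2.2.2 i A) x = dd i (fun y => (chi z y).2.2.2 i) x A := fun i =>
    dd_apply i (h i) A
  have e2 : ∀ i, ∑ B, th (z x).1 i.succ B * (chi z x).2.2.1 i B A
      = -lo (rotW (lo2 ((chi z x).2.2.1 i)) (th (z x).1 i.succ)) A := fun i =>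
    (sum_mul_skew ((chi_mem hz x).2 i) _ A).trans (by rw [lo_rotW_lo2])
  simp only [e, e2, rotVL_eq, ← sub_eq_add_neg]
  have := congrFun (bianchi_torsion hz x) A
  simpa only [Finset.sum_apply, Pi.add_apply, Pi.sub_apply, Pi.zero_apply] using this

end

/-! ### Dimensions -/

/-- An antisymmetric bivector is determined by its six components with increasing indices. -/
def skewEquiv : skew ≃ₗ[ℝ] ({p : Fin 4 × Fin 4 // p.1 < p.2} → ℝ) where
  toFun X p := X.1 p.1.1 p.1.2
  map_add' _ _ := rfl
  map_smul' _ _ := rfl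
  invFun f := ⟨fun A B => if h : A < B then f ⟨(A, B), h⟩ else if h : B < A then -f ⟨(B, A), h⟩ else 0, fun A B => by
    rcases lt_trichotomy A B with h | rfl | h
    · simp [h, h.not_gt]
    · simp
    · simp [h, h.not_gt]⟩
  left_inv X := by
    refine Subtype.ext (funext fun A => funext fun B => ?_)
    rcases lt_trichotomy A B with h | rfl | h
    · simp [h]
    · have := X.2 A A
      simp only [lt_self_iff_false, dite_false]
      linarith
    · have := X.2 A B
      simp only [h, h.not_gt, dite_false, dite_true]
      linarith
  right_inv f := by
    funext p
    simp [p.2]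

theorem finrank_skew : Module.finrank ℝ skew = 6 := by
  rw [skewEquiv.finrank_eq, Module.finrank_pi]
  decide

/-- The smearing parameters in terms of independent families. -/
def parEquiv : parFibre ≃ₗ[ℝ] skew × Vec × (Fin 3 → skew) × (Fin 3 → Vec) where
  toFun N := (⟨N.1.1, N.2.1⟩, N.1.2.1, fun i => ⟨N.1.2.2.1 i, N.2.2 i⟩, N.1.2.2.2)
  map_add' _ _ := rfl
  map_smul' _ _ := rfl
  invFun M := ⟨(M.1.1, M.2.1, fun i => (M.2.2.1 i).1, M.2.2.2), M.1.2, fun i => (M.2.2.1 i).2⟩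
  left_inv _ := rfl
  right_inv _ := rfl

theorem finrank_parFibre : Module.finrank ℝ parFibre = 40 := by
  rw [parEquiv.finrank_eq]
  simp [Module.finrank_prod, Module.finrank_pi_fintype, finrank_skew]

/-- The spatial components in terms of independent families. -/
def sparEquiv : sparFibre ≃ₗ[ℝ] (Fin 3 → skew) × (Fin 3 → Vec) where
  toFun S := (fun i => ⟨S.1.1 i, S.2 i⟩, S.1.2)
  map_add' _ _ := rfl
  map_smul' _ _ := rfl
  invFun M := ⟨(fun i => (M.1 i).1, M.2), fun i => (M.1 i).2⟩
  left_inv _ := rfl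
  right_inv _ := rfl

theorem finrank_sparFibre : Module.finrank ℝ sparFibre = 30 := by
  rw [sparEquiv.finrank_eq]
  simp [Module.finrank_prod, Module.finrank_pi_fintype, finrank_skew]

/-- A configuration in terms of its temporal components, of `ω_i`, `θ_i`, and of the duals of `B_{ij}`, `β_{ij}`. -/
def configEquiv : configFibre ≃ₗ[ℝ] parFibre × sparFibre × sparFibre where
  toFun q := (⟨temporalPart q.1, temporalPart_mem q.2⟩, ⟨spatialPart q.1, spatialPart_mem q.2⟩,
    ⟨spatialPart (momenta q.1), spatialPart_mem (momenta_mem q.2).1⟩)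
  map_add' p q := Prod.ext rfl (Prod.ext rfl (Subtype.ext (by
    change spatialPart (momenta (p.1 + q.1)) = _
    rw [momenta_add]; rfl)))
  map_smul' r q := Prod.ext rfl (Prod.ext rfl (Subtype.ext (by
    change spatialPart (momenta (r • q.1)) = _
    rw [momenta_smul]; rfl)))
  invFun M := ⟨redConfig M.1.1 M.2.1.1 + dual (redConfig 0 M.2.2.1),
    configFibre.add_mem (redConfig_mem M.1.2 M.2.1.2).1
      (dual_mem (redConfig_mem parFibre.zero_mem M.2.2.2).1)⟩
  left_inv q := Subtype.ext (by
    have h := reduced_eq (sub_dual_mem q.2)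
    change redConfig (temporalPart q.1) (spatialPart q.1) + dual (spat (momenta q.1)) = q.1
    rw [dual_spat]
    refine eq_sub_iff_add_eq.1 (Eq.trans ?_ h.symm)
    refine congrArg₂ redConfig ?_ ?_
    · exact (sub_zero (temporalPart q.1)).symm
    · exact (sub_zero (spatialPart q.1)).symm)
  right_inv M := by
    have h1 := redConfig_mem M.1.2 M.2.1.2
    have h2 := (redConfig_mem parFibre.zero_mem M.2.2.2)
    refine Prod.ext (Subtype.ext ?_) (Prod.ext (Subtype.ext ?_) (Subtype.ext ?_))
    · exact add_zero M.1.1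
    · exact add_zero M.2.1.1
    · change spatialPart (momenta (redConfig M.1.1 M.2.1.1 + dual (redConfig 0 M.2.2.1))) = M.2.2.1
      rw [momenta_add, momenta_eq_zero h1, momenta_dual h2.1, zero_add]
      rfl

/-- A configuration without spatial 2-forms in terms of its temporal and spatial components. -/
def reducedEquiv : reducedConfig ≃ₗ[ℝ] parFibre × sparFibre where
  toFun q := (⟨temporalPart q.1, temporalPart_mem q.2.1⟩, ⟨spatialPart q.1, spatialPart_mem q.2.1⟩)
  map_add' _ _ := rfl
  map_smul' _ _ := rfl
  invFun M := ⟨redConfig M.1.1 M.2.1, redConfig_mem M.1.2 M.2.2⟩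
  left_inv q := Subtype.ext (reduced_eq q.2).symm
  right_inv _ := rfl

/-- A spatial configuration in terms of `ω_i`, `θ_i` and of the duals of `B_{ij}`, `β_{ij}`. -/
def spatialEquiv : spatialConfig ≃ₗ[ℝ] sparFibre × sparFibre where
  toFun q := (⟨spatialPart q.1, spatialPart_mem q.2.1⟩,
    ⟨spatialPart (momenta q.1), spatialPart_mem (momenta_mem q.2.1).1⟩)
  map_add' p q := Prod.ext rfl (Subtype.ext (by
    change spatialPart (momenta (p.1 + q.1)) = _
    rw [momenta_add]; rfl))
  map_smul' r q := Prod.ext rfl (Subtype.ext (by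
    change spatialPart (momenta (r • q.1)) = _
    rw [momenta_smul]; rfl))
  invFun M := ⟨spat (redConfig 0 M.1.1) + dual (redConfig 0 M.2.1), spatialConfig.add_mem
    (spat_mem_spatialConfig (redConfig_mem parFibre.zero_mem M.1.2).1)
    (dual_mem_spatialConfig (redConfig_mem parFibre.zero_mem M.2.2).1)⟩
  left_inv q := Subtype.ext ((mem_spatialConfig q.2.1).1 q.2)
  right_inv M := by
    have h1 := redConfig_mem parFibre.zero_mem M.1.2
    have h2 := redConfig_mem parFibre.zero_mem M.2.2
    refine Prod.ext (Subtype.ext ?_) (Subtype.ext ?_)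
    · exact add_zero M.1.1
    · change spatialPart (momenta (redConfig 0 M.1.1 + dual (redConfig 0 M.2.1))) = M.2.1
      rw [momenta_add, momenta_eq_zero h1, momenta_dual h2.1, zero_add]
      rfl

/-- A temporal configuration in terms of its components. -/
def temporalEquiv : temporalConfig ≃ₗ[ℝ] parFibre where
  toFun q := ⟨temporalPart q.1, temporalPart_mem q.2.1.1⟩
  map_add' _ _ := rfl
  map_smul' _ _ := rfl
  invFun M := ⟨redConfig M.1 0, redConfig_mem M.2 sparFibre.zero_mem, fun _ _ _ => rfl, fun _ _ => rfl⟩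
  left_inv q := Subtype.ext (by
    have e : spatialPart q.1 = 0 := Prod.ext (funext fun i => funext fun A => funext fun B => q.2.2.1 i A B)
      (funext fun i => funext fun A => q.2.2.2 i A)
    change redConfig (temporalPart q.1) 0 = q.1
    rw [← e, ← reduced_eq q.2.1])
  right_inv _ := rfl

/-- The elements of a product of subspaces as pairs. -/
def prodEquiv {V W : Type*} [AddCommGroup V] [Module ℝ V] [AddCommGroup W] [Module ℝ W] (p : Submodule ℝ V)
    (q : Submodule ℝ W) : p.prod q ≃ₗ[ℝ] p × q where
  toFun x := (⟨x.1.1, x.2.1⟩, ⟨x.1.2, x.2.2⟩)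
  map_add' _ _ := rfl
  map_smul' _ _ := rfl
  invFun x := ⟨(x.1.1, x.2.1), x.1.2, x.2.2⟩
  left_inv _ := rfl
  right_inv _ := rfl

theorem finrank_configFibre : Module.finrank ℝ configFibre = 100 := by
  rw [configEquiv.finrank_eq, Module.finrank_prod, Module.finrank_prod, finrank_parFibre, finrank_sparFibre]

theorem finrank_phaseFibre : Module.finrank ℝ phaseFibre = 200 := by
  rw [phaseFibre, (prodEquiv _ _).finrank_eq, Module.finrank_prod, finrank_configFibre]

theorem finrank_reducedFibre : Module.finrank ℝ reducedFibre = 140 := by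
  rw [reducedFibre, (prodEquiv _ _).finrank_eq, Module.finrank_prod, reducedEquiv.finrank_eq, Module.finrank_prod,
    finrank_parFibre, finrank_sparFibre]

theorem finrank_spatialConfig : Module.finrank ℝ spatialConfig = 60 := by
  rw [spatialEquiv.finrank_eq, Module.finrank_prod, finrank_sparFibre]

theorem finrank_primaryRadical : Module.finrank ℝ primaryRadical = 40 := by
  rw [primaryRadical_eq, temporalEquiv.finrank_eq, finrank_parFibre]

theorem secondClassCount_eq : secondClassCount = 60 := by
  rw [secondClassCount, finrank_configFibre, finrank_primaryRadical]

/-! ### The principal symbol of the secondary constraints -/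

/-- The principal symbol of the secondary constraints. -/
def symbol (k : Fin 3 → ℝ) : Phase →ₗ[ℝ] Par where
  toFun w := (∑ i : Fin 3, k i • om w.2 i.succ, ∑ i : Fin 3, k i • th w.2 i.succ,
    fun i => lo2 ((1 / 2 : ℝ) • (k (i + 1) • om w.1 (i + 2).succ - k (i + 2) • om w.1 (i + 1).succ)),
    fun i => lo ((1 / 2 : ℝ) • (k (i + 1) • th w.1 (i + 2).succ - k (i + 2) • th w.1 (i + 1).succ)))
  map_add' w w' := by
    refine Prod.ext ?_ (Prod.ext ?_ (Prod.ext (funext fun i => ?_) (funext fun i => ?_)))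
    all_goals
      simp only [Prod.fst_add, Prod.snd_add, Pi.add_apply, om_add, th_add, map_sub, map_smul, map_add,
        Fin.sum_univ_three]
      module
  map_smul' r w := by
    refine Prod.ext ?_ (Prod.ext ?_ (Prod.ext (funext fun i => ?_) (funext fun i => ?_)))
    all_goals
      simp only [Prod.smul_fst, Prod.smul_snd, Pi.smul_apply, om_smul, th_smul, map_sub, map_smul,
        Fin.sum_univ_three, RingHom.id_apply]
      module

theorem chiSymbol_eq {z : Space → Phase} (hz : IsField phaseFibre z) (x : Space) (k : Fin 3 → ℝ) {w : Phase}
    (hw : w ∈ phaseFibre) : chiSymbol z x k w = symbol k w := by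
  have hc : ContDiff ℝ ∞ fun y : Space => dotProduct k (y - x) := by
    unfold dotProduct
    fun_prop
  have hh : IsField phaseFibre fun y => dotProduct k (y - x) • w :=
    ⟨hc.smul contDiff_const, fun y => phaseFibre.smul_mem _ hw⟩
  have hj : ∀ i, jet (fun y => dotProduct k (y - x) • w) x i = k i • w := fun i => by
    have h1 : dd i (fun y => dotProduct k (y - x) • w) x = dd i (fun y => dotProduct k (y - x)) x • w :=
      dd_linear i (LinearMap.toSpanSingleton ℝ Phase w) (hc.differentiable (by simp) x)
    have h2 : dd i (fun y => dotProduct k (y - x)) x = k i := by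
      have h3 := dd_linear i (dotProductBilin ℝ ℝ k : Space →ₗ[ℝ] ℝ) (f := fun y => y - x) (x := x)
        (differentiableAt_id.sub_const x)
      refine h3.trans ?_
      rw [dd, fderiv_sub_const, fderiv_fun_id]
      exact dotProduct_single_one k i
    rw [jet, h1, h2]
  have h0 : chiJ (0 : Phase) 0 = 0 := by
    refine Prod.ext ?_ (Prod.ext ?_ (Prod.ext (funext fun i => ?_) (funext fun i => ?_))) <;>
      simp [chiJ, om_zero, th_zero]
  have e : (fun s : ℝ => chi (fun y => z y + (s * dotProduct k (y - x)) • w) x)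
      = fun s => chi z x + s • symbol k w := by
    funext s
    have h := chi_add hz hh s x
    have e1 : (fun y => z y + (s * dotProduct k (y - x)) • w) = z + s • fun y => dotProduct k (y - x) • w := by
      funext y
      simp only [Pi.add_apply, Pi.smul_apply, smul_smul]
    rw [e1, h, sub_self, dotProduct_zero, zero_smul, h0, smul_zero, add_zero, funext hj]
    congr 2
    refine Prod.ext ?_ (Prod.ext ?_ (Prod.ext (funext fun i => ?_) (funext fun i => ?_))) <;>
      simp [chiLin, symbol, om_zero, th_zero, om_smul, th_smul]
  rw [chiSymbol, e]
  have h := ((hasDerivAt_id (0 : ℝ)).smul_const (symbol k w)).const_add (chi z x)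
  rw [one_smul] at h
  exact h.deriv

/-- The contractions `k_i K^i_{AB}`, `k_i K^i_A`, i.e. the principal symbol of the Bianchi identities. -/
def divergence (k : Fin 3 → ℝ) : parFibre →ₗ[ℝ] skew × Vec where
  toFun K := (∑ i, k i • (parEquiv K).2.2.1 i, ∑ i, k i • (parEquiv K).2.2.2 i)
  map_add' K K' := by
    simp only [map_add, Prod.snd_add, Prod.fst_add, Pi.add_apply, smul_add, Finset.sum_add_distrib, Prod.mk_add_mk]
  map_smul' r K := by
    simp only [map_smul, Prod.smul_snd, Prod.smul_fst, Pi.smul_apply, smul_comm _ r, ← Finset.smul_sum, Prod.smul_mk,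
      RingHom.id_apply]

theorem divergence_surjective {k : Fin 3 → ℝ} (hk : k ≠ 0) : Function.Surjective (divergence k) := by
  obtain ⟨i, hi⟩ := Function.ne_iff.1 hk
  have hi : k i ≠ 0 := hi
  rintro ⟨X, v⟩
  refine ⟨parEquiv.symm (0, 0, Pi.single i ((k i)⁻¹ • X), Pi.single i ((k i)⁻¹ • v)), ?_⟩
  refine Prod.ext ?_ ?_
  · simp [divergence, Pi.single_apply, hi]
  · simp [divergence, Pi.single_apply, hi]

theorem mem_ker_divergence {k : Fin 3 → ℝ} {K : parFibre} : K ∈ LinearMap.ker (divergence k) ↔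
    ∑ i, k i • K.1.2.2.1 i = 0 ∧ ∑ i, k i • K.1.2.2.2 i = 0 := by
  have e : ((∑ i, k i • (parEquiv K).2.2.1 i : skew) : Biv) = ∑ i, k i • K.1.2.2.1 i := by
    rw [Submodule.coe_sum]; rfl
  rw [LinearMap.mem_ker, Prod.ext_iff, ← e]
  exact and_congr (Subtype.ext_iff (a2 := (0 : skew))) Iff.rfl

/-- Dividing the relation `k × (k × X) = -|k|² X`, valid for `k · X = 0`, by `|k|²`. -/
theorem cross_cross {E : Type*} [AddCommGroup E] [Module ℝ E] {k : Fin 3 → ℝ} {r : ℝ}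
    (hr : r * ∑ i, k i * k i = 1) {X : Fin 3 → E} (hX : ∑ i, k i • X i = 0) (i : Fin 3) :
    k (i + 1) • (-r) • (k (i + 2 + 1) • X (i + 2 + 2) - k (i + 2 + 2) • X (i + 2 + 1))
      - k (i + 2) • (-r) • (k (i + 1 + 1) • X (i + 1 + 2) - k (i + 1 + 2) • X (i + 1 + 1)) = X i := by
  simp only [Fin.sum_univ_three] at hr hX
  have h1 : X i = (r * (k 0 * k 0 + k 1 * k 1 + k 2 * k 2)) • X i := by rw [hr, one_smul]
  conv_rhs => rw [h1]
  fin_cases i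
  · simp only [Fin.zero_eta, Fin.isValue, Fin.reduceAdd, zero_add]
    linear_combination (norm := module) (-(r * k 0)) • hX
  · simp only [Fin.mk_one, Fin.isValue, Fin.reduceAdd]
    linear_combination (norm := module) (-(r * k 1)) • hX
  · simp only [Fin.reduceFinMk, Fin.isValue, Fin.reduceAdd]
    linear_combination (norm := module) (-(r * k 2)) • hX

/-- The image of the principal symbol is cut out by the principal symbol of the Bianchi identities. -/
theorem map_symbol {k : Fin 3 → ℝ} (hk : k ≠ 0) : reducedFibre.map (symbol k)
    = (LinearMap.ker (divergence k)).map parFibre.subtype := by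
  have hn : ∑ i, k i * k i ≠ 0 := fun h => hk (dotProduct_self_eq_zero.1 h)
  ext K
  constructor
  · rintro ⟨w, hw, rfl⟩
    have hs : symbol k w ∈ parFibre := by
      obtain ⟨h1, -⟩ := mem_configFibre.1 hw.1.1
      obtain ⟨h2, -⟩ := mem_configFibre.1 hw.2.1
      have h3 : ∑ i : Fin 3, k i • om w.2 i.succ ∈ skew :=
        Submodule.sum_mem _ fun i _ => skew.smul_mem _ (h2 _)
      exact ⟨h3, fun i => lo2_mem_skew (skew.smul_mem _
        (skew.sub_mem (skew.smul_mem _ (h1 _)) (skew.smul_mem _ (h1 _))))⟩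
    refine ⟨⟨symbol k w, hs⟩, mem_ker_divergence.2 ⟨?_, ?_⟩, rfl⟩
    · simp only [symbol, LinearMap.coe_mk, AddHom.coe_mk, Fin.sum_univ_three, map_sub, map_smul, Fin.isValue,
        Fin.reduceAdd, zero_add]
      module
    · simp only [symbol, LinearMap.coe_mk, AddHom.coe_mk, Fin.sum_univ_three, map_sub, map_smul, Fin.isValue,
        Fin.reduceAdd, zero_add]
      module
  · rintro ⟨⟨K, hK⟩, h, rfl⟩
    obtain ⟨h3, h4⟩ := mem_ker_divergence.1 h
    obtain ⟨r, hr⟩ : ∃ r : ℝ, r * ∑ i, k i * k i = 1 := ⟨_, inv_mul_cancel₀ hn⟩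
    -- A preimage: `Π^i = k_i K / |k|²` and `ω = -2 k × K / |k|²`, and likewise for `π`, `θ`.
    have m1 : redConfig 0 (fun i => (-2 * r) • lo2 (k (i + 1) • K.2.2.1 (i + 2) - k (i + 2) • K.2.2.1 (i + 1)),
        fun i => (-2 * r) • lo (k (i + 1) • K.2.2.2 (i + 2) - k (i + 2) • K.2.2.2 (i + 1))) ∈ reducedConfig :=
      redConfig_mem parFibre.zero_mem fun i => skew.smul_mem _ (lo2_mem_skew
        (skew.sub_mem (skew.smul_mem _ (hK.2 _)) (skew.smul_mem _ (hK.2 _))))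
    have m2 : redConfig 0 (fun i => (r * k i) • K.1, fun i => (r * k i) • K.2.1) ∈ reducedConfig :=
      redConfig_mem parFibre.zero_mem fun i => skew.smul_mem _ hK.1
    refine ⟨(_, _), ⟨m1, m2⟩, ?_⟩
    have s : ∀ {E : Type} [AddCommGroup E] [Module ℝ E] (Y : E), ∑ i, k i • (r * k i) • Y = Y := fun Y => by
      simp only [smul_smul, ← Finset.sum_smul]
      rw [show ∑ i, k i * (r * k i) = r * ∑ i, k i * k i by
        rw [Finset.mul_sum]; exact Finset.sum_congr rfl fun i _ => by ring, hr, one_smul]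
    refine Prod.ext ?_ (Prod.ext ?_ (Prod.ext (funext fun i => ?_) (funext fun i => ?_)))
    · exact s K.1
    · exact s K.2.1
    · refine Eq.trans ?_ (cross_cross hr h3 i)
      change lo2 ((1 / 2 : ℝ) • (
        k (i + 1) • (-2 * r) • lo2 (k (i + 2 + 1) • K.2.2.1 (i + 2 + 2) - k (i + 2 + 2) • K.2.2.1 (i + 2 + 1))
        - k (i + 2) • (-2 * r) • lo2 (k (i + 1 + 1) • K.2.2.1 (i + 1 + 2) - k (i + 1 + 2) • K.2.2.1 (i + 1 + 1)))) = _
      simp only [map_sub, map_smul, lo2_lo2]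
      module
    · refine Eq.trans ?_ (cross_cross hr h4 i)
      change lo ((1 / 2 : ℝ) • (
        k (i + 1) • (-2 * r) • lo (k (i + 2 + 1) • K.2.2.2 (i + 2 + 2) - k (i + 2 + 2) • K.2.2.2 (i + 2 + 1))
        - k (i + 2) • (-2 * r) • lo (k (i + 1 + 1) • K.2.2.2 (i + 1 + 2) - k (i + 1 + 2) • K.2.2.2 (i + 1 + 1)))) = _
      simp only [map_sub, map_smul, lo_lo]
      module

theorem secondaryRank_eq {z : Space → Phase} (hz : IsField phaseFibre z) (x : Space) {k : Fin 3 → ℝ}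
    (hk : k ≠ 0) : secondaryRank z x k = 30 := by
  have h1 : chiSymbol z x k '' (reducedFibre : Set Phase) = reducedFibre.map (symbol k) := by
    rw [Submodule.map_coe]
    exact Set.image_congr fun w hw => chiSymbol_eq hz x k (reducedFibre_le hw)
  -- The image is the kernel of a surjection from dimension 40 onto dimension 10.
  have h2 := LinearMap.finrank_range_add_finrank_ker (divergence k)
  rw [LinearMap.range_eq_top.2 (divergence_surjective hk), finrank_top, Module.finrank_prod, finrank_skew,
    finrank_parFibre, Module.finrank_fin_fun] at h2
  rw [secondaryRank, h1, Submodule.span_eq, map_symbol hk, Submodule.finrank_map_subtype_eq]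
  omega

theorem count_eq {z : Space → Phase} (hz : IsField phaseFibre z) (x : Space) {k : Fin 3 → ℝ} (hk : k ≠ 0) :
    secondaryRank z x k = 40 - (6 + 4) ∧
      2 * (Module.finrank ℝ primaryRadical + secondaryRank z x k) = 140 ∧ localDegreesOfFreedom z x k = 0 := by
  rw [localDegreesOfFreedom, secondaryRank_eq hz x hk, finrank_primaryRadical, secondClassCount_eq, finrank_phaseFibre]
  norm_num

/-! ### Calculus on spacetime -/

/-- The coordinate directions of spacetime. -/
def direction (a : Fin 4) : ℝ × Space := Fin.cases (1, 0) (fun i => (0, Pi.single i 1)) a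

section
variable {E F G : Type*} [NormedAddCommGroup E] [NormedSpace ℝ E] [NormedAddCommGroup F]
  [NormedSpace ℝ F] [NormedAddCommGroup G] [NormedSpace ℝ G]

/-- The partial derivative `∂_a f` of a vector-valued function on spacetime. -/
def sd (a : Fin 4) (f : ℝ × Space → E) (p : ℝ × Space) : E := fderiv ℝ f p (direction a)

theorem sd_add (a : Fin 4) {f g : ℝ × Space → E} {p : ℝ × Space} (hf : DifferentiableAt ℝ f p)
    (hg : DifferentiableAt ℝ g p) : sd a (fun y => f y + g y) p = sd a f p + sd a g p := by
  unfold sd; rw [fderiv_fun_add hf hg]; rfl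

theorem sd_linear [FiniteDimensional ℝ E] (a : Fin 4) (L : E →ₗ[ℝ] F) {f : ℝ × Space → E} {p : ℝ × Space}
    (hf : DifferentiableAt ℝ f p) : sd a (fun y => L (f y)) p = L (sd a f p) := by
  have h : HasFDerivAt (fun y => L (f y)) (L.toContinuousLinearMap.comp (fderiv ℝ f p)) p :=
    (L.toContinuousLinearMap.hasFDerivAt (x := f p)).comp p hf.hasFDerivAt
  unfold sd; rw [h.fderiv]; rfl

theorem sd_bilinear [FiniteDimensional ℝ E] [FiniteDimensional ℝ F] (a : Fin 4)
    (L : E →ₗ[ℝ] F →ₗ[ℝ] G) {f : ℝ × Space → E} {g : ℝ × Space → F} {p : ℝ × Space}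
    (hf : DifferentiableAt ℝ f p) (hg : DifferentiableAt ℝ g p) :
    sd a (fun y => L (f y) (g y)) p = L (sd a f p) (g p) + L (f p) (sd a g p) := by
  have h : HasFDerivAt (fun y => L (f y) (g y)) _ p :=
    L.toContinuousBilinearMap.hasFDerivAt_of_bilinear hf.hasFDerivAt hg.hasFDerivAt
  unfold sd; rw [h.fderiv]
  simp [add_comm]

theorem contDiff_sd (a : Fin 4) {f : ℝ × Space → E} (hf : ContDiff ℝ ∞ f) : ContDiff ℝ ∞ (sd a f) :=
  (hf.fderiv_right (m := ∞) (by simp)).clm_apply contDiff_const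

theorem sd_comm (a b : Fin 4) {f : ℝ × Space → E} (hf : ContDiff ℝ ∞ f) (p : ℝ × Space) :
    sd a (sd b f) p = sd b (sd a f) p := by
  have h1 : DifferentiableAt ℝ (fderiv ℝ f) p :=
    ((hf.fderiv_right (m := ∞) (by simp)).differentiable (by simp)) p
  have h2 : ∀ c d, sd c (sd d f) p = fderiv ℝ (fderiv ℝ f) p (direction c) (direction d) := by
    intro c d
    have h : HasFDerivAt (fun y => fderiv ℝ f y (direction d)) _ p :=
      h1.hasFDerivAt.clm_apply (hasFDerivAt_const (direction d) p)
    change fderiv ℝ (fun y => fderiv ℝ f y (direction d)) p (direction c) = _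
    rw [h.fderiv]
    simp
  rw [h2, h2]
  exact (hf.contDiffAt.isSymmSndFDerivAt (by simp; exact WithTop.coe_le_coe.2 le_top)) _ _

theorem sd_apply {ι : Type*} [Fintype ι] (a : Fin 4) {f : ℝ × Space → ι → E} {p : ℝ × Space}
    (hf : DifferentiableAt ℝ f p) (k : ι) : sd a (fun y => f y k) p = sd a f p k := by
  have h := hasFDerivAt_pi'.1 hf.hasFDerivAt k
  unfold sd; rw [h.fderiv]; rfl

theorem deriv_eq_sd {f : ℝ → Space → E} {t : ℝ} {x : Space}
    (hf : DifferentiableAt ℝ (fun p : ℝ × Space => f p.1 p.2) (t, x)) :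
    deriv (fun s => f s x) t = sd 0 (fun p => f p.1 p.2) (t, x) := by
  have h := HasFDerivAt.comp_hasDerivAt (f := fun s => (s, x)) t hf.hasFDerivAt
    ((hasDerivAt_id' t).prodMk (hasDerivAt_const t x))
  exact h.deriv

theorem dd_eq_sd {f : ℝ → Space → E} {t : ℝ} {x : Space} (i : Fin 3)
    (hf : DifferentiableAt ℝ (fun p : ℝ × Space => f p.1 p.2) (t, x)) :
    dd i (f t) x = sd i.succ (fun p => f p.1 p.2) (t, x) := by
  have h : HasFDerivAt (f t) _ x := hf.hasFDerivAt.comp x (hasFDerivAt_prodMk_right t x)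
  unfold dd; rw [h.fderiv]; rfl

end

theorem stD_eq_sd (a : Fin 4) {f : ℝ → Space → ℝ} {t : ℝ} {x : Space}
    (hf : DifferentiableAt ℝ (fun p : ℝ × Space => f p.1 p.2) (t, x)) :
    stD a f t x = sd a (fun p => f p.1 p.2) (t, x) := by
  refine Fin.cases ?_ (fun i => ?_) a
  · exact deriv_eq_sd hf
  · exact dd_eq_sd i hf

theorem stB_eq (Q : ℝ → Space → Config) (a : Fin 4) {X : ℝ → Space → Biv} {t : ℝ} {x : Space}
    (hX : DifferentiableAt ℝ (fun p : ℝ × Space => X p.1 p.2) (t, x)) :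
    stB Q a X t x = sd a (fun p => X p.1 p.2) (t, x) + rotB (om (Q t x) a) (X t x) := by
  ext A B
  have hA := differentiableAt_pi.1 hX A
  have e := stD_eq_sd a (f := fun s y => X s y A B) (differentiableAt_pi.1 hA B)
  rw [sd_apply a hA B, sd_apply a hX A] at e
  simp only [stB, e, Pi.add_apply, rotB_apply]

theorem stV_eq (Q : ℝ → Space → Config) (a : Fin 4) {X : ℝ → Space → Vec} {t : ℝ} {x : Space}
    (hX : DifferentiableAt ℝ (fun p : ℝ × Space => X p.1 p.2) (t, x)) :
    stV Q a X t x = sd a (fun p => X p.1 p.2) (t, x) + rotW (om (Q t x) a) (X t x) := by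
  ext A
  have e := stD_eq_sd a (f := fun s y => X s y A) (differentiableAt_pi.1 hX A)
  rw [sd_apply a hX A] at e
  simp only [stV, e, Pi.add_apply, rotW_apply]

/-! ### Flatness of solutions and trivial gauge transformations -/

/-- An antisymmetric array is zero if its components `0i` and those in cyclic order are. -/
theorem antisymm_eq_zero {E : Type*} [AddCommGroup E] [Module ℝ E] {F : Fin 4 → Fin 4 → E}
    (h : ∀ a b, F b a = -F a b) (h0 : ∀ i : Fin 3, F 0 i.succ = 0)
    (h1 : ∀ i : Fin 3, F (i + 1).succ (i + 2).succ = 0) (a b : Fin 4) : F a b = 0 := by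
  have hd : ∀ a, F a a = 0 := fun a => by
    have h2 : (2 : ℝ) • F a a = 0 := by rw [two_smul]; nth_rewrite 1 [h a a]; exact neg_add_cancel _
    exact (smul_eq_zero.1 h2).resolve_left two_ne_zero
  refine Fin.cases (Fin.cases (hd 0) h0 b) (fun i => Fin.cases ?_ (fun j => ?_) b) a
  · rw [h, h0, neg_zero]
  · rcases (by decide : ∀ i j : Fin 3, j = i ∨ ∃ m, (i = m + 1 ∧ j = m + 2) ∨ (i = m + 2 ∧ j = m + 1)) i j with
      rfl | ⟨m, ⟨rfl, rfl⟩ | ⟨rfl, rfl⟩⟩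
    · exact hd _
    · exact h1 m
    · rw [h, h1, neg_zero]

section
variable {Q : ℝ → Space → Config} (hQ : IsHistory Q) (hmem : ∀ t x, Q t x ∈ configFibre)

include hQ in
theorem dst_eq_sd (a : Fin 4) (t : ℝ) (x : Space) (c : CIdx) :
    dst (Q t) (velocity Q t) a (fun p => p c) x = sd a (fun p => Q p.1 p.2) (t, x) c := by
  have hd := hQ.differentiable (by simp) (t, x)
  refine Fin.cases ?_ (fun i => ?_) a
  · exact congrFun (deriv_eq_sd hd) c
  · have hd2 : DifferentiableAt ℝ (fun p : ℝ × Space => Q p.1 p.2 c) (t, x) := differentiableAt_pi.1 hd c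
    exact (dd_eq_sd (f := fun t x => Q t x c) i hd2).trans (sd_apply i.succ hd c)

include hQ hmem in
theorem curv_eq (a b : Fin 4) (t : ℝ) (x : Space) : curv (Q t) (velocity Q t) a b x =
    om (sd a (fun p => Q p.1 p.2) (t, x)) b - om (sd b (fun p => Q p.1 p.2) (t, x)) a
      + rotB (om (Q t x) a) (om (Q t x) b) := by
  ext A B
  rw [rotB_eq_mm ((mem_configFibre.1 (hmem t x)).1 a)]
  simp only [curv, Pi.add_apply, Pi.sub_apply, mm_apply, mul_sub, Finset.sum_sub_distrib, ← mul_assoc]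
  congr 2
  · exact dst_eq_sd hQ a t x _
  · exact dst_eq_sd hQ b t x _

include hQ in
theorem tors_eq (a b : Fin 4) (t : ℝ) (x : Space) : tors (Q t) (velocity Q t) a b x =
    th (sd a (fun p => Q p.1 p.2) (t, x)) b - th (sd b (fun p => Q p.1 p.2) (t, x)) a
      + rotW (om (Q t x) a) (th (Q t x) b) - rotW (om (Q t x) b) (th (Q t x) a) := by
  ext A
  simp only [tors, Pi.add_apply, Pi.sub_apply, rotW_apply]
  congr 3
  · exact dst_eq_sd hQ a t x _
  · exact dst_eq_sd hQ b t x _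

theorem curv_eq_zero (hS : IsSolution Q) (a b : Fin 4) (t : ℝ) (x : Space) :
    curv (Q t) (velocity Q t) a b x = 0 := by
  have key : ∀ X : Biv, lo2 ((1 / 2 : ℝ) • X) = 0 → X = 0 := fun X h => by
    have := lo2_injective (h.trans (map_zero lo2).symm)
    exact (smul_eq_zero.1 this).resolve_left (by norm_num)
  refine antisymm_eq_zero (F := fun a b => curv (Q t) (velocity Q t) a b x)
    (fun a b => curv_antisymm _ _ _ _ _) (fun i => key _ ?_) (fun i => key _ ?_) a b
  · rw [← bB_eulerLagrange_succ, hS]; rfl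
  · rw [← bB_eulerLagrange_zero, hS]; rfl

theorem tors_eq_zero (hS : IsSolution Q) (a b : Fin 4) (t : ℝ) (x : Space) :
    tors (Q t) (velocity Q t) a b x = 0 := by
  have key : ∀ X : Vec, lo ((1 / 2 : ℝ) • X) = 0 → X = 0 := fun X h => by
    have := lo_injective (h.trans (map_zero lo).symm)
    exact (smul_eq_zero.1 this).resolve_left (by norm_num)
  refine antisymm_eq_zero (F := fun a b => tors (Q t) (velocity Q t) a b x)
    (fun a b => tors_antisymm _ _ _ _ _) (fun i => key _ ?_) (fun i => key _ ?_) a b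
  · rw [← be_eulerLagrange_succ, hS]; rfl
  · rw [← be_eulerLagrange_zero, hS]; rfl

variable {lam : ℝ → Space → Biv} {l : ℝ → Space → Vec} (hlam : IsHistory lam) (hl : IsHistory l)

include hQ hl in
/-- The commutator of covariant derivatives of a vector is the action of the curvature, here zero. -/
theorem stV_stV (hmem : ∀ t x, Q t x ∈ configFibre) (hS : IsSolution Q) (a b : Fin 4) (t : ℝ) (x : Space) :
    stV Q a (fun s y => stV Q b l s y) t x = stV Q b (fun s y => stV Q a l s y) t x := by
  have hl' : ContDiff ℝ ∞ fun p : ℝ × Space => l p.1 p.2 := hl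
  have hQ' : ContDiff ℝ ∞ fun p : ℝ × Space => Q p.1 p.2 := hQ
  have dl := hl'.differentiable (by simp)
  have dQ := hQ'.differentiable (by simp)
  have hw : ∀ b, ContDiff ℝ ∞ fun p : ℝ × Space => om (Q p.1 p.2) b := fun b => by fun_prop
  have e1 : ∀ b s y, stV Q b l s y = sd b (fun p => l p.1 p.2) (s, y) + rotW (om (Q s y) b) (l s y) :=
    fun b s y => stV_eq Q b (dl _)
  have h1 : ∀ b, ContDiff ℝ ∞ (sd b fun p : ℝ × Space => l p.1 p.2) := fun b => contDiff_sd b hl'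
  have h2 : ∀ b, ContDiff ℝ ∞ fun p : ℝ × Space => rotW (om (Q p.1 p.2) b) (l p.1 p.2) := fun b => by fun_prop
  have h3 : ∀ b, ContDiff ℝ ∞ fun p : ℝ × Space => stV Q b l p.1 p.2 := fun b => by
    simp only [e1]; exact (h1 b).add (h2 b)
  have e2 : ∀ a b, stV Q a (fun s y => stV Q b l s y) t x = sd a (sd b fun p => l p.1 p.2) (t, x)
      + (rotW (om (sd a (fun p => Q p.1 p.2) (t, x)) b) (l t x)
        + rotW (om (Q t x) b) (sd a (fun p => l p.1 p.2) (t, x)))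
      + rotW (om (Q t x) a) (sd b (fun p => l p.1 p.2) (t, x) + rotW (om (Q t x) b) (l t x)) := fun a b => by
    rw [stV_eq Q a ((h3 b).differentiable (by simp) _), e1]
    congr 1
    simp only [e1]
    rw [sd_add a ((h1 b).differentiable (by simp) _) ((h2 b).differentiable (by simp) _),
      sd_bilinear a rotW ((hw b).differentiable (by simp) _) (dl _)]
    congr 3
    exact sd_linear a (omL b) (dQ _) ▸ rfl
  have c := curv_eq_zero hS a b t x
  rw [curv_eq hQ hmem] at c
  have r := rotW_rotW ((mem_configFibre.1 (hmem t x)).1 a) (om (Q t x) b) (l t x)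
  have c' := congrArg (fun Y => rotW Y (l t x)) c
  simp only [map_add, map_sub, LinearMap.add_apply, LinearMap.sub_apply, map_zero, LinearMap.zero_apply] at c'
  rw [e2, e2, sd_comm a b hl', map_add, map_add, r]
  linear_combination (norm := module) c'

include hl hQ in
theorem isHistory_stV (b : Fin 4) : IsHistory (stV Q b l) := by
  unfold IsHistory
  have hl' : ContDiff ℝ ∞ fun p : ℝ × Space => l p.1 p.2 := hl
  have hQ' : ContDiff ℝ ∞ fun p : ℝ × Space => Q p.1 p.2 := hQ
  simp only [fun s y => stV_eq Q b (hl'.differentiable (by simp) (s, y))]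
  exact (contDiff_sd b hl').add (by fun_prop)

include hQ hlam hl in
theorem isHistory_exactPar (b : Fin 4) :
    IsHistory fun s y => stB Q b lam s y + wdg (l s y) (th (Q s y) b) := by
  unfold IsHistory
  have hl' : ContDiff ℝ ∞ fun p : ℝ × Space => l p.1 p.2 := hl
  have hX' : ContDiff ℝ ∞ fun p : ℝ × Space => lam p.1 p.2 := hlam
  have hQ' : ContDiff ℝ ∞ fun p : ℝ × Space => Q p.1 p.2 := hQ
  simp only [fun s y => stB_eq Q b (hX'.differentiable (by simp) (s, y))]
  exact ((contDiff_sd b hX').add (by fun_prop)).add (by fun_prop)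

include hQ hlam hl in
/-- The analogue of `stV_stV` for bivectors, with the torsion acting on `l`. -/
theorem stB_exactPar (hmem : ∀ t x, Q t x ∈ configFibre) (hS : IsSolution Q) (a b : Fin 4) (t : ℝ) (x : Space) :
    stB Q a (fun s y => stB Q b lam s y + wdg (l s y) (th (Q s y) b)) t x
        - stB Q b (fun s y => stB Q a lam s y + wdg (l s y) (th (Q s y) a)) t x
      = wdg (stV Q a l t x) (th (Q t x) b) - wdg (stV Q b l t x) (th (Q t x) a) := by
  have hl' : ContDiff ℝ ∞ fun p : ℝ × Space => l p.1 p.2 := hl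
  have hX' : ContDiff ℝ ∞ fun p : ℝ × Space => lam p.1 p.2 := hlam
  have hQ' : ContDiff ℝ ∞ fun p : ℝ × Space => Q p.1 p.2 := hQ
  have dl := hl'.differentiable (by simp)
  have dX := hX'.differentiable (by simp)
  have dQ := hQ'.differentiable (by simp)
  have hw : ∀ b, ContDiff ℝ ∞ fun p : ℝ × Space => om (Q p.1 p.2) b := fun b => by fun_prop
  have ht : ∀ b, ContDiff ℝ ∞ fun p : ℝ × Space => th (Q p.1 p.2) b := fun b => by fun_prop
  have e1 : ∀ b s y, stB Q b lam s y = sd b (fun p => lam p.1 p.2) (s, y) + rotB (om (Q s y) b) (lam s y) :=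
    fun b s y => stB_eq Q b (dX _)
  have h1 : ∀ b, ContDiff ℝ ∞ (sd b fun p : ℝ × Space => lam p.1 p.2) := fun b => contDiff_sd b hX'
  have h2 : ∀ b, ContDiff ℝ ∞ fun p : ℝ × Space => rotB (om (Q p.1 p.2) b) (lam p.1 p.2) := fun b => by fun_prop
  have h3 : ∀ b, ContDiff ℝ ∞ fun p : ℝ × Space => wdg (l p.1 p.2) (th (Q p.1 p.2) b) := fun b => by fun_prop
  have ow : ∀ a b, sd a (fun p : ℝ × Space => om (Q p.1 p.2) b) (t, x) = om (sd a (fun p => Q p.1 p.2) (t, x)) b :=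
    fun a b => sd_linear a (omL b) (dQ _)
  have ot : ∀ a b, sd a (fun p : ℝ × Space => th (Q p.1 p.2) b) (t, x) = th (sd a (fun p => Q p.1 p.2) (t, x)) b :=
    fun a b => sd_linear a (thL b) (dQ _)
  have e2 : ∀ a b, stB Q a (fun s y => stB Q b lam s y + wdg (l s y) (th (Q s y) b)) t x
      = sd a (sd b fun p => lam p.1 p.2) (t, x)
      + (rotB (om (sd a (fun p => Q p.1 p.2) (t, x)) b) (lam t x)
        + rotB (om (Q t x) b) (sd a (fun p => lam p.1 p.2) (t, x)))
      + (wdg (sd a (fun p => l p.1 p.2) (t, x)) (th (Q t x) b)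
        + wdg (l t x) (th (sd a (fun p => Q p.1 p.2) (t, x)) b))
      + rotB (om (Q t x) a) (sd b (fun p => lam p.1 p.2) (t, x) + rotB (om (Q t x) b) (lam t x)
        + wdg (l t x) (th (Q t x) b)) := fun a b => by
    rw [stB_eq Q a ((isHistory_exactPar hQ hlam hl b).differentiable (by simp) _), e1]
    congr 1
    simp only [e1]
    rw [sd_add a (((h1 b).add (h2 b)).differentiable (by simp) _) ((h3 b).differentiable (by simp) _),
      sd_add a ((h1 b).differentiable (by simp) _) ((h2 b).differentiable (by simp) _),
      sd_bilinear a rotB ((hw b).differentiable (by simp) _) (dX _),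
      sd_bilinear a wdg (dl _) ((ht b).differentiable (by simp) _), ow, ot]
  have c := curv_eq_zero hS a b t x
  rw [curv_eq hQ hmem] at c
  have d := tors_eq_zero hS a b t x
  rw [tors_eq hQ] at d
  have r := rotB_rotB ((mem_configFibre.1 (hmem t x)).1 a) (om (Q t x) b) (lam t x)
  have c' := congrArg (fun Y => rotB Y (lam t x)) c
  have d' := congrArg (fun v => wdg (l t x) v) d
  simp only [map_add, map_sub, LinearMap.add_apply, LinearMap.sub_apply, map_zero, LinearMap.zero_apply] at c' d'
  rw [e2, e2, sd_comm a b hX', stV_eq Q a (dl _), stV_eq Q b (dl _)]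
  simp only [map_add, LinearMap.add_apply, r, rotB_wdg]
  linear_combination (norm := module) c' + d'

theorem stB_add (Q : ℝ → Space → Config) (a : Fin 4) {X Y : ℝ → Space → Biv} (hX : IsHistory X)
    (hY : IsHistory Y) (t : ℝ) (x : Space) :
    stB Q a (fun s y => X s y + Y s y) t x = stB Q a X t x + stB Q a Y t x := by
  have dX := ContDiff.differentiable (f := fun p : ℝ × Space => X p.1 p.2) hX (by simp) (t, x)
  have dY := ContDiff.differentiable (f := fun p : ℝ × Space => Y p.1 p.2) hY (by simp) (t, x)
  rw [stB_eq Q a (dX.fun_add dY), stB_eq Q a dX, stB_eq Q a dY, sd_add a dX dY, map_add]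
  abel

theorem stV_add (Q : ℝ → Space → Config) (a : Fin 4) {X Y : ℝ → Space → Vec} (hX : IsHistory X)
    (hY : IsHistory Y) (t : ℝ) (x : Space) :
    stV Q a (fun s y => X s y + Y s y) t x = stV Q a X t x + stV Q a Y t x := by
  have dX := ContDiff.differentiable (f := fun p : ℝ × Space => X p.1 p.2) hX (by simp) (t, x)
  have dY := ContDiff.differentiable (f := fun p : ℝ × Space => Y p.1 p.2) hY (by simp) (t, x)
  rw [stV_eq Q a (dX.fun_add dY), stV_eq Q a dX, stV_eq Q a dY, sd_add a dX dY, map_add]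
  abel

/-- The covariant gauge transformations in terms of bilinear operations. -/
theorem covariantVariation_eq (Q : ℝ → Space → Config) (P : ℝ → Space → STPar) (t : ℝ) (x : Space) :
    covariantVariation Q P t x = mkConfig (fun a => -stB Q a (fun s y => (P s y).1) t x)
      (fun a => -stV Q a (fun s y => (P s y).2.1) t x + rotW (P t x).1 (th (Q t x) a))
      (fun a b => rotB (P t x).1 (bB (Q t x) a b) - wdg (P t x).2.1 (be (Q t x) a b)
        + (stB Q a (fun s y => (P s y).2.2.1 b) t x - stB Q b (fun s y => (P s y).2.2.1 a) t x)
        - (wdg ((P t x).2.2.2 a) (th (Q t x) b) - wdg ((P t x).2.2.2 b) (th (Q t x) a)))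
      (fun a b => rotW (P t x).1 (be (Q t x) a b)
        + (stV Q a (fun s y => (P s y).2.2.2 b) t x - stV Q b (fun s y => (P s y).2.2.2 a) t x)) := rfl

include hQ hlam hl in
/-- Without curvature and torsion, `D(Dλ + l ∧ θ) = Dl ∧ θ`, which cancels the change of `-ξ ∧ θ`, and
`D(Dl) = 0`. -/
theorem covariantVariation_add_exactPar {P : ℝ → Space → STPar} (hP : IsHistory P)
    (hmem : ∀ t x, Q t x ∈ configFibre) (hS : IsSolution Q) (t : ℝ) (x : Space) :
    covariantVariation Q (fun s y => P s y + exactPar Q lam l s y) t x = covariantVariation Q P t x := by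
  have hP' : ContDiff ℝ ∞ fun p : ℝ × Space => P p.1 p.2 := hP
  have p3 : ∀ b, IsHistory fun s y => (P s y).2.2.1 b := fun b => contDiff_pi.1 hP'.snd.snd.fst b
  have p4 : ∀ b, IsHistory fun s y => (P s y).2.2.2 b := fun b => contDiff_pi.1 hP'.snd.snd.snd b
  have e1 : (fun s y => (P s y + exactPar Q lam l s y).1) = fun s y => (P s y).1 :=
    funext fun s => funext fun y => add_zero (P s y).1
  have e2 : (fun s y => (P s y + exactPar Q lam l s y).2.1) = fun s y => (P s y).2.1 :=
    funext fun s => funext fun y => add_zero (P s y).2.1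
  have e3 : ∀ b, (fun s y => (P s y + exactPar Q lam l s y).2.2.1 b)
      = fun s y => (P s y).2.2.1 b + (stB Q b lam s y + wdg (l s y) (th (Q s y) b)) := fun b => rfl
  have e4 : ∀ b, (fun s y => (P s y + exactPar Q lam l s y).2.2.2 b)
      = fun s y => (P s y).2.2.2 b + stV Q b l s y := fun b => rfl
  have v1 : (P t x + exactPar Q lam l t x).1 = (P t x).1 := add_zero _
  have v2 : (P t x + exactPar Q lam l t x).2.1 = (P t x).2.1 := add_zero _
  have v4 : ∀ b, (P t x + exactPar Q lam l t x).2.2.2 b = (P t x).2.2.2 b + stV Q b l t x := fun b => rfl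
  rw [covariantVariation_eq, covariantVariation_eq]
  simp only [e1, e2, e3, e4, v1, v2, v4]
  refine congrArg₂ (mkConfig _ _) (funext fun a => funext fun b => ?_) (funext fun a => funext fun b => ?_)
  · rw [stB_add Q a (p3 b) (isHistory_exactPar hQ hlam hl b), stB_add Q b (p3 a) (isHistory_exactPar hQ hlam hl a)]
    simp only [map_add, LinearMap.add_apply]
    linear_combination (norm := module) stB_exactPar hQ hlam hl hmem hS a b t x
  · rw [stV_add Q a (p4 b) (isHistory_stV hQ hl b), stV_add Q b (p4 a) (isHistory_stV hQ hl a),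
      stV_stV hQ hl hmem hS a b]
    abel

end

/-! ### The canonical transformations as covariant transformations -/

theorem deriv_linear {E F : Type*} [NormedAddCommGroup E] [NormedSpace ℝ E] [NormedAddCommGroup F]
    [NormedSpace ℝ F] [FiniteDimensional ℝ E] (L : E →ₗ[ℝ] F) {f : ℝ → E} {t : ℝ} (hf : DifferentiableAt ℝ f t) :
    deriv (fun s => L (f s)) t = L (deriv f t) :=
  (L.toContinuousLinearMap.hasFDerivAt.comp_hasDerivAt t hf.hasDerivAt).deriv

/-- The contraction of two Levi-Civita symbols, applied to an array `F`. -/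
theorem sum_eps3_cross {E : Type*} [AddCommGroup E] [Module ℝ E] (F : Fin 3 → Fin 3 → E) (i j : Fin 3) :
    ∑ k, eps3 i j k • (F (k + 1) (k + 2) - F (k + 2) (k + 1)) = F i j - F j i := by
  simp only [eps3_eq, Fin.sum_univ_three]
  fin_cases i <;> fin_cases j <;> simp

/-- The spatial 2-forms of `lift`. -/
theorem bB_lift_succ (w : Phase) (i j : Fin 3) :
    bB (lift w).1 i.succ j.succ = ∑ k : Fin 3, eps3 i j k • lo2 (om w.2 k.succ) := by
  ext A B
  simp only [Finset.sum_apply, Pi.smul_apply, smul_eq_mul]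
  rfl

theorem be_lift_succ (w : Phase) (i j : Fin 3) :
    be (lift w).1 i.succ j.succ = ∑ k : Fin 3, eps3 i j k • lo (th w.2 k.succ) := by
  ext A
  simp only [Finset.sum_apply, Pi.smul_apply, smul_eq_mul]
  rfl

theorem om_gaugeVariation_succ (N M : Space → Par) (z : Space → Phase) (x : Space) (i : Fin 3) :
    om (gaugeVariation N M z x).2 i.succ = lo2 (rotB (N x).1 (lo2 (om (z x).2 i.succ))
      - wdg (N x).2.1 (lo (th (z x).2 i.succ))
      + ((covB z (i + 1) (fun y => (N y).2.2.1 (i + 2)) x - wdg (th (z x).1 (i + 1).succ) ((N x).2.2.2 (i + 2)))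
        - (covB z (i + 2) (fun y => (N y).2.2.1 (i + 1)) x
          - wdg (th (z x).1 (i + 2).succ) ((N x).2.2.2 (i + 1))))) := by
  ext A B
  simp only [map_add, map_sub, ← rotL_eq, ← asym_low_left, Pi.add_apply, Pi.sub_apply]
  refine (congrArg (_ + ·) (sum_eps3_mul i _)).trans ?_
  simp only [low2, lo2_apply, wdg_apply]
  ring

theorem th_gaugeVariation_succ (N M : Space → Par) (z : Space → Phase) (x : Space) (i : Fin 3) :
    th (gaugeVariation N M z x).2 i.succ = lo (rotW (N x).1 (lo (th (z x).2 i.succ))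
      + (covV z (i + 1) (fun y => (N y).2.2.2 (i + 2)) x - covV z (i + 2) (fun y => (N y).2.2.2 (i + 1)) x)) := by
  ext A
  simp only [map_add, map_sub, ← rotVL_eq, Pi.add_apply, Pi.sub_apply]
  exact congrArg (_ + ·) (sum_eps3_mul i _)

section
variable {Q : ℝ → Space → Config} {P : ℝ → Space → STPar} {t : ℝ} {z : Space → Phase}
  (hP : IsHistory P) (hmem : ∀ t x, Q t x ∈ configFibre) (hlift : ∀ x, (lift (z x)).1 = Q t x)

include hP in
/-- The rates of the parameters, componentwise. -/
theorem ratePar_eq (x : Space) : ratePar P t x = ((fun A B => stD 0 (fun s y => (P s y).1 A B) t x),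
    (fun A => stD 0 (fun s y => (P s y).2.1 A) t x), (fun i A B => stD 0 (fun s y => (P s y).2.2.1 i.succ A B) t x),
    fun i A => stD 0 (fun s y => (P s y).2.2.2 i.succ A) t x) := by
  have hP' : ContDiff ℝ ∞ fun p : ℝ × Space => P p.1 p.2 := hP
  have h0 : Differentiable ℝ fun s => P s x :=
    (hP'.comp (contDiff_id.prodMk contDiff_const)).differentiable (by simp)
  have h : DifferentiableAt ℝ (fun s => spatialPar P s x) t := by
    refine ((h0 t).fst).prodMk ((h0 t).snd.fst.prodMk ((differentiableAt_pi.2 fun i => ?_).prodMk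
      (differentiableAt_pi.2 fun i => ?_)))
    · exact differentiableAt_pi.1 (h0 t).snd.snd.fst i.succ
    · exact differentiableAt_pi.1 (h0 t).snd.snd.snd i.succ
  have L : ∀ L : Par →ₗ[ℝ] ℝ, L (ratePar P t x) = deriv (fun s => L (spatialPar P s x)) t := fun L =>
    (deriv_linear L h).symm
  refine Prod.ext ?_ (Prod.ext ?_ (Prod.ext ?_ ?_))
  · ext A B
    exact L ((LinearMap.proj B).comp ((LinearMap.proj A : Biv →ₗ[ℝ] Vec).comp (LinearMap.fst ℝ _ _)))
  · ext A
    exact L ((LinearMap.proj A : Vec →ₗ[ℝ] ℝ).comp ((LinearMap.fst ℝ _ _).comp (LinearMap.snd ℝ _ _)))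
  · ext i A B
    exact L ((LinearMap.proj B).comp ((LinearMap.proj A : Biv →ₗ[ℝ] Vec).comp
      ((LinearMap.proj i : (Fin 3 → Biv) →ₗ[ℝ] Biv).comp ((LinearMap.fst ℝ _ _).comp
        ((LinearMap.snd ℝ _ _).comp (LinearMap.snd ℝ _ _))))))
  · ext i A
    exact L ((LinearMap.proj A : Vec →ₗ[ℝ] ℝ).comp
      ((LinearMap.proj i : (Fin 3 → Vec) →ₗ[ℝ] Vec).comp ((LinearMap.snd ℝ _ _).comp
        ((LinearMap.snd ℝ _ _).comp (LinearMap.snd ℝ _ _)))))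

include hP hmem hlift in
/-- For the components other than `B_{ij}`, `β_{ij}` the two transformations agree term by term. For these, the
symbol `ε_{ijk}` of `lift` contracts with that in the curls `ε^{klm} D_l Ξ_m`, `ε^{klm} D_l ξ_m`
(`sum_eps3_cross`). -/
theorem lift_gaugeVariation (x : Space) :
    (lift (gaugeVariation (spatialPar P t) (ratePar P t + temporalShift Q P t) z x)).1
      = covariantVariation Q P t x := by
  have o : ∀ a, om (z x).1 a = om (Q t x) a := fun a => by rw [← hlift]; rfl
  have h : ∀ a, th (z x).1 a = th (Q t x) a := fun a => by rw [← hlift]; rfl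
  have b0 : ∀ i : Fin 3, bB (z x).1 0 i.succ = bB (Q t x) 0 i.succ := fun i => by rw [← hlift]; rfl
  have c0 : ∀ i : Fin 3, be (z x).1 0 i.succ = be (Q t x) 0 i.succ := fun i => by rw [← hlift]; rfl
  have bs : ∀ i j : Fin 3, bB (Q t x) i.succ j.succ = ∑ k : Fin 3, eps3 i j k • lo2 (om (z x).2 k.succ) :=
    fun i j => by rw [← hlift, bB_lift_succ]
  have cs : ∀ i j : Fin 3, be (Q t x) i.succ j.succ = ∑ k : Fin 3, eps3 i j k • lo (th (z x).2 k.succ) :=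
    fun i j => by rw [← hlift, be_lift_succ]
  have hr := ratePar_eq (t := t) hP x
  obtain ⟨-, -, s3, s4⟩ := mem_configFibre.1 (hmem t x)
  have z3 := bB_self (hmem t x) 0
  have z4 := be_self (hmem t x) 0
  have cB : ∀ (i j : Fin 3), covB z i (fun y => (spatialPar P t y).2.2.1 j) x
      = stB Q i.succ (fun s y => (P s y).2.2.1 j.succ) t x := fun i j => by
    ext A B; simp only [covB, stB, o]; rfl
  have cV : ∀ (i j : Fin 3), covV z i (fun y => (spatialPar P t y).2.2.2 j) x
      = stV Q i.succ (fun s y => (P s y).2.2.2 j.succ) t x := fun i j => by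
    ext A; simp only [covV, stV, o]; rfl
  have V3 : ∀ i, varB (spatialPar P t) (ratePar P t + temporalShift Q P t) z x i
      = bB (covariantVariation Q P t x) 0 i.succ := fun i => by
    ext A B
    simp only [varB, Pi.add_apply, Prod.snd_add, Prod.fst_add, hr, o, h, b0, c0, covariantVariation_eq]
    simp only [temporalShift, spatialPar, stB, asym, wdg_apply, rotB_apply, mkConfig, bB, Sum.elim_inl, Sum.elim_inr,
      Pi.add_apply, Pi.sub_apply]
    ring
  have V4 : ∀ i, varBe (spatialPar P t) (ratePar P t + temporalShift Q P t) z x i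
      = be (covariantVariation Q P t x) 0 i.succ := fun i => by
    ext A
    simp only [varBe, Pi.add_apply, Prod.snd_add, hr, o, c0, covariantVariation_eq]
    simp only [temporalShift, spatialPar, stV, rotW_apply, mkConfig, be, Sum.elim_inr,
      Pi.add_apply, Pi.sub_apply]
    ring
  refine config_ext (fun a => ?_) (fun a => ?_) (fun a b => ?_) (fun a b => ?_)
  · refine Fin.cases ?_ (fun i => ?_) a
    · ext A B
      change -((ratePar P t x).1 A B + 0 + rot (om (z x).1 0) (P t x).1 A B) = -stB Q 0 (fun s y => (P s y).1) t x A B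
      rw [hr, o, add_zero]; rfl
    · ext A B
      change -(_ + rot (om (z x).1 i.succ) (P t x).1 A B) = -(_ + rot (om (Q t x) i.succ) (P t x).1 A B)
      rw [o]; rfl
  · refine Fin.cases ?_ (fun i => ?_) a
    · ext A
      change -((ratePar P t x).2.1 A + 0 + rotV (om (z x).1 0) (P t x).2.1 A) + rotV (P t x).1 (th (z x).1 0) A
        = -stV Q 0 (fun s y => (P s y).2.1) t x A + rotV (P t x).1 (th (Q t x) 0) A
      rw [hr, o, h, add_zero]; rfl
    · ext A
      change -(_ + rotV (om (z x).1 i.succ) (P t x).2.1 A) + rotV (P t x).1 (th (z x).1 i.succ) A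
        = -(_ + rotV (om (Q t x) i.succ) (P t x).2.1 A) + rotV (P t x).1 (th (Q t x) i.succ) A
      rw [o, h]; rfl
  · refine Fin.cases (Fin.cases ?_ (fun j => ?_) b) (fun i => Fin.cases ?_ (fun j => ?_) b) a
    · change (0 : Biv) = rotB (P t x).1 (bB (Q t x) 0 0) - wdg (P t x).2.1 (be (Q t x) 0 0) + (_ - _) - (_ - _)
      rw [z3, z4, map_zero, map_zero, sub_self, sub_self, sub_self, add_zero, sub_zero]
    · exact V3 j
    · change -varB (spatialPar P t) (ratePar P t + temporalShift Q P t) z x i = _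
      rw [V3]
      change -(rotB (P t x).1 (bB (Q t x) 0 i.succ) - wdg (P t x).2.1 (be (Q t x) 0 i.succ) + (_ - _) - (_ - _))
        = rotB (P t x).1 (bB (Q t x) i.succ 0) - wdg (P t x).2.1 (be (Q t x) i.succ 0) + (_ - _) - (_ - _)
      rw [s3 0 i.succ, s4 0 i.succ, map_neg, map_neg]
      abel
    · rw [bB_lift_succ]
      simp only [om_gaugeVariation_succ, lo2_lo2, cB, h]
      have e := sum_eps3_cross (fun i j => stB Q i.succ (fun s y => (P s y).2.2.1 j.succ) t x
        - wdg (th (Q t x) i.succ) ((P t x).2.2.2 j.succ)) i j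
      have f : ∑ k : Fin 3, eps3 i j k • (rotB (P t x).1 (lo2 (om (z x).2 k.succ))
          - wdg (P t x).2.1 (lo (th (z x).2 k.succ)))
          = rotB (P t x).1 (bB (Q t x) i.succ j.succ) - wdg (P t x).2.1 (be (Q t x) i.succ j.succ) := by
        simp only [bs, cs, map_sum, map_smul, smul_sub, Finset.sum_sub_distrib]
      simp only [smul_add (eps3 i j _), Finset.sum_add_distrib]
      refine (congrArg₂ (· + ·) f e).trans ?_
      change _ = rotB (P t x).1 (bB (Q t x) i.succ j.succ) - wdg (P t x).2.1 (be (Q t x) i.succ j.succ)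
        + (stB Q i.succ (fun s y => (P s y).2.2.1 j.succ) t x - stB Q j.succ (fun s y => (P s y).2.2.1 i.succ) t x)
        - (wdg ((P t x).2.2.2 i.succ) (th (Q t x) j.succ) - wdg ((P t x).2.2.2 j.succ) (th (Q t x) i.succ))
      rw [wdg_comm ((P t x).2.2.2 i.succ), wdg_comm ((P t x).2.2.2 j.succ)]
      abel
  · refine Fin.cases (Fin.cases ?_ (fun j => ?_) b) (fun i => Fin.cases ?_ (fun j => ?_) b) a
    · change (0 : Vec) = rotW (P t x).1 (be (Q t x) 0 0) + (_ - _)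
      rw [z4, map_zero, sub_self, add_zero]
    · exact V4 j
    · change -varBe (spatialPar P t) (ratePar P t + temporalShift Q P t) z x i = _
      rw [V4]
      change -(rotW (P t x).1 (be (Q t x) 0 i.succ) + (_ - _)) = rotW (P t x).1 (be (Q t x) i.succ 0) + (_ - _)
      rw [s4 0 i.succ, map_neg]
      abel
    · rw [be_lift_succ]
      simp only [th_gaugeVariation_succ, lo_lo, cV]
      have e := sum_eps3_cross (fun i j => stV Q i.succ (fun s y => (P s y).2.2.2 j.succ) t x) i j
      have f : ∑ k : Fin 3, eps3 i j k • rotW (P t x).1 (lo (th (z x).2 k.succ))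
          = rotW (P t x).1 (be (Q t x) i.succ j.succ) := by
        simp only [cs, map_sum, map_smul]
      simp only [smul_add (eps3 i j _), Finset.sum_add_distrib]
      exact congrArg₂ (· + ·) f e

end

end

end PoincareBF

open PoincareBF in
theorem mainTheorem6 :
    -- Conjugate momenta: `∂L/∂q̇` does not involve the velocities, so all the relations `p = ∂L/∂q̇` are primary constraints.
    (∀ q v : Space → Config, IsField configFibre q → IsField configFibre v → ∀ x, ∀ w ∈ configFibre,
      HasDerivAt (fun s : ℝ => lagrangian q (fun y => v y + s • w) x) (dotProduct (momenta (q x)) w) 0) ∧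
    -- Total Hamiltonian: primary constraints with the velocities as multipliers, plus the canonical part.
    (∀ (z : Space → Phase) (v : Space → Config), IsField phaseFibre z → IsField configFibre v → ∀ x,
      hamiltonian v z x = primary v z x + canonicalHamiltonian z x) ∧
    -- Brackets of the primary constraints.
    (∀ z l l', IsField phaseFibre z → IsTest configFibre l → IsTest configFibre l' →
      HasBracket phaseFibre (primary l) (primary l') z (∫ x, diracForm (l x) (l' x))) ∧
    (∀ l ∈ configFibre, ∀ l' ∈ configFibre, diracForm l l' =
      (1 / 2) * ∑ i : Fin 3, ∑ j : Fin 3, ∑ k : Fin 3, eps3 i j k *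
        ((∑ A, ∑ B, (low2 (bB l i.succ j.succ) A B * om l' k.succ A B
            - om l k.succ A B * low2 (bB l' i.succ j.succ) A B))
          + ∑ A, (low (be l i.succ j.succ) A * th l' k.succ A
            - th l k.succ A * low (be l' i.succ j.succ) A))) ∧
    -- First class among the primary constraints: the temporal ones; the spatial ones are second class.
    primaryRadical = temporalConfig ∧
    (∀ l ∈ spatialConfig, (∀ l' ∈ spatialConfig, diracForm l l' = 0) → l = 0) ∧
    -- Time derivatives of all the primary constraints: the Euler-Lagrange derivatives.
    (∀ z l v, IsField phaseFibre z → IsTest configFibre l → IsField configFibre v →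
      HasBracket phaseFibre (primary l) (hamiltonian v) z
        (∫ x, dotProduct (l x) (eulerLagrange (fun y => (z y).1) v x))) ∧
    -- Preservation of the second-class constraints fixes exactly the spatial velocities.
    (∀ (z : Space → Phase) (v₀ : Space → Config), IsField phaseFibre z → IsField configFibre v₀ →
      ∃! v, IsField configFibre v ∧ (∀ x, v x - v₀ x ∈ spatialConfig) ∧
        ∀ x, ∀ l ∈ spatialConfig, dotProduct l (eulerLagrange (fun y => (z y).1) v x) = 0) ∧
    -- The second-class constraints are solved for the spatial `B`, `β` and their momenta.
    (∀ w ∈ phaseFibre, (∀ l ∈ spatialConfig, dotProduct l (w.2 - momenta w.1) = 0) ↔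
      ∃! y, y ∈ reducedFibre ∧ lift y = w) ∧
    -- The Dirac bracket is the canonical bracket of the remaining variables.
    (∀ (F G : Density) (z f g : Space → Phase), IsField reducedFibre z →
      HasGradient phaseFibre F (fun x => lift (z x)) f → HasGradient phaseFibre G (fun x => lift (z x)) g →
      (HasCompactSupport f ∨ HasCompactSupport g) →
      (∃ c, HasDiracBracket F G (fun x => lift (z x)) c) ∧
      ∀ c, HasDiracBracket F G (fun x => lift (z x)) c →
        HasBracket reducedFibre (restrict F) (restrict G) z c) ∧
    -- Secondary constraints: time derivatives of the first-class primary ones.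
    (∀ z N v, IsField reducedFibre z → IsTest parFibre N → IsField configFibre v →
      HasBracket reducedFibre (prim N) (restrict (hamiltonian v)) z (∫ x, sec N z x)) ∧
    -- The canonical Hamiltonian is a combination of the secondary constraints, up to a divergence.
    (∀ z, IsField reducedFibre z → ∀ x, restrict canonicalHamiltonian z x =
      -parPair (temporalFields (z x)) (chi z x) + ∑ i : Fin 3, pd i (fun y =>
        (∑ A, ∑ B, om (z y).1 0 A B * om (z y).2 i.succ A B)
          + ∑ A, th (z y).1 0 A * th (z y).2 i.succ A) x) ∧
    -- The algebra of the primary and secondary first-class constraints closes.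
    (∀ z N N', IsField reducedFibre z → IsTest parFibre N → IsTest parFibre N' →
      HasBracket reducedFibre (prim N) (prim N') z 0 ∧
      HasBracket reducedFibre (prim N) (sec N') z 0 ∧
      HasBracket reducedFibre (sec N) (sec N') z (∫ x, algebra (N x) (N' x) (chi z x))) ∧
    -- No further constraints: the secondary constraints are preserved on their zero set.
    (∀ z N v, IsField reducedFibre z → IsTest parFibre N → IsField configFibre v → (∀ x, chi z x = 0) →
      HasBracket reducedFibre (sec N) (restrict (hamiltonian v)) z 0) ∧
    -- Reducibility of the secondary constraints (spatial Bianchi identities).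
    (∀ z, IsField reducedFibre z → ∀ x A B,
      ∑ i : Fin 3, (pd i (fun y => (chi z y).2.2.1 i A B) x
        + rotL (om (z x).1 i.succ) ((chi z x).2.2.1 i) A B) = 0) ∧
    (∀ z, IsField reducedFibre z → ∀ x A,
      ∑ i : Fin 3, (pd i (fun y => (chi z y).2.2.2 i A) x
        + rotVL (om (z x).1 i.succ) ((chi z x).2.2.2 i) A
        + ∑ B, th (z x).1 i.succ B * (chi z x).2.2.1 i B A) = 0) ∧
    -- Counting.
    Module.finrank ℝ phaseFibre = 200 ∧ Module.finrank ℝ reducedFibre = 140 ∧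
    Module.finrank ℝ spatialConfig = 60 ∧ secondClassCount = 60 ∧
    Module.finrank ℝ primaryRadical = 40 ∧ Module.finrank ℝ parFibre = 40 ∧
    (∀ z, IsField reducedFibre z → ∀ x, chi z x ∈ parFibre) ∧
    (∀ z, IsField reducedFibre z → ∀ x, ∀ k : Fin 3 → ℝ, k ≠ 0 →
      secondaryRank z x k = 40 - (6 + 4) ∧
      2 * (Module.finrank ℝ primaryRadical + secondaryRank z x k) = 140 ∧
      localDegreesOfFreedom z x k = 0) ∧
    -- Castellani chains.
    (∀ w, temporalMomenta w = 0 → chainShift w = 0) ∧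
    (∀ z N, IsField reducedFibre z → IsTest parFibre N →
      HasBracket reducedFibre (chain N) (restrict canonicalHamiltonian) z 0) ∧
    (∀ z N v, IsField reducedFibre z → IsTest parFibre N → IsField configFibre v →
      (∀ x, temporalMomenta (z x) = 0) →
      HasBracket reducedFibre (chain N) (restrict (hamiltonian v)) z 0) ∧
    -- The transformations `δf = {f, G}` of all the canonical variables.
    (∀ z N M, IsField reducedFibre z → IsField parFibre N → IsField parFibre M →
      IsField reducedFibre (gaugeVariation N M z) ∧
      ∀ a, IsTest reducedFibre a →
        HasBracket reducedFibre (fun z' x => pair (a x) (z' x)) (generator N M) z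
          (∫ x, pair (a x) (gaugeVariation N M z x))) ∧
    -- They are the covariant gauge transformations of all the fields.
    (∀ (Q : ℝ → Space → Config) (P : ℝ → Space → STPar), IsHistory Q → IsHistory P →
      (∀ t x, Q t x ∈ configFibre) →
      (∀ t x A B, (P t x).1 B A = -(P t x).1 A B ∧ ∀ a, (P t x).2.2.1 a B A = -(P t x).2.2.1 a A B) →
      ∀ (t : ℝ) (z : Space → Phase), IsField reducedFibre z → (∀ x, (lift (z x)).1 = Q t x) →
      ∀ x, (lift (gaugeVariation (spatialPar P t) (ratePar P t + temporalShift Q P t) z x)).1 =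
        covariantVariation Q P t x) ∧
    -- On solutions, covariant parameters that differ by exact ones generate the same transformation.
    (∀ (Q : ℝ → Space → Config) (P : ℝ → Space → STPar) (lam : ℝ → Space → Fin 4 → Fin 4 → ℝ)
      (l : ℝ → Space → Fin 4 → ℝ), IsHistory Q → IsHistory P → IsHistory lam → IsHistory l →
      (∀ t x, Q t x ∈ configFibre) → (∀ t x A B, lam t x B A = -lam t x A B) → IsSolution Q →
      ∀ t x, covariantVariation Q (fun s y => P s y + exactPar Q lam l s y) t x =
        covariantVariation Q P t x) := by
  refine ⟨fun q v hq hv x w hw => hasDerivAt_lagrangian hq hv x hw,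
    fun z v hz hv x => hamiltonian_eq hz x (hv.mem x),
    fun z l l' hz hl hl' => hasBracket_primary hz hl hl'.toIsField,
    fun l hl l' hl' => diracForm_explicit hl hl',
    primaryRadical_eq,
    fun l hl h => diracForm_nondegenerate hl h,
    fun z l v hz hl hv => hasBracket_primary_hamiltonian hz hl hv,
    fun z v₀ hz hv => existsUnique_velocity hz hv,
    fun w hw => secondClass_surface hw,
    fun F G z f g hz hf hg hs => ⟨exists_hasDiracBracket hf hg hs, fun c hc => hc.hasBracket hz⟩,
    fun z N v hz hN hv => hasBracket_prim_hamiltonian hz hN hv,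
    fun z hz x => restrict_canonicalHamiltonian hz x,
    fun z N N' hz hN hN' => ⟨hasBracket_prim_prim hz hN hN'.toIsField, hasBracket_prim_sec hz hN hN'.toIsField,
      hasBracket_sec_sec hz hN hN'.toIsField⟩,
    fun z N v hz hN hv h0 => hasBracket_sec_hamiltonian hz hN hv h0,
    fun z hz x A B => bianchi_curvature_components (hz.mono reducedFibre_le) x A B,
    fun z hz x A => bianchi_torsion_components (hz.mono reducedFibre_le) x A,
    finrank_phaseFibre, finrank_reducedFibre, finrank_spatialConfig, secondClassCount_eq, finrank_primaryRadical,
    finrank_parFibre,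
    fun z hz x => chi_mem (hz.mono reducedFibre_le) x,
    fun z hz x k hk => count_eq (hz.mono reducedFibre_le) x hk,
    chainShift_eq_zero,
    fun z N hz hN => (hasBracket_chain_canonicalHamiltonian hz hN).1,
    fun z N v hz hN hv h0 => hasBracket_chain_hamiltonian hz hN hv h0,
    fun z N M hz hN hM => ⟨isField_gaugeVariation hz hN hM, fun a ha => hasBracket_generator hz hN hM ha⟩,
    fun Q P _ hP hmem _ t z _ hlift x => lift_gaugeVariation hP hmem hlift x,
    fun Q P lam l hQ hP hlam hl hmem _ hS t x =>
      covariantVariation_add_exactPar hQ hlam hl hP hmem hS t x⟩
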